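/- Let $M$ be a closed smooth 3-manifold with a (strictly pseudoconvex) pseudohermitian structure $(J,\theta)$: $\theta$ is a smooth contact form, $J$ is a smooth endomorphism of the contact bundle $\xi=\ker\theta$ with $J^2=-\mathrm{Id}$, and $d\theta(\cdot,J\cdot)>0$ on $\xi$. Let $T$ be the Reeb field. Around every point there is a local unitary frame $Z_1$, that is, a section of $\xi\otimes\mathbb C$ with $JZ_1=iZ_1$ whose dual coframe $\theta^1$ ($\theta^1(Z_1)=1$, $\theta^1(Z_{\bar 1})=\theta^1(T)=0$) satisfies $d\theta=i\theta^1\wedge\theta^{\bar 1}$. The connection form $\omega_1^1$, the torsion $A_{11}$ (with $A_{\bar1\bar1}=\overline{A_{11}}$) and the Tanaka–Webster scalar curvature $R$ are given by $$d\theta^1=\theta^1\wedge\omega_1^1+A_{\bar1\bar1}\,\theta\wedge\theta^{\bar1},\qquad \omega_1^1+\overline{\omega_1^1}=0,\qquad d\omega_1^1\equiv R\,\theta^1\wedge\theta^{\bar1}\pmod\theta .$$ Indices after a comma denote covariant derivatives, taken from left to right, along $Z_1$, $Z_{\bar1}$ and $T$ (index $0$): the derivative along $V$ of a component $u$ with $k$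 more lower indices $1$ than $\bar1$ is $Vu-k\,\omega_1^1(V)u$. Put $\Delta_bR=R_{,1\bar1}+R_{,\bar11}$, $|A|^2=A_{11}A_{\bar1\bar1}$, and $$E(J,\theta)=\int_M(R^2-|A|^2)\,\theta\wedge d\theta .$$ (1) Let $J_t$ be a smooth family of endomorphisms of $\xi$ such that, for $t$ near $0$, $(J_t,\theta)$ is pseudohermitian, with $J_0=J$ and $\frac{d}{dt}\big|_{t=0}J_t=2E$, where $E=E_{11}\theta^1\otimes Z_{\bar1}+\text{conjugate}$. Then $t\mapsto E(J_t,\theta)$ is differentiable at $0$ with derivative $$\delta_JE(J,\theta)=\int_M\Big[(2iR_{,\bar1\bar1}-2RA_{\bar1\bar1}+iA_{\bar1\bar1,0})E_{11}+\text{conjugate}\Big]\,\theta\wedge d\theta .$$ (2) Let $\theta_t$ be a smooth family of contact forms with $\ker\theta_t=\xi$ such that, for $t$ near $0$, $(J,\theta_t)$ is pseudohermitian, with $\theta_0=\theta$ and $\frac{d}{dt}\big|_{t=0}\theta_t=2h\theta$. Then $t\mapsto E(J,\theta_t)$ is differentiable at $0$ with derivative $$\delta_\theta E(J,\theta)=\int_M\big\{-8\Delta_bR-2i(A_{\bar1\bar1,11}-A_{11,\bar1\bar1})\big\}\,h\,\theta\wedge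 d\theta .$$ The integrands in (1) and (2) do not depend on the choice of the local unitary frame, and they are integrable. (3) The Euler–Lagrange equations for $(J,\theta)$ are $$R_{,11}-\tfrac i2(A_{11,1\bar1}-A_{11,\bar11})=0,\qquad -4\Delta_bR-i(A_{\bar1\bar1,11}-A_{11,\bar1\bar1})=0 .$$ More precisely, $\delta_JE(J,\theta)=0$ for all variations as in (1) if and only if the first equation holds in every local unitary frame, and $\delta_\theta E(J,\theta)=0$ for all variations as in (2) if and only if the second one does. -/

import Mathlib

open Set MeasureTheory Bundle ComplexConjugate
open scoped Manifold ContDiff Topology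

noncomputable section

namespace CR3

/-- The model space of a three-dimensional manifold. -/
abbrev E3 : Type := EuclideanSpace ℝ (Fin 3)

section Forms

variable {M : Type*} [TopologicalSpace M] [ChartedSpace E3 M]

/-- A vector field on `M`; smoothness is always required separately. -/
abbrev VField (M : Type*) [TopologicalSpace M] [ChartedSpace E3 M] : Type _ :=
  Π p : M, TangentSpace (𝓡 3) p

/-- A one-form on `M` with real or complex values. -/
abbrev OneForm (M : Type*) [TopologicalSpace M] [ChartedSpace E3 M] (F : Type*)
    [NormedAddCommGroup F] [NormedSpace ℝ F] : Type _ :=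
  Π p : M, TangentSpace (𝓡 3) p →L[ℝ] F

/-- A field of endomorphisms of the tangent spaces of `M`. -/
abbrev EndField (M : Type*) [TopologicalSpace M] [ChartedSpace E3 M] : Type _ :=
  Π p : M, TangentSpace (𝓡 3) p →L[ℝ] TangentSpace (𝓡 3) p

/-- Smoothness of a vector field on `U`, as a section of the tangent bundle. -/
def SmoothVField [IsManifold (𝓡 3) ∞ M] (X : VField M) (U : Set M) : Prop :=
  ContMDiffOn (𝓡 3) (𝓡 3).tangent ∞
    (fun p => (TotalSpace.mk' E3 p (X p) : TangentBundle (𝓡 3) M)) U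

/-- Smoothness of a one-form on `U`, as a section of the bundle `Hom(TM, F)`. -/
def SmoothOneForm [IsManifold (𝓡 3) ∞ M] {F : Type*} [NormedAddCommGroup F] [NormedSpace ℝ F]
    (α : OneForm M F) (U : Set M) : Prop :=
  ContMDiffOn (𝓡 3) ((𝓡 3).prod 𝓘(ℝ, E3 →L[ℝ] F)) ∞
    (fun p => TotalSpace.mk' (E3 →L[ℝ] F)
      (E := fun p : M => TangentSpace (𝓡 3) p →L[ℝ] Trivial M F p) p (α p)) U

/-- Joint smoothness, on `S ⊆ ℝ × M`, of a family of one-forms depending on a real parameter. -/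
def SmoothOneFormFamily [IsManifold (𝓡 3) ∞ M] (α : ℝ → OneForm M ℝ) (S : Set (ℝ × M)) : Prop :=
  ContMDiffOn (𝓘(ℝ, ℝ).prod (𝓡 3)) ((𝓡 3).prod 𝓘(ℝ, E3 →L[ℝ] ℝ)) ∞
    (fun x : ℝ × M => TotalSpace.mk' (E3 →L[ℝ] ℝ)
      (E := fun p : M => TangentSpace (𝓡 3) p →L[ℝ] Trivial M ℝ p) x.2 (α x.1 x.2)) S

/-- Smoothness of a field of endomorphisms, as a section of `End(TM)`. -/
def SmoothEndField [IsManifold (𝓡 3) ∞ M] (J : EndField M) : Prop :=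
  ContMDiff (𝓡 3) ((𝓡 3).prod 𝓘(ℝ, E3 →L[ℝ] E3)) ∞
    (fun p => TotalSpace.mk' (E3 →L[ℝ] E3)
      (E := fun p : M => TangentSpace (𝓡 3) p →L[ℝ] TangentSpace (𝓡 3) p) p (J p))

/-- Joint smoothness, on `S ⊆ ℝ × M`, of a family of fields of endomorphisms. -/
def SmoothEndFieldFamily [IsManifold (𝓡 3) ∞ M] (J : ℝ → EndField M) (S : Set (ℝ × M)) : Prop :=
  ContMDiffOn (𝓘(ℝ, ℝ).prod (𝓡 3)) ((𝓡 3).prod 𝓘(ℝ, E3 →L[ℝ] E3)) ∞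
    (fun x : ℝ × M => TotalSpace.mk' (E3 →L[ℝ] E3)
      (E := fun p : M => TangentSpace (𝓡 3) p →L[ℝ] TangentSpace (𝓡 3) p) x.2 (J x.1 x.2)) S

/-- The expression of a one-form in the chart around `p` (its pull-back by the inverse chart). -/
def chartForm {F : Type*} [NormedAddCommGroup F] [NormedSpace ℝ F]
    (α : OneForm M F) (p : M) (y : E3) : E3 →L[ℝ] F :=
  (α ((extChartAt (𝓡 3) p).symm y)).comp
    (mfderiv 𝓘(ℝ, E3) (𝓡 3) (extChartAt (𝓡 3) p).symm y)

/-- The exterior derivative `dα` of a one-form, computed in the chart around `p`, with the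
convention `dα(V, W) = V (α W) - W (α V) - α [V, W]`. -/
def extD {F : Type*} [NormedAddCommGroup F] [NormedSpace ℝ F]
    (α : OneForm M F) (p : M) (v w : TangentSpace (𝓡 3) p) : F :=
  let D := fderiv ℝ (chartForm α p) (extChartAt (𝓡 3) p p)
  let v' : E3 := mfderiv (𝓡 3) 𝓘(ℝ, E3) (extChartAt (𝓡 3) p) p v
  let w' : E3 := mfderiv (𝓡 3) 𝓘(ℝ, E3) (extChartAt (𝓡 3) p) p w
  D v' w' - D w' v'

/-- The three-form `θ ∧ dθ`. -/
def wedgeD (θ : OneForm M ℝ) (p : M) (u v w : TangentSpace (𝓡 3) p) : ℝ :=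
  θ p u * extD θ p v w + θ p v * extD θ p w u + θ p w * extD θ p u v

/-- The coefficient `|(θ ∧ dθ)(∂₁, ∂₂, ∂₃)|` of the volume form in the chart around `x`. -/
def volDensity (θ : OneForm M ℝ) (x : M) (y : E3) : ℝ :=
  let φ := extChartAt (𝓡 3) x
  let b := fun i : Fin 3 =>
    mfderiv 𝓘(ℝ, E3) (𝓡 3) φ.symm y (EuclideanSpace.single i (1 : ℝ) : E3)
  |wedgeD θ (φ.symm y) (b 0) (b 1) (b 2)|

/-- Integration against the volume form `θ ∧ dθ`, for the orientation in which it is positive.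
In the chart around `x` it is the measure `|(θ ∧ dθ)(∂₁, ∂₂, ∂₃)| dy₁ dy₂ dy₃`; these local
measures agree on overlaps and the global measure is the smallest one that is at least as large
as each of them. -/
def contactVolume [MeasurableSpace M] (θ : OneForm M ℝ) : Measure M :=
  ⨆ x : M, Measure.map (extChartAt (𝓡 3) x).symm
    ((volume.restrict (extChartAt (𝓡 3) x).target).withDensity
      (fun y => ENNReal.ofReal (volDensity θ x y)))

end Forms

section Pseudohermitian

variable {M : Type*} [TopologicalSpace M] [ChartedSpace E3 M] [IsManifold (𝓡 3) ∞ M]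

/-- `(J, θ)` is a (strictly pseudoconvex) pseudohermitian structure: `θ` is a contact form, `J` is
a CR structure on the contact bundle `ξ = ker θ`, and `dθ(·, J·) > 0` on `ξ`.
Only the restriction of `J p` to `ξ p` carries information: `J` is stored as a smooth
extension to the tangent bundle, and nothing below depends on the extension. -/
structure IsPseudohermitian (J : EndField M) (θ : OneForm M ℝ) : Prop where
  smooth_form : SmoothOneForm θ univ
  contact : ∀ p, ∃ u v w : TangentSpace (𝓡 3) p, wedgeD θ p u v w ≠ 0
  smooth_J : SmoothEndField J
  map_ker : ∀ p v, θ p v = 0 → θ p (J p v) = 0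
  sq_J : ∀ p v, θ p v = 0 → J p (J p v) = -v
  pos : ∀ p v, θ p v = 0 → v ≠ 0 → 0 < extD θ p v (J p v)

/-- A local unitary frame `Z₁ = (X - iY)/2`, `Z_1̄ = (X + iY)/2`, `T` over the open set `U`,
with `J Z₁ = i Z₁` and `T` the Reeb field, together with its dual coframe `θ¹`
(so `dθ = i θ¹ ∧ θ^1̄`) and the Tanaka-Webster data given by the structure equations

`dθ¹ = θ¹ ∧ ω + A_{1̄1̄} θ ∧ θ^1̄`,  `ω + ω̄ = 0`,  `dω = R θ¹ ∧ θ^1̄` modulo `θ`: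

the connection form `ω = ω₁¹` (the field `conn`), the torsion component `A = A₁₁` and the scalar curvature `R`.
The values of all the fields outside `U` are irrelevant. -/
structure UnitaryFrame (J : EndField M) (θ : OneForm M ℝ) (U : Set M) where
  X : VField M
  Y : VField M
  T : VField M
  θ1 : OneForm M ℂ
  conn : OneForm M ℂ
  A : M → ℂ
  R : M → ℝ
  isOpen : IsOpen U
  smooth_X : SmoothVField X U
  smooth_Y : SmoothVField Y U
  smooth_T : SmoothVField T U
  smooth_θ1 : SmoothOneForm θ1 U
  smooth_conn : SmoothOneForm conn U
  reeb : ∀ p ∈ U, θ p (T p) = 1 ∧ ∀ v, extD θ p (T p) v = 0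
  X_mem : ∀ p ∈ U, θ p (X p) = 0
  Y_eq : ∀ p ∈ U, Y p = J p (X p)
  θ1_X : ∀ p ∈ U, θ1 p (X p) = 1
  θ1_Y : ∀ p ∈ U, θ1 p (Y p) = Complex.I
  θ1_T : ∀ p ∈ U, θ1 p (T p) = 0
  unitary : ∀ p ∈ U, ∀ v w, ((extD θ p v w : ℝ) : ℂ) =
    Complex.I * (θ1 p v * conj (θ1 p w) - θ1 p w * conj (θ1 p v))
  structure_eq : ∀ p ∈ U, ∀ v w, extD θ1 p v w =
    (θ1 p v * conn p w - θ1 p w * conn p v)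
      + conj (A p) * (θ p v * conj (θ1 p w) - θ p w * conj (θ1 p v))
  skew : ∀ p ∈ U, ∀ v, conn p v + conj (conn p v) = 0
  curvature : ∀ p ∈ U, ∀ v w, θ p v = 0 → θ p w = 0 → extD conn p v w =
    R p * (θ1 p v * conj (θ1 p w) - θ1 p w * conj (θ1 p v))

namespace UnitaryFrame

variable {J : EndField M} {θ : OneForm M ℝ} {U : Set M} (f : UnitaryFrame J θ U)

/-- The derivative of a complex function along a real tangent vector. -/
def dir (u : M → ℂ) (p : M) (v : TangentSpace (𝓡 3) p) : ℂ :=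
  mfderiv (𝓡 3) 𝓘(ℝ, ℂ) u p v

/-- Covariant derivative along `Z₁ = (X - iY)/2` of a tensor component `u` of weight `k`, that is,
with `k` more lower indices `1` than lower indices `1̄`: `Z₁ u - k ω(Z₁) u`. It has weight
`k + 1`. -/
def D1 (k : ℤ) (u : M → ℂ) (p : M) : ℂ :=
  (1 / 2) * (dir u p (f.X p) - Complex.I * dir u p (f.Y p))
    - k * ((1 / 2) * (f.conn p (f.X p) - Complex.I * f.conn p (f.Y p))) * u p

/-- Covariant derivative along `Z_1̄ = (X + iY)/2` of a component of weight `k`: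
`Z_1̄ u - k ω(Z_1̄) u`. It has weight `k - 1`. -/
def D1bar (k : ℤ) (u : M → ℂ) (p : M) : ℂ :=
  (1 / 2) * (dir u p (f.X p) + Complex.I * dir u p (f.Y p))
    - k * ((1 / 2) * (f.conn p (f.X p) + Complex.I * f.conn p (f.Y p))) * u p

/-- Covariant derivative along the Reeb field of a component of weight `k`: `T u - k ω(T) u`. -/
def D0 (k : ℤ) (u : M → ℂ) (p : M) : ℂ :=
  dir u p (f.T p) - k * f.conn p (f.T p) * u p

/-- The scalar curvature as a complex function. -/
def Rc (p : M) : ℂ := (f.R p : ℂ)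

/-- `A_{1̄1̄}`, the conjugate of `A₁₁`. -/
def Abar (p : M) : ℂ := conj (f.A p)

/-- `R_{,11}` -/
def R_11 : M → ℂ := f.D1 1 (f.D1 0 f.Rc)

/-- `R_{,1̄1̄}` -/
def R_bb : M → ℂ := f.D1bar (-1) (f.D1bar 0 f.Rc)

/-- The sublaplacian `Δ_b R = R_{,11̄} + R_{,1̄1}` -/
def sublapR (p : M) : ℂ := f.D1bar 1 (f.D1 0 f.Rc) p + f.D1 (-1) (f.D1bar 0 f.Rc) p

/-- `A_{11,11̄}` (first derivative along `Z₁`, then along `Z_1̄`) -/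
def A_1b : M → ℂ := f.D1bar 3 (f.D1 2 f.A)

/-- `A_{11,1̄1}` (first derivative along `Z_1̄`, then along `Z₁`) -/
def A_b1 : M → ℂ := f.D1 1 (f.D1bar 2 f.A)

/-- `A_{11,1̄1̄}` -/
def A_bb : M → ℂ := f.D1bar 1 (f.D1bar 2 f.A)

/-- `A_{1̄1̄,11}` -/
def Abar_11 : M → ℂ := f.D1 (-1) (f.D1 (-2) f.Abar)

/-- `A_{1̄1̄,0}` -/
def Abar_0 : M → ℂ := f.D0 (-2) f.Abar

/-- The component `E₁₁ = θ^1̄(E Z₁)` of `E = E₁₁ θ¹ ⊗ Z_1̄ + conjugate`, where `E` is extended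
complex linearly to `Z₁ = (X - iY)/2`. -/
def E11 (E : EndField M) (p : M) : ℂ :=
  (1 / 2) * (conj (f.θ1 p (E p (f.X p))) - Complex.I * conj (f.θ1 p (E p (f.Y p))))

end UnitaryFrame

/-- The Tanaka-Webster scalar curvature: the value at `p` of `R` in a local unitary frame around
`p` (it does not depend on the frame). -/
def websterR (J : EndField M) (θ : OneForm M ℝ) (p : M) : ℝ :=
  Classical.epsilon fun r : ℝ => ∃ (U : Set M) (f : UnitaryFrame J θ U), p ∈ U ∧ f.R p = r

/-- The squared norm `|A|² = A₁₁ A_{1̄1̄}` of the torsion: its value at `p` in a local unitary frame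
around `p` (it does not depend on the frame). -/
def torsionSq (J : EndField M) (θ : OneForm M ℝ) (p : M) : ℝ :=
  Classical.epsilon fun r : ℝ =>
    ∃ (U : Set M) (f : UnitaryFrame J θ U), p ∈ U ∧ ‖f.A p‖ ^ 2 = r

/-- The energy `E(J, θ) = ∫_M (R² - |A|²) θ ∧ dθ`. -/
def energy [MeasurableSpace M] (J : EndField M) (θ : OneForm M ℝ) : ℝ :=
  ∫ p, ((websterR J θ p) ^ 2 - torsionSq J θ p) ∂(contactVolume θ)

/-- `Jt` is a smooth one-parameter family of CR structures on `ker θ` through `J`, with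
`δJ = 2E` on `ker θ`; the contact form `θ` is fixed. -/
structure IsJVariation (J : EndField M) (θ : OneForm M ℝ) (Jt : ℝ → EndField M)
    (E : EndField M) : Prop where
  initial : ∀ p v, θ p v = 0 → Jt 0 p v = J p v
  exists_interval : ∃ ε > 0, SmoothEndFieldFamily Jt (Ioo (-ε) ε ×ˢ univ) ∧
    ∀ t ∈ Ioo (-ε) ε, IsPseudohermitian (Jt t) θ
  deriv_eq : ∀ p v, θ p v = 0 → HasDerivAt (fun t => Jt t p v) ((2 : ℝ) • E p v) 0

/-- `θt` is a smooth one-parameter family of contact forms through `θ` for the fixed contact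
bundle `ker θ` and the fixed CR structure `J`, with `δθ = 2hθ`. -/
structure IsThetaVariation (J : EndField M) (θ : OneForm M ℝ) (θt : ℝ → OneForm M ℝ)
    (h : M → ℝ) : Prop where
  initial : θt 0 = θ
  exists_interval : ∃ ε > 0, SmoothOneFormFamily θt (Ioo (-ε) ε ×ˢ univ) ∧
    ∀ t ∈ Ioo (-ε) ε, IsPseudohermitian J (θt t) ∧ ∀ p v, θt t p v = 0 ↔ θ p v = 0
  deriv_eq : ∀ p v, HasDerivAt (fun t => θt t p v) (2 * h p * θ p v) 0

/-- The first variation of the energy vanishes for all variations of `J`. -/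
def IsCriticalInJ [MeasurableSpace M] (J : EndField M) (θ : OneForm M ℝ) : Prop :=
  ∀ (Jt : ℝ → EndField M) (E : EndField M), IsJVariation J θ Jt E →
    HasDerivAt (fun t => energy (Jt t) θ) 0 0

/-- The first variation of the energy vanishes for all variations of `θ`. -/
def IsCriticalInTheta [MeasurableSpace M] (J : EndField M) (θ : OneForm M ℝ) : Prop :=
  ∀ (θt : ℝ → OneForm M ℝ) (h : M → ℝ), IsThetaVariation J θ θt h →
    HasDerivAt (fun t => energy J (θt t)) 0 0

end Pseudohermitian

end CR3

end

/-! The proof is a moving-coframe computation in charts, followed by one application of the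
divergence theorem. Write ζ for θ¹. A variation with θ̇ = 2hθ and J̇ = 2E on ξ is followed, near any
point, by a family of unitary coframes ζ_t that is jointly smooth in time and space
(`exists_frameFamily`). Expand ζ̇ = pζ + Bζ̄ + sθ. Differentiating dθ = iζ∧ζ̄ gives Re p = h and s =
2i h_{,1̄} (`p_add_conj`, `s_eq`); differentiating ζ∘J = iζ on ξ gives E₁₁ = -i B̄ (`e_eq`). The
imaginary part of p is an infinitesimal rotation of the frame and drops out in the end.

Linearizing the structure equation for dζ determines the one-form η = ω̇ + dp and the variation of
the torsion. Since d(dp) = 0, the variation of the curvature can be read from dη. The outcome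
(`Rd_eq`, `Abd_eq`) is Ṙ + 2hR = 2 Re(B_{,11} - iBA₁₁) - 4Δ_b h and Ȧ_{1̄1̄} = (p - p̄ - 2h)A_{1̄1̄}
+ B_{,0} - s_{,1̄}.

Because θ_t = φ_t θ implies θ_t∧dθ_t = φ_t² θ∧dθ (`contactVolume_smul`), the energy is the integral
of φ_t²(R_t² - |A_t|²) against the fixed measure of θ. The time derivative of this density is 2
Re(`gradJ` E₁₁ + `gradθ` h) plus the divergence of an explicit vector field (`dt_dens_eq`,
`divg_realVec`). That field does not depend on the frame (`bdryVec_eq_of_chart`), so it is global,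
and its divergence integrates to zero over a closed manifold (`integral_eq_zero_of_divg`).
Compactness and joint smoothness justify differentiating under the integral
(`hasDerivAt_integral_of_locally`).

For the Euler–Lagrange equations, the commutation formula applied to A₁₁ shows that the conjugate of
`gradJ` is -2i times the left side of the first equation, and the real part of `gradθ` is the left
side of the second. Their necessity is the fundamental lemma of the calculus of variations: for a
bump function ρ and a constant c, the families √(1 + 4t²ρ²|c|²) J + 2tE with E₁₁ = ρc, and exp(2tcρ)
θ, are admissible, and the volume measure charges every nonempty open set. -/

noncomputable section

namespace CR3

/-! ### Forms, vector fields and exterior derivatives in charts -/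

section Chart

variable {M : Type*} [TopologicalSpace M] [ChartedSpace E3 M]

/-- The derivative of the chart around `x` at `q`. -/
def dChart (x q : M) : TangentSpace (𝓡 3) q →L[ℝ] E3 :=
  mfderiv (𝓡 3) 𝓘(ℝ, E3) (extChartAt (𝓡 3) x) q

/-- The derivative of the inverse chart around `x` at `y`. -/
def dChartSymm (x : M) (y : E3) : E3 →L[ℝ] TangentSpace (𝓡 3) ((extChartAt (𝓡 3) x).symm y) :=
  mfderiv 𝓘(ℝ, E3) (𝓡 3) (extChartAt (𝓡 3) x).symm y

/-- The transition map from the chart around `x` to the chart around `x'`. -/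
def transition (x x' : M) (y : E3) : E3 :=
  extChartAt (𝓡 3) x' ((extChartAt (𝓡 3) x).symm y)

lemma isOpen_target (x : M) : IsOpen (extChartAt (𝓡 3) x).target :=
  isOpen_extChartAt_target x

lemma target_mem_nhds (x : M) {y : E3} (hy : y ∈ (extChartAt (𝓡 3) x).target) :
    (extChartAt (𝓡 3) x).target ∈ 𝓝 y := (isOpen_target x).mem_nhds hy

variable [IsManifold (𝓡 3) ∞ M]

lemma mdifferentiableAt_chart {x q : M} (hq : q ∈ (extChartAt (𝓡 3) x).source) :
    MDifferentiableAt (𝓡 3) 𝓘(ℝ, E3) (extChartAt (𝓡 3) x) q := by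
  have : IsManifold (𝓡 3) 1 M := IsManifold.of_le (n := ∞) (by norm_cast)
  exact mdifferentiableAt_extChartAt (by rwa [extChartAt_source] at hq)

lemma mdifferentiableAt_chart_symm {x : M} {y : E3} (hy : y ∈ (extChartAt (𝓡 3) x).target) :
    MDifferentiableAt 𝓘(ℝ, E3) (𝓡 3) (extChartAt (𝓡 3) x).symm y := by
  have : IsManifold (𝓡 3) 1 M := IsManifold.of_le (n := ∞) (by norm_cast)
  exact (mdifferentiableWithinAt_extChartAt_symm hy).mdifferentiableAt (by simp)

lemma dChart_dChartSymm {x : M} {y : E3} (hy : y ∈ (extChartAt (𝓡 3) x).target) (w : E3) :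
    dChart x ((extChartAt (𝓡 3) x).symm y) (dChartSymm x y w) = w := by
  have : IsManifold (𝓡 3) 1 M := IsManifold.of_le (n := ∞) (by norm_cast)
  have h := mfderiv_extChartAt_comp_mfderivWithin_extChartAt_symm (I := 𝓡 3) hy
  rw [ModelWithCorners.range_eq_univ, mfderivWithin_univ] at h
  exact DFunLike.congr_fun h w

lemma dChartSymm_dChart {x : M} {y : E3} (hy : y ∈ (extChartAt (𝓡 3) x).target)
    (v : TangentSpace (𝓡 3) ((extChartAt (𝓡 3) x).symm y)) :
    dChartSymm x y (dChart x ((extChartAt (𝓡 3) x).symm y) v) = v := by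
  have : IsManifold (𝓡 3) 1 M := IsManifold.of_le (n := ∞) (by norm_cast)
  have h := mfderivWithin_extChartAt_symm_comp_mfderiv_extChartAt (I := 𝓡 3) hy
  rw [ModelWithCorners.range_eq_univ, mfderivWithin_univ] at h
  exact DFunLike.congr_fun h v

omit [IsManifold (𝓡 3) ∞ M] in
/-- Every point of a chart domain is of the form `φ⁻¹ y`. -/
lemma exists_chart_eq {x q : M} (hq : q ∈ (extChartAt (𝓡 3) x).source) :
    ∃ y ∈ (extChartAt (𝓡 3) x).target, (extChartAt (𝓡 3) x).symm y = q ∧ extChartAt (𝓡 3) x q = y :=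
  ⟨_, (extChartAt (𝓡 3) x).map_source hq, (extChartAt (𝓡 3) x).left_inv hq, rfl⟩

section Forms
variable {F : Type*} [NormedAddCommGroup F] [NormedSpace ℝ F]

omit [IsManifold (𝓡 3) ∞ M] in
lemma chartForm_apply (α : OneForm M F) (x : M) (y w : E3) :
    chartForm α x y w = α ((extChartAt (𝓡 3) x).symm y) (dChartSymm x y w) := rfl

lemma chartForm_dChart (α : OneForm M F) {x : M} {y : E3}
    (hy : y ∈ (extChartAt (𝓡 3) x).target) (v : TangentSpace (𝓡 3) ((extChartAt (𝓡 3) x).symm y)) :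
    chartForm α x y (dChart x _ v) = α ((extChartAt (𝓡 3) x).symm y) v := by
  rw [chartForm_apply, dChartSymm_dChart hy]

lemma contDiffAt_transition {x x' : M} {y : E3} (hy : y ∈ (extChartAt (𝓡 3) x).target)
    (hy' : (extChartAt (𝓡 3) x).symm y ∈ (extChartAt (𝓡 3) x').source) :
    ContDiffAt ℝ ∞ (transition x x') y := by
  have h1 : ContMDiffAt 𝓘(ℝ, E3) (𝓡 3) ∞ (extChartAt (𝓡 3) x).symm y :=
    (contMDiffOn_extChartAt_symm (n := ∞) x).contMDiffAt (target_mem_nhds x hy)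
  have h2 : ContMDiffAt (𝓡 3) 𝓘(ℝ, E3) ∞ (extChartAt (𝓡 3) x') ((extChartAt (𝓡 3) x).symm y) :=
    contMDiffAt_extChartAt' (by rwa [extChartAt_source] at hy')
  exact (h2.comp y h1).contDiffAt

lemma fderiv_transition {x x' : M} {y : E3} (hy : y ∈ (extChartAt (𝓡 3) x).target)
    (hy' : (extChartAt (𝓡 3) x).symm y ∈ (extChartAt (𝓡 3) x').source) (w : E3) :
    fderiv ℝ (transition x x') y w =
      dChart x' ((extChartAt (𝓡 3) x).symm y) (dChartSymm x y w) := by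
  have h := mfderiv_comp (I := 𝓘(ℝ, E3)) (I' := 𝓡 3) (I'' := 𝓘(ℝ, E3)) y
    (mdifferentiableAt_chart hy') (mdifferentiableAt_chart_symm hy)
  have h2 : mfderiv 𝓘(ℝ, E3) 𝓘(ℝ, E3) (transition x x') y = fderiv ℝ (transition x x') y :=
    mfderiv_eq_fderiv
  have h3 : mfderiv 𝓘(ℝ, E3) 𝓘(ℝ, E3) (transition x x') y =
    (dChart x' ((extChartAt (𝓡 3) x).symm y)).comp (dChartSymm x y) := h
  rw [← h2, h3]; rfl

lemma fderiv_transition_dChart {x x' q : M} (hq : q ∈ (extChartAt (𝓡 3) x).source)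
    (hq' : q ∈ (extChartAt (𝓡 3) x').source) (v : TangentSpace (𝓡 3) q) :
    fderiv ℝ (transition x x') (extChartAt (𝓡 3) x q) (dChart x q v) = dChart x' q v := by
  obtain ⟨y, hy, rfl, h⟩ := exists_chart_eq hq
  rw [h, fderiv_transition hy hq', dChartSymm_dChart hy]

omit [IsManifold (𝓡 3) ∞ M] in
lemma transition_mem {x x' : M} {y : E3}
    (hy' : (extChartAt (𝓡 3) x).symm y ∈ (extChartAt (𝓡 3) x').source) :
    transition x x' y ∈ (extChartAt (𝓡 3) x').target :=
  (extChartAt (𝓡 3) x').map_source hy'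

omit [IsManifold (𝓡 3) ∞ M] in
lemma symm_transition {x x' : M} {y : E3}
    (hy' : (extChartAt (𝓡 3) x).symm y ∈ (extChartAt (𝓡 3) x').source) :
    (extChartAt (𝓡 3) x').symm (transition x x' y) = (extChartAt (𝓡 3) x).symm y :=
  (extChartAt (𝓡 3) x').left_inv hy'

lemma eq_chartForm (α : OneForm M F) {x q : M}
    (hq : q ∈ (extChartAt (𝓡 3) x).source) (v : TangentSpace (𝓡 3) q) :
    α q v = chartForm α x (extChartAt (𝓡 3) x q) (dChart x q v) := by
  obtain ⟨y, hy, rfl, h⟩ := exists_chart_eq hq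
  rw [h, chartForm_dChart α hy]

lemma chartForm_transition (α : OneForm M F) {x x' : M} {y : E3}
    (hy : y ∈ (extChartAt (𝓡 3) x).target)
    (hy' : (extChartAt (𝓡 3) x).symm y ∈ (extChartAt (𝓡 3) x').source) :
    chartForm α x y =
      (chartForm α x' (transition x x' y)).comp (fderiv ℝ (transition x x') y) := by
  ext w
  rw [ContinuousLinearMap.comp_apply, fderiv_transition hy hy', chartForm_apply,
    eq_chartForm α hy']
  rfl

/-- The exterior derivative of a one-form on an open set of `E3`. -/
def ed (α : E3 → E3 →L[ℝ] F) (y v w : E3) : F := fderiv ℝ α y v w - fderiv ℝ α y w v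

/-- The derivative of the pulled-back form contains the second derivative of `τ`; that term is
symmetric and disappears on antisymmetrization. This is naturality of d, and it makes `extD`
independent of the chart. -/
lemma ed_pullback {β : E3 → E3 →L[ℝ] F} {τ : E3 → E3} {y : E3}
    (hτ : ContDiffAt ℝ 2 τ y) (hβ : DifferentiableAt ℝ β (τ y)) (v w : E3) :
    ed (fun z => (β (τ z)).comp (fderiv ℝ τ z)) y v w =
      ed β (τ y) (fderiv ℝ τ y v) (fderiv ℝ τ y w) := by
  have hτ1 : DifferentiableAt ℝ τ y := hτ.differentiableAt (by norm_num)
  have hτ2 : DifferentiableAt ℝ (fderiv ℝ τ) y :=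
    (hτ.fderiv_right (m := 1) (by norm_num)).differentiableAt (by norm_num)
  have hc : HasFDerivAt (fun z => β (τ z)) ((fderiv ℝ β (τ y)).comp (fderiv ℝ τ y)) y :=
    hβ.hasFDerivAt.comp y hτ1.hasFDerivAt
  have h := (hc.clm_comp hτ2.hasFDerivAt).fderiv
  have hs : fderiv ℝ (fderiv ℝ τ) y v w = fderiv ℝ (fderiv ℝ τ) y w v :=
    (hτ.isSymmSndFDerivAt (by simp)).eq v w
  simp only [ed, h]
  simp [hs]

lemma ed_congr {α β : E3 → E3 →L[ℝ] F} {y : E3} (h : α =ᶠ[𝓝 y] β) (v w : E3) :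
    ed α y v w = ed β y v w := by
  simp only [ed, h.fderiv_eq]

/-- The exterior derivative may be computed in any chart. -/
lemma extD_eq_ed (α : OneForm M F) {x q : M} (hq : q ∈ (extChartAt (𝓡 3) x).source)
    (hα : DifferentiableAt ℝ (chartForm α x) (extChartAt (𝓡 3) x q))
    (v w : TangentSpace (𝓡 3) q) :
    extD α q v w =
      ed (chartForm α x) (extChartAt (𝓡 3) x q) (dChart x q v) (dChart x q w) := by
  obtain ⟨y, hy, hyq, hqy⟩ := exists_chart_eq (mem_extChartAt_source (I := 𝓡 3) q)
  have hyx : (extChartAt (𝓡 3) q).symm y ∈ (extChartAt (𝓡 3) x).source := by rwa [hyq]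
  have hτ : transition q x y = extChartAt (𝓡 3) x q := by rw [transition, hyq]
  -- `extD` at `q` uses the chart centred at `q`. Near the image of `q`, that expression is the
  -- pull-back under the transition map of the expression in the chart around `x`.
  have hev : chartForm α q =ᶠ[𝓝 y]
      fun z => (chartForm α x (transition q x z)).comp (fderiv ℝ (transition q x) z) := by
    have h1 : ∀ᶠ z in 𝓝 y, z ∈ (extChartAt (𝓡 3) q).target := target_mem_nhds q hy
    have h2 : ∀ᶠ z in 𝓝 y, (extChartAt (𝓡 3) q).symm z ∈ (extChartAt (𝓡 3) x).source :=
      (mdifferentiableAt_chart_symm hy).continuousAt.eventually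
        ((isOpen_extChartAt_source (I := 𝓡 3) x).mem_nhds hyx)
    filter_upwards [h1, h2] with z hz1 hz2 using chartForm_transition α hz1 hz2
  have key : ∀ v : TangentSpace (𝓡 3) q,
      fderiv ℝ (transition q x) y (dChart q q v) = dChart x q v := fun v => by
    rw [← hqy, fderiv_transition_dChart (mem_extChartAt_source q) hq]
  change ed (chartForm α q) (extChartAt (𝓡 3) q q) (dChart q q v) (dChart q q w) = _
  rw [hqy, ed_congr hev, ed_pullback ((contDiffAt_transition hy hyx).of_le (by norm_cast)) (by rwa [hτ]), key, key, hτ]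

/-- The derivative of a function may be computed in any chart. -/
lemma dir_eq_fderiv (u : M → ℂ) {x q : M} (hq : q ∈ (extChartAt (𝓡 3) x).source)
    (v : TangentSpace (𝓡 3) q) :
    UnitaryFrame.dir u q v =
      fderiv ℝ (u ∘ (extChartAt (𝓡 3) x).symm) (extChartAt (𝓡 3) x q) (dChart x q v) := by
  obtain ⟨y, hy, rfl, h⟩ := exists_chart_eq hq
  rw [h]
  have hev : u =ᶠ[𝓝 ((extChartAt (𝓡 3) x).symm y)]
      (u ∘ (extChartAt (𝓡 3) x).symm) ∘ extChartAt (𝓡 3) x := by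
    filter_upwards [(isOpen_extChartAt_source (I := 𝓡 3) x).mem_nhds hq] with z hz
    simp only [Function.comp_apply, (extChartAt (𝓡 3) x).left_inv hz]
  by_cases hd : DifferentiableAt ℝ (u ∘ (extChartAt (𝓡 3) x).symm) y
  · have hd' : MDifferentiableAt 𝓘(ℝ, E3) 𝓘(ℝ, ℂ) (u ∘ (extChartAt (𝓡 3) x).symm)
        (extChartAt (𝓡 3) x ((extChartAt (𝓡 3) x).symm y)) := by
      rw [h]; exact hd.mdifferentiableAt
    have h1 := mfderiv_comp (I := 𝓡 3) (I' := 𝓘(ℝ, E3)) (I'' := 𝓘(ℝ, ℂ))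
      ((extChartAt (𝓡 3) x).symm y) hd' (mdifferentiableAt_chart hq)
    rw [UnitaryFrame.dir, hev.mfderiv_eq, h1, mfderiv_eq_fderiv, h]
    rfl
  -- Without differentiability both derivatives take the default value 0, so the formula needs no
  -- hypothesis on `u`.
  · have hn : ¬ MDifferentiableAt (𝓡 3) 𝓘(ℝ, ℂ) u ((extChartAt (𝓡 3) x).symm y) := fun hu =>
      hd (mdifferentiableAt_iff_differentiableAt.1 (hu.comp y (mdifferentiableAt_chart_symm hy)))
    rw [UnitaryFrame.dir, mfderiv_zero_of_not_mdifferentiableAt hn,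
      fderiv_zero_of_not_differentiableAt hd]
    rfl

end Forms

section Smoothness
variable {F : Type*} [NormedAddCommGroup F] [NormedSpace ℝ F]

/-- The part of the range of the chart around `x` that corresponds to `U`. -/
def chartSet (x : M) (U : Set M) : Set E3 :=
  (extChartAt (𝓡 3) x).target ∩ (extChartAt (𝓡 3) x).symm ⁻¹' U

omit [IsManifold (𝓡 3) ∞ M] in
lemma isOpen_chartSet (x : M) {U : Set M} (hU : IsOpen U) : IsOpen (chartSet x U) :=
  (continuousOn_extChartAt_symm x).isOpen_inter_preimage (isOpen_target x) hU

omit [IsManifold (𝓡 3) ∞ M] in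
lemma mem_chartSet {x q : M} {U : Set M} (hq : q ∈ (extChartAt (𝓡 3) x).source) (hU : q ∈ U) :
    extChartAt (𝓡 3) x q ∈ chartSet x U :=
  ⟨(extChartAt (𝓡 3) x).map_source hq, by
    rwa [mem_preimage, (extChartAt (𝓡 3) x).left_inv hq]⟩

lemma contMDiffOn_family_iff {g : ℝ × M → F} {I : Set ℝ} {x : M} {U : Set M}
    (hU : U ⊆ (extChartAt (𝓡 3) x).source) :
    ContMDiffOn (𝓘(ℝ, ℝ).prod (𝓡 3)) 𝓘(ℝ, F) ∞ g (I ×ˢ U) ↔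
      ContDiffOn ℝ ∞ (fun z : ℝ × E3 => g (z.1, (extChartAt (𝓡 3) x).symm z.2))
        (I ×ˢ chartSet x U) := by
  rw [← contMDiffOn_iff_contDiffOn]
  constructor
  · intro h
    have h2 : ContMDiffOn 𝓘(ℝ, ℝ × E3) (𝓘(ℝ, ℝ).prod (𝓡 3)) ∞
        (fun z : ℝ × E3 => (z.1, (extChartAt (𝓡 3) x).symm z.2)) (I ×ˢ chartSet x U) :=
      ContMDiffOn.prodMk contDiff_fst.contMDiff.contMDiffOn
        ((contMDiffOn_extChartAt_symm (n := ∞) x).comp contDiff_snd.contMDiff.contMDiffOn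
          fun z hz => hz.2.1)
    exact h.comp h2 fun z hz => ⟨hz.1, hz.2.2⟩
  · intro h
    have h2 : ContMDiffOn (𝓘(ℝ, ℝ).prod (𝓡 3)) 𝓘(ℝ, ℝ × E3) ∞
        (fun z : ℝ × M => (z.1, extChartAt (𝓡 3) x z.2)) (I ×ˢ U) :=
      ContMDiffOn.prodMk_space contMDiffOn_fst
        ((contMDiffOn_extChartAt (n := ∞) (x := x)).comp contMDiffOn_snd fun z hz => by
          rw [← extChartAt_source (𝓡 3)]; exact hU hz.2)
    refine (h.comp h2 fun z hz => ⟨hz.1, mem_chartSet (hU hz.2) hz.2⟩).congr ?_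
    intro z hz
    simp only [Function.comp_apply, (extChartAt (𝓡 3) x).left_inv (hU hz.2)]

omit [IsManifold (𝓡 3) ∞ M] in
lemma chartForm_eq_comp (α : OneForm M F) {x q : M} (hq : q ∈ (extChartAt (𝓡 3) x).source) :
    chartForm α x (extChartAt (𝓡 3) x q) =
      (α q).comp (mfderiv 𝓘(ℝ, E3) (𝓡 3) (extChartAt (𝓡 3) x).symm (extChartAt (𝓡 3) x q)) := by
  obtain ⟨y, hy, rfl, h⟩ := exists_chart_eq hq
  rw [h]; rfl

/-- A field of endomorphisms in the chart around `x`. -/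
def chartEnd (J : EndField M) (x : M) (y : E3) : E3 →L[ℝ] E3 :=
  (dChart x ((extChartAt (𝓡 3) x).symm y)).comp
    ((J ((extChartAt (𝓡 3) x).symm y)).comp (dChartSymm x y))

/-- A vector field in the chart around `x`. -/
def chartVec (X : VField M) (x : M) (y : E3) : E3 :=
  dChart x ((extChartAt (𝓡 3) x).symm y) (X ((extChartAt (𝓡 3) x).symm y))

omit [IsManifold (𝓡 3) ∞ M] in
lemma chartEnd_eq_comp (J : EndField M) {x q : M} (hq : q ∈ (extChartAt (𝓡 3) x).source) :
    chartEnd J x (extChartAt (𝓡 3) x q) = (dChart x q).comp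
      ((J q).comp (mfderiv 𝓘(ℝ, E3) (𝓡 3) (extChartAt (𝓡 3) x).symm (extChartAt (𝓡 3) x q))) := by
  obtain ⟨y, hy, rfl, h⟩ := exists_chart_eq hq
  rw [h]; rfl

omit [IsManifold (𝓡 3) ∞ M] in
lemma chartVec_eq (X : VField M) {x q : M} (hq : q ∈ (extChartAt (𝓡 3) x).source) :
    chartVec X x (extChartAt (𝓡 3) x q) = dChart x q (X q) := by
  obtain ⟨y, hy, rfl, h⟩ := exists_chart_eq hq
  rw [h]; rfl

/-- Over the chart domain of `x`, the trivialization of Hom(TM, F) is precomposition with the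
derivative of the inverse chart, so its fibre coordinate is exactly `chartForm`. Smoothness of a
section thereby becomes ordinary smoothness on a product in ℝ × `E3`. -/
lemma contMDiffOn_family_oneForm_iff {α : ℝ → OneForm M F} {I : Set ℝ} {x : M} {U : Set M}
    (hU : U ⊆ (extChartAt (𝓡 3) x).source) :
    ContMDiffOn (𝓘(ℝ, ℝ).prod (𝓡 3)) ((𝓡 3).prod 𝓘(ℝ, E3 →L[ℝ] F)) ∞
      (fun z : ℝ × M => TotalSpace.mk' (E3 →L[ℝ] F)
        (E := fun p : M => TangentSpace (𝓡 3) p →L[ℝ] Trivial M F p) z.2 (α z.1 z.2)) (I ×ˢ U) ↔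
      ContDiffOn ℝ ∞ (fun z : ℝ × E3 => chartForm (α z.1) x z.2) (I ×ˢ chartSet x U) := by
  have hmem : ∀ z ∈ I ×ˢ U, z.2 ∈ (chartAt E3 x).source := fun z hz => by
    rw [← extChartAt_source (𝓡 3)]; exact hU hz.2
  rw [Trivialization.contMDiffOn_iff (e := trivializationAt (E3 →L[ℝ] F)
    (fun p : M => TangentSpace (𝓡 3) p →L[ℝ] Trivial M F p) x)]
  · rw [and_iff_right contMDiffOn_snd]
    have hI : IsManifold (𝓡 3) 1 M := IsManifold.of_le (n := ∞) (by norm_cast)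
    have key : ∀ z ∈ I ×ˢ U, ((trivializationAt (E3 →L[ℝ] F)
        (fun p : M => TangentSpace (𝓡 3) p →L[ℝ] Trivial M F p) x)
          (TotalSpace.mk' (E3 →L[ℝ] F) z.2 (α z.1 z.2))).2 =
        chartForm (α z.1) x (extChartAt (𝓡 3) x z.2) := by
      intro z hz
      have h1 := TangentBundle.symmL_trivializationAt (I := 𝓡 3) (hmem z hz)
      rw [ModelWithCorners.range_eq_univ, mfderivWithin_univ] at h1
      rw [chartForm_eq_comp _ (hU hz.2), ← h1]
      ext w
      change ((Trivial.trivialization M F).continuousLinearMapAt ℝ z.2) _ = _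
      exact DFunLike.congr_fun (Trivial.continuousLinearMapAt_trivialization ℝ M F z.2) _
    rw [contMDiffOn_congr key, contMDiffOn_family_iff hU]
    refine contDiffOn_congr fun z hz => ?_
    simp only [(extChartAt (𝓡 3) x).right_inv hz.2.1]
  · intro z hz
    exact ⟨hmem z hz, trivial⟩

lemma contMDiffOn_family_endField_iff {J : ℝ → EndField M} {I : Set ℝ} {x : M} {U : Set M}
    (hU : U ⊆ (extChartAt (𝓡 3) x).source) :
    SmoothEndFieldFamily J (I ×ˢ U) ↔
      ContDiffOn ℝ ∞ (fun z : ℝ × E3 => chartEnd (J z.1) x z.2) (I ×ˢ chartSet x U) := by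
  have hmem : ∀ z ∈ I ×ˢ U, z.2 ∈ (chartAt E3 x).source := fun z hz => by
    rw [← extChartAt_source (𝓡 3)]; exact hU hz.2
  rw [SmoothEndFieldFamily, Trivialization.contMDiffOn_iff (e := trivializationAt (E3 →L[ℝ] E3)
    (fun p : M => TangentSpace (𝓡 3) p →L[ℝ] TangentSpace (𝓡 3) p) x)]
  · rw [and_iff_right contMDiffOn_snd]
    have hI : IsManifold (𝓡 3) 1 M := IsManifold.of_le (n := ∞) (by norm_cast)
    have key : ∀ z ∈ I ×ˢ U, ((trivializationAt (E3 →L[ℝ] E3)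
        (fun p : M => TangentSpace (𝓡 3) p →L[ℝ] TangentSpace (𝓡 3) p) x)
          (TotalSpace.mk' (E3 →L[ℝ] E3) z.2 (J z.1 z.2))).2 =
        chartEnd (J z.1) x (extChartAt (𝓡 3) x z.2) := by
      intro z hz
      have h1 := TangentBundle.symmL_trivializationAt (I := 𝓡 3) (hmem z hz)
      have h2 := TangentBundle.continuousLinearMapAt_trivializationAt (I := 𝓡 3) (hmem z hz)
      rw [ModelWithCorners.range_eq_univ, mfderivWithin_univ] at h1
      rw [chartEnd_eq_comp _ (hU hz.2), ← h1, dChart, ← h2]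
      rfl
    rw [contMDiffOn_congr key, contMDiffOn_family_iff hU]
    refine contDiffOn_congr fun z hz => ?_
    simp only [(extChartAt (𝓡 3) x).right_inv hz.2.1]
  · intro z hz
    exact ⟨hmem z hz, hmem z hz⟩

lemma smoothVField_iff {X : VField M} {x : M} {U : Set M}
    (hU : U ⊆ (extChartAt (𝓡 3) x).source) :
    SmoothVField X U ↔ ContDiffOn ℝ ∞ (chartVec X x) (chartSet x U) := by
  have hmem : ∀ z ∈ U, z ∈ (chartAt E3 x).source := fun z hz => by
    rw [← extChartAt_source (𝓡 3)]; exact hU hz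
  rw [SmoothVField, Trivialization.contMDiffOn_iff
    (e := trivializationAt E3 (TangentSpace (M := M) (𝓡 3)) x)]
  · rw [and_iff_right (show ContMDiffOn (𝓡 3) (𝓡 3) ∞ (fun q : M => q) U from contMDiffOn_id)]
    have hI : IsManifold (𝓡 3) 1 M := IsManifold.of_le (n := ∞) (by norm_cast)
    have key : ∀ z ∈ U, ((trivializationAt E3 (TangentSpace (M := M) (𝓡 3)) x)
          (TotalSpace.mk' E3 z (X z))).2 = chartVec X x (extChartAt (𝓡 3) x z) := by
      intro z hz
      have h2 := TangentBundle.continuousLinearMapAt_trivializationAt (I := 𝓡 3) (hmem z hz)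
      rw [chartVec_eq _ (hU hz), dChart, ← h2, Trivialization.continuousLinearMapAt_apply,
        Trivialization.coe_linearMapAt_of_mem _ (hmem z hz)]
    rw [contMDiffOn_congr key, ← contMDiffOn_iff_contDiffOn]
    constructor
    · intro h
      refine (h.comp ((contMDiffOn_extChartAt_symm (n := ∞) x).mono fun z hz => hz.1)
        fun z hz => hz.2).congr fun z hz => ?_
      simp only [Function.comp_apply, (extChartAt (𝓡 3) x).right_inv hz.1]
    · intro h
      exact h.comp ((contMDiffOn_extChartAt (n := ∞) (x := x)).mono hmem)
        fun z hz => mem_chartSet (hU hz) hz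
  · intro z hz
    exact hmem z hz

omit [IsManifold (𝓡 3) ∞ M] in
lemma chartSet_inter_source (x : M) (U : Set M) :
    chartSet x (U ∩ (extChartAt (𝓡 3) x).source) = chartSet x U := by
  ext y
  exact ⟨fun h => ⟨h.1, h.2.1⟩, fun h => ⟨h.1, h.2, (extChartAt (𝓡 3) x).map_target h.1⟩⟩

lemma smoothOneForm_iff {α : OneForm M F} {x : M} {U : Set M}
    (hU : U ⊆ (extChartAt (𝓡 3) x).source) :
    SmoothOneForm α U ↔ ContDiffOn ℝ ∞ (chartForm α x) (chartSet x U) := by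
  -- A single form is a constant family, so the criterion with a parameter covers it.
  have h := contMDiffOn_family_oneForm_iff (α := fun _ : ℝ => α) (I := univ) hU
  constructor
  · intro hα
    have := h.1 (ContMDiffOn.comp hα contMDiffOn_snd fun z hz => hz.2)
    exact this.comp (contDiff_const.prodMk contDiff_id : ContDiff ℝ ∞ fun y : E3 => ((0 : ℝ), y)).contDiffOn
      fun y hy => ⟨trivial, hy⟩
  · intro hα
    have := h.2 (hα.comp contDiff_snd.contDiffOn fun z hz => hz.2)
    exact this.comp (contMDiffOn_const.prodMk contMDiffOn_id :
      ContMDiffOn (𝓡 3) (𝓘(ℝ, ℝ).prod (𝓡 3)) ∞ (fun q : M => ((0 : ℝ), q)) U)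
      fun y hy => ⟨trivial, hy⟩

lemma SmoothOneForm.contDiffOn {α : OneForm M F} {U : Set M} (h : SmoothOneForm α U) (x : M) :
    ContDiffOn ℝ ∞ (chartForm α x) (chartSet x U) := by
  rw [← chartSet_inter_source]
  exact (smoothOneForm_iff inter_subset_right).1 (h.mono inter_subset_left)

lemma SmoothVField.contDiffOn {X : VField M} {U : Set M} (h : SmoothVField X U) (x : M) :
    ContDiffOn ℝ ∞ (chartVec X x) (chartSet x U) := by
  rw [← chartSet_inter_source]
  exact (smoothVField_iff inter_subset_right).1 (h.mono inter_subset_left)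

lemma SmoothEndFieldFamily.contDiffOn {J : ℝ → EndField M} {I : Set ℝ}
    (h : SmoothEndFieldFamily J (I ×ˢ univ)) (x : M) :
    ContDiffOn ℝ ∞ (fun z : ℝ × E3 => chartEnd (J z.1) x z.2)
      (I ×ˢ (extChartAt (𝓡 3) x).target) := by
  have := (contMDiffOn_family_endField_iff (J := J) (I := I) (x := x) subset_rfl).1
    (h.mono (prod_mono subset_rfl (subset_univ _)))
  refine this.mono (prod_mono subset_rfl fun y hy => ⟨hy, (extChartAt (𝓡 3) x).map_target hy⟩)

lemma SmoothOneFormFamily.contDiffOn {α : ℝ → OneForm M ℝ} {I : Set ℝ}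
    (h : SmoothOneFormFamily α (I ×ˢ univ)) (x : M) :
    ContDiffOn ℝ ∞ (fun z : ℝ × E3 => chartForm (α z.1) x z.2)
      (I ×ˢ (extChartAt (𝓡 3) x).target) := by
  have := (contMDiffOn_family_oneForm_iff (α := α) (I := I) (x := x) subset_rfl).1
    (h.mono (prod_mono subset_rfl (subset_univ _)))
  refine this.mono (prod_mono subset_rfl fun y hy => ⟨hy, (extChartAt (𝓡 3) x).map_target hy⟩)

lemma SmoothEndField.family {J : EndField M} (h : SmoothEndField J) (S : Set (ℝ × M)) :
    SmoothEndFieldFamily (fun _ => J) S :=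
  (h.comp contMDiff_snd).contMDiffOn

lemma SmoothOneForm.family {α : OneForm M ℝ} (h : SmoothOneForm α univ) (S : Set (ℝ × M)) :
    SmoothOneFormFamily (fun _ => α) S :=
  ContMDiffOn.comp h contMDiffOn_snd fun _ _ => trivial

lemma SmoothEndFieldFamily.slice {J : ℝ → EndField M} {I : Set ℝ}
    (h : SmoothEndFieldFamily J (I ×ˢ univ)) {t : ℝ} (ht : t ∈ I) : SmoothEndField (J t) := by
  rw [SmoothEndField, ← contMDiffOn_univ]
  exact ContMDiffOn.comp h (contMDiffOn_const.prodMk contMDiffOn_id :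
      ContMDiffOn (𝓡 3) (𝓘(ℝ, ℝ).prod (𝓡 3)) ∞ (fun q : M => (t, q)) univ)
      fun y hy => ⟨ht, hy⟩

lemma SmoothOneFormFamily.slice {α : ℝ → OneForm M ℝ} {I : Set ℝ}
    (h : SmoothOneFormFamily α (I ×ˢ univ)) {t : ℝ} (ht : t ∈ I) : SmoothOneForm (α t) univ :=
  ContMDiffOn.comp h (contMDiffOn_const.prodMk contMDiffOn_id :
      ContMDiffOn (𝓡 3) (𝓘(ℝ, ℝ).prod (𝓡 3)) ∞ (fun q : M => (t, q)) univ)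
      fun _ hy => ⟨ht, hy⟩

end Smoothness
end Chart

end CR3

end

/-! ### Dual frames, exterior calculus on `E3`, and covariant derivatives in a unitary frame -/

noncomputable section

namespace CR3

section LinearAlgebra

/-- A real linear functional with complex values, evaluated at `(X - iY)/2`. -/
def zOne (X Y : E3) (l : E3 →L[ℝ] ℂ) : ℂ := (1 / 2) * (l X - Complex.I * l Y)

/-- A real linear functional with complex values, evaluated at `(X + iY)/2`. -/
def zBar (X Y : E3) (l : E3 →L[ℝ] ℂ) : ℂ := (1 / 2) * (l X + Complex.I * l Y)

/-- The values of a coframe `(θ, ζ)` on its dual frame `(T, X, Y)`. -/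
structure IsDualFrame (θ : E3 →L[ℝ] ℝ) (ζ : E3 →L[ℝ] ℂ) (X Y T : E3) : Prop where
  θX : θ X = 0
  θY : θ Y = 0
  θT : θ T = 1
  ζX : ζ X = 1
  ζY : ζ Y = Complex.I
  ζT : ζ T = 0

namespace IsDualFrame

variable {θ : E3 →L[ℝ] ℝ} {ζ : E3 →L[ℝ] ℂ} {X Y T : E3}

/-- The values on `T`, `X`, `Y` make (θ, ζ) a surjection from `E3` onto ℝ × ℂ, and both spaces have
real dimension three. -/
lemma injective (h : IsDualFrame θ ζ X Y T) {v : E3} (h1 : θ v = 0) (h2 : ζ v = 0) : v = 0 := by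
  let L : E3 →ₗ[ℝ] ℝ × ℂ := (θ : E3 →ₗ[ℝ] ℝ).prod (ζ : E3 →ₗ[ℝ] ℂ)
  have hs : Function.Surjective L := by
    rintro ⟨r, c⟩
    refine ⟨r • T + c.re • X + c.im • Y, ?_⟩
    refine Prod.ext ?_ ?_
    · simp [L, h.θX, h.θY, h.θT]
    · simp [L, h.ζX, h.ζY, h.ζT, Complex.re_add_im]
  have hi : Function.Injective L :=
    (LinearMap.injective_iff_surjective_of_finrank_eq_finrank (by simp)).2 hs
  apply hi
  simp [L, h1, h2]

lemma decomp (h : IsDualFrame θ ζ X Y T) (v : E3) :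
    v = (ζ v).re • X + (ζ v).im • Y + θ v • T := by
  rw [← sub_eq_zero]
  apply h.injective
  · simp [h.θX, h.θY, h.θT]
  · simp [h.ζX, h.ζY, h.ζT, Complex.re_add_im]

/-- Expand `v` in the frame and use X = Z₁ + Z_1̄ and Y = i(Z₁ - Z_1̄). Complex one-forms are thus
determined by three components along ζ, ζ̄ and θ; identities between one-forms are checked below on
these components. -/
lemma apply_eq (h : IsDualFrame θ ζ X Y T) (l : E3 →L[ℝ] ℂ) (v : E3) :
    l v = ζ v * zOne X Y l + conj (ζ v) * zBar X Y l + θ v * l T := by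
  conv_lhs => rw [h.decomp v]
  have h1 : ζ v = (ζ v).re + (ζ v).im * Complex.I := (Complex.re_add_im _).symm
  have h2 : conj (ζ v) = (ζ v).re - (ζ v).im * Complex.I := by
    apply Complex.ext <;> simp
  rw [h2]
  conv_rhs => rw [h1]
  simp only [map_add, map_smul, Complex.real_smul, zOne, zBar, Complex.add_re, Complex.add_im,
    Complex.ofReal_re, Complex.ofReal_im, Complex.mul_re, Complex.mul_im, Complex.I_re,
    Complex.I_im, mul_zero, mul_one, sub_zero, zero_add, add_zero]
  linear_combination ((ζ v).im * l Y) * Complex.I_sq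

lemma ext (h : IsDualFrame θ ζ X Y T) {l l' : E3 →L[ℝ] ℂ} (hX : l X = l' X) (hY : l Y = l' Y)
    (hT : l T = l' T) : l = l' := by
  ext v
  rw [h.apply_eq l, h.apply_eq l', zOne, zOne, zBar, zBar, hX, hY, hT]

end IsDualFrame

end LinearAlgebra

section ExteriorDerivative

variable {F : Type*} [NormedAddCommGroup F] [NormedSpace ℝ F]

lemma ed_add {α β : E3 → E3 →L[ℝ] F} {y : E3} (hα : DifferentiableAt ℝ α y)
    (hβ : DifferentiableAt ℝ β y) (v w : E3) :
    ed (fun z => α z + β z) y v w = ed α y v w + ed β y v w := by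
  rw [ed, fderiv_fun_add hα hβ]
  simp only [ed, add_apply]
  abel

lemma ed_smul {u : E3 → ℂ} {α : E3 → E3 →L[ℝ] ℂ} {y : E3} (hu : DifferentiableAt ℝ u y)
    (hα : DifferentiableAt ℝ α y) (v w : E3) :
    ed (fun z => u z • α z) y v w =
      fderiv ℝ u y v * α y w - fderiv ℝ u y w * α y v + u y * ed α y v w := by
  rw [ed, fderiv_fun_smul hu hα]
  simp only [ed, add_apply, smul_apply,
    ContinuousLinearMap.smulRight_apply, smul_eq_mul]
  ring

lemma ed_comp {G : Type*} [NormedAddCommGroup G] [NormedSpace ℝ G] (L : F →L[ℝ] G)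
    {α : E3 → E3 →L[ℝ] F} {y : E3} (hα : DifferentiableAt ℝ α y) (v w : E3) :
    ed (fun z => L.comp (α z)) y v w = L (ed α y v w) := by
  have h := ((hasFDerivAt_const L y).clm_comp hα.hasFDerivAt).fderiv
  simp only [ed, h]
  simp

lemma ed_fderiv {u : E3 → F} {y : E3} (hu : ContDiffAt ℝ 2 u y) (v w : E3) :
    ed (fderiv ℝ u) y v w = 0 := by
  rw [ed, (hu.isSymmSndFDerivAt (by simp)).eq v w, sub_self]

lemma ed_swap (α : E3 → E3 →L[ℝ] F) (y v w : E3) : ed α y v w = - ed α y w v := by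
  simp [ed]

lemma ed_self (α : E3 → E3 →L[ℝ] F) (y v : E3) : ed α y v v = 0 := by
  simp [ed]

lemma ed_add_left (α : E3 → E3 →L[ℝ] F) (y v v' w : E3) :
    ed α y (v + v') w = ed α y v w + ed α y v' w := by
  simp only [ed, map_add, add_apply]; abel

lemma ed_smul_left (α : E3 → E3 →L[ℝ] F) (y : E3) (r : ℝ) (v w : E3) :
    ed α y (r • v) w = r • ed α y v w := by
  simp only [ed, map_smul, smul_apply, smul_sub]

lemma ed_add_right (α : E3 → E3 →L[ℝ] F) (y v w w' : E3) :
    ed α y v (w + w') = ed α y v w + ed α y v w' := by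
  simp only [ed, map_add, add_apply]; abel

lemma ed_smul_right (α : E3 → E3 →L[ℝ] F) (y : E3) (r : ℝ) (v w : E3) :
    ed α y v (r • w) = r • ed α y v w := by
  simp only [ed, map_smul, smul_apply, smul_sub]

/-- The complex conjugate of a complex one-form. -/
def conjForm (l : E3 →L[ℝ] ℂ) : E3 →L[ℝ] ℂ := (Complex.conjCLE : ℂ →L[ℝ] ℂ).comp l

/-- A real one-form as a complex one. -/
def realForm (l : E3 →L[ℝ] ℝ) : E3 →L[ℝ] ℂ := Complex.ofRealCLM.comp l

@[simp] lemma conjForm_apply (l : E3 →L[ℝ] ℂ) (v : E3) : conjForm l v = conj (l v) := rfl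
@[simp] lemma realForm_apply (l : E3 →L[ℝ] ℝ) (v : E3) : realForm l v = (l v : ℂ) := rfl

lemma ed_conjForm {α : E3 → E3 →L[ℝ] ℂ} {y : E3} (hα : DifferentiableAt ℝ α y) (v w : E3) :
    ed (fun z => conjForm (α z)) y v w = conj (ed α y v w) := ed_comp _ hα v w

lemma ed_realForm {α : E3 → E3 →L[ℝ] ℝ} {y : E3} (hα : DifferentiableAt ℝ α y) (v w : E3) :
    ed (fun z => realForm (α z)) y v w = ((ed α y v w : ℝ) : ℂ) := ed_comp _ hα v w

lemma contDiffOn_conjForm {α : E3 → E3 →L[ℝ] ℂ} {Ω : Set E3} (h : ContDiffOn ℝ ∞ α Ω) :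
    ContDiffOn ℝ ∞ (fun z => conjForm (α z)) Ω := contDiffOn_const.clm_comp h

lemma contDiffOn_realForm {α : E3 → E3 →L[ℝ] ℝ} {Ω : Set E3} (h : ContDiffOn ℝ ∞ α Ω) :
    ContDiffOn ℝ ∞ (fun z => realForm (α z)) Ω := contDiffOn_const.clm_comp h

lemma contDiffOn_ed {α : E3 → E3 →L[ℝ] F} {X Y : E3 → E3} {Ω : Set E3} (hΩ : IsOpen Ω)
    (h : ContDiffOn ℝ ∞ α Ω) (hX : ContDiffOn ℝ ∞ X Ω) (hY : ContDiffOn ℝ ∞ Y Ω) :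
    ContDiffOn ℝ ∞ (fun z => ed α z (X z) (Y z)) Ω := by
  have hd : ContDiffOn ℝ ∞ (fderiv ℝ α) Ω := h.fderiv_of_isOpen hΩ (by simp)
  exact ((hd.clm_apply hX).clm_apply hY).sub ((hd.clm_apply hY).clm_apply hX)

lemma contDiffOn_conj {u : E3 → ℂ} {Ω : Set E3} (h : ContDiffOn ℝ ∞ u Ω) :
    ContDiffOn ℝ ∞ (fun z => conj (u z)) Ω :=
  (Complex.conjCLE : ℂ →L[ℝ] ℂ).contDiff.comp_contDiffOn h

lemma contDiffOn_ofReal {u : E3 → ℝ} {Ω : Set E3} (h : ContDiffOn ℝ ∞ u Ω) :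
    ContDiffOn ℝ ∞ (fun z => (u z : ℂ)) Ω :=
  Complex.ofRealCLM.contDiff.comp_contDiffOn h

lemma fderiv_conj {u : E3 → ℂ} {y : E3} (h : DifferentiableAt ℝ u y) (v : E3) :
    fderiv ℝ (fun z => conj (u z)) y v = conj (fderiv ℝ u y v) := by
  have := ((Complex.conjCLE : ℂ →L[ℝ] ℂ).hasFDerivAt.comp y h.hasFDerivAt).fderiv
  exact DFunLike.congr_fun this v

lemma diffAt_of_contDiffOn {G : Type*} [NormedAddCommGroup G] [NormedSpace ℝ G] {E : Type*}
    [NormedAddCommGroup E] [NormedSpace ℝ E] {u : E → G}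
    {Ω : Set E} (h : ContDiffOn ℝ ∞ u Ω) (hΩ : IsOpen Ω) {y : E} (hy : y ∈ Ω) :
    DifferentiableAt ℝ u y :=
  (h.contDiffAt (hΩ.mem_nhds hy)).differentiableAt (by simp)

end ExteriorDerivative

/-- A local unitary frame on an open set `Ω` of `E3`, with its coframe and its Tanaka-Webster
data. -/
structure ChartFrame (J : E3 → E3 →L[ℝ] E3) (θ : E3 → E3 →L[ℝ] ℝ) (Ω : Set E3) where
  X : E3 → E3
  Y : E3 → E3
  T : E3 → E3
  ζ : E3 → E3 →L[ℝ] ℂ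
  conn : E3 → E3 →L[ℝ] ℂ
  A : E3 → ℂ
  R : E3 → ℝ
  isOpen : IsOpen Ω
  smooth_θ : ContDiffOn ℝ ∞ θ Ω
  smooth_X : ContDiffOn ℝ ∞ X Ω
  smooth_Y : ContDiffOn ℝ ∞ Y Ω
  smooth_T : ContDiffOn ℝ ∞ T Ω
  smooth_ζ : ContDiffOn ℝ ∞ ζ Ω
  smooth_conn : ContDiffOn ℝ ∞ conn Ω
  dual : ∀ y ∈ Ω, IsDualFrame (θ y) (ζ y) (X y) (Y y) (T y)
  reeb : ∀ y ∈ Ω, ∀ v, ed θ y (T y) v = 0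
  Y_eq : ∀ y ∈ Ω, Y y = J y (X y)
  unitary : ∀ y ∈ Ω, ∀ v w, ((ed θ y v w : ℝ) : ℂ) =
    Complex.I * (ζ y v * conj (ζ y w) - ζ y w * conj (ζ y v))
  structure_eq : ∀ y ∈ Ω, ∀ v w, ed ζ y v w =
    (ζ y v * conn y w - ζ y w * conn y v)
      + conj (A y) * (θ y v * conj (ζ y w) - θ y w * conj (ζ y v))
  skew : ∀ y ∈ Ω, ∀ v, conn y v + conj (conn y v) = 0
  curvature : ∀ y ∈ Ω, ∀ v w, θ y v = 0 → θ y w = 0 → ed conn y v w =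
    R y * (ζ y v * conj (ζ y w) - ζ y w * conj (ζ y v))

namespace ChartFrame

variable {J : E3 → E3 →L[ℝ] E3} {θ : E3 → E3 →L[ℝ] ℝ} {Ω : Set E3} (f : ChartFrame J θ Ω)

/-- The covariant differential of a component of weight `k`. -/
def cov (k : ℤ) (u : E3 → ℂ) (y : E3) : E3 →L[ℝ] ℂ := fderiv ℝ u y - (k * u y) • f.conn y

/-- Covariant derivative along `Z₁`. -/
def D1 (k : ℤ) (u : E3 → ℂ) (y : E3) : ℂ := zOne (f.X y) (f.Y y) (f.cov k u y)

/-- Covariant derivative along `Z_1̄`. -/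
def Db (k : ℤ) (u : E3 → ℂ) (y : E3) : ℂ := zBar (f.X y) (f.Y y) (f.cov k u y)

/-- Covariant derivative along the Reeb field. -/
def D0 (k : ℤ) (u : E3 → ℂ) (y : E3) : ℂ := f.cov k u y (f.T y)

/-- The scalar curvature as a complex function. -/
def Rc (y : E3) : ℂ := f.R y

/-- The conjugate of the torsion. -/
def Abar (y : E3) : ℂ := conj (f.A y)

lemma cov_apply (k : ℤ) (u : E3 → ℂ) (y v : E3) :
    f.cov k u y v = fderiv ℝ u y v - k * u y * f.conn y v := rfl

lemma smooth_cov (k : ℤ) {u : E3 → ℂ} (hu : ContDiffOn ℝ ∞ u Ω) :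
    ContDiffOn ℝ ∞ (f.cov k u) Ω :=
  (hu.fderiv_of_isOpen f.isOpen (by simp)).sub ((contDiffOn_const.mul hu).smul f.smooth_conn)

lemma smooth_D1 (k : ℤ) {u : E3 → ℂ} (hu : ContDiffOn ℝ ∞ u Ω) :
    ContDiffOn ℝ ∞ (f.D1 k u) Ω :=
  contDiffOn_const.mul (((f.smooth_cov k hu).clm_apply f.smooth_X).sub
    (contDiffOn_const.mul ((f.smooth_cov k hu).clm_apply f.smooth_Y)))

lemma smooth_Db (k : ℤ) {u : E3 → ℂ} (hu : ContDiffOn ℝ ∞ u Ω) :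
    ContDiffOn ℝ ∞ (f.Db k u) Ω :=
  contDiffOn_const.mul (((f.smooth_cov k hu).clm_apply f.smooth_X).add
    (contDiffOn_const.mul ((f.smooth_cov k hu).clm_apply f.smooth_Y)))

lemma smooth_D0 (k : ℤ) {u : E3 → ℂ} (hu : ContDiffOn ℝ ∞ u Ω) :
    ContDiffOn ℝ ∞ (f.D0 k u) Ω := (f.smooth_cov k hu).clm_apply f.smooth_T

variable {f}

lemma diffAt {G : Type*} [NormedAddCommGroup G] [NormedSpace ℝ G] (f : ChartFrame J θ Ω)
    {u : E3 → G} (hu : ContDiffOn ℝ ∞ u Ω) {y : E3} (hy : y ∈ Ω) : DifferentiableAt ℝ u y :=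
  diffAt_of_contDiffOn hu f.isOpen hy

variable (f)

lemma ed_ζ_XY {y : E3} (hy : y ∈ Ω) :
    ed f.ζ y (f.X y) (f.Y y) = f.conn y (f.Y y) - Complex.I * f.conn y (f.X y) := by
  have h := f.dual y hy
  simp [f.structure_eq y hy, h.ζX, h.ζY, h.θX, h.θY]

lemma ed_ζ_TX {y : E3} (hy : y ∈ Ω) :
    ed f.ζ y (f.T y) (f.X y) = - f.conn y (f.T y) + f.Abar y := by
  have h := f.dual y hy
  simp [f.structure_eq y hy, h.ζX, h.ζT, h.θX, h.θT, Abar]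

lemma ed_ζ_TY {y : E3} (hy : y ∈ Ω) :
    ed f.ζ y (f.T y) (f.Y y) =
      - Complex.I * f.conn y (f.T y) - Complex.I * f.Abar y := by
  have h := f.dual y hy
  simp [f.structure_eq y hy, h.ζY, h.ζT, h.θY, h.θT, Abar]
  ring

lemma ed_θ_XY {y : E3} (hy : y ∈ Ω) : ed θ y (f.X y) (f.Y y) = 2 := by
  have h := f.dual y hy
  have h2 := f.unitary y hy (f.X y) (f.Y y)
  rw [h.ζX, h.ζY] at h2
  have : ((ed θ y (f.X y) (f.Y y) : ℝ) : ℂ) = ((2 : ℝ) : ℂ) := by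
    rw [h2]; simp
    linear_combination (-2) * Complex.I_sq
  exact_mod_cast this

lemma ed_conn_XY {y : E3} (hy : y ∈ Ω) :
    ed f.conn y (f.X y) (f.Y y) = -2 * Complex.I * f.Rc y := by
  have h := f.dual y hy
  rw [f.curvature y hy _ _ h.θX h.θY, h.ζX, h.ζY, Rc]
  simp
  ring

/-- The right side is dζ(T, Z_1̄), where the connection does not contribute because ζ(Z_1̄) = 0 =
ζ(T). Smoothness of `A` is not part of the frame data and is recovered from this formula. -/
lemma Abar_eq {y : E3} (hy : y ∈ Ω) : f.Abar y =
    (1 / 2) * (ed f.ζ y (f.T y) (f.X y) + Complex.I * ed f.ζ y (f.T y) (f.Y y)) := by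
  rw [f.ed_ζ_TX hy, f.ed_ζ_TY hy]
  linear_combination (1 / 2 * (f.conn y (f.T y)) + 1 / 2 * f.Abar y) * Complex.I_sq

lemma smooth_Abar : ContDiffOn ℝ ∞ f.Abar Ω := by
  refine ContDiffOn.congr ?_ fun y hy => f.Abar_eq hy
  exact contDiffOn_const.mul ((contDiffOn_ed f.isOpen f.smooth_ζ f.smooth_T f.smooth_X).add
    (contDiffOn_const.mul (contDiffOn_ed f.isOpen f.smooth_ζ f.smooth_T f.smooth_Y)))

lemma smooth_A : ContDiffOn ℝ ∞ f.A Ω :=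
  (contDiffOn_conj f.smooth_Abar).congr fun y _ => by simp [Abar]

/-- The curvature equation on (X, Y) reads dω(X, Y) = -2iR, so R = (i/2) dω(X, Y) inherits
smoothness from the connection. -/
lemma smooth_Rc : ContDiffOn ℝ ∞ f.Rc Ω := by
  refine ContDiffOn.congr (f := fun y => (Complex.I / 2) * ed f.conn y (f.X y) (f.Y y))
    (contDiffOn_const.mul (contDiffOn_ed f.isOpen f.smooth_conn f.smooth_X f.smooth_Y))
    fun y hy => ?_
  rw [f.ed_conn_XY hy]
  linear_combination (f.Rc y) * Complex.I_sq

lemma conj_conn {y : E3} (hy : y ∈ Ω) (v : E3) : conj (f.conn y v) = - f.conn y v := by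
  linear_combination f.skew y hy v

/-- The conjugate of a covariant derivative. -/
lemma cov_conj (k : ℤ) {u : E3 → ℂ} {y : E3} (hy : y ∈ Ω) (hu : DifferentiableAt ℝ u y) (v : E3) :
    f.cov (-k) (fun z => conj (u z)) y v = conj (f.cov k u y v) := by
  simp only [cov_apply, fderiv_conj hu, map_sub, map_mul, f.conj_conn hy, map_intCast]
  push_cast
  ring

lemma D1_conj (k : ℤ) {u : E3 → ℂ} {y : E3} (hy : y ∈ Ω) (hu : DifferentiableAt ℝ u y) :
    f.D1 (-k) (fun z => conj (u z)) y = conj (f.Db k u y) := by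
  simp only [D1, Db, zOne, zBar, f.cov_conj k hy hu, map_mul, map_add, Complex.conj_I, map_div₀,
    map_one, Complex.conj_ofNat]
  ring

lemma Db_conj (k : ℤ) {u : E3 → ℂ} {y : E3} (hy : y ∈ Ω) (hu : DifferentiableAt ℝ u y) :
    f.Db (-k) (fun z => conj (u z)) y = conj (f.D1 k u y) := by
  simp only [D1, Db, zOne, zBar, f.cov_conj k hy hu, map_mul, map_sub, Complex.conj_I, map_div₀,
    map_one, Complex.conj_ofNat]
  ring

lemma D0_conj (k : ℤ) {u : E3 → ℂ} {y : E3} (hy : y ∈ Ω) (hu : DifferentiableAt ℝ u y) :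
    f.D0 (-k) (fun z => conj (u z)) y = conj (f.D0 k u y) := f.cov_conj k hy hu _

lemma cov_mul (k l : ℤ) {u v : E3 → ℂ} {y : E3} (hu : DifferentiableAt ℝ u y)
    (hv : DifferentiableAt ℝ v y) (w : E3) :
    f.cov (k + l) (fun z => u z * v z) y w = f.cov k u y w * v y + u y * f.cov l v y w := by
  simp only [cov_apply, fderiv_fun_mul hu hv, add_apply,
    smul_apply, smul_eq_mul]
  push_cast
  ring

lemma cov_add (k : ℤ) {u v : E3 → ℂ} {y : E3} (hu : DifferentiableAt ℝ u y)
    (hv : DifferentiableAt ℝ v y) :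
    f.cov k (fun z => u z + v z) y = f.cov k u y + f.cov k v y := by
  ext w
  simp only [cov_apply, fderiv_fun_add hu hv, add_apply]
  ring

lemma cov_const_mul (k : ℤ) {u : E3 → ℂ} {y : E3} (hu : DifferentiableAt ℝ u y) (c : ℂ) :
    f.cov k (fun z => c * u z) y = c • f.cov k u y := by
  ext w
  simp only [cov_apply, fderiv_const_mul hu, smul_apply, smul_eq_mul]
  ring

lemma D1_congr (k : ℤ) {u v : E3 → ℂ} (h : ∀ y ∈ Ω, u y = v y) {y : E3} (hy : y ∈ Ω) :
    f.D1 k u y = f.D1 k v y := by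
  have he : u =ᶠ[𝓝 y] v := Filter.eventuallyEq_of_mem (f.isOpen.mem_nhds hy) h
  simp only [D1, zOne, cov_apply, he.fderiv_eq, h y hy]

lemma Db_congr (k : ℤ) {u v : E3 → ℂ} (h : ∀ y ∈ Ω, u y = v y) {y : E3} (hy : y ∈ Ω) :
    f.Db k u y = f.Db k v y := by
  have he : u =ᶠ[𝓝 y] v := Filter.eventuallyEq_of_mem (f.isOpen.mem_nhds hy) h
  simp only [Db, zBar, cov_apply, he.fderiv_eq, h y hy]

lemma D0_congr (k : ℤ) {u v : E3 → ℂ} (h : ∀ y ∈ Ω, u y = v y) {y : E3} (hy : y ∈ Ω) :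
    f.D0 k u y = f.D0 k v y := by
  have he : u =ᶠ[𝓝 y] v := Filter.eventuallyEq_of_mem (f.isOpen.mem_nhds hy) h
  simp only [D0, cov_apply, he.fderiv_eq, h y hy]

/-- The value on `(X, Y)` of the exterior derivative of `a ζ + b ζ̄ + c θ`. -/
lemma ed_comb {a b c : E3 → ℂ} {y : E3} (hy : y ∈ Ω) (ha : DifferentiableAt ℝ a y)
    (hb : DifferentiableAt ℝ b y) (hc : DifferentiableAt ℝ c y) :
    ed (fun z => a z • f.ζ z + b z • conjForm (f.ζ z) + c z • realForm (θ z)) y (f.X y) (f.Y y) =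
      2 * Complex.I * (f.Db 1 a y - f.D1 (-1) b y) + 2 * c y := by
  have hζ := f.diffAt f.smooth_ζ hy
  have hζ' := f.diffAt (contDiffOn_conjForm f.smooth_ζ) hy
  have hθ := f.diffAt f.smooth_θ hy
  have hθ' := f.diffAt (contDiffOn_realForm f.smooth_θ) hy
  have h := f.dual y hy
  rw [ed_add ((ha.fun_smul hζ).fun_add (hb.fun_smul hζ')) (hc.fun_smul hθ'),
    ed_add (ha.fun_smul hζ) (hb.fun_smul hζ'),
    ed_smul ha hζ, ed_smul hb hζ', ed_smul hc hθ', ed_conjForm hζ, ed_realForm hθ,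
    f.ed_ζ_XY hy, f.ed_θ_XY hy]
  simp only [conjForm_apply, realForm_apply, h.ζX, h.ζY, h.θX, h.θY, D1, Db, zOne, zBar, cov_apply,
    map_sub, map_mul, Complex.conj_I, f.conj_conn hy, map_one]
  push_cast
  linear_combination (-(fderiv ℝ a y (f.Y y)) + a y * f.conn y (f.Y y) - fderiv ℝ b y (f.Y y)
    - b y * f.conn y (f.Y y)) * Complex.I_sq

lemma cov_eq (k : ℤ) (u : E3 → ℂ) {y : E3} (hy : y ∈ Ω) :
    f.cov k u y = f.D1 k u y • f.ζ y + f.Db k u y • conjForm (f.ζ y)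
      + f.D0 k u y • realForm (θ y) := by
  ext v
  rw [(f.dual y hy).apply_eq (f.cov k u y) v]
  simp only [add_apply, smul_apply, conjForm_apply,
    realForm_apply, smul_eq_mul, D1, Db, D0]
  ring

/-- The commutation formula `u_{,11̄} - u_{,1̄1} = i u_{,0} + k R u`. -/
lemma commutation (k : ℤ) {u : E3 → ℂ} (hu : ContDiffOn ℝ ∞ u Ω) {y : E3} (hy : y ∈ Ω) :
    f.Db (k + 1) (f.D1 k u) y - f.D1 (k - 1) (f.Db k u) y =
      Complex.I * f.D0 k u y + k * f.Rc y * u y := by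
  -- The exterior derivative of the covariant differential of `u` is evaluated on (X, Y) in two
  -- ways. Here the differential is expanded in the coframe.
  have h1 : ed (f.cov k u) y (f.X y) (f.Y y) =
      2 * Complex.I * (f.Db 1 (f.D1 k u) y - f.D1 (-1) (f.Db k u) y) + 2 * f.D0 k u y := by
    rw [← f.ed_comb hy (f.diffAt (f.smooth_D1 k hu) hy) (f.diffAt (f.smooth_Db k hu) hy)
      (f.diffAt (f.smooth_D0 k hu) hy)]
    exact ed_congr (Filter.eventuallyEq_of_mem (f.isOpen.mem_nhds hy)
      fun z hz => f.cov_eq k u hz) _ _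
  have hu1 := f.diffAt hu hy
  have hω := f.diffAt f.smooth_conn hy
  have hdu : DifferentiableAt ℝ (fderiv ℝ u) y :=
    f.diffAt (hu.fderiv_of_isOpen f.isOpen (m := ∞) (by simp)) hy
  -- Second evaluation: d(du) = 0, so only d(k u ω) remains, and it brings in the curvature.
  have h2 : ed (f.cov k u) y (f.X y) (f.Y y) =
      -k * (fderiv ℝ u y (f.X y) * f.conn y (f.Y y) - fderiv ℝ u y (f.Y y) * f.conn y (f.X y)
        + u y * (-2 * Complex.I * f.Rc y)) := by
    have he : f.cov k u = fun z => fderiv ℝ u z + (fun z => -(k : ℂ) * u z) z • f.conn z := by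
      ext z v
      simp only [cov_apply, add_apply, smul_apply,
        smul_eq_mul]
      ring
    have hk : DifferentiableAt ℝ (fun z => -(k : ℂ) * u z) y := hu1.const_mul _
    rw [he, ed_add hdu (hk.fun_smul hω), ed_smul hk hω, f.ed_conn_XY hy, fderiv_const_mul hu1,
      ed_fderiv ((hu.contDiffAt (f.isOpen.mem_nhds hy)).of_le (by norm_cast))]
    simp only [smul_apply, smul_eq_mul]
    ring
  -- `ed_comb` differentiates the coefficients as objects of weights 1 and -1, while the iterated
  -- covariant derivatives have weights k + 1 and k - 1. The differences are multiples of the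
  -- connection and match the connection terms of the second evaluation.
  have e1 : f.Db (k + 1) (f.D1 k u) y = f.Db 1 (f.D1 k u) y
      - k * f.D1 k u y * zBar (f.X y) (f.Y y) (f.conn y) := by
    simp only [Db, zBar, cov_apply]; push_cast; ring
  have e2 : f.D1 (k - 1) (f.Db k u) y = f.D1 (-1) (f.Db k u) y
      - k * f.Db k u y * zOne (f.X y) (f.Y y) (f.conn y) := by
    simp only [D1, zOne, cov_apply]; push_cast; ring
  have h3 := h1.symm.trans h2
  rw [e1, e2]
  have e3 : f.D1 k u y = zOne (f.X y) (f.Y y) (f.cov k u y) := rfl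
  have e4 : f.Db k u y = zBar (f.X y) (f.Y y) (f.cov k u y) := rfl
  rw [e3, e4]
  simp only [zOne, zBar, cov_apply]
  linear_combination (-Complex.I / 2) * h3 + (f.Db 1 (f.D1 k u) y - f.D1 (-1) (f.Db k u) y
    - k * u y * f.Rc y) * Complex.I_sq

end ChartFrame

end CR3

end

/-! ### Unitary changes of frame -/

noncomputable section

namespace CR3

namespace ChartFrame

variable {J : E3 → E3 →L[ℝ] E3} {θ : E3 → E3 →L[ℝ] ℝ} {Ω : Set E3}

/-- The frames `f` and `f'` are related by the unitary change of frame `ζ' = g ζ`. -/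
structure GaugeRel (f f' : ChartFrame J θ Ω) (g : E3 → ℂ) : Prop where
  smooth : ContDiffOn ℝ ∞ g Ω
  ζ_eq : ∀ y ∈ Ω, f'.ζ y = g y • f.ζ y
  norm : ∀ y ∈ Ω, g y * conj (g y) = 1

lemma ζ_comp_J (f : ChartFrame J θ Ω) {y : E3} (hy : y ∈ Ω)
    (hJ : ∀ v, θ y v = 0 → J y (J y v) = -v) {v : E3} (hv : θ y v = 0) :
    f.ζ y (J y v) = Complex.I * f.ζ y v := by
  have h := f.dual y hy
  have hd := h.decomp v
  rw [hv, zero_smul, add_zero] at hd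
  have h1 : J y v = (f.ζ y v).re • f.Y y - (f.ζ y v).im • f.X y := by
    conv_lhs => rw [hd]
    rw [map_add, map_smul, map_smul, f.Y_eq y hy, hJ _ h.θX]
    module
  rw [h1]
  conv_rhs => rw [← Complex.re_add_im (f.ζ y v)]
  simp only [map_sub, map_smul, h.ζX, h.ζY, Complex.real_smul]
  linear_combination (-(f.ζ y v).im) * Complex.I_sq

/-- Two frames for the same structure differ by a unitary factor. -/
lemma exists_gaugeRel (f f' : ChartFrame J θ Ω)
    (hJ : ∀ y ∈ Ω, ∀ v, θ y v = 0 → J y (J y v) = -v) :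
    GaugeRel f f' fun y => f'.ζ y (f.X y) := by
  -- The Reeb vector is the same in both frames: dθ(T, ·) = 0 and unitarity of `f'` force ζ'(T) = 0,
  -- and θ(T) = 1 for both.
  have hT : ∀ y ∈ Ω, f.T y = f'.T y := by
    intro y hy
    have h := f.dual y hy
    have h' := f'.dual y hy
    have hz : ∀ w, f'.ζ y (f.T y) * conj (f'.ζ y w) - f'.ζ y w * conj (f'.ζ y (f.T y)) = 0 := by
      intro w
      have := f'.unitary y hy (f.T y) w
      rw [f.reeb y hy] at this
      simpa using this
    have h1 := hz (f'.X y)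
    have h2 := hz (f'.Y y)
    rw [h'.ζX, map_one] at h1
    rw [h'.ζY, Complex.conj_I] at h2
    rw [← sub_eq_zero]
    apply h'.injective
    · rw [map_sub, h.θT, h'.θT, sub_self]
    · rw [map_sub, h'.ζT, sub_zero]
      linear_combination (1 / 2) * h1 + (Complex.I / 2) * h2
        + (f'.ζ y (f.T y) + conj (f'.ζ y (f.T y))) / 2 * Complex.I_sq
  -- Both coframes are complex linear on ξ with respect to J and vanish on T, so they are
  -- proportional.
  have hζ : ∀ y ∈ Ω, f'.ζ y = f'.ζ y (f.X y) • f.ζ y := by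
    intro y hy
    have h := f.dual y hy
    refine h.ext ?_ ?_ ?_
    · simp [h.ζX]
    · rw [f.Y_eq y hy, f'.ζ_comp_J hy (hJ y hy) h.θX, ← f.Y_eq y hy, smul_apply,
        h.ζY, smul_eq_mul, mul_comm]
    · rw [smul_apply, h.ζT, smul_zero, hT y hy, (f'.dual y hy).ζT]
  refine ⟨f'.smooth_ζ.clm_apply f.smooth_X, hζ, fun y hy => ?_⟩
  have h := f.dual y hy
  -- dθ(X, Y) equals 2 in the frame `f`, while unitarity of `f'` gives 2|g|².
  have h1 := f'.unitary y hy (f.X y) (f.Y y)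
  rw [f.ed_θ_XY hy, hζ y hy] at h1
  simp only [smul_apply, h.ζX, h.ζY, smul_eq_mul, mul_one, map_mul, Complex.conj_I] at h1
  push_cast at h1
  linear_combination (-1 / 2) * h1 + (f'.ζ y (f.X y) * conj (f'.ζ y (f.X y))) * Complex.I_sq

namespace GaugeRel

variable {f f' : ChartFrame J θ Ω} {g : E3 → ℂ} (h : GaugeRel f f' g) {y : E3}
include h

lemma ne_zero (hy : y ∈ Ω) : g y ≠ 0 := fun h0 => by
  have := h.norm y hy
  simp [h0] at this

lemma conj_eq (hy : y ∈ Ω) : conj (g y) = (g y)⁻¹ :=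
  eq_inv_of_mul_eq_one_right (h.norm y hy)

lemma T_eq (hy : y ∈ Ω) : f'.T y = f.T y := by
  have h1 := f.dual y hy
  have h2 := f'.dual y hy
  rw [← sub_eq_zero]
  apply h1.injective
  · rw [map_sub, h1.θT, h2.θT, sub_self]
  · have := h2.ζT
    rw [h.ζ_eq y hy, smul_apply, smul_eq_mul] at this
    rw [map_sub, h1.ζT, sub_zero]
    exact (mul_eq_zero.1 this).resolve_left (h.ne_zero hy)

lemma ζ_X (hy : y ∈ Ω) : f.ζ y (f'.X y) = conj (g y) := by
  have := (f'.dual y hy).ζX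
  rw [h.ζ_eq y hy, smul_apply, smul_eq_mul] at this
  rw [h.conj_eq hy]
  exact eq_inv_of_mul_eq_one_right this

lemma ζ_Y (hy : y ∈ Ω) : f.ζ y (f'.Y y) = conj (g y) * Complex.I := by
  have := (f'.dual y hy).ζY
  rw [h.ζ_eq y hy, smul_apply, smul_eq_mul] at this
  linear_combination conj (g y) * this - f.ζ y (f'.Y y) * h.norm y hy

lemma zOne_eq (hy : y ∈ Ω) (l : E3 →L[ℝ] ℂ) :
    zOne (f'.X y) (f'.Y y) l = conj (g y) * zOne (f.X y) (f.Y y) l := by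
  have h1 := f.dual y hy
  have h2 := f'.dual y hy
  rw [zOne, h1.apply_eq l (f'.X y), h1.apply_eq l (f'.Y y), h.ζ_X hy, h.ζ_Y hy, h2.θX, h2.θY]
  simp only [map_mul, Complex.conj_conj, Complex.conj_I]
  push_cast
  linear_combination (-(1 / 2) * conj (g y) * zOne (f.X y) (f.Y y) l
    + (1 / 2) * g y * zBar (f.X y) (f.Y y) l) * Complex.I_sq

lemma zBar_eq (hy : y ∈ Ω) (l : E3 →L[ℝ] ℂ) :
    zBar (f'.X y) (f'.Y y) l = g y * zBar (f.X y) (f.Y y) l := by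
  have h1 := f.dual y hy
  have h2 := f'.dual y hy
  rw [zBar, h1.apply_eq l (f'.X y), h1.apply_eq l (f'.Y y), h.ζ_X hy, h.ζ_Y hy, h2.θX, h2.θY]
  simp only [map_mul, Complex.conj_conj, Complex.conj_I]
  push_cast
  linear_combination ((1 / 2) * conj (g y) * zOne (f.X y) (f.Y y) l
    - (1 / 2) * g y * zBar (f.X y) (f.Y y) l) * Complex.I_sq

lemma fderiv_norm (hy : y ∈ Ω) (v : E3) :
    g y * conj (fderiv ℝ g y v) + fderiv ℝ g y v * conj (g y) = 0 := by
  have hg := f.diffAt h.smooth hy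
  have hg' := f.diffAt (contDiffOn_conj h.smooth) hy
  have h1 : (fun z => g z * conj (g z)) =ᶠ[𝓝 y] fun _ => (1 : ℂ) :=
    Filter.eventuallyEq_of_mem (f.isOpen.mem_nhds hy) h.norm
  have h2 := DFunLike.congr_fun (h1.fderiv_eq (𝕜 := ℝ)) v
  rw [fderiv_fun_mul hg hg'] at h2
  simp only [add_apply, smul_apply, smul_eq_mul, fderiv_conj hg] at h2
  simp only [fderiv_fun_const, Pi.zero_apply, zero_apply] at h2
  linear_combination h2

lemma ed_ζ (hy : y ∈ Ω) (v w : E3) : ed f'.ζ y v w =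
    fderiv ℝ g y v * f.ζ y w - fderiv ℝ g y w * f.ζ y v + g y * ed f.ζ y v w := by
  rw [← ed_smul (f.diffAt h.smooth hy) (f.diffAt f.smooth_ζ hy)]
  exact ed_congr (Filter.eventuallyEq_of_mem (f.isOpen.mem_nhds hy) h.ζ_eq) _ _

/-- This is uniqueness of the Tanaka–Webster connection. Comparing dζ' = dg∧ζ + g dζ with the
structure equation of `f'`, the one-form δ = ω' - ω + ḡ dg must vanish: its Z_1̄-component does by
the ζ∧ζ̄ part, its Z₁-component follows by conjugation since δ is imaginary, and its T-component
separates from the torsion. -/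
lemma conn_Abar (hy : y ∈ Ω) :
    f'.conn y = f.conn y - conj (g y) • fderiv ℝ g y ∧ f'.Abar y = g y ^ 2 * f.Abar y := by
  have h1 := f.dual y hy
  have hn := h.norm y hy
  have hdn := h.fderiv_norm hy
  have hXY := h.ed_ζ hy (f.X y) (f.Y y)
  have hTX := h.ed_ζ hy (f.T y) (f.X y)
  have hTY := h.ed_ζ hy (f.T y) (f.Y y)
  rw [f'.structure_eq y hy, h.ζ_eq y hy] at hXY hTX hTY
  rw [f.ed_ζ_XY hy] at hXY
  rw [f.ed_ζ_TX hy] at hTX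
  rw [f.ed_ζ_TY hy] at hTY
  simp only [smul_apply, smul_eq_mul, h1.ζX, h1.ζY, h1.ζT, h1.θX, h1.θY, h1.θT, map_mul,
    Complex.conj_I, map_one, map_zero] at hXY hTX hTY
  push_cast at hXY hTX hTY
  have ea : conj (f'.A y) = f'.Abar y := rfl
  rw [ea] at hXY hTX hTY
  have key : ∀ v, conj (f'.conn y v - f.conn y v + conj (g y) * fderiv ℝ g y v) =
      - (f'.conn y v - f.conn y v + conj (g y) * fderiv ℝ g y v) := by
    intro v
    simp only [map_add, map_sub, map_mul, Complex.conj_conj, f.conj_conn hy, f'.conj_conn hy]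
    linear_combination hdn v
  have e1 : (f'.conn y (f.Y y) - f.conn y (f.Y y) + conj (g y) * fderiv ℝ g y (f.Y y))
      - Complex.I * (f'.conn y (f.X y) - f.conn y (f.X y) + conj (g y) * fderiv ℝ g y (f.X y))
      = 0 := by
    linear_combination conj (g y) * hXY + (Complex.I * (f'.conn y (f.X y) - f.conn y (f.X y))
      - (f'.conn y (f.Y y) - f.conn y (f.Y y))) * hn
  have e2 := congrArg conj e1
  rw [map_sub, map_mul, key, key, Complex.conj_I, map_zero] at e2
  have eY : f'.conn y (f.Y y) - f.conn y (f.Y y) + conj (g y) * fderiv ℝ g y (f.Y y) = 0 := by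
    linear_combination (1 / 2) * e1 - (1 / 2) * e2
  have eX : f'.conn y (f.X y) - f.conn y (f.X y) + conj (g y) * fderiv ℝ g y (f.X y) = 0 := by
    linear_combination (Complex.I / 2) * (e1 + e2) +
      (f'.conn y (f.X y) - f.conn y (f.X y) + conj (g y) * fderiv ℝ g y (f.X y)) * Complex.I_sq
  -- The equations on (T, X) and (T, Y) have the form -δ(T) ± (ḡ²A'_{1̄1̄} - A_{1̄1̄}) = 0. Their
  -- sum gives the connection and their difference the torsion.
  have a1 : -(f'.conn y (f.T y) - f.conn y (f.T y) + conj (g y) * fderiv ℝ g y (f.T y))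
      + (f'.Abar y * conj (g y) ^ 2 - f.Abar y) = 0 := by
    linear_combination conj (g y) * hTX + (f'.conn y (f.T y) - f.conn y (f.T y) + f.Abar y) * hn
  have a2 : -(f'.conn y (f.T y) - f.conn y (f.T y) + conj (g y) * fderiv ℝ g y (f.T y))
      - (f'.Abar y * conj (g y) ^ 2 - f.Abar y) = 0 := by
    linear_combination -Complex.I * conj (g y) * hTY +
      (f'.conn y (f.T y) - f.conn y (f.T y) - f.Abar y) * hn
      + (-(f'.conn y (f.T y)) * g y * conj (g y)
       - f'.Abar y * conj (g y) ^ 2 - conj (g y) * fderiv ℝ g y (f.T y)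
        + g y * conj (g y) * (f.conn y (f.T y) + f.Abar y)) * Complex.I_sq
  constructor
  · refine h1.ext ?_ ?_ ?_ <;> simp only [sub_apply, smul_apply, smul_eq_mul]
    · linear_combination eX
    · linear_combination eY
    · linear_combination (-1 / 2) * (a1 + a2)
  · linear_combination (g y ^ 2 / 2) * (a1 - a2)
      + (-(f'.Abar y) * (g y * conj (g y) + 1)) * hn

/-- The curvature forms differ by dḡ∧dg, which vanishes: |g| = 1 makes dḡ a multiple of dg. -/
lemma Rc_eq (hy : y ∈ Ω) : f'.Rc y = f.Rc y := by
  have h1 := f.dual y hy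
  have hn := h.norm y hy
  have hg := f.diffAt h.smooth hy
  have hg' : DifferentiableAt ℝ (fun z => -conj (g z)) y :=
    (f.diffAt (contDiffOn_conj h.smooth) hy).fun_neg
  have hdg : DifferentiableAt ℝ (fderiv ℝ g) y :=
    f.diffAt (h.smooth.fderiv_of_isOpen f.isOpen (m := ∞) (by simp)) hy
  have he : f'.conn =ᶠ[𝓝 y] fun z => f.conn z + (fun z => -conj (g z)) z • fderiv ℝ g z :=
    Filter.eventuallyEq_of_mem (f.isOpen.mem_nhds hy) fun z hz => by
      rw [(h.conn_Abar hz).1]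
      ext v
      simp only [sub_apply, add_apply, smul_apply, smul_eq_mul]
      ring
  have e1 := ed_congr he (f.X y) (f.Y y)
  rw [ed_add (f.diffAt f.smooth_conn hy) (hg'.fun_smul hdg), ed_smul hg' hdg,
    ed_fderiv ((h.smooth.contDiffAt (f.isOpen.mem_nhds hy)).of_le (by norm_cast)),
    f'.curvature y hy _ _ h1.θX h1.θY, f.ed_conn_XY hy, h.ζ_eq y hy, fderiv_fun_neg] at e1
  simp only [smul_apply, smul_eq_mul, h1.ζX, h1.ζY, neg_apply, fderiv_conj hg, map_mul,
    Complex.conj_I, map_one] at e1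
  have d1 := h.fderiv_norm hy (f.X y)
  have d2 := h.fderiv_norm hy (f.Y y)
  change (f'.R y : ℂ) = f.Rc y
  linear_combination (Complex.I / 2) * e1
    + (Complex.I / 2) * conj (g y) * fderiv ℝ g y (f.X y) * d2
    - (Complex.I / 2) * conj (g y) * fderiv ℝ g y (f.Y y) * d1
    + ((Complex.I / 2) * (conj (fderiv ℝ g y (f.X y)) * fderiv ℝ g y (f.Y y)
      - conj (fderiv ℝ g y (f.Y y)) * fderiv ℝ g y (f.X y)) + f'.R y * Complex.I ^ 2) * hn
    + (f'.R y - f.Rc y) * Complex.I_sq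

/-- The derivative of g^{-k} produces -k g^{-k} ḡ dg u, which is cancelled by the change ω' = ω - ḡ
dg of the connection. Hence a covariant derivative of a tensor component is again one. -/
lemma cov_eq (hy : y ∈ Ω) (k : ℤ) {u u' : E3 → ℂ} (hu : ContDiffOn ℝ ∞ u Ω)
    (he : ∀ z ∈ Ω, u' z = g z ^ (-k) * u z) : f'.cov k u' y = g y ^ (-k) • f.cov k u y := by
  have hg := f.diffAt h.smooth hy
  have hu1 := f.diffAt hu hy
  have h0 := h.ne_zero hy
  have hz : HasFDerivAt (fun z => g z ^ (-k))
      ((((-k : ℤ) : ℂ) * g y ^ (-k - 1)) • fderiv ℝ g y) y := by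
    have h1 := ((hasDerivAt_zpow (-k) (g y) (Or.inl h0)).hasFDerivAt.restrictScalars ℝ).comp y
      hg.hasFDerivAt
    refine h1.congr_fderiv ?_
    ext v
    simp [mul_comm]
  have hev : u' =ᶠ[𝓝 y] fun z => g z ^ (-k) * u z :=
    Filter.eventuallyEq_of_mem (f.isOpen.mem_nhds hy) he
  ext v
  rw [smul_apply, cov_apply, cov_apply, hev.fderiv_eq, (h.conn_Abar hy).1, he y hy,
    fderiv_fun_mul hz.differentiableAt hu1, hz.fderiv, h.conj_eq hy]
  simp only [add_apply, sub_apply, smul_apply, smul_eq_mul, zpow_sub₀ h0, zpow_one]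
  push_cast
  field_simp
  ring

lemma D1_eq (hy : y ∈ Ω) (k : ℤ) {u u' : E3 → ℂ} (hu : ContDiffOn ℝ ∞ u Ω)
    (he : ∀ z ∈ Ω, u' z = g z ^ (-k) * u z) :
    f'.D1 k u' y = g y ^ (-(k + 1)) * f.D1 k u y := by
  rw [D1, h.zOne_eq hy, h.cov_eq hy k hu he, h.conj_eq hy, neg_add, zpow_add₀ (h.ne_zero hy),
    zpow_neg_one, D1]
  simp only [zOne, smul_apply, smul_eq_mul]
  ring

lemma Db_eq (hy : y ∈ Ω) (k : ℤ) {u u' : E3 → ℂ} (hu : ContDiffOn ℝ ∞ u Ω)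
    (he : ∀ z ∈ Ω, u' z = g z ^ (-k) * u z) :
    f'.Db k u' y = g y ^ (-(k - 1)) * f.Db k u y := by
  rw [Db, h.zBar_eq hy, h.cov_eq hy k hu he, neg_sub', sub_neg_eq_add, zpow_add₀ (h.ne_zero hy),
    zpow_one, Db]
  simp only [zBar, smul_apply, smul_eq_mul]
  ring

lemma D0_eq (hy : y ∈ Ω) (k : ℤ) {u u' : E3 → ℂ} (hu : ContDiffOn ℝ ∞ u Ω)
    (he : ∀ z ∈ Ω, u' z = g z ^ (-k) * u z) :
    f'.D0 k u' y = g y ^ (-k) * f.D0 k u y := by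
  rw [D0, h.T_eq hy, h.cov_eq hy k hu he, smul_apply, smul_eq_mul, D0]

end GaugeRel

end ChartFrame

end CR3

end

/-! ### Construction of smooth families of unitary frames -/

noncomputable section

namespace CR3

section Parameter

variable {F : Type*} [NormedAddCommGroup F] [NormedSpace ℝ F]

/-- The exterior derivative along `E3` of a family of one-forms depending on a parameter. -/
def edPar (α : ℝ × E3 → E3 →L[ℝ] F) (z : ℝ × E3) (v w : E3) : F :=
  fderiv ℝ α z (0, v) w - fderiv ℝ α z (0, w) v

lemma fderiv_slice {G : Type*} [NormedAddCommGroup G] [NormedSpace ℝ G] {u : ℝ × E3 → G} {t : ℝ}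
    {y : E3} (hu : DifferentiableAt ℝ u (t, y)) (v : E3) :
    fderiv ℝ (fun y => u (t, y)) y v = fderiv ℝ u (t, y) (0, v) := by
  have h : HasFDerivAt (fun y : E3 => (t, y)) (ContinuousLinearMap.inr ℝ ℝ E3) y :=
    hasFDerivAt_prodMk_right t y
  have := (hu.hasFDerivAt.comp y h).fderiv
  exact DFunLike.congr_fun this v

lemma ed_slice {α : ℝ × E3 → E3 →L[ℝ] F} {t : ℝ} {y : E3} (hα : DifferentiableAt ℝ α (t, y))
    (v w : E3) : ed (fun y => α (t, y)) y v w = edPar α (t, y) v w := by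
  simp only [ed, edPar, fderiv_slice hα]

lemma contDiffOn_edPar {α : ℝ × E3 → E3 →L[ℝ] F} {W : Set (ℝ × E3)} (hW : IsOpen W)
    (hα : ContDiffOn ℝ ∞ α W) {X Y : ℝ × E3 → E3} (hX : ContDiffOn ℝ ∞ X W)
    (hY : ContDiffOn ℝ ∞ Y W) : ContDiffOn ℝ ∞ (fun z => edPar α z (X z) (Y z)) W := by
  have hd : ContDiffOn ℝ ∞ (fderiv ℝ α) W := hα.fderiv_of_isOpen hW (by simp)
  exact ((hd.clm_apply (contDiffOn_const.prodMk hX)).clm_apply hY).sub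
    ((hd.clm_apply (contDiffOn_const.prodMk hY)).clm_apply hX)

lemma ContDiffOn.slice {G : Type*} [NormedAddCommGroup G] [NormedSpace ℝ G] {u : ℝ × E3 → G}
    {I : Set ℝ} {Ω : Set E3} (h : ContDiffOn ℝ ∞ u (I ×ˢ Ω)) {t : ℝ} (ht : t ∈ I) :
    ContDiffOn ℝ ∞ (fun y => u (t, y)) Ω :=
  h.comp (contDiff_const.prodMk contDiff_id : ContDiff ℝ ∞ fun y : E3 => (t, y)).contDiffOn
    fun _ hy => ⟨ht, hy⟩

end Parameter

section Expand

variable {F : Type*} [NormedAddCommGroup F] [NormedSpace ℝ F]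

lemma IsDualFrame.ed_expand {θ : E3 →L[ℝ] ℝ} {ζ : E3 →L[ℝ] ℂ} {X Y T : E3}
    (h : IsDualFrame θ ζ X Y T) (α : E3 → E3 →L[ℝ] F) (y v w : E3) :
    ed α y v w = ((ζ v).re * (ζ w).im - (ζ v).im * (ζ w).re) • ed α y X Y
      + (θ v * (ζ w).re - (ζ v).re * θ w) • ed α y T X
      + (θ v * (ζ w).im - (ζ v).im * θ w) • ed α y T Y := by
  conv_lhs => rw [h.decomp v, h.decomp w]
  simp only [ed_add_left, ed_add_right, ed_smul_left, ed_smul_right, ed_self]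
  rw [ed_swap α y Y X, ed_swap α y X T, ed_swap α y Y T]
  module

/-- The third derivative-free part of `d(dθ) = 0` for `dθ = i ζ ∧ ζ̄`. -/
lemma ed_ζ_bianchi {θ : E3 → E3 →L[ℝ] ℝ} {ζ : E3 → E3 →L[ℝ] ℂ} {y X Y T : E3} {Ω : Set E3}
    (hΩ : IsOpen Ω) (hy : y ∈ Ω) (hθ : ContDiffOn ℝ ∞ θ Ω) (hζ : ContDiffOn ℝ ∞ ζ Ω)
    (hu : ∀ y ∈ Ω, ∀ v w, ((ed θ y v w : ℝ) : ℂ) =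
      Complex.I * (ζ y v * conj (ζ y w) - ζ y w * conj (ζ y v)))
    (h : IsDualFrame (θ y) (ζ y) X Y T) :
    (ed ζ y Y T - conj (ed ζ y Y T)) - Complex.I * (ed ζ y T X + conj (ed ζ y T X)) = 0 := by
  have hζd := diffAt_of_contDiffOn hζ hΩ hy
  have hdθ : ContDiffOn ℝ ∞ (fderiv ℝ θ) Ω := hθ.fderiv_of_isOpen hΩ (by simp)
  have hdd := diffAt_of_contDiffOn hdθ hΩ hy
  have hζv : ∀ v u, DifferentiableAt ℝ (fun z => ζ z v) y ∧
      fderiv ℝ (fun z => ζ z v) y u = fderiv ℝ ζ y u v := by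
    intro v u
    have := hζd.hasFDerivAt.clm_apply (hasFDerivAt_const v y)
    refine ⟨this.differentiableAt, ?_⟩
    rw [this.fderiv]; simp
  have hζc : ∀ v u, DifferentiableAt ℝ (fun z => conj (ζ z v)) y ∧
      fderiv ℝ (fun z => conj (ζ z v)) y u = conj (fderiv ℝ ζ y u v) := by
    intro v u
    refine ⟨?_, by rw [fderiv_conj (hζv v u).1, (hζv v u).2]⟩
    exact (Complex.conjCLE : ℂ →L[ℝ] ℂ).differentiableAt.comp y (hζv v u).1
  -- Both sides of dθ(v, w) = i(ζ∧ζ̄)(v, w) are differentiated in the direction `u`, with constant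
  -- vectors `v` and `w`.
  have key : ∀ u v w, ((fderiv ℝ (fderiv ℝ θ) y u v w - fderiv ℝ (fderiv ℝ θ) y u w v : ℝ) : ℂ) =
      Complex.I * ((fderiv ℝ ζ y u v * conj (ζ y w) + ζ y v * conj (fderiv ℝ ζ y u w))
        - (fderiv ℝ ζ y u w * conj (ζ y v) + ζ y w * conj (fderiv ℝ ζ y u v))) := by
    intro u v w
    have h1 : HasFDerivAt (fun z => ((ed θ z v w : ℝ) : ℂ)) _ y :=
      Complex.ofRealCLM.hasFDerivAt.comp y
        (((hdd.hasFDerivAt.clm_apply (hasFDerivAt_const v y)).clm_apply (hasFDerivAt_const w y)).sub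
        ((hdd.hasFDerivAt.clm_apply (hasFDerivAt_const w y)).clm_apply (hasFDerivAt_const v y)))
    have h2 : (fun z => ((ed θ z v w : ℝ) : ℂ)) =ᶠ[𝓝 y] fun z =>
        Complex.I * (ζ z v * conj (ζ z w) - ζ z w * conj (ζ z v)) :=
      Filter.eventuallyEq_of_mem (hΩ.mem_nhds hy) fun z hz => hu z hz v w
    have h3 := DFunLike.congr_fun (h1.fderiv.symm.trans (h2.fderiv_eq (𝕜 := ℝ))) u
    rw [fderiv_const_mul (((hζv v u).1.fun_mul (hζc w u).1).fun_sub ((hζv w u).1.fun_mul (hζc v u).1)),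
      fderiv_fun_sub ((hζv v u).1.fun_mul (hζc w u).1) ((hζv w u).1.fun_mul (hζc v u).1),
      fderiv_fun_mul (hζv v u).1 (hζc w u).1, fderiv_fun_mul (hζv w u).1 (hζc v u).1] at h3
    simp only [smul_apply, sub_apply, add_apply, smul_eq_mul, (hζc _ _).2, (hζv _ _).2] at h3
    have h4 : ((fderiv ℝ (fderiv ℝ θ) y u v w - fderiv ℝ (fderiv ℝ θ) y u w v : ℝ) : ℂ) = _ :=
      Eq.trans (by simp) h3
    rw [h4]; ring
  -- Symmetry of the second derivative of θ makes the cyclic sum of the left sides vanish; this is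
  -- d(dθ) = 0.
  have hsym : ∀ u v, fderiv ℝ (fderiv ℝ θ) y u v = fderiv ℝ (fderiv ℝ θ) y v u := fun u v =>
    (((hθ.contDiffAt (hΩ.mem_nhds hy)).of_le (by norm_cast)).isSymmSndFDerivAt (n := 2) (by simp)).eq u v
  have k1 := key X Y T
  have k2 := key Y T X
  have k3 := key T X Y
  rw [hsym X T] at k1
  rw [hsym Y X] at k2
  rw [hsym T Y] at k3
  rw [h.ζY, h.ζT] at k1
  rw [h.ζX, h.ζT] at k2
  rw [h.ζX, h.ζY] at k3
  simp only [ed, map_sub, map_one, map_zero, Complex.conj_I] at k1 k2 k3 ⊢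
  push_cast at k1 k2 k3
  linear_combination Complex.I * (k1 + k2 + k3) + (fderiv ℝ ζ y Y T - fderiv ℝ ζ y T Y
    - conj (fderiv ℝ ζ y Y T) + conj (fderiv ℝ ζ y T Y) - Complex.I * fderiv ℝ ζ y T X
    + Complex.I * fderiv ℝ ζ y X T - Complex.I * conj (fderiv ℝ ζ y T X)
    + Complex.I * conj (fderiv ℝ ζ y X T)) * Complex.I_sq

end Expand

section Connection

variable {θ : E3 → E3 →L[ℝ] ℝ} {ζ : E3 → E3 →L[ℝ] ℂ} {X Y T : E3 → E3} {Ω : Set E3}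

/-- The coefficients of `dζ = a ζ ∧ ζ̄ + b θ ∧ ζ + c θ ∧ ζ̄`. -/
def coefA (P : ℂ) : ℂ := Complex.I / 2 * P
def coefB (Q S : ℂ) : ℂ := (1 / 2) * (Q - Complex.I * S)
def coefC (Q S : ℂ) : ℂ := (1 / 2) * (Q + Complex.I * S)

/-- The connection form determined by the values `P = dζ(X, Y)`, `Q = dζ(T, X)`,
`S = dζ(T, Y)`. -/
def connOf (P Q S : ℂ) (θ : E3 →L[ℝ] ℝ) (ζ : E3 →L[ℝ] ℂ) : E3 →L[ℝ] ℂ :=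
  coefA P • conjForm ζ - conj (coefA P) • ζ - coefB Q S • realForm θ

lemma connOf_apply (P Q S : ℂ) (θ : E3 →L[ℝ] ℝ) (ζ : E3 →L[ℝ] ℂ) (v : E3) :
    connOf P Q S θ ζ v = coefA P * conj (ζ v) - conj (coefA P) * ζ v - coefB Q S * (θ v : ℂ) := rfl

/-- Applying d to dθ = iζ∧ζ̄ forces the θ∧ζ coefficient of dζ to be imaginary. This is the
integrability condition that lets -bθ be part of a skew connection form. -/
lemma coefB_imaginary {y : E3} (hΩ : IsOpen Ω) (hy : y ∈ Ω) (hθ : ContDiffOn ℝ ∞ θ Ω)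
    (hζ : ContDiffOn ℝ ∞ ζ Ω)
    (hu : ∀ y ∈ Ω, ∀ v w, ((ed θ y v w : ℝ) : ℂ) =
      Complex.I * (ζ y v * conj (ζ y w) - ζ y w * conj (ζ y v)))
    (h : IsDualFrame (θ y) (ζ y) (X y) (Y y) (T y)) :
    conj (coefB (ed ζ y (T y) (X y)) (ed ζ y (T y) (Y y))) =
      - coefB (ed ζ y (T y) (X y)) (ed ζ y (T y) (Y y)) := by
  have := ed_ζ_bianchi hΩ hy hθ hζ hu h
  rw [ed_swap ζ y (Y y), map_neg] at this
  simp only [coefB, map_mul, map_sub, map_div₀, map_one, Complex.conj_ofNat, Complex.conj_I]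
  linear_combination (Complex.I / 2) * this + (1 / 2) * (ed ζ y (T y) (X y)
    + conj (ed ζ y (T y) (X y))) * Complex.I_sq

lemma connOf_skew {P Q S : ℂ} {θ : E3 →L[ℝ] ℝ} {ζ : E3 →L[ℝ] ℂ}
    (hb : conj (coefB Q S) = - coefB Q S) (v : E3) :
    connOf P Q S θ ζ v + conj (connOf P Q S θ ζ v) = 0 := by
  simp only [connOf_apply, map_sub, map_mul, Complex.conj_conj, Complex.conj_ofReal, hb]
  ring

/-- With ω = aζ̄ - āζ - bθ one has ζ∧ω = aζ∧ζ̄ + bθ∧ζ, and the remaining cθ∧ζ̄ is the torsion. The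
term -āζ is invisible here; it is in ω only to make it skew. -/
lemma connOf_structure {y : E3} (h : IsDualFrame (θ y) (ζ y) (X y) (Y y) (T y)) (v w : E3) :
    let P := ed ζ y (X y) (Y y)
    let Q := ed ζ y (T y) (X y)
    let S := ed ζ y (T y) (Y y)
    ed ζ y v w = (ζ y v * connOf P Q S (θ y) (ζ y) w - ζ y w * connOf P Q S (θ y) (ζ y) v)
      + coefC Q S * (θ y v * conj (ζ y w) - θ y w * conj (ζ y v)) := by
  intro P Q S
  rw [h.ed_expand ζ y v w]
  simp only [connOf_apply, coefA, coefB, coefC]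
  change ((_ : ℝ) • P + (_ : ℝ) • Q + (_ : ℝ) • S : ℂ) = _
  have e1 : ∀ z : ℂ, conj z = z.re - z.im * Complex.I := fun z => by
    apply Complex.ext <;> simp
  generalize hv : ζ y v = zv
  generalize hw : ζ y w = zw
  rw [e1 zv, e1 zw]
  conv_rhs => rw [← Complex.re_add_im zv, ← Complex.re_add_im zw]
  simp only [Complex.real_smul, Complex.add_re, Complex.add_im, Complex.ofReal_re,
    Complex.ofReal_im, Complex.mul_re, Complex.mul_im, Complex.I_re, Complex.I_im, mul_zero,
    mul_one, sub_zero, zero_add, add_zero]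
  push_cast
  linear_combination (zv.re * zw.im * P + zw.im * θ y v * S - zv.im * zw.re * P
    - zv.im * θ y w * S) * Complex.I_sq

end Connection

section Construction

/-- The standard basis of `E3`. -/
def stdVec (i : Fin 3) : E3 := EuclideanSpace.single i (1 : ℝ)

lemma eq_sum_stdVec (v : E3) : v = v 0 • stdVec 0 + v 1 • stdVec 1 + v 2 • stdVec 2 := by
  ext i
  fin_cases i <;> simp [stdVec]

/-- The value of `θ ∧ dθ` on the standard basis. -/
def wedgeStd (θ : E3 → E3 →L[ℝ] ℝ) (y : E3) : ℝ :=
  θ y (stdVec 0) * ed θ y (stdVec 1) (stdVec 2) + θ y (stdVec 1) * ed θ y (stdVec 2) (stdVec 0)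
    + θ y (stdVec 2) * ed θ y (stdVec 0) (stdVec 1)

/-- The Reeb vector of a contact form. -/
def reebVec (θ : E3 → E3 →L[ℝ] ℝ) (y : E3) : E3 :=
  (wedgeStd θ y)⁻¹ • (ed θ y (stdVec 1) (stdVec 2) • stdVec 0
    + ed θ y (stdVec 2) (stdVec 0) • stdVec 1 + ed θ y (stdVec 0) (stdVec 1) • stdVec 2)

/-- In dimension three the coefficient vector of a two-form lies in its kernel: contraction with it
is the cross product of that vector with itself. -/
lemma ed_reebVec (θ : E3 → E3 →L[ℝ] ℝ) (y v : E3) : ed θ y (reebVec θ y) v = 0 := by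
  rw [reebVec, eq_sum_stdVec v]
  simp only [ed_add_left, ed_add_right, ed_smul_left, ed_smul_right, ed_self, smul_eq_mul]
  rw [ed_swap θ y (stdVec 1) (stdVec 0), ed_swap θ y (stdVec 2) (stdVec 1),
    ed_swap θ y (stdVec 0) (stdVec 2)]
  ring

lemma apply_reebVec {θ : E3 → E3 →L[ℝ] ℝ} {y : E3} (h : wedgeStd θ y ≠ 0) :
    θ y (reebVec θ y) = 1 := by
  rw [reebVec, map_smul, smul_eq_mul, inv_mul_eq_div, div_eq_one_iff_eq h]
  simp only [map_add, map_smul, smul_eq_mul, wedgeStd]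
  ring

/-- The coframe `½ dθ(·, Y) + (i/2) dθ(X, ·)`. -/
def coframeOf (D : E3 →L[ℝ] E3 →L[ℝ] ℝ) (X Y : E3) : E3 →L[ℝ] ℂ :=
  (1 / 2 : ℂ) • realForm ((ContinuousLinearMap.apply ℝ ℝ Y).comp D - D Y)
    + (Complex.I / 2) • realForm (D X - (ContinuousLinearMap.apply ℝ ℝ X).comp D)

lemma coframeOf_apply (D : E3 →L[ℝ] E3 →L[ℝ] ℝ) (X Y v : E3) : coframeOf D X Y v =
    (1 / 2) * ((D v Y - D Y v : ℝ) : ℂ) + (Complex.I / 2) * ((D X v - D v X : ℝ) : ℂ) := rfl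

lemma contDiffOn_coframeOf {W : Set (ℝ × E3)} {D : ℝ × E3 → E3 →L[ℝ] E3 →L[ℝ] ℝ}
    {X Y : ℝ × E3 → E3} (hD : ContDiffOn ℝ ∞ D W) (hX : ContDiffOn ℝ ∞ X W)
    (hY : ContDiffOn ℝ ∞ Y W) : ContDiffOn ℝ ∞ (fun z => coframeOf (D z) (X z) (Y z)) W := by
  have hre : ∀ {l : ℝ × E3 → E3 →L[ℝ] ℝ}, ContDiffOn ℝ ∞ l W →
      ContDiffOn ℝ ∞ (fun z => realForm (l z)) W := fun h => contDiffOn_const.clm_comp h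
  have hflip : ∀ {V : ℝ × E3 → E3}, ContDiffOn ℝ ∞ V W →
      ContDiffOn ℝ ∞ (fun z => (ContinuousLinearMap.apply ℝ ℝ (V z)).comp (D z)) W := by
    intro V hV
    rw [contDiffOn_clm_apply]
    exact fun w => (hD.clm_apply contDiffOn_const).clm_apply hV
  exact ((contDiffOn_const (c := (1 / 2 : ℂ))).smul (hre ((hflip hY).sub (hD.clm_apply hY)))).add
    ((contDiffOn_const (c := Complex.I / 2)).smul (hre ((hD.clm_apply hX).sub (hflip hX))))

/-- A family of local unitary frames depending smoothly on a parameter. -/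
structure FrameFamily (J : ℝ × E3 → E3 →L[ℝ] E3) (θ : ℝ × E3 → E3 →L[ℝ] ℝ) (I : Set ℝ)
    (Ω : Set E3) where
  ζ : ℝ × E3 → E3 →L[ℝ] ℂ
  conn : ℝ × E3 → E3 →L[ℝ] ℂ
  A : ℝ × E3 → ℂ
  R : ℝ × E3 → ℝ
  isOpen_left : IsOpen I
  isOpen_right : IsOpen Ω
  smooth_θ : ContDiffOn ℝ ∞ θ (I ×ˢ Ω)
  smooth_ζ : ContDiffOn ℝ ∞ ζ (I ×ˢ Ω)
  smooth_conn : ContDiffOn ℝ ∞ conn (I ×ˢ Ω)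
  smooth_A : ContDiffOn ℝ ∞ A (I ×ˢ Ω)
  smooth_R : ContDiffOn ℝ ∞ R (I ×ˢ Ω)
  slice : ∀ t ∈ I, ∃ f : ChartFrame (fun y => J (t, y)) (fun y => θ (t, y)) Ω,
    (∀ y, f.ζ y = ζ (t, y)) ∧ (∀ y, f.conn y = conn (t, y)) ∧ (∀ y, f.A y = A (t, y)) ∧
      ∀ y, f.R y = R (t, y)

/-- The pseudohermitian conditions for chart expressions. -/
structure ChartPseudo (J : E3 → E3 →L[ℝ] E3) (θ : E3 → E3 →L[ℝ] ℝ) (y : E3) : Prop where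
  contact : wedgeStd θ y ≠ 0
  map_ker : ∀ v, θ y v = 0 → θ y (J y v) = 0
  sq_J : ∀ v, θ y v = 0 → J y (J y v) = -v
  pos : ∀ v, θ y v = 0 → v ≠ 0 → 0 < ed θ y v (J y v)

-- Every ingredient is an explicit expression in θ_t, J_t and their derivatives: the Reeb vector, a
-- fixed vector projected to ξ_t and normalized, its image under J_t, the dual coframe, and the
-- connection read off from dζ. Joint smoothness in (t, y) is therefore inherited. The only
-- restriction is that the projected vector be nonzero, which holds on a product neighbourhood.
set_option maxHeartbeats 1000000 in
lemma exists_frameFamily {J : ℝ × E3 → E3 →L[ℝ] E3} {θ : ℝ × E3 → E3 →L[ℝ] ℝ} {I : Set ℝ}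
    {Ω : Set E3} (hI : IsOpen I) (hΩ : IsOpen Ω) (hθ : ContDiffOn ℝ ∞ θ (I ×ˢ Ω))
    (hJ : ContDiffOn ℝ ∞ J (I ×ˢ Ω))
    (hp : ∀ t ∈ I, ∀ y ∈ Ω, ChartPseudo (fun y => J (t, y)) (fun y => θ (t, y)) y)
    {t₀ : ℝ} (ht₀ : t₀ ∈ I) {y₀ : E3} (hy₀ : y₀ ∈ Ω) :
    ∃ I' ⊆ I, ∃ Ω' ⊆ Ω, t₀ ∈ I' ∧ y₀ ∈ Ω' ∧ Nonempty (FrameFamily J θ I' Ω') := by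
  have hW : IsOpen (I ×ˢ Ω) := hI.prod hΩ
  have hed : ∀ z ∈ I ×ˢ Ω, ∀ v w, ed (fun y => θ (z.1, y)) z.2 v w = edPar θ z v w :=
    fun z hz v w => ed_slice (diffAt_of_contDiffOn hθ hW hz) v w
  have hedc : ∀ v w : E3, ContDiffOn ℝ ∞ (fun z => edPar θ z v w) (I ×ˢ Ω) :=
    fun v w => contDiffOn_edPar hW hθ contDiffOn_const contDiffOn_const
  have hθc : ∀ v : E3, ContDiffOn ℝ ∞ (fun z => θ z v) (I ×ˢ Ω) :=
    fun v => hθ.clm_apply contDiffOn_const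
  -- the Reeb field
  let T : ℝ × E3 → E3 := fun z => reebVec (fun y => θ (z.1, y)) z.2
  have hT : ContDiffOn ℝ ∞ T (I ×ˢ Ω) := by
    have hw : ContDiffOn ℝ ∞ (fun z : ℝ × E3 => wedgeStd (fun y => θ (z.1, y)) z.2) (I ×ˢ Ω) := by
      refine ContDiffOn.congr (((hθc (stdVec 0)).mul (hedc (stdVec 1) (stdVec 2))).add
        ((hθc (stdVec 1)).mul (hedc (stdVec 2) (stdVec 0))) |>.add
        ((hθc (stdVec 2)).mul (hedc (stdVec 0) (stdVec 1)))) (fun z hz => ?_)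
      simp only [wedgeStd, hed z hz]
    refine ContDiffOn.congr ((hw.inv fun z hz => (hp z.1 hz.1 z.2 hz.2).contact).smul
      ((((hedc (stdVec 1) (stdVec 2)).smul (contDiffOn_const (c := stdVec 0))).add
        ((hedc (stdVec 2) (stdVec 0)).smul (contDiffOn_const (c := stdVec 1)))).add
        ((hedc (stdVec 0) (stdVec 1)).smul (contDiffOn_const (c := stdVec 2))))) (fun z hz => ?_)
    simp only [T, reebVec, hed z hz]
    rfl
  have hT1 : ∀ z ∈ I ×ˢ Ω, θ z (T z) = 1 := fun z hz =>
    apply_reebVec (θ := fun y => θ (z.1, y)) (hp z.1 hz.1 z.2 hz.2).contact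
  have hT2 : ∀ z ∈ I ×ˢ Ω, ∀ v, edPar θ z (T z) v = 0 := fun z hz v => by
    rw [← hed z hz]; exact ed_reebVec _ _ _
  -- a section of the contact bundle
  obtain ⟨v₀, hv₀, hv₀'⟩ : ∃ v : E3, v ≠ 0 ∧ θ (t₀, y₀) v = 0 := by
    have : LinearMap.ker (θ (t₀, y₀) : E3 →ₗ[ℝ] ℝ) ≠ ⊥ :=
      LinearMap.ker_ne_bot_of_finrank_lt (by simp)
    obtain ⟨v, hv, hv'⟩ := (Submodule.ne_bot_iff _).1 this
    exact ⟨v, hv', hv⟩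
  -- Projection of `v₀` to the contact plane along the Reeb vector; at the base point it is `v₀`
  -- itself, hence nonzero.
  let X₀ : ℝ × E3 → E3 := fun z => v₀ - θ z v₀ • T z
  have hX₀ : ContDiffOn ℝ ∞ X₀ (I ×ˢ Ω) := contDiffOn_const.sub ((hθc v₀).smul hT)
  have hX₀θ : ∀ z ∈ I ×ˢ Ω, θ z (X₀ z) = 0 := fun z hz => by simp [X₀, hT1 z hz]
  obtain ⟨I', Ω', hI', hΩ', ht', hy', hsub⟩ : ∃ I' Ω', IsOpen I' ∧ IsOpen Ω' ∧ t₀ ∈ I' ∧ y₀ ∈ Ω' ∧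
      I' ×ˢ Ω' ⊆ (I ×ˢ Ω) ∩ X₀ ⁻¹' {0}ᶜ := by
    have ho := hX₀.continuousOn.isOpen_inter_preimage hW (isOpen_compl_singleton (x := (0 : E3)))
    have hm : (t₀, y₀) ∈ (I ×ˢ Ω) ∩ X₀ ⁻¹' {0}ᶜ := ⟨⟨ht₀, hy₀⟩, by simp [X₀, hv₀', hv₀]⟩
    obtain ⟨u, v, hu, hv, h1, h2, h3⟩ := isOpen_prod_iff.1 ho t₀ y₀ hm
    exact ⟨u, v, hu, hv, h1, h2, h3⟩
  have hI'I : I' ⊆ I := fun t ht => (hsub (mk_mem_prod ht hy')).1.1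
  have hΩ'Ω : Ω' ⊆ Ω := fun y hy => (hsub (mk_mem_prod ht' hy)).1.2
  refine ⟨I', hI'I, Ω', hΩ'Ω, ht', hy', ?_⟩
  have hs : I' ×ˢ Ω' ⊆ I ×ˢ Ω := prod_mono hI'I hΩ'Ω
  have hW' : IsOpen (I' ×ˢ Ω') := hI'.prod hΩ'
  have hpz : ∀ z ∈ I' ×ˢ Ω', ChartPseudo (fun y => J (z.1, y)) (fun y => θ (z.1, y)) z.2 :=
    fun z hz => hp _ (hI'I hz.1) _ (hΩ'Ω hz.2)
  -- normalization
  let ρ : ℝ × E3 → ℝ := fun z => (1 / 2) * edPar θ z (X₀ z) (J z (X₀ z))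
  have hρ : ∀ z ∈ I' ×ˢ Ω', 0 < ρ z := fun z hz => by
    have := (hpz z hz).pos (X₀ z) (hX₀θ z (hs hz)) (hsub hz).2
    rw [hed z (hs hz)] at this
    exact mul_pos (by norm_num) this
  have hρc : ContDiffOn ℝ ∞ ρ (I' ×ˢ Ω') := (contDiffOn_const.mul
    (contDiffOn_edPar hW hθ hX₀ (hJ.clm_apply hX₀))).mono hs
  let X : ℝ × E3 → E3 := fun z => (Real.sqrt (ρ z))⁻¹ • X₀ z
  let Y : ℝ × E3 → E3 := fun z => J z (X z)
  have hXc : ContDiffOn ℝ ∞ X (I' ×ˢ Ω') := ((hρc.sqrt fun z hz => (hρ z hz).ne').inv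
    fun z hz => (Real.sqrt_pos.2 (hρ z hz)).ne').smul (hX₀.mono hs)
  have hYc : ContDiffOn ℝ ∞ Y (I' ×ˢ Ω') := (hJ.mono hs).clm_apply hXc
  have hθX : ∀ z ∈ I' ×ˢ Ω', θ z (X z) = 0 := fun z hz => by simp [X, hX₀θ z (hs hz)]
  have hθY : ∀ z ∈ I' ×ˢ Ω', θ z (Y z) = 0 := fun z hz => (hpz z hz).map_ker _ (hθX z hz)
  -- The value 2 is what dθ = iζ∧ζ̄ requires when ζ(X) = 1 and ζ(Y) = i; it explains the factor 1/2
  -- in `ρ`.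
  have hXY : ∀ z ∈ I' ×ˢ Ω', edPar θ z (X z) (Y z) = 2 := fun z hz => by
    have h1 : edPar θ z (X z) (Y z) = (Real.sqrt (ρ z))⁻¹ * (Real.sqrt (ρ z))⁻¹ * (2 * ρ z) := by
      have : Y z = (Real.sqrt (ρ z))⁻¹ • J z (X₀ z) := map_smul _ _ _
      rw [this, ← hed z (hs hz)]
      simp only [X, ed_smul_left, ed_smul_right, smul_eq_mul]
      rw [hed z (hs hz)]
      simp only [ρ]
      ring
    have h2 : Real.sqrt (ρ z) ≠ 0 := (Real.sqrt_pos.2 (hρ z hz)).ne'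
    rw [h1]
    field_simp
    rw [Real.sq_sqrt (hρ z hz).le]
  -- the coframe
  let D : ℝ × E3 → E3 →L[ℝ] E3 →L[ℝ] ℝ := fun z =>
    (fderiv ℝ θ z).comp (ContinuousLinearMap.inr ℝ ℝ E3)
  have hD : ContDiffOn ℝ ∞ D (I ×ˢ Ω) :=
    (hθ.fderiv_of_isOpen hW (m := ∞) (by simp)).clm_comp contDiffOn_const
  have hDed : ∀ z v w, D z v w - D z w v = edPar θ z v w := fun z v w => rfl
  -- From dθ = 2 Re ζ∧Im ζ one reads Re ζ = ½dθ(·, Y) and Im ζ = ½dθ(X, ·).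
  let ζ : ℝ × E3 → E3 →L[ℝ] ℂ := fun z => coframeOf (D z) (X z) (Y z)
  have hζv : ∀ z v, ζ z v = (1 / 2) * ((edPar θ z v (Y z) : ℝ) : ℂ)
      + (Complex.I / 2) * ((edPar θ z (X z) v : ℝ) : ℂ) := fun z v => by
    rw [← hDed, ← hDed]; exact coframeOf_apply _ _ _ _
  have hre : ∀ {l : ℝ × E3 → E3 →L[ℝ] ℝ}, ContDiffOn ℝ ∞ l (I' ×ˢ Ω') →
      ContDiffOn ℝ ∞ (fun z => realForm (l z)) (I' ×ˢ Ω') := fun h => contDiffOn_const.clm_comp h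
  have hco : ∀ {l : ℝ × E3 → E3 →L[ℝ] ℂ}, ContDiffOn ℝ ∞ l (I' ×ˢ Ω') →
      ContDiffOn ℝ ∞ (fun z => conjForm (l z)) (I' ×ˢ Ω') := fun h => contDiffOn_const.clm_comp h
  have hconj : ∀ {u : ℝ × E3 → ℂ}, ContDiffOn ℝ ∞ u (I' ×ˢ Ω') →
      ContDiffOn ℝ ∞ (fun z => conj (u z)) (I' ×ˢ Ω') := fun h =>
    (Complex.conjCLE : ℂ →L[ℝ] ℂ).contDiff.comp_contDiffOn h
  have hζc : ContDiffOn ℝ ∞ ζ (I' ×ˢ Ω') := contDiffOn_coframeOf (hD.mono hs) hXc hYc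
  have hself : ∀ z v, edPar θ z v v = 0 := fun z v => by simp [edPar]
  have hswap : ∀ z v w, edPar θ z v w = - edPar θ z w v := fun z v w => by simp [edPar]
  have hdual : ∀ z ∈ I' ×ˢ Ω', IsDualFrame (θ z) (ζ z) (X z) (Y z) (T z) := fun z hz => by
    refine ⟨hθX z hz, hθY z hz, hT1 z (hs hz), ?_, ?_, ?_⟩
    · rw [hζv, hself, hXY z hz]; norm_num
    · rw [hζv, hself, hXY z hz]; norm_num
    · rw [hζv, hT2 z (hs hz), hswap z (X z), hT2 z (hs hz)]; norm_num
  have hunit : ∀ z ∈ I' ×ˢ Ω', ∀ v w, ((ed (fun y => θ (z.1, y)) z.2 v w : ℝ) : ℂ) =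
      Complex.I * (ζ z v * conj (ζ z w) - ζ z w * conj (ζ z v)) := fun z hz v w => by
    rw [(hdual z hz).ed_expand (fun y => θ (z.1, y)) z.2 v w, hed z (hs hz), hed z (hs hz),
      hed z (hs hz), hXY z hz, hT2 z (hs hz), hT2 z (hs hz)]
    apply Complex.ext <;> simp <;> ring
  -- the connection
  let P : ℝ × E3 → ℂ := fun z => edPar ζ z (X z) (Y z)
  let Q : ℝ × E3 → ℂ := fun z => edPar ζ z (T z) (X z)
  let S : ℝ × E3 → ℂ := fun z => edPar ζ z (T z) (Y z)
  have hP : ContDiffOn ℝ ∞ P (I' ×ˢ Ω') := contDiffOn_edPar hW' hζc hXc hYc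
  have hQ : ContDiffOn ℝ ∞ Q (I' ×ˢ Ω') := contDiffOn_edPar hW' hζc (hT.mono hs) hXc
  have hS : ContDiffOn ℝ ∞ S (I' ×ˢ Ω') := contDiffOn_edPar hW' hζc (hT.mono hs) hYc
  have hedζ : ∀ z ∈ I' ×ˢ Ω', ∀ v w, ed (fun y => ζ (z.1, y)) z.2 v w = edPar ζ z v w :=
    fun z hz v w => ed_slice (diffAt_of_contDiffOn hζc hW' hz) v w
  let ω' : ℝ × E3 → E3 →L[ℝ] ℂ := fun z => connOf (P z) (Q z) (S z) (θ z) (ζ z)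
  have hωc : ContDiffOn ℝ ∞ ω' (I' ×ˢ Ω') := by
    have hA : ContDiffOn ℝ ∞ (fun z => coefA (P z)) (I' ×ˢ Ω') := contDiffOn_const.mul hP
    have hB : ContDiffOn ℝ ∞ (fun z => coefB (Q z) (S z)) (I' ×ˢ Ω') :=
      contDiffOn_const.mul (hQ.sub (contDiffOn_const.mul hS))
    exact ((hA.smul (hco hζc)).sub ((hconj hA).smul hζc)).sub (hB.smul (hre (hθ.mono hs)))
  have himag : ∀ z ∈ I' ×ˢ Ω', conj (coefB (Q z) (S z)) = - coefB (Q z) (S z) := fun z hz => by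
    have := coefB_imaginary (θ := fun y => θ (z.1, y)) (ζ := fun y => ζ (z.1, y))
      (X := fun y => X (z.1, y)) (Y := fun y => Y (z.1, y)) (T := fun y => T (z.1, y)) hΩ' hz.2
      (ContDiffOn.slice (hθ.mono hs) hz.1) (ContDiffOn.slice hζc hz.1)
      (fun y hy => hunit (z.1, y) ⟨hz.1, hy⟩) (hdual z hz)
    simpa only [hedζ z hz] using this
  have hskew : ∀ z ∈ I' ×ˢ Ω', ∀ v, ω' z v + conj (ω' z v) = 0 := fun z hz v =>
    connOf_skew (himag z hz) v
  have hedω : ∀ z ∈ I' ×ˢ Ω', ∀ v w, ed (fun y => ω' (z.1, y)) z.2 v w = edPar ω' z v w :=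
    fun z hz v w => ed_slice (diffAt_of_contDiffOn hωc hW' hz) v w
  let K : ℝ × E3 → ℂ := fun z => Complex.I / 2 * edPar ω' z (X z) (Y z)
  have hK : ContDiffOn ℝ ∞ K (I' ×ˢ Ω') :=
    contDiffOn_const.mul (contDiffOn_edPar hW' hωc hXc hYc)
  -- The connection equals minus its conjugate on an open set, so dω(X, Y) is imaginary and the
  -- curvature K = (i/2) dω(X, Y) is real.
  have hKre : ∀ z ∈ I' ×ˢ Ω', ((K z).re : ℂ) = K z := fun z hz => by
    rw [← Complex.conj_eq_iff_re]
    have hd : DifferentiableAt ℝ (fun y => ω' (z.1, y)) z.2 :=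
      diffAt_of_contDiffOn (ContDiffOn.slice hωc hz.1) hΩ' hz.2
    have h1 : ed (fun y => conjForm (ω' (z.1, y))) z.2 (X z) (Y z) =
        ed (fun y => (-1 : ℂ) • ω' (z.1, y)) z.2 (X z) (Y z) := by
      refine ed_congr (Filter.eventuallyEq_of_mem (hΩ'.mem_nhds hz.2) fun y hy => ?_) _ _
      ext v
      simp only [conjForm_apply, smul_apply, smul_eq_mul]
      linear_combination hskew (z.1, y) ⟨hz.1, hy⟩ v
    rw [ed_conjForm hd, ed_smul (differentiableAt_const _) hd, hedω z hz] at h1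
    simp only [fderiv_fun_const, Pi.zero_apply, zero_apply] at h1
    simp only [K, map_mul, map_div₀, Complex.conj_I, Complex.conj_ofNat]
    linear_combination (-Complex.I / 2) * h1
  refine ⟨⟨ζ, ω', fun z => conj (coefC (Q z) (S z)), fun z => (K z).re, hI', hΩ', hθ.mono hs, hζc,
    hωc, hconj (contDiffOn_const.mul (hQ.add (contDiffOn_const.mul hS))),
    Complex.reCLM.contDiff.comp_contDiffOn hK, fun t ht => ?_⟩⟩
  have hz : ∀ y ∈ Ω', (t, y) ∈ I' ×ˢ Ω' := fun y hy => ⟨ht, hy⟩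
  refine ⟨{
    X := fun y => X (t, y)
    Y := fun y => Y (t, y)
    T := fun y => T (t, y)
    ζ := fun y => ζ (t, y)
    conn := fun y => ω' (t, y)
    A := fun y => conj (coefC (Q (t, y)) (S (t, y)))
    R := fun y => (K (t, y)).re
    isOpen := hΩ'
    smooth_θ := ContDiffOn.slice (hθ.mono hs) ht
    smooth_X := ContDiffOn.slice hXc ht
    smooth_Y := ContDiffOn.slice hYc ht
    smooth_T := ContDiffOn.slice (hT.mono hs) ht
    smooth_ζ := ContDiffOn.slice hζc ht
    smooth_conn := ContDiffOn.slice hωc ht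
    dual := fun y hy => hdual _ (hz y hy)
    reeb := fun y hy v => by
      rw [hed (t, y) (hs (hz y hy))]; exact hT2 _ (hs (hz y hy)) v
    Y_eq := fun y hy => rfl
    unitary := fun y hy => hunit _ (hz y hy)
    structure_eq := fun y hy v w => by
      have := connOf_structure (θ := fun y => θ (t, y)) (ζ := fun y => ζ (t, y))
        (X := fun y => X (t, y)) (Y := fun y => Y (t, y)) (T := fun y => T (t, y))
        (hdual _ (hz y hy)) v w
      simp only [hedζ _ (hz y hy)] at this ⊢
      rw [this, Complex.conj_conj]
    skew := fun y hy => hskew _ (hz y hy)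
    curvature := fun y hy v w hv hw => by
      rw [(hdual _ (hz y hy)).ed_expand _ y v w, hv, hw, hKre _ (hz y hy)]
      rw [hedω _ (hz y hy)]
      simp only [K]
      generalize ζ (t, y) v = zv
      generalize ζ (t, y) w = zw
      have e1 : zv * conj zw - zw * conj zv =
          -2 * Complex.I * ((zv.re * zw.im - zv.im * zw.re : ℝ) : ℂ) := by
        apply Complex.ext <;> simp <;> ring
      rw [e1]
      simp only [zero_mul, mul_zero, sub_zero, zero_smul, add_zero, Complex.real_smul]
      linear_combination (((zv.re * zw.im - zv.im * zw.re : ℝ) : ℂ)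
        * edPar ω' (t, y) (X (t, y)) (Y (t, y))) * Complex.I_sq }, fun _ => rfl, fun _ => rfl,
    fun _ => rfl, fun _ => rfl⟩

end Construction

end CR3

end

/-! ### Infinitesimal variation of the coframe -/

noncomputable section

namespace CR3

section TimeDerivative

variable {G : Type*} [NormedAddCommGroup G] [NormedSpace ℝ G] {I : Set ℝ} {Ω : Set E3}

/-- The derivative at `0` with respect to the parameter. -/
def dt (u : ℝ × E3 → G) (y : E3) : G := fderiv ℝ u (0, y) (1, 0)

lemma hasDerivAt_dt (hI : IsOpen I) (hΩ : IsOpen Ω) (h0 : (0 : ℝ) ∈ I) {u : ℝ × E3 → G}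
    (hu : ContDiffOn ℝ ∞ u (I ×ˢ Ω)) {y : E3} (hy : y ∈ Ω) :
    HasDerivAt (fun t => u (t, y)) (dt u y) 0 := by
  have hd := (diffAt_of_contDiffOn hu (hI.prod hΩ) (mk_mem_prod h0 hy)).hasFDerivAt
  have h1 : HasDerivAt (fun t : ℝ => (t, y)) ((1 : ℝ), (0 : E3)) 0 :=
    (hasDerivAt_id (0 : ℝ)).prodMk (hasDerivAt_const (0 : ℝ) y)
  exact hd.comp_hasDerivAt (0 : ℝ) h1

lemma contDiffOn_dt (hI : IsOpen I) (hΩ : IsOpen Ω) (h0 : (0 : ℝ) ∈ I) {u : ℝ × E3 → G}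
    (hu : ContDiffOn ℝ ∞ u (I ×ˢ Ω)) : ContDiffOn ℝ ∞ (dt u) Ω := by
  have hd : ContDiffOn ℝ ∞ (fderiv ℝ u) (I ×ˢ Ω) := hu.fderiv_of_isOpen (hI.prod hΩ) (by simp)
  exact (ContDiffOn.slice hd h0).clm_apply contDiffOn_const

-- Time and space derivatives commute: the second derivative of the jointly smooth form is symmetric
-- in the directions (1, 0) and (0, a).
set_option synthInstance.maxHeartbeats 400000 in
set_option maxHeartbeats 1000000 in
lemma hasDerivAt_ed (hI : IsOpen I) (hΩ : IsOpen Ω) (h0 : (0 : ℝ) ∈ I) {α : ℝ × E3 → E3 →L[ℝ] G}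
    (hα : ContDiffOn ℝ ∞ α (I ×ˢ Ω)) {y : E3} (hy : y ∈ Ω) (v w : E3) :
    HasDerivAt (fun t => ed (fun y => α (t, y)) y v w) (ed (dt α) y v w) 0 := by
  have hW := hI.prod hΩ
  have hm : ((0 : ℝ), y) ∈ I ×ˢ Ω := mk_mem_prod h0 hy
  have hd : ContDiffOn ℝ ∞ (fderiv ℝ α) (I ×ˢ Ω) := hα.fderiv_of_isOpen hW (by simp)
  have hdd := diffAt_of_contDiffOn hd hW hm
  have hs := ((hα.contDiffAt (hW.mem_nhds hm)).of_le (by norm_cast :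
    (2 : WithTop ℕ∞) ≤ ∞)).isSymmSndFDerivAt (by simp)
  have h1 : HasDerivAt (fun t : ℝ => (t, y)) ((1 : ℝ), (0 : E3)) 0 :=
    (hasDerivAt_id (0 : ℝ)).prodMk (hasDerivAt_const (0 : ℝ) y)
  have h2 : HasDerivAt (fun t : ℝ => fderiv ℝ α (t, y)) (fderiv ℝ (fderiv ℝ α) (0, y) (1, 0)) 0 :=
    HasFDerivAt.comp_hasDerivAt (l := fderiv ℝ α) (0 : ℝ) hdd.hasFDerivAt h1
  have h3 : ∀ a b : E3, HasDerivAt (fun t : ℝ => fderiv ℝ α (t, y) (0, a) b)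
      (fderiv ℝ (dt α) y a b) 0 := by
    intro a b
    have h4 := (h2.clm_apply (hasDerivAt_const (0 : ℝ) ((0 : ℝ), a))).clm_apply
      (hasDerivAt_const (0 : ℝ) b)
    have h5 : fderiv ℝ (dt α) y a = fderiv ℝ (fderiv ℝ α) (0, y) (0, a) (1, 0) := by
      have h6 : HasFDerivAt (fun y : E3 => fderiv ℝ α (0, y))
          ((fderiv ℝ (fderiv ℝ α) (0, y)).comp (ContinuousLinearMap.inr ℝ ℝ E3)) y :=
        hdd.hasFDerivAt.comp y (hasFDerivAt_prodMk_right 0 y)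
      have h7 := (h6.clm_apply (hasFDerivAt_const ((1 : ℝ), (0 : E3)) y)).fderiv
      have h8 : fderiv ℝ (dt α) y = _ := h7
      rw [h8]; simp
    rw [h5, hs.eq (0, a) (1, 0)]
    simpa using h4
  have h4 := (h3 v w).sub (h3 w v)
  refine h4.congr_of_eventuallyEq ?_
  filter_upwards [hI.mem_nhds h0] with t ht
  exact ed_slice (diffAt_of_contDiffOn hα hW (mk_mem_prod ht hy)) v w

end TimeDerivative

/-- A frame family for a variation of the pseudohermitian structure that keeps the contact bundle,
with `δθ = 2hθ` and `δJ = 2E` on the contact bundle. -/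
structure ChartVariation (J : ℝ × E3 → E3 →L[ℝ] E3) (θ : ℝ × E3 → E3 →L[ℝ] ℝ) (I : Set ℝ)
    (Ω : Set E3) (h : E3 → ℝ) (E : E3 → E3 →L[ℝ] E3) extends FrameFamily J θ I Ω where
  zero_mem : (0 : ℝ) ∈ I
  pseudo : ∀ t ∈ I, ∀ y ∈ Ω, ChartPseudo (fun y => J (t, y)) (fun y => θ (t, y)) y
  ker_eq : ∀ t ∈ I, ∀ y ∈ Ω, ∀ v, θ (t, y) v = 0 ↔ θ (0, y) v = 0
  deriv_θ : ∀ y ∈ Ω, ∀ v, HasDerivAt (fun t => θ (t, y) v) (2 * h y * θ (0, y) v) 0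
  deriv_J : ∀ y ∈ Ω, ∀ v, θ (0, y) v = 0 → HasDerivAt (fun t => J (t, y) v) ((2 : ℝ) • E y v) 0

namespace ChartVariation

variable {J : ℝ × E3 → E3 →L[ℝ] E3} {θ : ℝ × E3 → E3 →L[ℝ] ℝ} {I : Set ℝ} {Ω : Set E3}
  {h : E3 → ℝ} {E : E3 → E3 →L[ℝ] E3} (V : ChartVariation J θ I Ω h E)

/-- The frame at parameter value `0`. -/
def base : ChartFrame (fun y => J (0, y)) (fun y => θ (0, y)) Ω := (V.slice 0 V.zero_mem).choose

lemma base_ζ (y : E3) : V.base.ζ y = V.ζ (0, y) := (V.slice 0 V.zero_mem).choose_spec.1 y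
lemma base_conn (y : E3) : V.base.conn y = V.conn (0, y) :=
  (V.slice 0 V.zero_mem).choose_spec.2.1 y
lemma base_A (y : E3) : V.base.A y = V.A (0, y) := (V.slice 0 V.zero_mem).choose_spec.2.2.1 y
lemma base_R (y : E3) : V.base.R y = V.R (0, y) := (V.slice 0 V.zero_mem).choose_spec.2.2.2 y

include V in
lemma hasDerivAt_u {G : Type*} [NormedAddCommGroup G] [NormedSpace ℝ G] {u : ℝ × E3 → G}
    (hu : ContDiffOn ℝ ∞ u (I ×ˢ Ω)) {y : E3} (hy : y ∈ Ω) :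
    HasDerivAt (fun t => u (t, y)) (dt u y) 0 :=
  hasDerivAt_dt V.isOpen_left V.isOpen_right V.zero_mem hu hy

include V in
lemma hasDerivAt_clm {G : Type*} [NormedAddCommGroup G] [NormedSpace ℝ G]
    {u : ℝ × E3 → E3 →L[ℝ] G} (hu : ContDiffOn ℝ ∞ u (I ×ˢ Ω)) {y : E3} (hy : y ∈ Ω) (v : E3) :
    HasDerivAt (fun t => u (t, y) v) (dt u y v) 0 := by
  simpa using (V.hasDerivAt_u hu hy).clm_apply (hasDerivAt_const (0 : ℝ) v)

/-- The coefficients of `ζ̇ = p ζ + B ζ̄ + s θ`. -/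
def p (y : E3) : ℂ := zOne (V.base.X y) (V.base.Y y) (dt V.ζ y)
def B (y : E3) : ℂ := zBar (V.base.X y) (V.base.Y y) (dt V.ζ y)
def s (y : E3) : ℂ := dt V.ζ y (V.base.T y)

/-- The infinitesimal conformal factor as a complex function. -/
def hc (_ : ChartVariation J θ I Ω h E) (y : E3) : ℂ := h y

/-- The component `E₁₁` in the base frame. -/
def e (y : E3) : ℂ := (1 / 2) * (conj (V.base.ζ y (E y (V.base.X y)))
  - Complex.I * conj (V.base.ζ y (E y (V.base.Y y))))

lemma smooth_ζd : ContDiffOn ℝ ∞ (dt V.ζ) Ω :=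
  contDiffOn_dt V.isOpen_left V.isOpen_right V.zero_mem V.smooth_ζ

lemma smooth_p : ContDiffOn ℝ ∞ V.p Ω := contDiffOn_const.mul
  ((V.smooth_ζd.clm_apply V.base.smooth_X).sub
    (contDiffOn_const.mul (V.smooth_ζd.clm_apply V.base.smooth_Y)))

lemma smooth_B : ContDiffOn ℝ ∞ V.B Ω := contDiffOn_const.mul
  ((V.smooth_ζd.clm_apply V.base.smooth_X).add
    (contDiffOn_const.mul (V.smooth_ζd.clm_apply V.base.smooth_Y)))

lemma smooth_s : ContDiffOn ℝ ∞ V.s Ω := V.smooth_ζd.clm_apply V.base.smooth_T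

include V in
lemma dt_θ {y : E3} (hy : y ∈ Ω) : dt θ y = (2 * h y) • θ (0, y) := by
  ext v
  exact (V.hasDerivAt_clm V.smooth_θ hy v).unique (V.deriv_θ y hy v)

-- The function `h` is given only pointwise through θ̇ = 2hθ. Evaluating on the Reeb field, h =
-- ½θ̇(T), shows that it is smooth.
include V in
lemma smooth_h : ContDiffOn ℝ ∞ h Ω := by
  have h1 : ContDiffOn ℝ ∞ (fun y => (1 / 2) * dt θ y (V.base.T y)) Ω := contDiffOn_const.mul
    ((contDiffOn_dt V.isOpen_left V.isOpen_right V.zero_mem V.smooth_θ).clm_apply V.base.smooth_T)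
  refine h1.congr fun y hy => ?_
  rw [V.dt_θ hy, smul_apply, (V.base.dual y hy).θT]
  simp

lemma smooth_hc : ContDiffOn ℝ ∞ V.hc Ω := contDiffOn_ofReal V.smooth_h

lemma fderiv_hc {y : E3} (hy : y ∈ Ω) (v : E3) :
    fderiv ℝ V.hc y v = ((fderiv ℝ h y v : ℝ) : ℂ) := by
  have := (Complex.ofRealCLM.hasFDerivAt.comp y (V.base.diffAt V.smooth_h hy).hasFDerivAt).fderiv
  exact DFunLike.congr_fun this v

lemma ζd_X {y : E3} : dt V.ζ y (V.base.X y) = V.p y + V.B y := by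
  simp only [p, B, zOne, zBar]; ring

lemma ζd_Y {y : E3} : dt V.ζ y (V.base.Y y) = Complex.I * V.p y - Complex.I * V.B y := by
  simp only [p, B, zOne, zBar]
  linear_combination (dt V.ζ y (V.base.Y y)) * Complex.I_sq

include V in
lemma ed_dt_θ {y : E3} (hy : y ∈ Ω) (v w : E3) : ed (dt θ) y v w =
    2 * (fderiv ℝ h y v * θ (0, y) w - fderiv ℝ h y w * θ (0, y) v)
      + 2 * h y * ed (fun y => θ (0, y)) y v w := by
  have he : dt θ =ᶠ[𝓝 y] fun z => (2 * h z) • θ (0, z) :=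
    Filter.eventuallyEq_of_mem (V.isOpen_right.mem_nhds hy) fun z hz => V.dt_θ hz
  have h1 := V.base.diffAt V.smooth_h hy
  have h2 := V.base.diffAt V.base.smooth_θ hy
  rw [ed_congr he, ed, fderiv_fun_smul (h1.const_mul 2) h2, fderiv_const_mul h1]
  simp only [ed, add_apply, smul_apply, ContinuousLinearMap.smulRight_apply, smul_eq_mul]
  ring

lemma unitary_deriv {y : E3} (hy : y ∈ Ω) (v w : E3) : ((ed (dt θ) y v w : ℝ) : ℂ) =
    Complex.I * ((dt V.ζ y v * conj (V.base.ζ y w) + V.base.ζ y v * conj (dt V.ζ y w))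
      - (dt V.ζ y w * conj (V.base.ζ y v) + V.base.ζ y w * conj (dt V.ζ y v))) := by
  have h1 : HasDerivAt (fun t => ((ed (fun y => θ (t, y)) y v w : ℝ) : ℂ))
      ((ed (dt θ) y v w : ℝ) : ℂ) 0 :=
    (hasDerivAt_ed V.isOpen_left V.isOpen_right V.zero_mem V.smooth_θ hy v w).ofReal_comp
  have hv := V.hasDerivAt_clm V.smooth_ζ hy v
  have hw := V.hasDerivAt_clm V.smooth_ζ hy w
  have h2 := ((hv.mul hw.star).sub (hw.mul hv.star)).const_mul Complex.I
  have h3 := h2.unique (h1.congr_of_eventuallyEq (by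
    filter_upwards [V.isOpen_left.mem_nhds V.zero_mem] with t ht
    obtain ⟨f, hf, -⟩ := V.slice t ht
    have := f.unitary y hy v w
    rw [hf] at this
    exact this.symm))
  rw [← h3, V.base_ζ]
  rfl

/-- On (X, Y), the derivative of dθ is 4h, because θ(X) = θ(Y) = 0 kills dh∧θ, while the derivative
of iζ∧ζ̄ is 2(p + p̄). -/
lemma p_add_conj {y : E3} (hy : y ∈ Ω) : V.p y + conj (V.p y) = 2 * V.hc y := by
  have h1 := V.unitary_deriv hy (V.base.X y) (V.base.Y y)
  have hd := V.base.dual y hy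
  rw [V.ed_dt_θ hy, V.base.ed_θ_XY hy, V.ζd_X, V.ζd_Y, hd.ζX, hd.ζY, hd.θX, hd.θY] at h1
  simp only [map_add, map_sub, map_mul, Complex.conj_I, map_one] at h1
  push_cast at h1
  simp only [hc]
  linear_combination (-1 / 2) * h1 + (V.p y + conj (V.p y)) * Complex.I_sq

/-- On (T, X) and (T, Y), the derivative 2dh∧θ + 2h dθ of dθ leaves only -2dh, and the derivative of
iζ∧ζ̄ leaves only s and its conjugate. Combining both gives s as a Z_1̄-derivative. -/
lemma s_eq {y : E3} (hy : y ∈ Ω) : V.s y = 2 * Complex.I * V.base.Db 0 V.hc y := by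
  have h1 := V.unitary_deriv hy (V.base.T y) (V.base.X y)
  have h2 := V.unitary_deriv hy (V.base.T y) (V.base.Y y)
  have hd := V.base.dual y hy
  rw [V.ed_dt_θ hy, V.base.reeb y hy] at h1 h2
  simp only [hd.ζX, hd.ζT, hd.θX, hd.θT, hd.ζY, hd.θY, map_one, map_zero, Complex.conj_I] at h1 h2
  change _ = Complex.I * ((V.s y * _ + _ * _) - (_ * _ + _ * conj (V.s y))) at h1
  change _ = Complex.I * ((V.s y * _ + _ * _) - (_ * _ + _ * conj (V.s y))) at h2
  push_cast at h1 h2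
  simp only [ChartFrame.Db, zBar, ChartFrame.cov_apply, V.fderiv_hc hy]
  push_cast
  linear_combination (Complex.I / 2) * h1 - (1 / 2) * h2
    + (V.s y - (fderiv ℝ h y (V.base.Y y) : ℝ)) * Complex.I_sq

/-- For `v` in ξ the relation ζ_t(J_t v) = iζ_t(v) persists in time because the contact planes do
not move. Its derivative at 0 expresses ζ(E·) through the antilinear part B of ζ̇; the linear part p
cancels. -/
lemma e_eq {y : E3} (hy : y ∈ Ω) : V.e y = -Complex.I * conj (V.B y) := by
  have hd := V.base.dual y hy
  have key : ∀ v, θ (0, y) v = 0 →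
      dt V.ζ y (J (0, y) v) + 2 * V.base.ζ y (E y v) = Complex.I * dt V.ζ y v := by
    intro v hv
    have h1 := (V.hasDerivAt_u V.smooth_ζ hy).clm_apply (V.deriv_J y hy v hv)
    have h2 := (V.hasDerivAt_clm V.smooth_ζ hy v).const_mul Complex.I
    have h3 := h1.unique (h2.congr_of_eventuallyEq (by
      filter_upwards [V.isOpen_left.mem_nhds V.zero_mem] with t ht
      obtain ⟨f, hf, -⟩ := V.slice t ht
      have := f.ζ_comp_J hy (V.pseudo t ht y hy).sq_J ((V.ker_eq t ht y hy v).2 hv)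
      rw [hf] at this
      exact this))
    rw [← h3, V.base_ζ, map_smul, Complex.real_smul]
    push_cast; rfl
  have k1 := key _ hd.θX
  have k2 := key _ hd.θY
  have hY : J (0, y) (V.base.X y) = V.base.Y y := (V.base.Y_eq y hy).symm
  have hX : J (0, y) (V.base.Y y) = - V.base.X y := by
    rw [← hY]; exact (V.pseudo 0 V.zero_mem y hy).sq_J _ hd.θX
  rw [hY, V.ζd_X, V.ζd_Y] at k1
  rw [hX, map_neg, V.ζd_X, V.ζd_Y] at k2
  have e1 : V.base.ζ y (E y (V.base.X y)) = Complex.I * V.B y := by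
    linear_combination (1 / 2) * k1
  have e2 : V.base.ζ y (E y (V.base.Y y)) = V.B y := by
    linear_combination (1 / 2) * k2 + (V.p y - V.B y) / 2 * Complex.I_sq
  rw [e, e1, e2, map_mul, Complex.conj_I]
  ring

end ChartVariation

end CR3

end

/-! ### Linearized structure equations: variation of curvature and torsion -/

noncomputable section

namespace CR3

namespace ChartFrame

variable {J : E3 → E3 →L[ℝ] E3} {θ : E3 → E3 →L[ℝ] ℝ} {Ω : Set E3} (f : ChartFrame J θ Ω)

lemma D1_add (k : ℤ) {u v : E3 → ℂ} {y : E3} (hu : DifferentiableAt ℝ u y)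
    (hv : DifferentiableAt ℝ v y) : f.D1 k (fun z => u z + v z) y = f.D1 k u y + f.D1 k v y := by
  simp only [D1, zOne, f.cov_add k hu hv, add_apply]; ring

lemma Db_add (k : ℤ) {u v : E3 → ℂ} {y : E3} (hu : DifferentiableAt ℝ u y)
    (hv : DifferentiableAt ℝ v y) : f.Db k (fun z => u z + v z) y = f.Db k u y + f.Db k v y := by
  simp only [Db, zBar, f.cov_add k hu hv, add_apply]; ring

lemma D1_const_mul (k : ℤ) {u : E3 → ℂ} {y : E3} (hu : DifferentiableAt ℝ u y) (c : ℂ) :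
    f.D1 k (fun z => c * u z) y = c * f.D1 k u y := by
  simp only [D1, zOne, f.cov_const_mul k hu, smul_apply, smul_eq_mul]; ring

lemma Db_const_mul (k : ℤ) {u : E3 → ℂ} {y : E3} (hu : DifferentiableAt ℝ u y) (c : ℂ) :
    f.Db k (fun z => c * u z) y = c * f.Db k u y := by
  simp only [Db, zBar, f.cov_const_mul k hu, smul_apply, smul_eq_mul]; ring

lemma D0_const_mul (k : ℤ) {u : E3 → ℂ} {y : E3} (hu : DifferentiableAt ℝ u y) (c : ℂ) :
    f.D0 k (fun z => c * u z) y = c * f.D0 k u y := by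
  simp only [D0, f.cov_const_mul k hu, smul_apply, smul_eq_mul]

lemma Db_mul (k l : ℤ) {u v : E3 → ℂ} {y : E3} (hu : DifferentiableAt ℝ u y)
    (hv : DifferentiableAt ℝ v y) :
    f.Db (k + l) (fun z => u z * v z) y = f.Db k u y * v y + u y * f.Db l v y := by
  simp only [Db, zBar, f.cov_mul k l hu hv]; ring

lemma D0_mul (k l : ℤ) {u v : E3 → ℂ} {y : E3} (hu : DifferentiableAt ℝ u y)
    (hv : DifferentiableAt ℝ v y) :
    f.D0 (k + l) (fun z => u z * v z) y = f.D0 k u y * v y + u y * f.D0 l v y := by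
  simp only [D0, f.cov_mul k l hu hv]

end ChartFrame

namespace ChartVariation

variable {J : ℝ × E3 → E3 →L[ℝ] E3} {θ : ℝ × E3 → E3 →L[ℝ] ℝ} {I : Set ℝ} {Ω : Set E3}
  {h : E3 → ℝ} {E : E3 → E3 →L[ℝ] E3} (V : ChartVariation J θ I Ω h E)

/-- The first variation of `A_{1̄1̄}`. -/
def Abd (y : E3) : ℂ := conj (dt V.A y)

/-- The first variation of the scalar curvature. -/
def Rd (y : E3) : ℂ := (dt V.R y : ℝ)

lemma dt_ζ_eq {y : E3} (hy : y ∈ Ω) : dt V.ζ y =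
    V.p y • V.base.ζ y + V.B y • conjForm (V.base.ζ y) + V.s y • realForm (θ (0, y)) := by
  ext v
  rw [(V.base.dual y hy).apply_eq (dt V.ζ y) v]
  simp only [add_apply, smul_apply, conjForm_apply, realForm_apply, smul_eq_mul, p, B, s]
  ring

lemma ed_dt_ζ {y : E3} (hy : y ∈ Ω) (v w : E3) : ed (dt V.ζ) y v w =
    fderiv ℝ V.p y v * V.base.ζ y w - fderiv ℝ V.p y w * V.base.ζ y v
      + V.p y * ed V.base.ζ y v w
      + (fderiv ℝ V.B y v * conj (V.base.ζ y w) - fderiv ℝ V.B y w * conj (V.base.ζ y v)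
        + V.B y * conj (ed V.base.ζ y v w))
      + (fderiv ℝ V.s y v * θ (0, y) w - fderiv ℝ V.s y w * θ (0, y) v
        + V.s y * (ed (fun y => θ (0, y)) y v w : ℝ)) := by
  have he : dt V.ζ =ᶠ[𝓝 y] fun z => V.p z • V.base.ζ z + V.B z • conjForm (V.base.ζ z)
      + V.s z • realForm (θ (0, z)) :=
    Filter.eventuallyEq_of_mem (V.isOpen_right.mem_nhds hy) fun z hz => V.dt_ζ_eq hz
  have hp := V.base.diffAt V.smooth_p hy
  have hB := V.base.diffAt V.smooth_B hy
  have hs := V.base.diffAt V.smooth_s hy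
  have hζ := V.base.diffAt V.base.smooth_ζ hy
  have hζ' := V.base.diffAt (contDiffOn_conjForm V.base.smooth_ζ) hy
  have hθ := V.base.diffAt V.base.smooth_θ hy
  have hθ' := V.base.diffAt (contDiffOn_realForm V.base.smooth_θ) hy
  rw [ed_congr he, ed_add ((hp.fun_smul hζ).fun_add (hB.fun_smul hζ')) (hs.fun_smul hθ'),
    ed_add (hp.fun_smul hζ) (hB.fun_smul hζ'),
    ed_smul hp hζ, ed_smul hB hζ', ed_smul hs hθ', ed_conjForm hζ, ed_realForm hθ]
  simp only [conjForm_apply, realForm_apply]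

lemma structure_deriv {y : E3} (hy : y ∈ Ω) (v w : E3) : ed (dt V.ζ) y v w =
    (dt V.ζ y v * V.base.conn y w + V.base.ζ y v * dt V.conn y w
      - (dt V.ζ y w * V.base.conn y v + V.base.ζ y w * dt V.conn y v))
    + (V.Abd y * (θ (0, y) v * conj (V.base.ζ y w) - θ (0, y) w * conj (V.base.ζ y v))
      + V.base.Abar y * (2 * h y * (θ (0, y) v * conj (V.base.ζ y w)
          - θ (0, y) w * conj (V.base.ζ y v))
        + (θ (0, y) v * conj (dt V.ζ y w) - θ (0, y) w * conj (dt V.ζ y v)))) := by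
  have h1 := hasDerivAt_ed V.isOpen_left V.isOpen_right V.zero_mem V.smooth_ζ hy v w
  have ζv := V.hasDerivAt_clm V.smooth_ζ hy v
  have ζw := V.hasDerivAt_clm V.smooth_ζ hy w
  have cv := V.hasDerivAt_clm V.smooth_conn hy v
  have cw := V.hasDerivAt_clm V.smooth_conn hy w
  have θv := (V.deriv_θ y hy v).ofReal_comp
  have θw := (V.deriv_θ y hy w).ofReal_comp
  have hA := (V.hasDerivAt_u V.smooth_A hy).star
  have h2 := ((ζv.mul cw).sub (ζw.mul cv)).add
    (hA.mul ((θv.mul ζw.star).sub (θw.mul ζv.star)))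
  have h3 := h2.unique (h1.congr_of_eventuallyEq (by
    filter_upwards [V.isOpen_left.mem_nhds V.zero_mem] with t ht
    obtain ⟨f, hf, hc, hA, -⟩ := V.slice t ht
    have := f.structure_eq y hy v w
    rw [hc, hA, hf] at this
    rw [show (fun y => V.ζ (t, y)) = f.ζ from (funext hf).symm, this]
    rfl))
  rw [← h3, V.base_ζ, ChartFrame.Abar, V.base_A, V.base_conn, Abd]
  simp only [Complex.star_def, Pi.sub_apply, Pi.mul_apply]
  push_cast
  ring

lemma skew_deriv {y : E3} (hy : y ∈ Ω) (v : E3) :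
    dt V.conn y v + conj (dt V.conn y v) = 0 := by
  have cv := V.hasDerivAt_clm V.smooth_conn hy v
  refine (cv.add cv.star).unique ((hasDerivAt_const (0 : ℝ) (0 : ℂ)).congr_of_eventuallyEq ?_)
  filter_upwards [V.isOpen_left.mem_nhds V.zero_mem] with t ht
  obtain ⟨f, -, hc, -⟩ := V.slice t ht
  have := f.skew y hy v
  rw [hc] at this
  exact this

/-- The fixed vectors X(0), Y(0) stay in ker θ_t, so the curvature equation holds on them at all
times. There it says dω_t(X, Y) = -iR_t dθ_t(X, Y), and dθ_t(X, Y) has value 2 and derivative 4h at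
0. -/
lemma curvature_deriv {y : E3} (hy : y ∈ Ω) :
    ed (dt V.conn) y (V.base.X y) (V.base.Y y) =
      -Complex.I * (2 * V.Rd y + 4 * V.hc y * V.base.Rc y) := by
  have hd := V.base.dual y hy
  have h1 := hasDerivAt_ed V.isOpen_left V.isOpen_right V.zero_mem V.smooth_conn hy
    (V.base.X y) (V.base.Y y)
  have hθ : HasDerivAt (fun t => ((ed (fun y => θ (t, y)) y (V.base.X y) (V.base.Y y) : ℝ) : ℂ))
      ((ed (dt θ) y (V.base.X y) (V.base.Y y) : ℝ) : ℂ) 0 :=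
    (hasDerivAt_ed V.isOpen_left V.isOpen_right V.zero_mem V.smooth_θ hy _ _).ofReal_comp
  have hR := (V.hasDerivAt_u V.smooth_R hy).ofReal_comp
  have h2 := (hR.mul hθ).const_mul (-Complex.I)
  have h3 := h2.unique (h1.congr_of_eventuallyEq (by
    filter_upwards [V.isOpen_left.mem_nhds V.zero_mem] with t ht
    obtain ⟨f, -, hc, -, hR⟩ := V.slice t ht
    have h4 := f.curvature y hy _ _ ((V.ker_eq t ht y hy _).2 hd.θX)
      ((V.ker_eq t ht y hy _).2 hd.θY)
    have h5 := f.unitary y hy (V.base.X y) (V.base.Y y)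
    rw [show (fun y => V.conn (t, y)) = f.conn from (funext hc).symm, h4, hR]
    simp only [Pi.mul_apply, h5]
    linear_combination -(V.R (t, y)) * (f.ζ y (V.base.X y) * conj (f.ζ y (V.base.Y y))
      - f.ζ y (V.base.Y y) * conj (f.ζ y (V.base.X y))) * Complex.I_sq))
  rw [← h3, V.ed_dt_θ hy, V.base.ed_θ_XY hy, hd.θX, hd.θY, Rd, hc, ChartFrame.Rc, V.base_R]
  push_cast
  ring

/-- The linearized structure equations. -/
lemma eta_b {y : E3} (hy : y ∈ Ω) :
    zBar (V.base.X y) (V.base.Y y) (dt V.conn y + fderiv ℝ V.p y) =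
      V.base.D1 (-2) V.B y + Complex.I * V.s y := by
  -- The term dp∧ζ in dζ̇ has the same shape as -ζ∧ω̇, so only the sum η = ω̇ + dp is determined.
  -- The ζ∧ζ̄ part of the linearized equation gives its Z_1̄-component.
  have hd := V.base.dual y hy
  have h1 := (V.ed_dt_ζ hy (V.base.X y) (V.base.Y y)).symm.trans
    (V.structure_deriv hy (V.base.X y) (V.base.Y y))
  rw [V.base.ed_ζ_XY hy, V.base.ed_θ_XY hy, V.ζd_X, V.ζd_Y] at h1
  simp only [hd.ζX, hd.ζY, hd.θX, hd.θY, map_sub, map_mul, map_one, Complex.conj_I,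
    V.base.conj_conn hy] at h1
  push_cast at h1
  simp only [zBar, zOne, ChartFrame.D1, ChartFrame.cov_apply, add_apply]
  push_cast
  linear_combination (-Complex.I / 2) * h1
    + ((dt V.conn y (V.base.X y) + fderiv ℝ V.p y (V.base.X y)) / 2
      - fderiv ℝ V.B y (V.base.X y) / 2 - V.B y * V.base.conn y (V.base.X y)) * Complex.I_sq

/-- The linearized equation on (T, X) and (T, Y) contains both η(T) and the variation of the
torsion. The combination along Z₁ isolates η(T). -/
lemma eta_T {y : E3} (hy : y ∈ Ω) :
    dt V.conn y (V.base.T y) + fderiv ℝ V.p y (V.base.T y) =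
      V.base.D1 (-1) V.s y - V.B y * V.base.A y + V.base.Abar y * conj (V.B y) := by
  have hd := V.base.dual y hy
  have h1 := (V.ed_dt_ζ hy (V.base.T y) (V.base.X y)).symm.trans
    (V.structure_deriv hy (V.base.T y) (V.base.X y))
  have h2 := (V.ed_dt_ζ hy (V.base.T y) (V.base.Y y)).symm.trans
    (V.structure_deriv hy (V.base.T y) (V.base.Y y))
  have hs : dt V.ζ y (V.base.T y) = V.s y := rfl
  have hA : conj (V.base.Abar y) = V.base.A y := by simp [ChartFrame.Abar]
  rw [V.base.ed_ζ_TX hy, V.base.reeb y hy, V.ζd_X, hs] at h1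
  rw [V.base.ed_ζ_TY hy, V.base.reeb y hy, V.ζd_Y, hs] at h2
  simp only [hd.ζX, hd.ζY, hd.θX, hd.θY, hd.ζT, hd.θT, map_sub, map_mul, map_one, Complex.conj_I,
    V.base.conj_conn hy, map_add, map_neg, map_zero, hA] at h1 h2
  push_cast at h1 h2
  simp only [zBar, zOne, ChartFrame.D1, ChartFrame.cov_apply, add_apply]
  push_cast
  linear_combination (1 / 2) * h1 - (Complex.I / 2) * h2
    + ((dt V.conn y (V.base.T y) + fderiv ℝ V.p y (V.base.T y) - V.p y * V.base.Abar y
      - 2 * V.B y * V.base.conn y (V.base.T y) + V.B y * V.base.A y + V.Abd y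
      + 2 * V.base.Abar y * h y + V.base.Abar y * conj (V.p y) - V.base.Abar y * conj (V.B y)
      - fderiv ℝ V.B y (V.base.T y)) / 2) * Complex.I_sq

/-- The same two equations as for η(T), now combined along Z_1̄: there the connection terms in ω̇
and dp cancel and the variation of the torsion remains. -/
lemma Abd_eq {y : E3} (hy : y ∈ Ω) : V.Abd y =
    V.p y * V.base.Abar y - conj (V.p y) * V.base.Abar y - 2 * V.hc y * V.base.Abar y
      + V.base.D0 (-2) V.B y - V.base.Db (-1) V.s y := by
  have hd := V.base.dual y hy
  have h1 := (V.ed_dt_ζ hy (V.base.T y) (V.base.X y)).symm.trans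
    (V.structure_deriv hy (V.base.T y) (V.base.X y))
  have h2 := (V.ed_dt_ζ hy (V.base.T y) (V.base.Y y)).symm.trans
    (V.structure_deriv hy (V.base.T y) (V.base.Y y))
  have hs : dt V.ζ y (V.base.T y) = V.s y := rfl
  have hA : conj (V.base.Abar y) = V.base.A y := by simp [ChartFrame.Abar]
  rw [V.base.ed_ζ_TX hy, V.base.reeb y hy, V.ζd_X, hs] at h1
  rw [V.base.ed_ζ_TY hy, V.base.reeb y hy, V.ζd_Y, hs] at h2
  simp only [hd.ζX, hd.ζY, hd.θX, hd.θY, hd.ζT, hd.θT, map_sub, map_mul, map_one, Complex.conj_I,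
    V.base.conj_conn hy, map_add, map_neg, map_zero, hA] at h1 h2
  push_cast at h1 h2
  simp only [zBar, zOne, ChartFrame.Db, ChartFrame.D0, ChartFrame.cov_apply, add_apply, hc]
  push_cast
  linear_combination -(1 / 2) * h1 - (Complex.I / 2) * h2
    + ((dt V.conn y (V.base.T y) + fderiv ℝ V.p y (V.base.T y) - V.p y * V.base.Abar y
      - 2 * V.B y * V.base.conn y (V.base.T y) + V.B y * V.base.A y + V.Abd y
      + 2 * V.base.Abar y * h y + V.base.Abar y * conj (V.p y) - V.base.Abar y * conj (V.B y)
      - fderiv ℝ V.B y (V.base.T y)) / 2) * Complex.I_sq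

/-- The variation ω̇ is imaginary and p + p̄ = 2h near the point, so η + η̄ = 2dh. This determines
the Z₁-component of η from its Z_1̄-component. -/
lemma eta_one {y : E3} (hy : y ∈ Ω) :
    zOne (V.base.X y) (V.base.Y y) (dt V.conn y + fderiv ℝ V.p y) =
      2 * V.base.D1 0 V.hc y - conj (V.base.D1 (-2) V.B y + Complex.I * V.s y) := by
  have hp := V.base.diffAt V.smooth_p hy
  have hh : ∀ v, fderiv ℝ V.p y v + conj (fderiv ℝ V.p y v) = 2 * fderiv ℝ V.hc y v := by
    intro v
    have he : (fun z => V.p z + conj (V.p z)) =ᶠ[𝓝 y] fun z => 2 * V.hc z :=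
      Filter.eventuallyEq_of_mem (V.isOpen_right.mem_nhds hy) fun z hz => V.p_add_conj hz
    have h1 := DFunLike.congr_fun (he.fderiv_eq (𝕜 := ℝ)) v
    rw [fderiv_fun_add hp (V.base.diffAt (contDiffOn_conj V.smooth_p) hy),
      fderiv_const_mul (V.base.diffAt V.smooth_hc hy)] at h1
    simpa [fderiv_conj hp] using h1
  have hX := hh (V.base.X y)
  have hY := hh (V.base.Y y)
  have sX := V.skew_deriv hy (V.base.X y)
  have sY := V.skew_deriv hy (V.base.Y y)
  rw [← V.eta_b hy]
  simp only [zBar, zOne, ChartFrame.D1, ChartFrame.cov_apply, add_apply, map_mul, map_add,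
    Complex.conj_I, map_div₀, map_one, Complex.conj_ofNat]
  push_cast
  linear_combination (1 / 2) * (hX + sX) - (Complex.I / 2) * (hY + sY)

lemma smooth_eta_b : ContDiffOn ℝ ∞ (fun y => V.base.D1 (-2) V.B y + Complex.I * V.s y) Ω :=
  (V.base.smooth_D1 _ V.smooth_B).add (contDiffOn_const.mul V.smooth_s)

lemma D1_s {y : E3} (hy : y ∈ Ω) :
    V.base.D1 (-1) V.s y = 2 * Complex.I * V.base.D1 (-1) (V.base.Db 0 V.hc) y := by
  rw [V.base.D1_congr (-1) (fun z hz => V.s_eq hz) hy, V.base.D1_const_mul _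
    (V.base.diffAt (V.base.smooth_Db 0 V.smooth_hc) hy)]

/-- The first variation of the scalar curvature. -/
lemma Rd_eq {y : E3} (hy : y ∈ Ω) : V.Rd y + 2 * V.hc y * V.base.Rc y =
    (V.base.D1 (-1) (V.base.D1 (-2) V.B) y - Complex.I * V.B y * V.base.A y)
      + conj (V.base.D1 (-1) (V.base.D1 (-2) V.B) y - Complex.I * V.B y * V.base.A y)
      - 4 * (V.base.Db 1 (V.base.D1 0 V.hc) y + V.base.D1 (-1) (V.base.Db 0 V.hc) y) := by
  set f := V.base with hf
  set b : E3 → ℂ := fun y => f.D1 (-2) V.B y + Complex.I * V.s y with hb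
  have sb : ContDiffOn ℝ ∞ b Ω := V.smooth_eta_b
  have sh1 : ContDiffOn ℝ ∞ (f.D1 0 V.hc) Ω := f.smooth_D1 0 V.smooth_hc
  have shb : ContDiffOn ℝ ∞ (f.Db 0 V.hc) Ω := f.smooth_Db 0 V.smooth_hc
  have sBB : ContDiffOn ℝ ∞ (fun y => conj (V.B y)) Ω := contDiffOn_conj V.smooth_B
  have sc : ContDiffOn ℝ ∞ (fun y => f.D1 (-1) V.s y - V.B y * f.A y
      + f.Abar y * conj (V.B y)) Ω :=
    ((f.smooth_D1 _ V.smooth_s).sub (V.smooth_B.mul f.smooth_A)).add (f.smooth_Abar.mul sBB)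
  have sa : ContDiffOn ℝ ∞ (fun y => 2 * f.D1 0 V.hc y + (-1) * conj (b y)) Ω :=
    (contDiffOn_const.mul sh1).add (contDiffOn_const.mul (contDiffOn_conj sb))
  have hcd : ContDiffOn ℝ ∞ (dt V.conn) Ω :=
    contDiffOn_dt V.isOpen_left V.isOpen_right V.zero_mem V.smooth_conn
  have hdp : ContDiffOn ℝ ∞ (fderiv ℝ V.p) Ω := V.smooth_p.fderiv_of_isOpen V.isOpen_right (by simp)
  have h1 := f.ed_comb hy (f.diffAt sa hy) (f.diffAt sb hy) (f.diffAt sc hy)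
  -- The one-form η written in the coframe with its three known components. Since d(dp) = 0, dη and
  -- dω̇ coincide, so `ed_comb` yields the variation of the curvature.
  have he : (fun z => dt V.conn z + fderiv ℝ V.p z) =ᶠ[𝓝 y] fun z =>
      (2 * f.D1 0 V.hc z + (-1) * conj (b z)) • f.ζ z + b z • conjForm (f.ζ z)
        + (f.D1 (-1) V.s z - V.B z * f.A z + f.Abar z * conj (V.B z)) • realForm (θ (0, z)) := by
    refine Filter.eventuallyEq_of_mem (V.isOpen_right.mem_nhds hy) fun z hz => ?_
    ext v
    rw [(f.dual z hz).apply_eq (dt V.conn z + fderiv ℝ V.p z) v, V.eta_one hz, V.eta_b hz,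
      add_apply (dt V.conn z), V.eta_T hz]
    simp only [add_apply, smul_apply, conjForm_apply, realForm_apply, smul_eq_mul, hb]
    ring
  have hcb := f.Db_conj (-1) hy (f.diffAt sb hy)
  have hcj := f.Db_conj (-1) hy (f.diffAt shb hy)
  rw [neg_neg] at hcb hcj
  rw [← ed_congr he, ed_add (f.diffAt hcd hy) (f.diffAt hdp hy), V.curvature_deriv hy,
    ed_fderiv ((V.smooth_p.contDiffAt (V.isOpen_right.mem_nhds hy)).of_le (by norm_cast)),
    f.Db_add 1 ((f.diffAt sh1 hy).const_mul 2) ((f.diffAt (contDiffOn_conj sb) hy).const_mul (-1)),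
    f.Db_const_mul 1 (f.diffAt sh1 hy), f.Db_const_mul 1 (f.diffAt (contDiffOn_conj sb) hy),
    hcb] at h1
  -- With s = 2i h_{,1̄}, the summand i s equals -2h_{,1̄}; this is one source of the sublaplacian
  -- of `h`.
  have hD : f.D1 (-1) b y = f.D1 (-1) (f.D1 (-2) V.B) y
      - 2 * f.D1 (-1) (f.Db 0 V.hc) y := by
    rw [hb, f.D1_add (-1) (f.diffAt (f.smooth_D1 _ V.smooth_B) hy)
      ((f.diffAt V.smooth_s hy).const_mul _), f.D1_const_mul _ (f.diffAt V.smooth_s hy),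
      V.D1_s hy]
    linear_combination 2 * f.D1 (-1) (f.Db 0 V.hc) y * Complex.I_sq
  replace hcj : conj (f.D1 (-1) (f.Db 0 V.hc) y) = f.Db 1 (f.D1 0 V.hc) y := by
    rw [← hcj]
    refine f.Db_congr _ (fun z hz => ?_) hy
    rw [← f.D1_conj 0 hz (f.diffAt V.smooth_hc hz)]
    simp [hc]
    rfl
  have hA : conj (f.Abar y) = f.A y := by simp [ChartFrame.Abar]
  rw [hD] at h1
  simp only [map_sub, map_mul, hcj, Complex.conj_ofNat, Complex.conj_I] at h1 ⊢
  rw [V.D1_s hy, ← hf] at h1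
  rw [show conj (f.A y) = f.Abar y from rfl]
  linear_combination (Complex.I / 2) * h1 + (V.Rd y + 2 * V.hc y * f.Rc y
    + 4 * f.Db 1 (f.D1 0 V.hc) y + 4 * f.D1 (-1) (f.Db 0 V.hc) y
    - conj (f.D1 (-1) (f.D1 (-2) V.B) y) - f.D1 (-1) (f.D1 (-2) V.B) y) * Complex.I_sq

end ChartVariation

end CR3

end

/-! ### First variation of the energy density modulo a divergence -/

noncomputable section

namespace CR3

namespace ChartFrame

variable {J : E3 → E3 →L[ℝ] E3} {θ : E3 → E3 →L[ℝ] ℝ} {Ω : Set E3} (f : ChartFrame J θ Ω)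

/-- The coefficient of `E₁₁` in the first variation with respect to the CR structure. -/
def gradJ (y : E3) : ℂ :=
  2 * Complex.I * f.Db (-1) (f.Db 0 f.Rc) y - 2 * f.Rc y * f.Abar y
    + Complex.I * f.D0 (-2) f.Abar y

/-- Half of the coefficient of `h` in the first variation with respect to the contact form. -/
def gradθ (y : E3) : ℂ :=
  -8 * f.Db 1 (f.D1 0 f.Rc) y + 2 * Complex.I * f.Db 1 (f.Db 2 f.A) y

lemma smooth_gradJ : ContDiffOn ℝ ∞ f.gradJ Ω :=
  ((contDiffOn_const.mul (f.smooth_Db _ (f.smooth_Db _ f.smooth_Rc))).sub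
    ((contDiffOn_const.mul f.smooth_Rc).mul f.smooth_Abar)).add
    (contDiffOn_const.mul (f.smooth_D0 _ f.smooth_Abar))

lemma smooth_gradθ : ContDiffOn ℝ ∞ f.gradθ Ω :=
  (contDiffOn_const.mul (f.smooth_Db _ (f.smooth_D1 _ f.smooth_Rc))).add
    (contDiffOn_const.mul (f.smooth_Db _ (f.smooth_Db _ f.smooth_A)))

/-- The `Z_1̄`-component of the boundary term of the first variation. -/
def bdryW (e hc : E3 → ℂ) (y : E3) : ℂ :=
  2 * Complex.I * (f.Rc y * f.Db 2 e y - f.Db 0 f.Rc y * e y)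
    - 8 * (f.Rc y * f.D1 0 hc y - hc y * f.D1 0 f.Rc y)
    + 2 * Complex.I * (f.Db 0 hc y * f.A y - hc y * f.Db 2 f.A y)

/-- The Reeb component of the boundary term of the first variation. -/
def bdryZ (e : E3 → ℂ) (y : E3) : ℂ := -Complex.I * (e y * f.Abar y)

lemma smooth_bdryW {e hc : E3 → ℂ} (he : ContDiffOn ℝ ∞ e Ω) (hh : ContDiffOn ℝ ∞ hc Ω) :
    ContDiffOn ℝ ∞ (f.bdryW e hc) Ω :=
  ((contDiffOn_const.mul ((f.smooth_Rc.mul (f.smooth_Db _ he)).sub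
    ((f.smooth_Db _ f.smooth_Rc).mul he))).sub
    (contDiffOn_const.mul ((f.smooth_Rc.mul (f.smooth_D1 _ hh)).sub
      (hh.mul (f.smooth_D1 _ f.smooth_Rc))))).add
    (contDiffOn_const.mul (((f.smooth_Db _ hh).mul f.smooth_A).sub
      (hh.mul (f.smooth_Db _ f.smooth_A))))

lemma smooth_bdryZ {e : E3 → ℂ} (he : ContDiffOn ℝ ∞ e Ω) : ContDiffOn ℝ ∞ (f.bdryZ e) Ω :=
  contDiffOn_const.mul (he.mul f.smooth_Abar)

/-- This is the product rule; every product in `bdryW` has weight 1. In the pairs (R, E₁₁) and (h,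
A₁₁) the mixed first-order terms cancel. In the pair (R, h) they leave R_{,1̄}h_{,1} -
h_{,1̄}R_{,1}, which is imaginary and disappears when the conjugate is added. -/
lemma Db_bdryW {e hc : E3 → ℂ} (he : ContDiffOn ℝ ∞ e Ω) (hh : ContDiffOn ℝ ∞ hc Ω) {y : E3}
    (hy : y ∈ Ω) : f.Db 1 (f.bdryW e hc) y =
      2 * Complex.I * (f.Rc y * f.Db 1 (f.Db 2 e) y - f.Db (-1) (f.Db 0 f.Rc) y * e y)
      - 8 * (f.Rc y * f.Db 1 (f.D1 0 hc) y + f.Db 0 f.Rc y * f.D1 0 hc y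
        - hc y * f.Db 1 (f.D1 0 f.Rc) y - f.Db 0 hc y * f.D1 0 f.Rc y)
      + 2 * Complex.I * (f.Db (-1) (f.Db 0 hc) y * f.A y - hc y * f.Db 1 (f.Db 2 f.A) y) := by
  have d : ∀ {u : E3 → ℂ}, ContDiffOn ℝ ∞ u Ω → DifferentiableAt ℝ u y := fun hu => f.diffAt hu hy
  have hR := f.smooth_Rc
  have hA := f.smooth_A
  have heb := f.smooth_Db 2 he
  have hRb := f.smooth_Db 0 hR
  have hR1 := f.smooth_D1 0 hR
  have hhb := f.smooth_Db 0 hh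
  have hh1 := f.smooth_D1 0 hh
  have hAb := f.smooth_Db 2 hA
  have e1 : f.bdryW e hc = fun y => (2 * Complex.I) * (f.Rc y * f.Db 2 e y)
      + ((-(2 * Complex.I)) * (f.Db 0 f.Rc y * e y) + ((-8) * (f.Rc y * f.D1 0 hc y)
      + (8 * (hc y * f.D1 0 f.Rc y) + ((2 * Complex.I) * (f.Db 0 hc y * f.A y)
      + (-(2 * Complex.I)) * (hc y * f.Db 2 f.A y))))) := by
    ext y; simp only [bdryW]; ring
  have m1 := hR.mul heb
  have m2 := hRb.mul he
  have m3 := hR.mul hh1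
  have m4 := hh.mul hR1
  have m5 := hhb.mul hA
  have m6 := hh.mul hAb
  have c : ∀ {u : E3 → ℂ} (c : ℂ), ContDiffOn ℝ ∞ u Ω → ContDiffOn ℝ ∞ (fun y => c * u y) Ω :=
    fun c hu => contDiffOn_const.mul hu
  have a6 := c (-(2 * Complex.I)) m6
  have a5 := (c (2 * Complex.I) m5).add a6
  have a4 := (c 8 m4).add a5
  have a3 := (c (-8) m3).add a4
  have a2 := (c (-(2 * Complex.I)) m2).add a3
  have k1 := f.Db_mul 0 1 (d hR) (d heb)
  have k2 := f.Db_mul (-1) 2 (d hRb) (d he)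
  have k3 := f.Db_mul 0 1 (d hR) (d hh1)
  have k4 := f.Db_mul 0 1 (d hh) (d hR1)
  have k5 := f.Db_mul (-1) 2 (d hhb) (d hA)
  have k6 := f.Db_mul 0 1 (d hh) (d hAb)
  norm_num at k1 k2 k3 k4 k5 k6
  rw [e1, f.Db_add 1 (d (c _ m1)) (d a2), f.Db_add 1 (d (c _ m2)) (d a3),
    f.Db_add 1 (d (c _ m3)) (d a4), f.Db_add 1 (d (c _ m4)) (d a5),
    f.Db_add 1 (d (c _ m5)) (d a6), f.Db_const_mul 1 (d m1), f.Db_const_mul 1 (d m2),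
    f.Db_const_mul 1 (d m3), f.Db_const_mul 1 (d m4), f.Db_const_mul 1 (d m5),
    f.Db_const_mul 1 (d m6)]
  rw [k1, k2, k3, k4, k5, k6]
  ring

lemma D0_bdryZ {e : E3 → ℂ} (he : ContDiffOn ℝ ∞ e Ω) {y : E3} (hy : y ∈ Ω) :
    f.D0 0 (f.bdryZ e) y =
      -Complex.I * (f.D0 2 e y * f.Abar y + e y * f.D0 (-2) f.Abar y) := by
  have k := f.D0_mul 2 (-2) (f.diffAt he hy) (f.diffAt f.smooth_Abar hy)
  norm_num at k
  rw [show f.bdryZ e = fun y => -Complex.I * (e y * f.Abar y) from rfl,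
    f.D0_const_mul 0 (f.diffAt (he.mul f.smooth_Abar) hy), k]

end ChartFrame

namespace ChartVariation

variable {J : ℝ × E3 → E3 →L[ℝ] E3} {θ : ℝ × E3 → E3 →L[ℝ] ℝ} {I : Set ℝ} {Ω : Set E3}
  {h : E3 → ℝ} {E : E3 → E3 →L[ℝ] E3} (V : ChartVariation J θ I Ω h E)

/-- The density of the energy with respect to the volume form of the base structure. -/
def dens (z : ℝ × E3) : ℝ := θ z (V.base.T z.2) ^ 2 * (V.R z ^ 2 - ‖V.A z‖ ^ 2)

lemma smooth_dens : ContDiffOn ℝ ∞ V.dens (I ×ˢ Ω) := by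
  have hT : ContDiffOn ℝ ∞ (fun z : ℝ × E3 => V.base.T z.2) (I ×ˢ Ω) :=
    V.base.smooth_T.comp contDiffOn_snd fun z hz => hz.2
  exact ((V.smooth_θ.clm_apply hT).pow 2).mul ((V.smooth_R.pow 2).sub (V.smooth_A.norm_sq ℝ))

/-- The factor θ_t(T)² has value 1 and derivative 4h. The resulting 4hR² is absorbed by writing Ṙ +
2hR, which is the combination that the linearized curvature equation provides. -/
lemma dt_dens {y : E3} (hy : y ∈ Ω) : ((dt V.dens y : ℝ) : ℂ) =
    2 * V.base.Rc y * (V.Rd y + 2 * V.hc y * V.base.Rc y)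
      - (V.Abd y * V.base.A y + conj (V.Abd y * V.base.A y))
      - 4 * V.hc y * (V.base.A y * V.base.Abar y) := by
  have hθ := (V.deriv_θ y hy (V.base.T y)).ofReal_comp
  have hR := (V.hasDerivAt_u V.smooth_R hy).ofReal_comp
  have hA := V.hasDerivAt_u V.smooth_A hy
  have h1 := (hθ.pow 2).mul ((hR.pow 2).sub (hA.mul hA.star))
  have h2 := (V.hasDerivAt_u V.smooth_dens hy).ofReal_comp
  have h3 := h2.unique (h1.congr_of_eventuallyEq (Filter.Eventually.of_forall fun t => by
    simp only [dens, Pi.mul_apply, Pi.sub_apply, Pi.pow_apply, Complex.star_def, Complex.mul_conj,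
      Complex.normSq_eq_norm_sq]
    push_cast
    ring))
  rw [h3]
  have e1 : θ (0, y) (V.base.T y) = 1 := (V.base.dual y hy).θT
  simp only [Pi.mul_apply, Pi.sub_apply, Pi.pow_apply, Complex.star_def, e1, Abd, hc, Rd,
    ChartFrame.Rc, ChartFrame.Abar, V.base_R, V.base_A, map_mul, Complex.conj_conj]
  push_cast
  ring

lemma B_eq {y : E3} (hy : y ∈ Ω) : V.B y = -Complex.I * conj (V.e y) := by
  rw [V.e_eq hy, map_mul, map_neg, Complex.conj_I, Complex.conj_conj]
  linear_combination V.B y * Complex.I_sq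

/-- A variation of J prescribes E only pointwise. Smoothness of E₁₁ comes from its expression
through B, that is, through the time derivative of the coframe. -/
lemma smooth_e : ContDiffOn ℝ ∞ V.e Ω :=
  (contDiffOn_const.mul (contDiffOn_conj V.smooth_B)).congr fun _ hy => V.e_eq hy

/-- Half of the integrand of the first variation, modulo divergences. -/
def varHalf (y : E3) : ℂ := V.base.gradJ y * V.e y + V.base.gradθ y * V.hc y

lemma smooth_varHalf : ContDiffOn ℝ ∞ V.varHalf Ω :=
  (V.base.smooth_gradJ.mul V.smooth_e).add (V.base.smooth_gradθ.mul V.smooth_hc)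

/-- Half of the divergence of the boundary term. -/
def divHalf (y : E3) : ℂ :=
  V.base.Db 1 (V.base.bdryW V.e V.hc) y + V.base.D0 0 (V.base.bdryZ V.e) y

/-- The first variation of the energy density. -/
lemma dt_dens_eq {y : E3} (hy : y ∈ Ω) : ((dt V.dens y : ℝ) : ℂ) =
    (V.varHalf y + conj (V.varHalf y)) + (V.divHalf y + conj (V.divHalf y)) := by
  set f := V.base with hf
  have sh := V.smooth_hc
  have se := V.smooth_e
  have d : ∀ {u : E3 → ℂ}, ContDiffOn ℝ ∞ u Ω → DifferentiableAt ℝ u y := fun hu => f.diffAt hu hy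
  have hRc : ∀ z, conj (f.Rc z) = f.Rc z := fun z => Complex.conj_ofReal _
  have hhc : ∀ z, conj (V.hc z) = V.hc z := fun z => Complex.conj_ofReal _
  have hAc : conj (f.A y) = f.Abar y := rfl
  have hAbc : conj (f.Abar y) = f.A y := Complex.conj_conj _
  -- conjugates of derivatives of real functions
  have r1 : ∀ {u : E3 → ℂ}, ContDiffOn ℝ ∞ u Ω → (∀ z, conj (u z) = u z) → ∀ z ∈ Ω,
      conj (f.D1 0 u z) = f.Db 0 u z := by
    intro u hu hc z hz
    rw [← f.Db_conj 0 hz (f.diffAt hu hz)]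
    simp only [hc, neg_zero]
  have r2 : ∀ {u : E3 → ℂ}, ContDiffOn ℝ ∞ u Ω → (∀ z, conj (u z) = u z) →
      conj (f.Db 1 (f.D1 0 u) y) = f.D1 (-1) (f.Db 0 u) y := by
    intro u hu hc
    rw [← f.D1_conj 1 hy (d (f.smooth_D1 0 hu))]
    exact f.D1_congr _ (r1 hu hc) hy
  -- expressing the variation of the coframe through `E₁₁`
  have b1 : ∀ z ∈ Ω, f.D1 (-2) V.B z = -Complex.I * conj (f.Db 2 V.e z) := by
    intro z hz
    rw [f.D1_congr (-2) (fun z hz => V.B_eq hz) hz,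
      f.D1_const_mul _ (f.diffAt (contDiffOn_conj se) hz), f.D1_conj 2 hz (f.diffAt se hz)]
  have b11 : f.D1 (-1) (f.D1 (-2) V.B) y = -Complex.I * conj (f.Db 1 (f.Db 2 V.e) y) := by
    have := f.smooth_Db 2 se
    rw [f.D1_congr (-1) b1 hy,
      f.D1_const_mul _ (d (contDiffOn_conj this)), f.D1_conj 1 hy (d this)]
  have b0 : f.D0 (-2) V.B y = -Complex.I * conj (f.D0 2 V.e y) := by
    rw [f.D0_congr (-2) (fun z hz => V.B_eq hz) hy,
      f.D0_const_mul _ (d (contDiffOn_conj se)), f.D0_conj 2 hy (d se)]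
  have sb : f.Db (-1) V.s y = 2 * Complex.I * f.Db (-1) (f.Db 0 V.hc) y := by
    rw [f.Db_congr (-1) (fun z hz => V.s_eq hz) hy,
      f.Db_const_mul _ (d (f.smooth_Db 0 sh))]
  have hp := V.p_add_conj hy
  -- After substitution the identity is algebraic. The factor p enters the torsion term only as p -
  -- p̄, which cancels against its conjugate since rotating the frame does not change |A|; the h|A|²
  -- terms cancel too.
  rw [V.dt_dens hy, V.Rd_eq hy, V.Abd_eq hy, varHalf, divHalf, f.Db_bdryW se sh hy,
    f.D0_bdryZ se hy, ChartFrame.gradJ, ChartFrame.gradθ, ← hf, b11, b0, sb, V.B_eq hy]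
  have hh2 := r2 sh hhc
  have hh1 := r1 sh hhc y hy
  have hR2 := r2 f.smooth_Rc hRc
  have hR1 := r1 f.smooth_Rc hRc y hy
  have hh1' : conj (f.Db 0 V.hc y) = f.D1 0 V.hc y := by rw [← hh1, Complex.conj_conj]
  have hR1' : conj (f.Db 0 f.Rc y) = f.D1 0 f.Rc y := by rw [← hR1, Complex.conj_conj]
  simp only [map_add, map_sub, map_mul, map_neg, Complex.conj_I, Complex.conj_conj, hRc, hhc, hAc,
    hAbc, hh2, hh1, hR2, hR1, hh1', hR1', Complex.conj_ofNat]
  linear_combination (2 * f.Rc y * (conj (V.e y) * f.A y + V.e y * f.Abar y)) * Complex.I_sq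

end ChartVariation

end CR3

end

/-! ### Divergence of a vector field with respect to θ∧dθ -/

noncomputable section

namespace CR3

section Divergence

/-- The divergence of a vector field on `E3`. -/
def divg (F : E3 → E3) (y : E3) : ℝ :=
  fderiv ℝ F y (stdVec 0) 0 + fderiv ℝ F y (stdVec 1) 1 + fderiv ℝ F y (stdVec 2) 2

/-- The cross product of two linear forms, as a vector. -/
def crossVec (a b : E3 →L[ℝ] ℝ) : E3 :=
  (a (stdVec 1) * b (stdVec 2) - a (stdVec 2) * b (stdVec 1)) • stdVec 0
    + (a (stdVec 2) * b (stdVec 0) - a (stdVec 0) * b (stdVec 2)) • stdVec 1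
    + (a (stdVec 0) * b (stdVec 1) - a (stdVec 1) * b (stdVec 0)) • stdVec 2

/-- The value of `l ∧ dβ` on the standard basis. -/
def wedgeEd (l : E3 →L[ℝ] ℝ) (β : E3 → E3 →L[ℝ] ℝ) (y : E3) : ℝ :=
  l (stdVec 0) * ed β y (stdVec 1) (stdVec 2) + l (stdVec 1) * ed β y (stdVec 2) (stdVec 0)
    + l (stdVec 2) * ed β y (stdVec 0) (stdVec 1)

lemma stdVec_apply (i j : Fin 3) : stdVec i j = if j = i then 1 else 0 := by
  simp [stdVec]

lemma divg_add {F G : E3 → E3} {y : E3} (hF : DifferentiableAt ℝ F y)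
    (hG : DifferentiableAt ℝ G y) : divg (fun z => F z + G z) y = divg F y + divg G y := by
  simp only [divg, fderiv_fun_add hF hG, add_apply, PiLp.add_apply]
  ring

lemma divg_smul {u : E3 → ℝ} {F : E3 → E3} {y : E3} (hu : DifferentiableAt ℝ u y)
    (hF : DifferentiableAt ℝ F y) :
    divg (fun z => u z • F z) y = u y * divg F y + fderiv ℝ u y (F y) := by
  conv_rhs => rw [eq_sum_stdVec (F y)]
  simp only [divg, fderiv_fun_smul hu hF, add_apply, smul_apply,
    ContinuousLinearMap.smulRight_apply, PiLp.add_apply, PiLp.smul_apply, smul_eq_mul, map_add,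
    map_smul]
  ring

lemma divg_congr {F G : E3 → E3} {y : E3} (h : F =ᶠ[𝓝 y] G) : divg F y = divg G y := by
  simp only [divg, h.fderiv_eq]

lemma divg_coord {u v w : E3 → ℝ} {y : E3} (hu : DifferentiableAt ℝ u y)
    (hv : DifferentiableAt ℝ v y) (hw : DifferentiableAt ℝ w y) :
    divg (fun z => u z • stdVec 0 + v z • stdVec 1 + w z • stdVec 2) y =
      fderiv ℝ u y (stdVec 0) + fderiv ℝ v y (stdVec 1) + fderiv ℝ w y (stdVec 2) := by
  have d : ∀ {u : E3 → ℝ} (i : Fin 3), DifferentiableAt ℝ u y →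
      DifferentiableAt ℝ (fun z => u z • stdVec i) y := fun i h => h.smul_const _
  have e : ∀ {u : E3 → ℝ} (i : Fin 3), DifferentiableAt ℝ u y →
      divg (fun z => u z • stdVec i) y = fderiv ℝ u y (stdVec i) := by
    intro u i h
    rw [divg_smul h (differentiableAt_const _)]
    simp [divg]
  rw [divg_add ((d 0 hu).fun_add (d 1 hv)) (d 2 hw), divg_add (d 0 hu) (d 1 hv), e 0 hu, e 1 hv,
    e 2 hw]

/-- The classical identity div(a × b) = b·curl a - a·curl b, with the curl read as the exterior
derivative. -/
lemma divg_crossVec {a b : E3 → E3 →L[ℝ] ℝ} {y : E3} (ha : DifferentiableAt ℝ a y)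
    (hb : DifferentiableAt ℝ b y) :
    divg (fun z => crossVec (a z) (b z)) y = wedgeEd (b y) a y - wedgeEd (a y) b y := by
  have da : ∀ i, DifferentiableAt ℝ (fun z => a z (stdVec i)) y := fun i =>
    ha.clm_apply (differentiableAt_const _)
  have db : ∀ i, DifferentiableAt ℝ (fun z => b z (stdVec i)) y := fun i =>
    hb.clm_apply (differentiableAt_const _)
  have fa : ∀ i v, fderiv ℝ (fun z => a z (stdVec i)) y v = fderiv ℝ a y v (stdVec i) := by
    intro i v
    rw [fderiv_clm_apply ha (differentiableAt_const _)]; simp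
  have fb : ∀ i v, fderiv ℝ (fun z => b z (stdVec i)) y v = fderiv ℝ b y v (stdVec i) := by
    intro i v
    rw [fderiv_clm_apply hb (differentiableAt_const _)]; simp
  have m : ∀ i j, DifferentiableAt ℝ (fun z => a z (stdVec i) * b z (stdVec j)) y :=
    fun i j => (da i).fun_mul (db j)
  have fm : ∀ i j v, fderiv ℝ (fun z => a z (stdVec i) * b z (stdVec j)) y v =
      a y (stdVec i) * fderiv ℝ b y v (stdVec j) + b y (stdVec j) * fderiv ℝ a y v (stdVec i) := by
    intro i j v
    rw [fderiv_fun_mul (da i) (db j)]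
    simp only [add_apply, smul_apply, smul_eq_mul, fa, fb]
  simp only [crossVec]
  rw [divg_coord ((m 1 2).fun_sub (m 2 1)) ((m 2 0).fun_sub (m 0 2)) ((m 0 1).fun_sub (m 1 0)),
    fderiv_fun_sub (m 1 2) (m 2 1), fderiv_fun_sub (m 2 0) (m 0 2), fderiv_fun_sub (m 0 1) (m 1 0)]
  simp only [sub_apply, fm, wedgeEd, ed]
  ring

lemma differentiableAt_crossVec {a b : E3 → E3 →L[ℝ] ℝ} {y : E3} (ha : DifferentiableAt ℝ a y)
    (hb : DifferentiableAt ℝ b y) : DifferentiableAt ℝ (fun z => crossVec (a z) (b z)) y := by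
  have da : ∀ i, DifferentiableAt ℝ (fun z => a z (stdVec i)) y := fun i =>
    ha.clm_apply (differentiableAt_const _)
  have db : ∀ i, DifferentiableAt ℝ (fun z => b z (stdVec i)) y := fun i =>
    hb.clm_apply (differentiableAt_const _)
  have m : ∀ i j k, DifferentiableAt ℝ (fun z => (a z (stdVec i) * b z (stdVec j)
      - a z (stdVec j) * b z (stdVec i)) • stdVec k) y :=
    fun i j k => (((da i).fun_mul (db j)).fun_sub ((da j).fun_mul (db i))).smul_const _
  exact ((m 1 2 0).fun_add (m 2 0 1)).fun_add (m 0 1 2)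

end Divergence

/-- The real part of a complex linear form. -/
def reForm (l : E3 →L[ℝ] ℂ) : E3 →L[ℝ] ℝ := Complex.reCLM.comp l

/-- The imaginary part of a complex linear form. -/
def imForm (l : E3 →L[ℝ] ℂ) : E3 →L[ℝ] ℝ := Complex.imCLM.comp l

@[simp] lemma reForm_apply (l : E3 →L[ℝ] ℂ) (v : E3) : reForm l v = (l v).re := rfl
@[simp] lemma imForm_apply (l : E3 →L[ℝ] ℂ) (v : E3) : imForm l v = (l v).im := rfl

namespace ChartFrame

variable {J : E3 → E3 →L[ℝ] E3} {θ : E3 → E3 →L[ℝ] ℝ} {Ω : Set E3} (f : ChartFrame J θ Ω)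

lemma ed_θ {y : E3} (hy : y ∈ Ω) (v w : E3) : ed θ y v w =
    2 * ((f.ζ y v).re * (f.ζ y w).im - (f.ζ y v).im * (f.ζ y w).re) := by
  rw [(f.dual y hy).ed_expand θ y v w, f.ed_θ_XY hy, f.reeb y hy, f.reeb y hy]
  simp; ring

lemma wedgeStd_eq {y : E3} (hy : y ∈ Ω) : wedgeStd θ y = 2 *
    (θ y (stdVec 0) * ((f.ζ y (stdVec 1)).re * (f.ζ y (stdVec 2)).im
        - (f.ζ y (stdVec 1)).im * (f.ζ y (stdVec 2)).re)
      + θ y (stdVec 1) * ((f.ζ y (stdVec 2)).re * (f.ζ y (stdVec 0)).im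
        - (f.ζ y (stdVec 2)).im * (f.ζ y (stdVec 0)).re)
      + θ y (stdVec 2) * ((f.ζ y (stdVec 0)).re * (f.ζ y (stdVec 1)).im
        - (f.ζ y (stdVec 0)).im * (f.ζ y (stdVec 1)).re)) := by
  simp only [wedgeStd, f.ed_θ hy]; ring

/-- A three-form is determined by its value on one basis. Passing from the standard basis to (X, Y,
T) costs the factor `wedgeStd`/2, since θ∧dθ takes the value 2 on the frame. -/
lemma wedgeEd_eq {y : E3} (hy : y ∈ Ω) (l : E3 →L[ℝ] ℝ) (β : E3 → E3 →L[ℝ] ℝ) :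
    wedgeEd l β y = wedgeStd θ y / 2 * (l (f.X y) * ed β y (f.Y y) (f.T y)
      + l (f.Y y) * ed β y (f.T y) (f.X y) + l (f.T y) * ed β y (f.X y) (f.Y y)) := by
  have h := f.dual y hy
  have e : ∀ v, l v = (f.ζ y v).re * l (f.X y) + (f.ζ y v).im * l (f.Y y)
      + θ y v * l (f.T y) := by
    intro v
    conv_lhs => rw [h.decomp v]
    simp
  rw [f.wedgeStd_eq hy, wedgeEd, e (stdVec 0), e (stdVec 1), e (stdVec 2),
    h.ed_expand β y (stdVec 1), h.ed_expand β y (stdVec 2), h.ed_expand β y (stdVec 0),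
    ed_swap β y (f.Y y) (f.T y)]
  simp only [smul_eq_mul]
  ring

lemma ext_vec {y : E3} (hy : y ∈ Ω) {v w : E3} (h1 : θ y v = θ y w) (h2 : f.ζ y v = f.ζ y w) :
    v = w := by
  rw [← sub_eq_zero]
  apply (f.dual y hy).injective <;> simp [h1, h2]

lemma apply_crossVec (l a b : E3 →L[ℝ] ℝ) : l (crossVec a b) =
    (a (stdVec 1) * b (stdVec 2) - a (stdVec 2) * b (stdVec 1)) * l (stdVec 0)
    + (a (stdVec 2) * b (stdVec 0) - a (stdVec 0) * b (stdVec 2)) * l (stdVec 1)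
    + (a (stdVec 0) * b (stdVec 1) - a (stdVec 1) * b (stdVec 0)) * l (stdVec 2) := by
  simp [crossVec]

/-- θ∧dθ equals 2θ∧Re ζ∧Im ζ, and vectors of a dual basis are cross products of forms divided by the
volume. With this and the analogues for Y and T, the divergence of a frame vector times the density
needs only the exterior derivatives of the coframe, which the structure equations supply. -/
lemma smul_X {y : E3} (hy : y ∈ Ω) :
    wedgeStd θ y • f.X y = (2 : ℝ) • crossVec (imForm (f.ζ y)) (θ y) := by
  have h := f.dual y hy
  refine f.ext_vec hy ?_ (Complex.ext ?_ ?_)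
  · simp [h.θX, apply_crossVec]; ring
  · change reForm (f.ζ y) _ = reForm (f.ζ y) _
    rw [map_smul, map_smul, apply_crossVec, f.wedgeStd_eq hy]
    simp [h.ζX]; ring
  · change imForm (f.ζ y) _ = imForm (f.ζ y) _
    rw [map_smul, map_smul, apply_crossVec, f.wedgeStd_eq hy]
    simp [h.ζX]; ring

lemma smul_Y {y : E3} (hy : y ∈ Ω) :
    wedgeStd θ y • f.Y y = (2 : ℝ) • crossVec (θ y) (reForm (f.ζ y)) := by
  have h := f.dual y hy
  refine f.ext_vec hy ?_ (Complex.ext ?_ ?_)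
  · simp [h.θY, apply_crossVec]; ring
  · change reForm (f.ζ y) _ = reForm (f.ζ y) _
    rw [map_smul, map_smul, apply_crossVec, f.wedgeStd_eq hy]
    simp [h.ζY]; ring
  · change imForm (f.ζ y) _ = imForm (f.ζ y) _
    rw [map_smul, map_smul, apply_crossVec, f.wedgeStd_eq hy]
    simp [h.ζY]; ring

lemma smul_T {y : E3} (hy : y ∈ Ω) :
    wedgeStd θ y • f.T y = (2 : ℝ) • crossVec (reForm (f.ζ y)) (imForm (f.ζ y)) := by
  have h := f.dual y hy
  refine f.ext_vec hy ?_ (Complex.ext ?_ ?_)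
  · rw [map_smul, map_smul, apply_crossVec, f.wedgeStd_eq hy]
    simp [h.θT]; ring
  · change reForm (f.ζ y) _ = reForm (f.ζ y) _
    rw [map_smul, map_smul, apply_crossVec]
    simp [h.ζT]; ring
  · change imForm (f.ζ y) _ = imForm (f.ζ y) _
    rw [map_smul, map_smul, apply_crossVec]
    simp [h.ζT]; ring

/-- The real vector field with `Z_1̄`-component `w` and `T`-component `z` up to conjugation. -/
def realVec (w z : E3 → ℂ) (y : E3) : E3 :=
  (w y).re • f.X y + (-(w y).im) • f.Y y + (2 * (z y).re) • f.T y

lemma smooth_realVec {w z : E3 → ℂ} (hw : ContDiffOn ℝ ∞ w Ω) (hz : ContDiffOn ℝ ∞ z Ω) :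
    ContDiffOn ℝ ∞ (f.realVec w z) Ω :=
  (((Complex.reCLM.contDiff.comp_contDiffOn hw).smul f.smooth_X).add
    ((Complex.imCLM.contDiff.comp_contDiffOn hw).neg.smul f.smooth_Y)).add
    ((contDiffOn_const.mul (Complex.reCLM.contDiff.comp_contDiffOn hz)).smul f.smooth_T)

lemma realVec_dual (w z : E3 → ℂ) {y : E3} (hy : y ∈ Ω) :
    θ y (f.realVec w z y) = 2 * (z y).re ∧ f.ζ y (f.realVec w z y) = conj (w y) := by
  have h := f.dual y hy
  constructor
  · simp [realVec, h.θX, h.θY, h.θT]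
  · apply Complex.ext <;> simp [realVec, h.ζX, h.ζY, h.ζT]

/-- The divergence, with respect to the volume form `θ ∧ dθ`, of a real vector field. -/
lemma divg_realVec {w z : E3 → ℂ} (hw : ContDiffOn ℝ ∞ w Ω) (hz : ContDiffOn ℝ ∞ z Ω) {y : E3}
    (hy : y ∈ Ω) : divg (fun y => wedgeStd θ y • f.realVec w z y) y =
      wedgeStd θ y * (2 * (f.Db 1 w y + f.D0 0 z y).re) := by
  have hζ := f.diffAt f.smooth_ζ hy
  have hθ := f.diffAt f.smooth_θ hy
  have hre : DifferentiableAt ℝ (fun y => reForm (f.ζ y)) y :=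
    (differentiableAt_const (c := (Complex.reCLM : ℂ →L[ℝ] ℝ))).clm_comp hζ
  have him : DifferentiableAt ℝ (fun y => imForm (f.ζ y)) y :=
    (differentiableAt_const (c := (Complex.imCLM : ℂ →L[ℝ] ℝ))).clm_comp hζ
  have edre : ∀ v u, ed (fun y => reForm (f.ζ y)) y v u = (ed f.ζ y v u).re :=
    fun v u => ed_comp Complex.reCLM hζ v u
  have edim : ∀ v u, ed (fun y => imForm (f.ζ y)) y v u = (ed f.ζ y v u).im :=
    fun v u => ed_comp Complex.imCLM hζ v u
  have hw' := f.diffAt hw hy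
  have hz' := f.diffAt hz hy
  have w1 : HasFDerivAt (fun y => 2 * (w y).re) _ y :=
    ((Complex.reCLM.hasFDerivAt.comp y hw'.hasFDerivAt).const_mul 2)
  have w2 : HasFDerivAt (fun y => -2 * (w y).im) _ y :=
    ((Complex.imCLM.hasFDerivAt.comp y hw'.hasFDerivAt).const_mul (-2))
  have z1 : HasFDerivAt (fun y => 4 * (z y).re) _ y :=
    ((Complex.reCLM.hasFDerivAt.comp y hz'.hasFDerivAt).const_mul 4)
  have he : (fun y => wedgeStd θ y • f.realVec w z y) =ᶠ[𝓝 y] fun y =>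
      (2 * (w y).re) • crossVec (imForm (f.ζ y)) (θ y)
        + (-2 * (w y).im) • crossVec (θ y) (reForm (f.ζ y))
        + (4 * (z y).re) • crossVec (reForm (f.ζ y)) (imForm (f.ζ y)) := by
    refine Filter.eventuallyEq_of_mem (f.isOpen.mem_nhds hy) fun x hx => ?_
    have e1 := f.smul_X hx
    have e2 := f.smul_Y hx
    have e3 := f.smul_T hx
    simp only [realVec, smul_add]
    rw [smul_comm _ (w x).re, smul_comm _ (-(w x).im), smul_comm _ (2 * (z x).re), e1, e2, e3]
    module
  have c1 := differentiableAt_crossVec him hθ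
  have c2 := differentiableAt_crossVec hθ hre
  have c3 := differentiableAt_crossVec hre him
  have d := f.dual y hy
  have k1 : fderiv ℝ (fun y => 2 * (w y).re) y (crossVec (imForm (f.ζ y)) (θ y)) =
      wedgeStd θ y * (fderiv ℝ w y (f.X y)).re := by
    have := congrArg (fun v => (fderiv ℝ w y v).re) (f.smul_X hy)
    simp only [map_smul, Complex.smul_re, smul_eq_mul] at this
    rw [w1.fderiv, this]
    rfl
  have k2 : fderiv ℝ (fun y => -2 * (w y).im) y (crossVec (θ y) (reForm (f.ζ y))) =
      - wedgeStd θ y * (fderiv ℝ w y (f.Y y)).im := by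
    have := congrArg (fun v => (fderiv ℝ w y v).im) (f.smul_Y hy)
    simp only [map_smul, Complex.smul_im, smul_eq_mul] at this
    rw [w2.fderiv, neg_mul, this, ← neg_mul]
    rfl
  have k3 : fderiv ℝ (fun y => 4 * (z y).re) y (crossVec (reForm (f.ζ y)) (imForm (f.ζ y))) =
      2 * wedgeStd θ y * (fderiv ℝ z y (f.T y)).re := by
    have := congrArg (fun v => (fderiv ℝ z y v).re) (f.smul_T hy)
    simp only [map_smul, Complex.smul_re, smul_eq_mul] at this
    rw [z1.fderiv, mul_assoc, this, ← mul_assoc, show (2 : ℝ) * 2 = 4 by norm_num]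
    rfl
  rw [divg_congr he, divg_add ((w1.differentiableAt.fun_smul c1).fun_add
      (w2.differentiableAt.fun_smul c2)) (z1.differentiableAt.fun_smul c3),
    divg_add (w1.differentiableAt.fun_smul c1) (w2.differentiableAt.fun_smul c2),
    divg_smul w1.differentiableAt c1, divg_smul w2.differentiableAt c2,
    divg_smul z1.differentiableAt c3, divg_crossVec him hθ, divg_crossVec hθ hre,
    divg_crossVec hre him, k1, k2, k3]
  simp only [f.wedgeEd_eq hy, ed_swap _ y (f.Y y) (f.T y), f.reeb y hy, edre, edim, f.ed_ζ_XY hy,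
    f.ed_ζ_TX hy, f.ed_ζ_TY hy, f.ed_θ_XY hy, d.θX, d.θY, d.θT, reForm_apply, imForm_apply, d.ζX,
    d.ζY, d.ζT]
  have sk : ∀ v, (f.conn y v).re = 0 := by
    intro v
    have := congrArg Complex.re (f.skew y hy v)
    simp at this
    linarith
  simp only [Db, D0, zBar, cov_apply]
  simp [sk]
  ring

end ChartFrame

end CR3

end

/-! ### Frame independence of the integrand and of the boundary field -/

noncomputable section

namespace CR3

namespace ChartFrame

variable {J : E3 → E3 →L[ℝ] E3} {θ : E3 → E3 →L[ℝ] ℝ} {Ω : Set E3}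

/-- `u` and `u'` are the components of weight `k` of one tensor in the frames `f` and `f'`. -/
structure IsComp (_f : ChartFrame J θ Ω) (g : E3 → ℂ) (k : ℤ) (u u' : E3 → ℂ) : Prop where
  smooth : ContDiffOn ℝ ∞ u Ω
  eq : ∀ y ∈ Ω, u' y = g y ^ (-k) * u y

namespace GaugeRel

variable {f f' : ChartFrame J θ Ω} {g : E3 → ℂ} (h : GaugeRel f f' g)
include h

lemma comp_D1 {k : ℤ} {u u' : E3 → ℂ} (hu : IsComp f g k u u') :
    IsComp f g (k + 1) (f.D1 k u) (f'.D1 k u') :=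
  ⟨f.smooth_D1 k hu.smooth, fun _ hy => h.D1_eq hy k hu.smooth hu.eq⟩

lemma comp_Db {k : ℤ} {u u' : E3 → ℂ} (hu : IsComp f g k u u') :
    IsComp f g (k - 1) (f.Db k u) (f'.Db k u') :=
  ⟨f.smooth_Db k hu.smooth, fun _ hy => h.Db_eq hy k hu.smooth hu.eq⟩

lemma comp_D0 {k : ℤ} {u u' : E3 → ℂ} (hu : IsComp f g k u u') :
    IsComp f g k (f.D0 k u) (f'.D0 k u') :=
  ⟨f.smooth_D0 k hu.smooth, fun _ hy => h.D0_eq hy k hu.smooth hu.eq⟩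

lemma comp_mul {k l : ℤ} {u u' v v' : E3 → ℂ} (hu : IsComp f g k u u') (hv : IsComp f g l v v') :
    IsComp f g (k + l) (fun y => u y * v y) (fun y => u' y * v' y) := by
  refine ⟨hu.smooth.mul hv.smooth, fun y hy => ?_⟩
  rw [hu.eq y hy, hv.eq y hy, neg_add, zpow_add₀ (h.ne_zero hy)]
  ring

lemma comp_Rc : IsComp f g 0 f.Rc f'.Rc := ⟨f.smooth_Rc, fun y hy => by simp [h.Rc_eq hy]⟩

lemma comp_Abar : IsComp f g (-2) f.Abar f'.Abar :=
  ⟨f.smooth_Abar, fun y hy => by rw [(h.conn_Abar hy).2]; norm_cast⟩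

lemma comp_conj {k : ℤ} {u u' : E3 → ℂ} (hu : IsComp f g k u u') :
    IsComp f g (-k) (fun y => conj (u y)) (fun y => conj (u' y)) :=
  ⟨contDiffOn_conj hu.smooth, fun y hy => by
    rw [hu.eq y hy, map_mul, map_zpow₀, h.conj_eq hy]; simp⟩

lemma comp_A : IsComp f g 2 f.A f'.A := by
  have := h.comp_conj h.comp_Abar
  simpa [Abar] using this

/-- Each term of `gradJ` has weight -2 and E₁₁ has weight 2, so the powers of g cancel in the
product. -/
lemma gradJ_mul_eq {e e' : E3 → ℂ} (he : IsComp f g 2 e e') {y : E3} (hy : y ∈ Ω) :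
    f'.gradJ y * e' y = f.gradJ y * e y := by
  have h0 := h.ne_zero hy
  have e1 := (h.comp_Db (h.comp_Db h.comp_Rc)).eq y hy
  have e2 := h.comp_Rc.eq y hy
  have e3 := h.comp_Abar.eq y hy
  have e4 := (h.comp_D0 h.comp_Abar).eq y hy
  norm_num at e1 e2 e3 e4
  rw [gradJ, gradJ, e1, e2, e3, e4, he.eq y hy, zpow_neg]
  have : (g y ^ 2) * (g y ^ (2 : ℤ))⁻¹ = 1 := mul_inv_cancel₀ (pow_ne_zero _ h0)
  linear_combination ((2 * Complex.I * f.Db (-1) (f.Db 0 f.Rc) y - 2 * f.Rc y * f.Abar y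
    + Complex.I * f.D0 (-2) f.Abar y) * e y) * this

lemma gradθ_eq {y : E3} (hy : y ∈ Ω) : f'.gradθ y = f.gradθ y := by
  have e1 := (h.comp_Db (h.comp_D1 h.comp_Rc)).eq y hy
  have e2 := (h.comp_Db (h.comp_Db h.comp_A)).eq y hy
  norm_num at e1 e2
  rw [gradθ, gradθ, e1, e2]

/-- A vector is determined by its values under θ and ζ. These are 2 Re z and w̄, and the factor g⁻¹
in w matches ζ' = gζ. -/
lemma realVec_eq {w w' z z' : E3 → ℂ} {y : E3} (hy : y ∈ Ω) (hw : w' y = g y ^ (-1 : ℤ) * w y)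
    (hz : z' y = z y) : f'.realVec w' z' y = f.realVec w z y := by
  obtain ⟨h1, h2⟩ := f.realVec_dual w z hy
  obtain ⟨h3, h4⟩ := f'.realVec_dual w' z' hy
  refine f.ext_vec hy (by rw [h1, h3, hz]) ?_
  rw [h.ζ_eq y hy, smul_apply, smul_eq_mul, hw, map_mul, zpow_neg_one, map_inv₀, h.conj_eq hy,
    inv_inv] at h4
  rw [h2]
  exact mul_left_cancel₀ (h.ne_zero hy) h4

/-- Every summand of the boundary term has weight 1. Together with weight 0 of its Reeb part, this
lets the local boundary fields glue to a global vector field. -/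
lemma bdryW_eq {e e' hc : E3 → ℂ} (he : IsComp f g 2 e e') (hh : ContDiffOn ℝ ∞ hc Ω) {y : E3}
    (hy : y ∈ Ω) : f'.bdryW e' hc y = g y ^ (-1 : ℤ) * f.bdryW e hc y := by
  have hc' : IsComp f g 0 hc hc := ⟨hh, fun y _ => by simp⟩
  have e1 := (h.comp_mul h.comp_Rc (h.comp_Db he)).eq y hy
  have e2 := (h.comp_mul (h.comp_Db h.comp_Rc) he).eq y hy
  have e3 := (h.comp_mul h.comp_Rc (h.comp_D1 hc')).eq y hy
  have e4 := (h.comp_mul hc' (h.comp_D1 h.comp_Rc)).eq y hy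
  have e5 := (h.comp_mul (h.comp_Db hc') h.comp_A).eq y hy
  have e6 := (h.comp_mul hc' (h.comp_Db h.comp_A)).eq y hy
  norm_num only at e1 e2 e3 e4 e5 e6
  rw [bdryW, bdryW, e1, e2, e3, e4, e5, e6]
  ring

lemma bdryZ_eq {e e' : E3 → ℂ} (he : IsComp f g 2 e e') {y : E3} (hy : y ∈ Ω) :
    f'.bdryZ e' y = f.bdryZ e y := by
  have e1 := (h.comp_mul he h.comp_Abar).eq y hy
  norm_num at e1
  rw [bdryZ, bdryZ, e1]

/-- The component `E₁₁` of an endomorphism has weight two. -/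
lemma comp_end {E : E3 → E3 →L[ℝ] E3} {y : E3} (hy : y ∈ Ω) :
    (1 / 2) * (conj (f'.ζ y (E y (f'.X y))) - Complex.I * conj (f'.ζ y (E y (f'.Y y)))) =
      g y ^ (-2 : ℤ) *
        ((1 / 2) * (conj (f.ζ y (E y (f.X y))) - Complex.I * conj (f.ζ y (E y (f.Y y))))) := by
  have e := h.zOne_eq hy (conjForm ((f.ζ y).comp (E y)))
  simp only [zOne, conjForm_apply, ContinuousLinearMap.comp_apply] at e
  rw [h.ζ_eq y hy]
  simp only [smul_apply, smul_eq_mul, map_mul, h.conj_eq hy] at e ⊢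
  rw [show (-2 : ℤ) = -1 + -1 from rfl, zpow_add₀ (h.ne_zero hy), zpow_neg_one]
  linear_combination (g y)⁻¹ * e

end GaugeRel

end ChartFrame

/-- The integral of the divergence of a compactly supported vector field vanishes. -/
lemma integral_divg_eq_zero {F : E3 → E3} (hF : ContDiff ℝ 1 F) (hc : HasCompactSupport F) :
    ∫ y, divg F y = 0 := by
  have hd : Differentiable ℝ F := hF.differentiable (by simp)
  have hcont : ∀ i, Continuous fun y => fderiv ℝ F y (stdVec i) i := fun i => by
    have h1 : Continuous fun y => fderiv ℝ F y (stdVec i) :=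
      (hF.continuous_fderiv (by simp)).clm_apply continuous_const
    fun_prop
  have hsupp : ∀ i, HasCompactSupport fun y => fderiv ℝ F y (stdVec i) i := fun i =>
    (hc.fderiv (𝕜 := ℝ)).comp_left
      (g := fun L : E3 →L[ℝ] E3 => L (stdVec i) i) (by simp)
  have hint : ∀ i, Integrable fun y => fderiv ℝ F y (stdVec i) i := fun i =>
    (hcont i).integrable_of_hasCompactSupport (hsupp i)
  have hz : ∀ i, ∫ y, fderiv ℝ F y (stdVec i) i = 0 := by
    intro i
    have hFi : ContDiff ℝ 1 fun y => F y i := by fun_prop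
    have hFc : HasCompactSupport fun y => F y i := hc.comp_left (g := fun v : E3 => v i) (by simp)
    have he : ∀ y v, fderiv ℝ (fun y => F y i) y v = fderiv ℝ F y v i := by
      intro y v
      have := ((EuclideanSpace.proj (𝕜 := ℝ) i).hasFDerivAt.comp y (hd y).hasFDerivAt).fderiv
      exact DFunLike.congr_fun this v
    -- Integration by parts against the constant function 1.
    have key := integral_mul_fderiv_eq_neg_fderiv_mul_of_integrable (μ := (volume : Measure E3))
      (f := fun _ => (1 : ℝ)) (g := fun y => F y i) (v := stdVec i) (by simp)
      (by simpa [he] using hint i)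
      (by simpa using hFi.continuous.integrable_of_hasCompactSupport hFc)
      (fun y _ => differentiableAt_const _) (fun y _ => hFi.differentiable (by simp) y)
    simpa [he] using key
  simp only [divg]
  have h1 := integral_add ((hint 0).add (hint 1)) (hint 2)
  simp only [Pi.add_apply] at h1
  rw [h1, integral_add (hint 0) (hint 1), hz, hz, hz]
  simp

end CR3

end

/-! ### Transfer of frames between the manifold and its charts -/

noncomputable section

namespace CR3

variable {M : Type*} [TopologicalSpace M] [ChartedSpace E3 M] [IsManifold (𝓡 3) ∞ M]

lemma dChart_injective {x : M} {y : E3} (hy : y ∈ (extChartAt (𝓡 3) x).target) :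
    Function.Injective (dChart x ((extChartAt (𝓡 3) x).symm y)) :=
  Function.LeftInverse.injective fun v => dChartSymm_dChart hy v

lemma chartEnd_dChart (J : EndField M) {x : M} {y : E3} (hy : y ∈ (extChartAt (𝓡 3) x).target)
    (v : TangentSpace (𝓡 3) ((extChartAt (𝓡 3) x).symm y)) :
    chartEnd J x y (dChart x _ v) = dChart x _ (J ((extChartAt (𝓡 3) x).symm y) v) := by
  simp only [chartEnd, ContinuousLinearMap.comp_apply, dChartSymm_dChart hy]

lemma chartEnd_apply (J : EndField M) (x : M) (y w : E3) :
    chartEnd J x y w = dChart x _ (J ((extChartAt (𝓡 3) x).symm y) (dChartSymm x y w)) := rfl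

lemma extD_symm {F : Type*} [NormedAddCommGroup F] [NormedSpace ℝ F] (α : OneForm M F) {x : M}
    {y : E3} (hy : y ∈ (extChartAt (𝓡 3) x).target)
    (hα : DifferentiableAt ℝ (chartForm α x) y)
    (v w : TangentSpace (𝓡 3) ((extChartAt (𝓡 3) x).symm y)) :
    extD α _ v w = ed (chartForm α x) y (dChart x _ v) (dChart x _ w) := by
  have h := (extChartAt (𝓡 3) x).right_inv hy
  rw [extD_eq_ed α ((extChartAt (𝓡 3) x).map_target hy) (by rwa [h]), h]

lemma ed_chartForm {F : Type*} [NormedAddCommGroup F] [NormedSpace ℝ F] (α : OneForm M F) {x : M}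
    {y : E3} (hy : y ∈ (extChartAt (𝓡 3) x).target)
    (hα : DifferentiableAt ℝ (chartForm α x) y) (v w : E3) :
    ed (chartForm α x) y v w = extD α _ (dChartSymm x y v) (dChartSymm x y w) := by
  rw [extD_symm α hy hα, dChart_dChartSymm hy, dChart_dChartSymm hy]

lemma differentiableAt_chartForm {F : Type*} [NormedAddCommGroup F] [NormedSpace ℝ F]
    {α : OneForm M F} {U : Set M} (h : SmoothOneForm α U) (hU : IsOpen U) {x : M} {y : E3}
    (hy : y ∈ chartSet x U) : DifferentiableAt ℝ (chartForm α x) y :=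
  diffAt_of_contDiffOn (h.contDiffOn x) (isOpen_chartSet x hU) hy

namespace UnitaryFrame

variable {J : EndField M} {θ : OneForm M ℝ} {U : Set M} (f : UnitaryFrame J θ U)

/-- The expression of a unitary frame in the chart around `x`. -/
def toChart (hP : IsPseudohermitian J θ) (x : M) :
    ChartFrame (chartEnd J x) (chartForm θ x) (chartSet x U) where
  X := chartVec f.X x
  Y := chartVec f.Y x
  T := chartVec f.T x
  ζ := chartForm f.θ1 x
  conn := chartForm f.conn x
  A := f.A ∘ (extChartAt (𝓡 3) x).symm
  R := f.R ∘ (extChartAt (𝓡 3) x).symm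
  isOpen := isOpen_chartSet x f.isOpen
  smooth_θ := (hP.smooth_form.contDiffOn x).mono fun _ hy => ⟨hy.1, trivial⟩
  smooth_X := f.smooth_X.contDiffOn x
  smooth_Y := f.smooth_Y.contDiffOn x
  smooth_T := f.smooth_T.contDiffOn x
  smooth_ζ := f.smooth_θ1.contDiffOn x
  smooth_conn := f.smooth_conn.contDiffOn x
  dual y hy :=
    { θX := by rw [chartVec, chartForm_dChart _ hy.1]; exact f.X_mem _ hy.2
      θY := by
        rw [chartVec, chartForm_dChart _ hy.1]
        rw [f.Y_eq _ hy.2]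
        exact hP.map_ker _ _ (f.X_mem _ hy.2)
      θT := by rw [chartVec, chartForm_dChart _ hy.1]; exact (f.reeb _ hy.2).1
      ζX := by rw [chartVec, chartForm_dChart _ hy.1]; exact f.θ1_X _ hy.2
      ζY := by rw [chartVec, chartForm_dChart _ hy.1]; exact f.θ1_Y _ hy.2
      ζT := by rw [chartVec, chartForm_dChart _ hy.1]; exact f.θ1_T _ hy.2 }
  reeb y hy v := by
    rw [chartVec, ← dChart_dChartSymm hy.1 v, ← extD_symm θ hy.1
      (differentiableAt_chartForm hP.smooth_form isOpen_univ ⟨hy.1, trivial⟩)]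
    exact (f.reeb _ hy.2).2 _
  Y_eq y hy := by
    rw [chartVec, chartVec, chartEnd_dChart _ hy.1, f.Y_eq _ hy.2]
  unitary y hy v w := by
    rw [ed_chartForm θ hy.1 (differentiableAt_chartForm hP.smooth_form isOpen_univ ⟨hy.1, trivial⟩)]
    exact f.unitary _ hy.2 _ _
  structure_eq y hy v w := by
    rw [ed_chartForm _ hy.1 (differentiableAt_chartForm f.smooth_θ1 f.isOpen hy)]
    exact f.structure_eq _ hy.2 _ _
  skew y hy v := f.skew _ hy.2 _
  curvature y hy v w hv hw := by
    rw [ed_chartForm _ hy.1 (differentiableAt_chartForm f.smooth_conn f.isOpen hy)]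
    exact f.curvature _ hy.2 _ _ hv hw

variable (hP : IsPseudohermitian J θ) (x : M)

lemma D1_symm (k : ℤ) (u : M → ℂ) {y : E3} (hy : y ∈ chartSet x U) :
    f.D1 k u ((extChartAt (𝓡 3) x).symm y) =
      (f.toChart hP x).D1 k (u ∘ (extChartAt (𝓡 3) x).symm) y := by
  have h := (extChartAt (𝓡 3) x).right_inv hy.1
  have hs := (extChartAt (𝓡 3) x).map_target hy.1
  simp only [D1, dir_eq_fderiv u hs, h, ChartFrame.D1, zOne, ChartFrame.cov_apply, toChart]
  simp only [chartVec, chartForm_dChart _ hy.1, Function.comp_apply]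
  ring

lemma D1bar_symm (k : ℤ) (u : M → ℂ) {y : E3} (hy : y ∈ chartSet x U) :
    f.D1bar k u ((extChartAt (𝓡 3) x).symm y) =
      (f.toChart hP x).Db k (u ∘ (extChartAt (𝓡 3) x).symm) y := by
  have h := (extChartAt (𝓡 3) x).right_inv hy.1
  have hs := (extChartAt (𝓡 3) x).map_target hy.1
  simp only [D1bar, dir_eq_fderiv u hs, h, ChartFrame.Db, zBar, ChartFrame.cov_apply, toChart]
  simp only [chartVec, chartForm_dChart _ hy.1, Function.comp_apply]
  ring

lemma D0_symm (k : ℤ) (u : M → ℂ) {y : E3} (hy : y ∈ chartSet x U) :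
    f.D0 k u ((extChartAt (𝓡 3) x).symm y) =
      (f.toChart hP x).D0 k (u ∘ (extChartAt (𝓡 3) x).symm) y := by
  have h := (extChartAt (𝓡 3) x).right_inv hy.1
  have hs := (extChartAt (𝓡 3) x).map_target hy.1
  simp only [D0, dir_eq_fderiv u hs, h, ChartFrame.D0, ChartFrame.cov_apply, toChart]
  simp only [chartVec, chartForm_dChart _ hy.1, Function.comp_apply]
  ring

lemma E11_symm (E : EndField M) {y : E3} (hy : y ∈ chartSet x U) :
    f.E11 E ((extChartAt (𝓡 3) x).symm y) = (1 / 2) *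
      (conj ((f.toChart hP x).ζ y (chartEnd E x y ((f.toChart hP x).X y)))
        - Complex.I * conj ((f.toChart hP x).ζ y (chartEnd E x y ((f.toChart hP x).Y y)))) := by
  simp only [E11, toChart, chartVec, chartEnd_dChart _ hy.1, chartForm_dChart _ hy.1]

/-- The same frame for a structure with the same restriction of `J` to the contact bundle. -/
def congrJ {J' : EndField M} (h : ∀ p v, θ p v = 0 → J' p v = J p v) : UnitaryFrame J' θ U :=
  { f with Y_eq := fun p hp => by rw [f.Y_eq p hp, h _ _ (f.X_mem p hp)] }

end UnitaryFrame

namespace ChartFrame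

variable {J : EndField M} {θ : OneForm M ℝ} {x : M} {Ω : Set E3}

/-- The part of the chart domain corresponding to `Ω`. -/
def _root_.CR3.chartPre (x : M) (Ω : Set E3) : Set M :=
  (extChartAt (𝓡 3) x).source ∩ extChartAt (𝓡 3) x ⁻¹' Ω

lemma chartPre_eq {p : M} (hp : p ∈ chartPre x Ω) : ∃ y ∈ (extChartAt (𝓡 3) x).target ∩ Ω,
    (extChartAt (𝓡 3) x).symm y = p ∧ extChartAt (𝓡 3) x p = y :=
  ⟨_, ⟨(extChartAt (𝓡 3) x).map_source hp.1, hp.2⟩, (extChartAt (𝓡 3) x).left_inv hp.1, rfl⟩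

lemma chartSet_chartPre : chartSet x (chartPre x Ω) = (extChartAt (𝓡 3) x).target ∩ Ω := by
  ext y
  constructor
  · rintro ⟨h1, -, h2⟩
    exact ⟨h1, by rwa [mem_preimage, (extChartAt (𝓡 3) x).right_inv h1] at h2⟩
  · rintro ⟨h1, h2⟩
    exact ⟨h1, (extChartAt (𝓡 3) x).map_target h1,
      by rwa [mem_preimage, (extChartAt (𝓡 3) x).right_inv h1]⟩

/-- The vector field on `M` with a given expression in the chart around `x`. -/
def _root_.CR3.vecOfChart (x : M) (X : E3 → E3) : VField M := fun p =>
  (dChartSymm x (extChartAt (𝓡 3) x p) (X (extChartAt (𝓡 3) x p)) : E3)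

/-- The form on `M` with a given expression in the chart around `x`. -/
def _root_.CR3.formOfChart {F : Type*} [NormedAddCommGroup F] [NormedSpace ℝ F] (x : M)
    (α : E3 → E3 →L[ℝ] F) : OneForm M F := fun p => (α (extChartAt (𝓡 3) x p)).comp (dChart x p)

omit [IsManifold (𝓡 3) ∞ M] in
lemma _root_.CR3.vecOfChart_symm {X : E3 → E3} {y : E3} (hy : y ∈ (extChartAt (𝓡 3) x).target) :
    vecOfChart x X ((extChartAt (𝓡 3) x).symm y) = dChartSymm x y (X y) := by
  have h := (extChartAt (𝓡 3) x).right_inv hy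
  -- The tangent space depends on the base point, so the two vectors are compared as elements of
  -- `E3` before the points are identified.
  have : ∀ z, z = y → (dChartSymm x z (X z) : E3) = (dChartSymm x y (X y) : E3) := by
    rintro z rfl; rfl
  exact this _ h

lemma _root_.CR3.chartVec_vecOfChart {X : E3 → E3} {y : E3}
    (hy : y ∈ (extChartAt (𝓡 3) x).target) : chartVec (vecOfChart x X) x y = X y := by
  rw [chartVec, vecOfChart_symm hy, dChart_dChartSymm hy]

omit [IsManifold (𝓡 3) ∞ M] in
lemma _root_.CR3.formOfChart_symm {F : Type*} [NormedAddCommGroup F] [NormedSpace ℝ F]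
    {α : E3 → E3 →L[ℝ] F} {y : E3} (hy : y ∈ (extChartAt (𝓡 3) x).target) (v) :
    formOfChart x α ((extChartAt (𝓡 3) x).symm y) v = α y (dChart x _ v) := by
  simp only [formOfChart, ContinuousLinearMap.comp_apply]
  rw [(extChartAt (𝓡 3) x).right_inv hy]

lemma _root_.CR3.chartForm_formOfChart {F : Type*} [NormedAddCommGroup F] [NormedSpace ℝ F]
    {α : E3 → E3 →L[ℝ] F} {y : E3} (hy : y ∈ (extChartAt (𝓡 3) x).target) :
    chartForm (formOfChart x α) x y = α y := by
  ext w
  rw [chartForm_apply, formOfChart_symm hy, dChart_dChartSymm hy]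

lemma _root_.CR3.isOpen_chartPre (x : M) (hΩ : IsOpen Ω) : IsOpen (chartPre x Ω) :=
  (continuousOn_extChartAt x).isOpen_inter_preimage (isOpen_extChartAt_source x) hΩ

lemma _root_.CR3.smooth_vecOfChart {X : E3 → E3} (hX : ContDiffOn ℝ ∞ X Ω) :
    SmoothVField (vecOfChart x X) (chartPre x Ω) := by
  rw [smoothVField_iff (x := x) (U := chartPre x Ω) inter_subset_left, chartSet_chartPre]
  exact (hX.mono inter_subset_right).congr fun y hy => chartVec_vecOfChart hy.1

lemma _root_.CR3.smooth_formOfChart {F : Type*} [NormedAddCommGroup F] [NormedSpace ℝ F]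
    {α : E3 → E3 →L[ℝ] F} (hα : ContDiffOn ℝ ∞ α Ω) :
    SmoothOneForm (formOfChart x α) (chartPre x Ω) := by
  rw [smoothOneForm_iff (x := x) (U := chartPre x Ω) inter_subset_left, chartSet_chartPre]
  exact (hα.mono inter_subset_right).congr fun y hy => chartForm_formOfChart hy.1

lemma _root_.CR3.extD_formOfChart {F : Type*} [NormedAddCommGroup F] [NormedSpace ℝ F]
    {α : E3 → E3 →L[ℝ] F} (hα : ContDiffOn ℝ ∞ α Ω) (hΩ : IsOpen Ω) {y : E3}
    (hy : y ∈ (extChartAt (𝓡 3) x).target) (hy' : y ∈ Ω) (v w) :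
    extD (formOfChart x α) ((extChartAt (𝓡 3) x).symm y) v w =
      ed α y (dChart x _ v) (dChart x _ w) := by
  have he : chartForm (formOfChart x α) x =ᶠ[𝓝 y] α :=
    Filter.eventuallyEq_of_mem (target_mem_nhds x hy) fun z hz => chartForm_formOfChart hz
  rw [extD_symm _ hy ((diffAt_of_contDiffOn hα hΩ hy').congr_of_eventuallyEq he), ed_congr he]

/-- The unitary frame on the manifold defined by a unitary frame in the chart around `x`. -/
def toUnitary (f : ChartFrame (chartEnd J x) (chartForm θ x) Ω) : UnitaryFrame J θ (chartPre x Ω) where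
  X := vecOfChart x f.X
  Y := vecOfChart x f.Y
  T := vecOfChart x f.T
  θ1 := formOfChart x f.ζ
  conn := formOfChart x f.conn
  A := f.A ∘ extChartAt (𝓡 3) x
  R := f.R ∘ extChartAt (𝓡 3) x
  isOpen := isOpen_chartPre x f.isOpen
  smooth_X := smooth_vecOfChart f.smooth_X
  smooth_Y := smooth_vecOfChart f.smooth_Y
  smooth_T := smooth_vecOfChart f.smooth_T
  smooth_θ1 := smooth_formOfChart f.smooth_ζ
  smooth_conn := smooth_formOfChart f.smooth_conn
  reeb p hp := by
    obtain ⟨y, hy, rfl, -⟩ := chartPre_eq hp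
    rw [vecOfChart_symm hy.1, ← chartForm_apply]
    refine ⟨(f.dual y hy.2).θT, fun v => ?_⟩
    rw [extD_symm _ hy.1 (f.diffAt f.smooth_θ hy.2), dChart_dChartSymm hy.1]
    exact f.reeb y hy.2 _
  X_mem p hp := by
    obtain ⟨y, hy, rfl, -⟩ := chartPre_eq hp
    rw [vecOfChart_symm hy.1, ← chartForm_apply]
    exact (f.dual y hy.2).θX
  Y_eq p hp := by
    obtain ⟨y, hy, rfl, -⟩ := chartPre_eq hp
    rw [vecOfChart_symm hy.1, vecOfChart_symm hy.1]
    apply dChart_injective hy.1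
    rw [dChart_dChartSymm hy.1, ← chartEnd_apply, f.Y_eq y hy.2]
  θ1_X p hp := by
    obtain ⟨y, hy, rfl, -⟩ := chartPre_eq hp
    rw [vecOfChart_symm hy.1, formOfChart_symm hy.1, dChart_dChartSymm hy.1, (f.dual y hy.2).ζX]
  θ1_Y p hp := by
    obtain ⟨y, hy, rfl, -⟩ := chartPre_eq hp
    rw [vecOfChart_symm hy.1, formOfChart_symm hy.1, dChart_dChartSymm hy.1, (f.dual y hy.2).ζY]
  θ1_T p hp := by
    obtain ⟨y, hy, rfl, -⟩ := chartPre_eq hp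
    rw [vecOfChart_symm hy.1, formOfChart_symm hy.1, dChart_dChartSymm hy.1, (f.dual y hy.2).ζT]
  unitary p hp v w := by
    obtain ⟨y, hy, rfl, -⟩ := chartPre_eq hp
    rw [extD_symm _ hy.1 (f.diffAt f.smooth_θ hy.2), formOfChart_symm hy.1, formOfChart_symm hy.1]
    exact f.unitary y hy.2 _ _
  structure_eq p hp v w := by
    obtain ⟨y, hy, rfl, h⟩ := chartPre_eq hp
    rw [extD_formOfChart f.smooth_ζ f.isOpen hy.1 hy.2, f.structure_eq y hy.2]
    simp only [formOfChart_symm hy.1, chartForm_dChart _ hy.1, Function.comp_apply, h]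
  skew p hp v := by
    obtain ⟨y, hy, rfl, h⟩ := chartPre_eq hp
    rw [formOfChart_symm hy.1]
    exact f.skew y hy.2 _
  curvature p hp v w hv hw := by
    obtain ⟨y, hy, rfl, h⟩ := chartPre_eq hp
    rw [extD_formOfChart f.smooth_conn f.isOpen hy.1 hy.2, f.curvature y hy.2 _ _
      (by rwa [chartForm_dChart _ hy.1]) (by rwa [chartForm_dChart _ hy.1])]
    simp only [formOfChart_symm hy.1, Function.comp_apply, h]

end ChartFrame

end CR3

end

/-! ### The volume measure of a contact form -/

noncomputable section

namespace CR3

/-- A supremum of compatible measures on a countable cover restricts to each of them. -/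
lemma iSup_measure_apply {α ι : Type*} [MeasurableSpace α] {m : ι → Measure α} {S : ι → Set α}
    (hS : ∀ i, MeasurableSet (S i)) (hsupp : ∀ i, m i (S i)ᶜ = 0)
    (hcompat : ∀ i j A, MeasurableSet A → A ⊆ S i → A ⊆ S j → m i A = m j A)
    {s : ℕ → ι} (hs : ⋃ n, S (s n) = univ) (i : ι) {A : Set α} (hA : MeasurableSet A)
    (hAi : A ⊆ S i) : (⨆ j, m j) A = m i A := by
  refine le_antisymm ?_ (le_iSup m i A)
  -- The index `i` is put in front of the cover so that the first set of the disjointification is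
  -- the whole of `S i`.
  let s' : ℕ → ι := fun n => Nat.casesOn n i s
  let D : ℕ → Set α := disjointed fun n => S (s' n)
  have hDm : ∀ n, MeasurableSet (D n) := fun n => MeasurableSet.disjointed (fun n => hS _) n
  have hDd : Pairwise (Function.onFun Disjoint D) := disjoint_disjointed _
  have hDu : ⋃ n, D n = univ := by
    rw [iUnion_disjointed, ← univ_subset_iff, ← hs]
    exact iUnion_subset fun n => subset_iUnion (fun n => S (s' n)) (n + 1)
  have hDs : ∀ n, D n ⊆ S (s' n) := fun n => disjointed_subset _ n
  -- The measures glued along a disjoint partition. By compatibility this dominates every `m j`,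
  -- hence the supremum, and on subsets of `S i` it only sees the first piece.
  let ν : Measure α := Measure.sum fun n => (m (s' n)).restrict (D n)
  have hle : ⨆ j, m j ≤ ν := by
    refine iSup_le fun j => Measure.le_iff.2 fun B hB => ?_
    have h1 : m j B = ∑' n, m j (B ∩ D n) := by
      rw [← measure_iUnion (fun a b hab => (hDd hab).mono inter_subset_right inter_subset_right)
        fun n => hB.inter (hDm n), ← inter_iUnion, hDu, inter_univ]
    rw [h1, Measure.sum_apply _ hB]
    refine ENNReal.tsum_le_tsum fun n => ?_
    rw [Measure.restrict_apply hB]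
    have h2 : m j (B ∩ D n) = m j (B ∩ D n ∩ S j) := by
      refine le_antisymm ?_ (measure_mono inter_subset_left)
      refine (measure_le_inter_add_diff _ _ (S j)).trans ?_
      rw [measure_mono_null (fun x hx => hx.2 : (B ∩ D n) \ S j ⊆ (S j)ᶜ) (hsupp j), add_zero]
    rw [h2, hcompat j (s' n) _ ((hB.inter (hDm n)).inter (hS j)) inter_subset_right
      fun x hx => hDs n hx.1.2]
    exact measure_mono inter_subset_left
  refine (hle A).trans ?_
  rw [Measure.sum_apply _ hA, tsum_eq_single 0]
  · exact (Measure.restrict_apply_le _ _)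
  · intro n hn
    rw [Measure.restrict_apply hA]
    have : A ∩ D n = ∅ := by
      have h0 : D 0 = S i := disjointed_zero _
      refine (disjoint_iff_inter_eq_empty.1 ?_)
      exact (hDd hn.symm).mono_left (h0 ▸ hAi)
    rw [this, measure_empty]

section Determinant

/-- The standard basis of `E3`. -/
def stdBasis : Module.Basis (Fin 3) ℝ E3 := (EuclideanSpace.basisFun (Fin 3) ℝ).toBasis

lemma stdBasis_apply (i : Fin 3) : stdBasis i = stdVec i := by
  simp [stdBasis, stdVec]

lemma stdBasis_det (v : Fin 3 → E3) : stdBasis.det v =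
    v 0 0 * (v 1 1 * v 2 2 - v 1 2 * v 2 1) + v 0 1 * (v 1 2 * v 2 0 - v 1 0 * v 2 2)
      + v 0 2 * (v 1 0 * v 2 1 - v 1 1 * v 2 0) := by
  rw [Module.Basis.det_apply, Matrix.det_fin_three]
  simp only [Module.Basis.toMatrix_apply, stdBasis, OrthonormalBasis.coe_toBasis_repr_apply,
    EuclideanSpace.basisFun_repr]
  ring

/-- The value of `θ ∧ dθ` on three vectors. -/
lemma wedge_eq_det (θ : E3 → E3 →L[ℝ] ℝ) (y u v w : E3) :
    θ y u * ed θ y v w + θ y v * ed θ y w u + θ y w * ed θ y u v =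
      wedgeStd θ y * stdBasis.det ![u, v, w] := by
  rw [stdBasis_det]
  conv_lhs => rw [eq_sum_stdVec u, eq_sum_stdVec v, eq_sum_stdVec w]
  simp only [ed_add_left, ed_add_right, ed_smul_left, ed_smul_right, ed_self, map_add, map_smul,
    smul_eq_mul, wedgeStd, Matrix.cons_val]
  rw [ed_swap θ y (stdVec 1) (stdVec 0), ed_swap θ y (stdVec 2) (stdVec 1),
    ed_swap θ y (stdVec 0) (stdVec 2)]
  ring

/-- θ∧dθ is of top degree and d commutes with pull-back, so the coefficient is multiplied by the
Jacobian determinant. -/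
lemma wedgeStd_pullback {β : E3 → E3 →L[ℝ] ℝ} {τ : E3 → E3} {y : E3}
    (hτ : ContDiffAt ℝ 2 τ y) (hβ : DifferentiableAt ℝ β (τ y)) :
    wedgeStd (fun z => (β (τ z)).comp (fderiv ℝ τ z)) y =
      wedgeStd β (τ y) * (fderiv ℝ τ y).det := by
  have h1 : (fderiv ℝ τ y).det = stdBasis.det ![fderiv ℝ τ y (stdVec 0), fderiv ℝ τ y (stdVec 1),
      fderiv ℝ τ y (stdVec 2)] := by
    have h2 := stdBasis.det_comp (fderiv ℝ τ y : E3 →ₗ[ℝ] E3) stdBasis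
    rw [stdBasis.det_self, mul_one] at h2
    rw [ContinuousLinearMap.det, ← h2]
    congr 1
    ext i
    fin_cases i <;> simp [stdBasis_apply]
  rw [h1, ← wedge_eq_det, wedgeStd, ed_pullback hτ hβ, ed_pullback hτ hβ, ed_pullback hτ hβ]
  rfl

lemma wedgeStd_congr {α β : E3 → E3 →L[ℝ] ℝ} {y : E3} (h : α =ᶠ[𝓝 y] β) :
    wedgeStd α y = wedgeStd β y := by
  simp only [wedgeStd, ed_congr h, h.self_of_nhds]

/-- The term θ∧du∧θ of (uθ)∧d(uθ) vanishes, which leaves the factor u². -/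
lemma wedgeStd_smul {θ : E3 → E3 →L[ℝ] ℝ} {u : E3 → ℝ} {y : E3} (hu : DifferentiableAt ℝ u y)
    (hθ : DifferentiableAt ℝ θ y) :
    wedgeStd (fun z => u z • θ z) y = u y ^ 2 * wedgeStd θ y := by
  have h : ∀ v w, ed (fun z => u z • θ z) y v w =
      fderiv ℝ u y v * θ y w - fderiv ℝ u y w * θ y v + u y * ed θ y v w := by
    intro v w
    rw [ed, fderiv_fun_smul hu hθ]
    simp only [ed, add_apply, smul_apply, ContinuousLinearMap.smulRight_apply, smul_eq_mul]
    ring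
  simp only [wedgeStd, h, smul_apply, smul_eq_mul]
  ring

end Determinant

section Volume

variable {M : Type*} [TopologicalSpace M] [ChartedSpace E3 M] [IsManifold (𝓡 3) ∞ M]

lemma contDiffOn_wedgeStd {θ : E3 → E3 →L[ℝ] ℝ} {Ω : Set E3} (hΩ : IsOpen Ω)
    (h : ContDiffOn ℝ ∞ θ Ω) : ContDiffOn ℝ ∞ (wedgeStd θ) Ω := by
  have h1 : ∀ i, ContDiffOn ℝ ∞ (fun y => θ y (stdVec i)) Ω := fun i =>
    h.clm_apply contDiffOn_const
  have h2 : ∀ i j, ContDiffOn ℝ ∞ (fun y => ed θ y (stdVec i) (stdVec j)) Ω := fun i j =>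
    contDiffOn_ed hΩ h contDiffOn_const contDiffOn_const
  exact (((h1 0).mul (h2 1 2)).add ((h1 1).mul (h2 2 0))).add ((h1 2).mul (h2 0 1))

lemma SmoothOneForm.contDiffOn_target {F : Type*} [NormedAddCommGroup F] [NormedSpace ℝ F]
    {α : OneForm M F} (h : SmoothOneForm α univ) (x : M) :
    ContDiffOn ℝ ∞ (chartForm α x) (extChartAt (𝓡 3) x).target :=
  (h.contDiffOn x).mono fun _ hy => ⟨hy, trivial⟩

variable {θ : OneForm M ℝ}

lemma wedgeD_symm (hθ : SmoothOneForm θ univ) {x : M} {y : E3}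
    (hy : y ∈ (extChartAt (𝓡 3) x).target)
    (u v w : TangentSpace (𝓡 3) ((extChartAt (𝓡 3) x).symm y)) : wedgeD θ _ u v w =
      wedgeStd (chartForm θ x) y * stdBasis.det ![dChart x _ u, dChart x _ v, dChart x _ w] := by
  have hd := differentiableAt_chartForm hθ isOpen_univ (x := x) ⟨hy, trivial⟩
  rw [← wedge_eq_det, wedgeD, extD_symm θ hy hd, extD_symm θ hy hd, extD_symm θ hy hd,
    chartForm_dChart θ hy, chartForm_dChart θ hy, chartForm_dChart θ hy]

lemma volDensity_eq (hθ : SmoothOneForm θ univ) {x : M} {y : E3}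
    (hy : y ∈ (extChartAt (𝓡 3) x).target) : volDensity θ x y = |wedgeStd (chartForm θ x) y| := by
  have h : volDensity θ x y = |wedgeD θ _ (dChartSymm x y (stdVec 0)) (dChartSymm x y (stdVec 1))
    (dChartSymm x y (stdVec 2))| := rfl
  rw [h, wedgeD_symm hθ hy, dChart_dChartSymm hy, dChart_dChartSymm hy, dChart_dChartSymm hy]
  have : ![stdVec 0, stdVec 1, stdVec 2] = stdBasis := by
    ext i : 1
    fin_cases i <;> simp [stdBasis_apply]
  rw [this, stdBasis.det_self, mul_one]

lemma volDensity_transition (hθ : SmoothOneForm θ univ) {x x' : M} {y : E3}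
    (hy : y ∈ (extChartAt (𝓡 3) x).target)
    (hy' : (extChartAt (𝓡 3) x).symm y ∈ (extChartAt (𝓡 3) x').source) :
    volDensity θ x y = |(fderiv ℝ (transition x x') y).det| * volDensity θ x' (transition x x' y) := by
  have hτ := contDiffAt_transition hy hy'
  have he : chartForm θ x =ᶠ[𝓝 y]
      fun z => (chartForm θ x' (transition x x' z)).comp (fderiv ℝ (transition x x') z) := by
    have hmem : chartSet x (extChartAt (𝓡 3) x').source ∈ 𝓝 y :=
      (isOpen_chartSet x (isOpen_extChartAt_source x')).mem_nhds ⟨hy, hy'⟩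
    filter_upwards [hmem] with z hz
    exact chartForm_transition θ hz.1 hz.2
  rw [volDensity_eq hθ hy, volDensity_eq hθ (transition_mem hy'), wedgeStd_congr he,
    wedgeStd_pullback (hτ.of_le (by norm_cast)) (differentiableAt_chartForm hθ isOpen_univ
      ⟨transition_mem hy', trivial⟩), abs_mul, mul_comm]

lemma wedgeStd_ne_zero (hθ : SmoothOneForm θ univ)
    (hc : ∀ p, ∃ u v w : TangentSpace (𝓡 3) p, wedgeD θ p u v w ≠ 0) {x : M} {y : E3}
    (hy : y ∈ (extChartAt (𝓡 3) x).target) : wedgeStd (chartForm θ x) y ≠ 0 := by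
  obtain ⟨u, v, w, h⟩ := hc ((extChartAt (𝓡 3) x).symm y)
  rw [wedgeD_symm hθ hy] at h
  exact left_ne_zero_of_mul h

variable [MeasurableSpace M] [BorelSpace M]

/-- The expression of the volume form in the chart around `x`, as a measure on `M`. -/
def chartVolume (θ : OneForm M ℝ) (x : M) : Measure M :=
  Measure.map (extChartAt (𝓡 3) x).symm
    ((volume.restrict (extChartAt (𝓡 3) x).target).withDensity
      (fun y => ENNReal.ofReal (volDensity θ x y)))

-- The inverse chart is controlled only on its open target, so the preimage is formed in the
-- subtype, where it is continuous, and then pushed back to `E3`.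
omit [IsManifold (𝓡 3) ∞ M] in
lemma measurableSet_chartSet (x : M) {A : Set M} (hA : MeasurableSet A) :
    MeasurableSet (chartSet x A) := by
  have h : chartSet x A = Subtype.val ''
      ((extChartAt (𝓡 3) x).target.domRestrict (extChartAt (𝓡 3) x).symm ⁻¹' A) := by
    ext y
    simp [chartSet, and_comm]
  rw [h]
  exact MeasurableSet.subtype_image (isOpen_target x).measurableSet
    ((continuousOn_iff_continuous_domRestrict.1 (continuousOn_extChartAt_symm x)).measurable hA)

omit [IsManifold (𝓡 3) ∞ M] in
lemma aemeasurable_symm (x : M) : AEMeasurable (extChartAt (𝓡 3) x).symm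
    ((volume.restrict (extChartAt (𝓡 3) x).target).withDensity
      (fun y => ENNReal.ofReal (volDensity θ x y))) := by
  refine AEMeasurable.mono_ac ?_ (withDensity_absolutelyContinuous _ _)
  exact (continuousOn_extChartAt_symm x).aemeasurable (isOpen_target x).measurableSet

omit [IsManifold (𝓡 3) ∞ M] in
lemma chartVolume_apply (θ : OneForm M ℝ) (x : M) {A : Set M} (hA : MeasurableSet A) :
    chartVolume θ x A = ∫⁻ y in chartSet x A, ENNReal.ofReal (volDensity θ x y) := by
  have hs := measurableSet_chartSet x hA
  set m := (volume.restrict (extChartAt (𝓡 3) x).target).withDensity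
      (fun y => ENNReal.ofReal (volDensity θ x y)) with hm
  have h1 : m (extChartAt (𝓡 3) x).targetᶜ = 0 := by
    refine withDensity_absolutelyContinuous _ _ ?_
    rw [Measure.restrict_apply (isOpen_target x).measurableSet.compl, compl_inter_self, measure_empty]
  rw [chartVolume, Measure.map_apply_of_aemeasurable (aemeasurable_symm x) hA, ← hm]
  have h2 : m ((extChartAt (𝓡 3) x).symm ⁻¹' A) = m (chartSet x A) := by
    refine le_antisymm ?_ (measure_mono inter_subset_right)
    refine (measure_le_inter_add_diff _ _ (extChartAt (𝓡 3) x).target).trans ?_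
    rw [measure_mono_null (fun x hx => hx.2 : (extChartAt (𝓡 3) x).symm ⁻¹' A \
      (extChartAt (𝓡 3) x).target ⊆ _) h1, add_zero, inter_comm]
    rfl
  rw [h2, hm, withDensity_apply _ hs, Measure.restrict_restrict hs,
    inter_eq_left.2 (fun y hy => hy.1 : chartSet x A ⊆ _)]

/-- Change of variables by the transition map: the density changes by exactly the absolute value of
the Jacobian determinant. -/
lemma chartVolume_compat (hθ : SmoothOneForm θ univ) (x x' : M) {A : Set M} (hA : MeasurableSet A)
    (hx : A ⊆ (extChartAt (𝓡 3) x).source) (hx' : A ⊆ (extChartAt (𝓡 3) x').source) :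
    chartVolume θ x A = chartVolume θ x' A := by
  rw [chartVolume_apply θ x hA, chartVolume_apply θ x' hA]
  have himg : transition x x' '' chartSet x A = chartSet x' A := by
    ext y
    constructor
    · rintro ⟨z, hz, rfl⟩
      exact ⟨transition_mem (hx' hz.2), by rw [mem_preimage, symm_transition (hx' hz.2)]; exact hz.2⟩
    · intro hy
      refine ⟨extChartAt (𝓡 3) x ((extChartAt (𝓡 3) x').symm y), mem_chartSet (hx hy.2) hy.2, ?_⟩
      rw [transition, (extChartAt (𝓡 3) x).left_inv (hx hy.2), (extChartAt (𝓡 3) x').right_inv hy.1]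
  have hinj : InjOn (transition x x') (chartSet x A) := by
    intro y hy z hz h
    have h2 := congrArg (extChartAt (𝓡 3) x').symm h
    rw [symm_transition (hx' hy.2), symm_transition (hx' hz.2)] at h2
    exact (extChartAt (𝓡 3) x).symm.injOn hy.1 hz.1 h2
  rw [← himg, lintegral_image_eq_lintegral_abs_det_fderiv_mul volume (measurableSet_chartSet x hA)
    (fun y hy => ((contDiffAt_transition hy.1 (hx' hy.2)).differentiableAt
      (by simp)).hasFDerivAt.hasFDerivWithinAt) hinj]
  refine setLIntegral_congr_fun (measurableSet_chartSet x hA) fun y hy => ?_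
  rw [volDensity_transition hθ hy.1 (hx' hy.2), ENNReal.ofReal_mul (abs_nonneg _)]

lemma exists_seq_cover [CompactSpace M] [Nonempty M] :
    ∃ s : ℕ → M, ⋃ n, (extChartAt (𝓡 3) (s n)).source = univ := by
  obtain ⟨s, hs, hu⟩ := countable_cover_nhds_of_sigmaCompact
    (f := fun x : M => (extChartAt (𝓡 3) x).source) fun x => extChartAt_source_mem_nhds x
  have hne : s.Nonempty := by
    by_contra h
    rw [not_nonempty_iff_eq_empty] at h
    rw [h, biUnion_empty] at hu
    exact empty_ne_univ hu
  obtain ⟨f, rfl⟩ := hs.exists_eq_range hne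
  exact ⟨f, by simpa using hu⟩

/-- A compact manifold is covered by countably many chart domains and the chart measures agree on
overlaps, so on a single chart domain the supremum is the measure of that chart. -/
lemma contactVolume_apply [CompactSpace M] (hθ : SmoothOneForm θ univ) (x : M) {A : Set M}
    (hA : MeasurableSet A) (hx : A ⊆ (extChartAt (𝓡 3) x).source) :
    contactVolume θ A = chartVolume θ x A := by
  have : Nonempty M := ⟨x⟩
  obtain ⟨s, hs⟩ := exists_seq_cover (M := M)
  refine iSup_measure_apply (m := chartVolume θ) (S := fun x => (extChartAt (𝓡 3) x).source)
    (fun i => (isOpen_extChartAt_source i).measurableSet) (fun i => ?_)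
    (fun i j A hA hi hj => chartVolume_compat hθ i j hA hi hj) hs x hA hx
  rw [chartVolume_apply θ i (isOpen_extChartAt_source i).measurableSet.compl]
  have : chartSet i (extChartAt (𝓡 3) i).sourceᶜ = ∅ := by
    ext y
    simp only [chartSet, mem_inter_iff, mem_preimage, mem_compl_iff, mem_empty_iff_false, iff_false,
      not_and, not_not]
    exact fun h => (extChartAt (𝓡 3) i).map_target h
  rw [this]; simp

lemma contactVolume_restrict [CompactSpace M] (hθ : SmoothOneForm θ univ) (x : M) :
    (contactVolume θ).restrict (extChartAt (𝓡 3) x).source = chartVolume θ x := by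
  have hm : MeasurableSet (extChartAt (𝓡 3) x).source := (isOpen_extChartAt_source x).measurableSet
  ext A hA
  rw [Measure.restrict_apply hA, contactVolume_apply hθ x (hA.inter hm) inter_subset_right,
    chartVolume_apply _ _ (hA.inter hm), chartVolume_apply _ _ hA, chartSet_inter_source]

lemma continuousOn_volDensity (hθ : SmoothOneForm θ univ) (x : M) :
    ContinuousOn (volDensity θ x) (extChartAt (𝓡 3) x).target :=
  ((contDiffOn_wedgeStd (isOpen_target x) (hθ.contDiffOn_target x)).continuousOn.abs).congr
    fun _ hy => volDensity_eq hθ hy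

/-- The density is continuous, hence integrable on closed balls inside a chart. This makes the
measure locally finite, and the manifold is compact. -/
lemma isFiniteMeasure_contactVolume [CompactSpace M] (hθ : SmoothOneForm θ univ) :
    IsFiniteMeasure (contactVolume θ) := by
  have : IsLocallyFiniteMeasure (contactVolume θ) := by
    refine ⟨fun p => ?_⟩
    set y₀ := extChartAt (𝓡 3) p p with hy₀
    have hy₀t : y₀ ∈ (extChartAt (𝓡 3) p).target := mem_extChartAt_target p
    obtain ⟨r, hr, hrb⟩ := Metric.nhds_basis_closedBall.mem_iff.1 (target_mem_nhds p hy₀t)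
    refine ⟨chartPre p (Metric.ball y₀ r), ?_, ?_⟩
    · exact (isOpen_chartPre p Metric.isOpen_ball).mem_nhds
        ⟨mem_extChartAt_source p, Metric.mem_ball_self hr⟩
    · have ho := isOpen_chartPre p (Metric.isOpen_ball (x := y₀) (ε := r))
      rw [contactVolume_apply hθ p ho.measurableSet inter_subset_left,
        chartVolume_apply _ _ ho.measurableSet, ChartFrame.chartSet_chartPre]
      have hi : IntegrableOn (volDensity θ p) (Metric.closedBall y₀ r) :=
        ((continuousOn_volDensity hθ p).mono hrb).integrableOn_compact (isCompact_closedBall _ _)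
      refine (lintegral_mono_set (inter_subset_right.trans Metric.ball_subset_closedBall)).trans_lt ?_
      refine (lintegral_mono fun y => ?_).trans_lt hi.2
      rw [← ofReal_norm]
      exact ENNReal.ofReal_le_ofReal (Real.le_norm_self _)
  infer_instance

/-- By the contact condition the density is strictly positive, so a nonempty open set of measure
zero would have a Lebesgue-null open image in a chart. This is the nondegeneracy behind the
necessity of the Euler–Lagrange equations. -/
lemma isOpenPosMeasure_contactVolume [CompactSpace M] (hθ : SmoothOneForm θ univ)
    (hc : ∀ p, ∃ u v w : TangentSpace (𝓡 3) p, wedgeD θ p u v w ≠ 0) :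
    (contactVolume θ).IsOpenPosMeasure := by
  refine ⟨fun U hU ⟨p, hp⟩ h0 => ?_⟩
  set S := U ∩ (extChartAt (𝓡 3) p).source
  have hS : IsOpen S := hU.inter (isOpen_extChartAt_source p)
  have h1 : contactVolume θ S = 0 := measure_mono_null inter_subset_left h0
  rw [contactVolume_apply hθ p hS.measurableSet inter_subset_right,
    chartVolume_apply _ _ hS.measurableSet] at h1
  have hcS := isOpen_chartSet p hS
  have hne : (chartSet p S).Nonempty :=
    ⟨_, mem_chartSet (mem_extChartAt_source p) ⟨hp, mem_extChartAt_source p⟩⟩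
  have hae : AEMeasurable (fun y => ENNReal.ofReal (volDensity θ p y))
      (volume.restrict (chartSet p S)) :=
    (((continuousOn_volDensity hθ p).mono fun y hy => hy.1).aemeasurable
      hcS.measurableSet).ennreal_ofReal
  have h2 := (ae_restrict_iff' hcS.measurableSet).1 ((lintegral_eq_zero_iff' hae).1 h1)
  have h3 : ∀ᵐ y ∂(volume : Measure E3), y ∉ chartSet p S := by
    filter_upwards [h2] with y hy hyS
    have := hy hyS
    rw [volDensity_eq hθ hyS.1] at this
    simp only [Pi.zero_apply, ENNReal.ofReal_eq_zero] at this
    exact (abs_pos.2 (wedgeStd_ne_zero hθ hc hyS.1)).not_ge this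
  exact (hcS.measure_pos volume hne).ne' (measure_eq_zero_iff_ae_notMem.2 h3)

/-- The integral of a function supported in a chart domain. -/
lemma integral_contactVolume_of_support [CompactSpace M] (hθ : SmoothOneForm θ univ) (x : M)
    {f : M → ℝ} (hf : Continuous f) (hs : ∀ p ∉ (extChartAt (𝓡 3) x).source, f p = 0) :
    ∫ p, f p ∂(contactVolume θ) = ∫ y in (extChartAt (𝓡 3) x).target,
      |wedgeStd (chartForm θ x) y| * f ((extChartAt (𝓡 3) x).symm y) := by
  rw [← setIntegral_eq_integral_of_forall_compl_eq_zero hs, contactVolume_restrict hθ, chartVolume,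
    integral_map (aemeasurable_symm x) hf.stronglyMeasurable.aestronglyMeasurable,
    integral_withDensity_eq_integral_toReal_smul₀
      ((continuousOn_volDensity hθ x).aemeasurable (isOpen_target x).measurableSet).ennreal_ofReal
      (by simp)]
  refine setIntegral_congr_fun (isOpen_target x).measurableSet fun y hy => ?_
  simp only [volDensity_eq hθ hy, smul_eq_mul, ENNReal.toReal_ofReal (abs_nonneg _)]

lemma chartForm_smul (u : M → ℝ) (θ : OneForm M ℝ) (x : M) :
    chartForm (fun p => u p • θ p) x =
      fun y => u ((extChartAt (𝓡 3) x).symm y) • chartForm θ x y := rfl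

/-- The effect of a conformal change of the contact form on the volume form. -/
lemma contactVolume_smul [CompactSpace M] (hθ : SmoothOneForm θ univ) {u : M → ℝ}
    (hu : Continuous u) (hus : ∀ x, ContDiffOn ℝ ∞ (u ∘ (extChartAt (𝓡 3) x).symm)
      (extChartAt (𝓡 3) x).target) (huθ : SmoothOneForm (fun p => u p • θ p) univ) :
    contactVolume (fun p => u p • θ p) =
      (contactVolume θ).withDensity fun p => ENNReal.ofReal (u p ^ 2) := by
  rcases isEmpty_or_nonempty M with hM | hM
  · ext A
    simp [Set.eq_empty_of_isEmpty A]
  obtain ⟨s, hs⟩ := exists_seq_cover (M := M)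
  -- The two measures are compared on the countably many chart domains, where each has an explicit
  -- density.
  have key := (Measure.restrict_iUnion_congr (μ := contactVolume (fun p => u p • θ p))
    (ν := (contactVolume θ).withDensity fun p => ENNReal.ofReal (u p ^ 2))
    (s := fun n => (extChartAt (𝓡 3) (s n)).source)).2 fun n => ?_
  · rwa [hs, Measure.restrict_univ, Measure.restrict_univ] at key
  set x := s n
  have hm : Measurable fun p => ENNReal.ofReal (u p ^ 2) := (hu.pow 2).measurable.ennreal_ofReal
  rw [restrict_withDensity (isOpen_extChartAt_source x).measurableSet, contactVolume_restrict hθ,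
    contactVolume_restrict huθ]
  ext A hA
  have hcs := measurableSet_chartSet x hA
  rw [chartVolume_apply _ _ hA, withDensity_apply _ hA, ← lintegral_indicator hA, chartVolume,
    lintegral_map' (hm.indicator hA).aemeasurable (aemeasurable_symm x)]
  have h2 := lintegral_withDensity_eq_lintegral_mul₀
      ((continuousOn_volDensity hθ x).aemeasurable
        (isOpen_target x).measurableSet (μ := volume)).ennreal_ofReal
      ((hm.indicator hA).comp_aemeasurable ((continuousOn_extChartAt_symm x).aemeasurable
        (isOpen_target x).measurableSet))
  refine Eq.trans ?_ h2.symm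
  have h1 : ∀ y ∈ (extChartAt (𝓡 3) x).target,
      volDensity (fun p => u p • θ p) x y =
        u ((extChartAt (𝓡 3) x).symm y) ^ 2 * volDensity θ x y := by
    intro y hy
    have h3 := wedgeStd_smul (diffAt_of_contDiffOn (hus x) (isOpen_target x) hy)
      (differentiableAt_chartForm hθ isOpen_univ ⟨hy, trivial⟩)
    simp only [Function.comp_apply] at h3
    rw [volDensity_eq huθ hy, volDensity_eq hθ hy, chartForm_smul, h3, abs_mul, abs_sq]
  rw [← lintegral_indicator hcs, ← lintegral_indicator (isOpen_target x).measurableSet]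
  refine lintegral_congr fun y => ?_
  by_cases hy : y ∈ (extChartAt (𝓡 3) x).target
  · rw [indicator_of_mem hy, Pi.mul_apply, Function.comp_apply]
    by_cases hyA : (extChartAt (𝓡 3) x).symm y ∈ A
    · rw [indicator_of_mem (show y ∈ chartSet x A from ⟨hy, hyA⟩), indicator_of_mem hyA, h1 y hy,
        mul_comm, ENNReal.ofReal_mul' (sq_nonneg _)]
    · rw [indicator_of_notMem (fun h : y ∈ chartSet x A => hyA h.2), indicator_of_notMem hyA,
        mul_zero]
  · rw [indicator_of_notMem (fun h : y ∈ chartSet x A => hy h.1), indicator_of_notMem hy]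

end Volume

end CR3

end

/-! ### The divergence theorem on a closed contact manifold -/

noncomputable section

namespace CR3

variable {M : Type*} [TopologicalSpace M] [ChartedSpace E3 M]

lemma continuousAt_iff_chart {F : Type*} [TopologicalSpace F] {f : M → F} {x p : M}
    (hp : p ∈ (extChartAt (𝓡 3) x).source)
    (h : ContinuousAt (f ∘ (extChartAt (𝓡 3) x).symm) (extChartAt (𝓡 3) x p)) :
    ContinuousAt f p := by
  have h1 : ContinuousAt ((f ∘ (extChartAt (𝓡 3) x).symm) ∘ extChartAt (𝓡 3) x) p :=
    h.comp (continuousAt_extChartAt' hp)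
  refine h1.congr ?_
  filter_upwards [(isOpen_extChartAt_source (I := 𝓡 3) x).mem_nhds hp] with z hz
  simp only [Function.comp_apply, (extChartAt (𝓡 3) x).left_inv hz]

lemma continuous_of_charts {F : Type*} [TopologicalSpace F] {f : M → F}
    (h : ∀ x, ContinuousAt (f ∘ (extChartAt (𝓡 3) x).symm) (extChartAt (𝓡 3) x x)) :
    Continuous f :=
  continuous_iff_continuousAt.2 fun x => continuousAt_iff_chart (mem_extChartAt_source x) (h x)

variable [IsManifold (𝓡 3) ∞ M]

lemma contDiffOn_symm_of_contMDiff {u : M → ℝ} (hu : ContMDiff (𝓡 3) 𝓘(ℝ, ℝ) ∞ u) (x : M) :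
    ContDiffOn ℝ ∞ (u ∘ (extChartAt (𝓡 3) x).symm) (extChartAt (𝓡 3) x).target :=
  contMDiffOn_iff_contDiffOn.1 (hu.comp_contMDiffOn (contMDiffOn_extChartAt_symm x))

/-- The derivative of a real function along a tangent vector. -/
def dirR (u : M → ℝ) (p : M) (v : TangentSpace (𝓡 3) p) : ℝ :=
  (UnitaryFrame.dir (fun p => (u p : ℂ)) p v).re

lemma dirR_symm {u : M → ℝ} {x : M} {y : E3} (hy : y ∈ (extChartAt (𝓡 3) x).target)
    (hu : DifferentiableAt ℝ (u ∘ (extChartAt (𝓡 3) x).symm) y)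
    (v : TangentSpace (𝓡 3) ((extChartAt (𝓡 3) x).symm y)) :
    dirR u _ v = fderiv ℝ (u ∘ (extChartAt (𝓡 3) x).symm) y (dChart x _ v) := by
  rw [dirR, dir_eq_fderiv _ ((extChartAt (𝓡 3) x).map_target hy),
    (extChartAt (𝓡 3) x).right_inv hy]
  have := (Complex.ofRealCLM.hasFDerivAt.comp y hu.hasFDerivAt).fderiv
  have h2 := DFunLike.congr_fun this (dChart x _ v)
  have h3 : fderiv ℝ ((fun p => (u p : ℂ)) ∘ (extChartAt (𝓡 3) x).symm) y (dChart x _ v) =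
    ((fderiv ℝ (u ∘ (extChartAt (𝓡 3) x).symm) y (dChart x _ v) : ℝ) : ℂ) := h2
  rw [h3, Complex.ofReal_re]

variable [CompactSpace M] [MeasurableSpace M] [BorelSpace M]
  {θ : OneForm M ℝ}

/-- Integration by parts against a function supported in a small chart domain. -/
lemma integral_mul_divg [T2Space M] (hθ : SmoothOneForm θ univ)
    {x : M} {N : Set M} (hN : IsOpen N)
    {r : ℝ} (hr : ∀ y ∈ chartSet x N, |wedgeStd (chartForm θ x) y| = r * wedgeStd (chartForm θ x) y)
    {V : VField M} {q : M → ℝ} (hq : Continuous q)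
    (hV : ContDiffOn ℝ ∞ (chartVec V x) (chartSet x N))
    (hdiv : ∀ y ∈ chartSet x N, divg (fun y => wedgeStd (chartForm θ x) y • chartVec V x y) y =
      wedgeStd (chartForm θ x) y * q ((extChartAt (𝓡 3) x).symm y))
    {ρ : M → ℝ} (hρ : ContMDiff (𝓡 3) 𝓘(ℝ, ℝ) ∞ ρ) (hρN : tsupport ρ ⊆ N)
    (hNs : N ⊆ (extChartAt (𝓡 3) x).source)
    (hcont : Continuous fun p => dirR ρ p (V p)) :
    ∫ p, ρ p * q p ∂(contactVolume θ) = - ∫ p, dirR ρ p (V p) ∂(contactVolume θ) := by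
  set w := wedgeStd (chartForm θ x) with hw
  set ψ := (extChartAt (𝓡 3) x).symm with hψ
  set S := chartSet x N with hS
  have hSo : IsOpen S := isOpen_chartSet x hN
  have hSt : S ⊆ (extChartAt (𝓡 3) x).target := fun y hy => hy.1
  have sw : ContDiffOn ℝ ∞ w S :=
    (contDiffOn_wedgeStd (isOpen_target x) (hθ.contDiffOn_target x)).mono hSt
  have sρ : ContDiffOn ℝ ∞ (ρ ∘ ψ) S := (contDiffOn_symm_of_contMDiff hρ x).mono hSt
  have hK : IsCompact (tsupport ρ) := (isClosed_tsupport ρ).isCompact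
  set K : Set E3 := extChartAt (𝓡 3) x '' tsupport ρ with hKdef
  have hKc : IsCompact K := hK.image_of_continuousOn
    ((continuousOn_extChartAt x).mono (hρN.trans hNs))
  have hKS : K ⊆ S := by
    rintro _ ⟨p, hp, rfl⟩
    exact mem_chartSet (hNs (hρN hp)) (hρN hp)
  have hρK : ∀ y ∈ (extChartAt (𝓡 3) x).target, y ∉ K → ψ y ∉ tsupport ρ := by
    intro y hy hyK h
    exact hyK ⟨ψ y, h, (extChartAt (𝓡 3) x).right_inv hy⟩
  have hρ0 : ∀ p ∉ (extChartAt (𝓡 3) x).source, ρ p = 0 := fun p hp =>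
    image_eq_zero_of_notMem_tsupport fun h => hp (hNs (hρN h))
  have hdρ0 : ∀ p ∉ tsupport ρ, ∀ v, dirR ρ p v = 0 := by
    intro p hp v
    have he : (fun p => (ρ p : ℂ)) =ᶠ[𝓝 p] fun _ => 0 := by
      filter_upwards [(isClosed_tsupport ρ).isOpen_compl.mem_nhds hp] with z hz
      rw [image_eq_zero_of_notMem_tsupport hz, Complex.ofReal_zero]
    rw [dirR, UnitaryFrame.dir, he.mfderiv_eq, mfderiv_const]
    rfl
  -- the compactly supported vector field
  set F : E3 → E3 := S.indicator fun y => (ρ (ψ y)) • (w y • chartVec V x y) with hF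
  have hFsupp : ∀ y ∉ K, F y = 0 := by
    intro y hy
    by_cases hyS : y ∈ S
    · rw [hF, indicator_of_mem hyS, image_eq_zero_of_notMem_tsupport (hρK y (hSt hyS) hy), zero_smul]
    · rw [hF, indicator_of_notMem hyS]
  have hFe : ∀ y ∈ S, F =ᶠ[𝓝 y] fun y => (ρ ∘ ψ) y • (w y • chartVec V x y) := by
    intro y hy
    filter_upwards [hSo.mem_nhds hy] with z hz
    rw [hF, indicator_of_mem hz]; rfl
  -- Extension by zero is smooth: `F` is a product of smooth fields on the open set `S` and vanishes
  -- off the compact set `K` inside `S`.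
  have hFs : ContDiff ℝ 1 F := by
    rw [contDiff_iff_contDiffAt]
    intro y
    by_cases hyS : y ∈ S
    · refine ContDiffAt.congr_of_eventuallyEq ?_ (hFe y hyS)
      exact ((sρ.smul (sw.smul hV)).contDiffAt (hSo.mem_nhds hyS)).of_le (by norm_cast)
    · have : F =ᶠ[𝓝 y] fun _ => 0 := by
        filter_upwards [hKc.isClosed.isOpen_compl.mem_nhds fun h => hyS (hKS h)] with z hz
        exact hFsupp z hz
      exact contDiffAt_const.congr_of_eventuallyEq this
  have hFc : HasCompactSupport F := HasCompactSupport.intro hKc hFsupp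
  have h0 := integral_divg_eq_zero hFs hFc
  have hdF : ∀ y ∈ S, divg F y = ρ (ψ y) * (w y * q (ψ y)) + w y * dirR ρ (ψ y) (V (ψ y)) := by
    intro y hy
    have hwV : DifferentiableAt ℝ (fun y => w y • chartVec V x y) y :=
      diffAt_of_contDiffOn (sw.smul hV) hSo hy
    rw [divg_congr (hFe y hy), divg_smul (diffAt_of_contDiffOn sρ hSo hy) hwV, hdiv y hy,
      dirR_symm (hSt hy) (diffAt_of_contDiffOn sρ hSo hy), map_smul]
    rfl
  have hdF0 : ∀ y ∉ K, divg F y = 0 := by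
    intro y hy
    have : F =ᶠ[𝓝 y] fun _ => 0 := by
      filter_upwards [hKc.isClosed.isOpen_compl.mem_nhds hy] with z hz
      exact hFsupp z hz
    rw [divg_congr this]
    simp [divg]
  have hρq : Continuous fun p => ρ p * q p := hρ.continuous.mul hq
  have hsumc : Continuous fun p => ρ p * q p + dirR ρ p (V p) := hρq.add hcont
  -- In the chart the integrand is |w| times a function whose product with w is div F. Since |w| = r
  -- w there, the integral is r times the vanishing integral of div F.
  have hI : ∫ p, (ρ p * q p + dirR ρ p (V p)) ∂(contactVolume θ) = 0 := by
    rw [integral_contactVolume_of_support hθ x hsumc fun p hp => by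
      rw [hρ0 p hp, hdρ0 p fun h => hp (hNs (hρN h))]; ring]
    rw [← integral_indicator (isOpen_target x).measurableSet, ← mul_zero r, ← h0,
      ← integral_const_mul]
    refine integral_congr_ae (Filter.Eventually.of_forall fun y => ?_)
    simp only
    by_cases hyK : y ∈ K
    · have hyS := hKS hyK
      rw [indicator_of_mem (hSt hyS), hdF y hyS, hr y hyS]
      ring
    · rw [hdF0 y hyK, mul_zero]
      by_cases hyt : y ∈ (extChartAt (𝓡 3) x).target
      · rw [indicator_of_mem hyt, image_eq_zero_of_notMem_tsupport (hρK y hyt hyK),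
          hdρ0 _ (hρK y hyt hyK)]
        ring
      · rw [indicator_of_notMem hyt]
  have hfin := isFiniteMeasure_contactVolume hθ
  have hint : ∀ {f : M → ℝ}, Continuous f → Integrable f (contactVolume θ) := fun hf =>
    hf.integrable_of_hasCompactSupport (HasCompactSupport.of_compactSpace _)
  rw [integral_add (hint hρq) (hint hcont)] at hI
  linarith

/-- The integral of a divergence over a closed contact manifold vanishes. -/
lemma integral_eq_zero_of_divg [T2Space M] (hθ : SmoothOneForm θ univ)
    (hc : ∀ p, ∃ u v w : TangentSpace (𝓡 3) p, wedgeD θ p u v w ≠ 0)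
    {V : VField M} {q : M → ℝ} (hq : Continuous q)
    (hV : ∀ x, ∃ N, IsOpen N ∧ x ∈ N ∧ N ⊆ (extChartAt (𝓡 3) x).source ∧
      ContDiffOn ℝ ∞ (chartVec V x) (chartSet x N) ∧ ∀ y ∈ chartSet x N,
        divg (fun y => wedgeStd (chartForm θ x) y • chartVec V x y) y =
          wedgeStd (chartForm θ x) y * q ((extChartAt (𝓡 3) x).symm y)) :
    ∫ p, q p ∂(contactVolume θ) = 0 := by
  have hV' : ∀ x, ∃ N, IsOpen N ∧ x ∈ N ∧ N ⊆ (extChartAt (𝓡 3) x).source ∧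
      ContDiffOn ℝ ∞ (chartVec V x) (chartSet x N) ∧ (∀ y ∈ chartSet x N,
        divg (fun y => wedgeStd (chartForm θ x) y • chartVec V x y) y =
          wedgeStd (chartForm θ x) y * q ((extChartAt (𝓡 3) x).symm y)) ∧
      ∃ r : ℝ, ∀ y ∈ chartSet x N,
        |wedgeStd (chartForm θ x) y| = r * wedgeStd (chartForm θ x) y := by
    intro x
    obtain ⟨N, hN, hxN, hNs, h1, h2⟩ := hV x
    have hwc : ContinuousOn (wedgeStd (chartForm θ x)) (extChartAt (𝓡 3) x).target :=
      (contDiffOn_wedgeStd (isOpen_target x) (hθ.contDiffOn_target x)).continuousOn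
    have hxt := mem_extChartAt_target (I := 𝓡 3) x
    have hne := wedgeStd_ne_zero hθ hc hxt
    have hwa := hwc.continuousAt (target_mem_nhds x hxt)
    -- The measure involves |w| and the divergence identity w. As w is continuous and nonzero, it
    -- has a constant sign near the point, and r = ±1 is that sign.
    have key : ∃ W : Set E3, IsOpen W ∧ extChartAt (𝓡 3) x x ∈ W ∧ ∃ r : ℝ, ∀ y ∈ W,
        |wedgeStd (chartForm θ x) y| = r * wedgeStd (chartForm θ x) y := by
      rcases hne.lt_or_gt with h | h
      · obtain ⟨W, hW, hWo, hxW⟩ := mem_nhds_iff.1 (hwa.eventually (gt_mem_nhds h))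
        exact ⟨W, hWo, hxW, -1, fun y hy => by rw [abs_of_neg (hW hy)]; ring⟩
      · obtain ⟨W, hW, hWo, hxW⟩ := mem_nhds_iff.1 (hwa.eventually (lt_mem_nhds h))
        exact ⟨W, hWo, hxW, 1, fun y hy => by rw [abs_of_pos (hW hy)]; ring⟩
    obtain ⟨W, hWo, hxW, r, hr⟩ := key
    have hsub : chartSet x (N ∩ chartPre x W) ⊆ chartSet x N := fun y hy => ⟨hy.1, hy.2.1⟩
    refine ⟨N ∩ chartPre x W, hN.inter (isOpen_chartPre x hWo),
      ⟨hxN, mem_extChartAt_source x, hxW⟩, inter_subset_left.trans hNs, h1.mono hsub,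
      fun y hy => h2 y (hsub hy), r, fun y hy => hr y ?_⟩
    have := hy.2.2.2
    rwa [mem_preimage, (extChartAt (𝓡 3) x).right_inv hy.1] at this
  choose N hNo hxN hNs hVs hdiv r hr using hV'
  obtain ⟨t, ht⟩ := isCompact_univ.elim_finite_subcover N hNo fun x _ => mem_iUnion.2 ⟨x, hxN x⟩
  obtain ⟨ρ, hρ⟩ := SmoothPartitionOfUnity.exists_isSubordinate (𝓡 3) isClosed_univ
    (fun i : t => N i) (fun i => hNo i) (by
      intro p hp
      obtain ⟨i, hi, hpi⟩ := mem_iUnion₂.1 (ht hp)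
      exact mem_iUnion.2 ⟨⟨i, hi⟩, hpi⟩)
  have hsum : ∀ p, ∑ i, ρ i p = 1 := fun p => by
    rw [← finsum_eq_sum_of_fintype]; exact ρ.sum_eq_one (mem_univ p)
  have hsmooth : ∀ i, ContMDiff (𝓡 3) 𝓘(ℝ, ℝ) ∞ (ρ i) := fun i => (ρ i).contMDiff
  have hbc : ∀ i, Continuous fun p => dirR (ρ i) p (V p) := by
    intro i
    refine continuous_of_charts fun x => ?_
    have hs := contDiffOn_symm_of_contMDiff (hsmooth i) x
    have hmem := mem_chartSet (mem_extChartAt_source (I := 𝓡 3) x) (hxN x)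
    have hSo := isOpen_chartSet x (hNo x)
    have hSt : chartSet x (N x) ⊆ (extChartAt (𝓡 3) x).target := fun y hy => hy.1
    have h1 : ContinuousOn (fun y => fderiv ℝ (ρ i ∘ (extChartAt (𝓡 3) x).symm) y
        (chartVec V x y)) (chartSet x (N x)) :=
      (((hs.mono hSt).fderiv_of_isOpen (m := ∞) hSo (by simp)).clm_apply (hVs x)).continuousOn
    refine (h1.continuousAt (hSo.mem_nhds hmem)).congr ?_
    filter_upwards [hSo.mem_nhds hmem] with y hy
    exact (dirR_symm hy.1 (diffAt_of_contDiffOn hs (isOpen_target x) hy.1) _).symm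
  -- The derivatives of a partition of unity add up to the derivative of the constant 1.
  have hbsum' : ∀ x, ∀ p ∈ (extChartAt (𝓡 3) x).source, ∑ i, dirR (ρ i) p (V p) = 0 := by
    intro x p hp
    obtain ⟨y, hy, rfl⟩ : ∃ y ∈ (extChartAt (𝓡 3) x).target, (extChartAt (𝓡 3) x).symm y = p :=
      ⟨_, (extChartAt (𝓡 3) x).map_source hp, (extChartAt (𝓡 3) x).left_inv hp⟩
    have hd : ∀ i, DifferentiableAt ℝ (ρ i ∘ (extChartAt (𝓡 3) x).symm) y := fun i =>
      diffAt_of_contDiffOn (contDiffOn_symm_of_contMDiff (hsmooth i) x) (isOpen_target x) hy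
    simp only [dirR_symm hy (hd _)]
    have h1 := fderiv_fun_sum (u := Finset.univ) (x := y) (𝕜 := ℝ)
      (A := fun i => ρ i ∘ (extChartAt (𝓡 3) x).symm) fun i _ => hd i
    simp only [Function.comp_apply, hsum] at h1
    rw [fderiv_fun_const] at h1
    have h2 := DFunLike.congr_fun h1 (dChart x _ (V ((extChartAt (𝓡 3) x).symm y)))
    rw [sum_apply] at h2
    exact h2.symm
  have hbsum : ∀ p, ∑ i, dirR (ρ i) p (V p) = 0 := fun p =>
    hbsum' p p (mem_extChartAt_source p)
  have hfin := isFiniteMeasure_contactVolume hθ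
  have hint : ∀ {f : M → ℝ}, Continuous f → Integrable f (contactVolume θ) := fun hf =>
    hf.integrable_of_hasCompactSupport (HasCompactSupport.of_compactSpace _)
  -- The function is split by the partition of unity and each piece is integrated by parts in its
  -- own chart; the terms with derivatives of the ρ_i cancel in the sum.
  calc ∫ p, q p ∂(contactVolume θ) = ∫ p, ∑ i, ρ i p * q p ∂(contactVolume θ) := by
        refine integral_congr_ae (Filter.Eventually.of_forall fun p => ?_)
        simp only
        rw [← Finset.sum_mul, hsum, one_mul]
    _ = ∑ i, ∫ p, ρ i p * q p ∂(contactVolume θ) :=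
        integral_finsetSum _ fun i _ => hint ((hsmooth i).continuous.mul hq)
    _ = ∑ i, - ∫ p, dirR (ρ i) p (V p) ∂(contactVolume θ) :=
        Finset.sum_congr rfl fun i _ => integral_mul_divg hθ (hNo i) (hr i) hq (hVs i) (hdiv i)
          (hsmooth i) (hρ i) (hNs i) (hbc i)
    _ = 0 := by
        rw [Finset.sum_neg_distrib, ← integral_finsetSum _ fun i _ => hint (hbc i)]
        simp only [hbsum, integral_zero, neg_zero]

end CR3

end

/-! ### Curvature, torsion norm and variational integrand in arbitrary frames -/

noncomputable section

namespace CR3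

namespace ChartFrame

variable {J : E3 → E3 →L[ℝ] E3} {θ : E3 → E3 →L[ℝ] ℝ} {Ω : Set E3}

/-- The restriction of a frame to a smaller open set. -/
def restrict (f : ChartFrame J θ Ω) {Ω' : Set E3} (h : Ω' ⊆ Ω) (hΩ' : IsOpen Ω') :
    ChartFrame J θ Ω' where
  X := f.X
  Y := f.Y
  T := f.T
  ζ := f.ζ
  conn := f.conn
  A := f.A
  R := f.R
  isOpen := hΩ'
  smooth_θ := f.smooth_θ.mono h
  smooth_X := f.smooth_X.mono h
  smooth_Y := f.smooth_Y.mono h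
  smooth_T := f.smooth_T.mono h
  smooth_ζ := f.smooth_ζ.mono h
  smooth_conn := f.smooth_conn.mono h
  dual p hp := f.dual p (h hp)
  reeb p hp := f.reeb p (h hp)
  Y_eq p hp := f.Y_eq p (h hp)
  unitary p hp := f.unitary p (h hp)
  structure_eq p hp := f.structure_eq p (h hp)
  skew p hp := f.skew p (h hp)
  curvature p hp := f.curvature p (h hp)

/-- The component `E₁₁` of an endomorphism. -/
def endComp (f : ChartFrame J θ Ω) (E : E3 → E3 →L[ℝ] E3) (y : E3) : ℂ :=
  (1 / 2) * (conj (f.ζ y (E y (f.X y))) - Complex.I * conj (f.ζ y (E y (f.Y y))))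

/-- Half of the integrand of the first variation. -/
def varInt (f : ChartFrame J θ Ω) (e hc : E3 → ℂ) (y : E3) : ℂ :=
  f.gradJ y * e y + f.gradθ y * hc y

/-- The vector field of the boundary term of the first variation. -/
def bdryVec (f : ChartFrame J θ Ω) (e hc : E3 → ℂ) : E3 → E3 :=
  f.realVec (f.bdryW e hc) (f.bdryZ e)

end ChartFrame

variable {M : Type*} [TopologicalSpace M] [ChartedSpace E3 M] [IsManifold (𝓡 3) ∞ M]
  {J : EndField M} {θ : OneForm M ℝ}

lemma IsPseudohermitian.chartPseudo (hP : IsPseudohermitian J θ) {x : M} {y : E3}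
    (hy : y ∈ (extChartAt (𝓡 3) x).target) : ChartPseudo (chartEnd J x) (chartForm θ x) y where
  contact := wedgeStd_ne_zero hP.smooth_form hP.contact hy
  map_ker v hv := by
    rw [chartForm_apply] at hv
    rw [chartEnd_apply, chartForm_dChart _ hy]
    exact hP.map_ker _ _ hv
  sq_J v hv := by
    rw [chartForm_apply] at hv
    rw [chartEnd_apply J x y v, chartEnd_dChart _ hy, hP.sq_J _ _ hv, map_neg,
      dChart_dChartSymm hy]
  pos v hv hv0 := by
    rw [chartForm_apply] at hv
    rw [ed_chartForm _ hy (differentiableAt_chartForm hP.smooth_form isOpen_univ ⟨hy, trivial⟩),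
      chartEnd_apply, dChartSymm_dChart hy]
    refine hP.pos _ _ hv fun h0 => hv0 ?_
    rw [← dChart_dChartSymm hy v, h0, map_zero]

/-- A single structure is treated as a constant family, and the family of frames is evaluated at
parameter 0. -/
lemma IsPseudohermitian.exists_chartFrame (hP : IsPseudohermitian J θ) {x : M} {y : E3}
    (hy : y ∈ (extChartAt (𝓡 3) x).target) : ∃ Ω ⊆ (extChartAt (𝓡 3) x).target,
      y ∈ Ω ∧ Nonempty (ChartFrame (chartEnd J x) (chartForm θ x) Ω) := by
  have hJ := (hP.smooth_J.family (univ ×ˢ univ)).contDiffOn x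
  have hθ := (hP.smooth_form.family (univ ×ˢ univ)).contDiffOn x
  obtain ⟨I', -, Ω', hΩ', h0, hy', ⟨F⟩⟩ := exists_frameFamily isOpen_univ (isOpen_target x) hθ hJ
    (fun t _ z hz => hP.chartPseudo hz) (mem_univ (0 : ℝ)) hy
  obtain ⟨f, -⟩ := F.slice 0 h0
  exact ⟨Ω', hΩ', hy', ⟨f⟩⟩

lemma IsPseudohermitian.exists_unitaryFrame (hP : IsPseudohermitian J θ) (p : M) :
    ∃ U : Set M, p ∈ U ∧ Nonempty (UnitaryFrame J θ U) := by
  obtain ⟨Ω, -, hy, ⟨f⟩⟩ := hP.exists_chartFrame (mem_extChartAt_target (I := 𝓡 3) p)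
  exact ⟨_, (show p ∈ chartPre p Ω from ⟨mem_extChartAt_source p, hy⟩), ⟨f.toUnitary⟩⟩

namespace UnitaryFrame

variable {U : Set M} (f : UnitaryFrame J θ U)

/-- The coefficient of `E₁₁` in the first variation with respect to the CR structure. -/
def gradJ (p : M) : ℂ :=
  2 * Complex.I * f.R_bb p - 2 * f.Rc p * f.Abar p + Complex.I * f.Abar_0 p

/-- Half of the coefficient of `h` in the first variation with respect to the contact form. -/
def gradθ (p : M) : ℂ := -8 * f.D1bar 1 (f.D1 0 f.Rc) p + 2 * Complex.I * f.A_bb p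

/-- Half of the integrand of the first variation. -/
def varInt (e hc : M → ℂ) (p : M) : ℂ := f.gradJ p * e p + f.gradθ p * hc p

/-- The `Z_1̄`-component of the boundary term of the first variation. -/
def bdryW (e hc : M → ℂ) (p : M) : ℂ :=
  2 * Complex.I * (f.Rc p * f.D1bar 2 e p - f.D1bar 0 f.Rc p * e p)
    - 8 * (f.Rc p * f.D1 0 hc p - hc p * f.D1 0 f.Rc p)
    + 2 * Complex.I * (f.D1bar 0 hc p * f.A p - hc p * f.D1bar 2 f.A p)

/-- The vector field of the boundary term of the first variation. -/
def bdryVec (e hc : M → ℂ) (p : M) : TangentSpace (𝓡 3) p :=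
  (f.bdryW e hc p).re • f.X p + (-(f.bdryW e hc p).im) • f.Y p
    + (2 * (-Complex.I * (e p * f.Abar p)).re) • f.T p

variable (hP : IsPseudohermitian J θ) (x : M) {y : E3} (hy : y ∈ chartSet x U)
include hy

lemma D1bar_D1bar_symm (k l : ℤ) (u : M → ℂ) :
    f.D1bar k (f.D1bar l u) ((extChartAt (𝓡 3) x).symm y) =
      (f.toChart hP x).Db k ((f.toChart hP x).Db l (u ∘ (extChartAt (𝓡 3) x).symm)) y := by
  rw [f.D1bar_symm hP x k _ hy]
  exact (f.toChart hP x).Db_congr k (fun z hz => f.D1bar_symm hP x l u hz) hy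

lemma D1bar_D1_symm (k l : ℤ) (u : M → ℂ) :
    f.D1bar k (f.D1 l u) ((extChartAt (𝓡 3) x).symm y) =
      (f.toChart hP x).Db k ((f.toChart hP x).D1 l (u ∘ (extChartAt (𝓡 3) x).symm)) y := by
  rw [f.D1bar_symm hP x k _ hy]
  exact (f.toChart hP x).Db_congr k (fun z hz => f.D1_symm hP x l u hz) hy

lemma D1_D1bar_symm (k l : ℤ) (u : M → ℂ) :
    f.D1 k (f.D1bar l u) ((extChartAt (𝓡 3) x).symm y) =
      (f.toChart hP x).D1 k ((f.toChart hP x).Db l (u ∘ (extChartAt (𝓡 3) x).symm)) y := by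
  rw [f.D1_symm hP x k _ hy]
  exact (f.toChart hP x).D1_congr k (fun z hz => f.D1bar_symm hP x l u hz) hy

lemma D1_D1_symm (k l : ℤ) (u : M → ℂ) :
    f.D1 k (f.D1 l u) ((extChartAt (𝓡 3) x).symm y) =
      (f.toChart hP x).D1 k ((f.toChart hP x).D1 l (u ∘ (extChartAt (𝓡 3) x).symm)) y := by
  rw [f.D1_symm hP x k _ hy]
  exact (f.toChart hP x).D1_congr k (fun z hz => f.D1_symm hP x l u hz) hy

lemma gradJ_symm : f.gradJ ((extChartAt (𝓡 3) x).symm y) = (f.toChart hP x).gradJ y := by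
  rw [gradJ, R_bb, Abar_0, f.D1bar_D1bar_symm hP x hy, f.D0_symm hP x _ _ hy]
  rfl

lemma gradθ_symm : f.gradθ ((extChartAt (𝓡 3) x).symm y) = (f.toChart hP x).gradθ y := by
  rw [gradθ, A_bb, f.D1bar_D1bar_symm hP x hy, f.D1bar_D1_symm hP x hy]
  rfl

lemma varInt_symm (e hc : M → ℂ) : f.varInt e hc ((extChartAt (𝓡 3) x).symm y) =
    (f.toChart hP x).varInt (e ∘ (extChartAt (𝓡 3) x).symm) (hc ∘ (extChartAt (𝓡 3) x).symm) y := by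
  rw [varInt, f.gradJ_symm hP x hy, f.gradθ_symm hP x hy]
  rfl

lemma bdryW_symm (e hc : M → ℂ) : f.bdryW e hc ((extChartAt (𝓡 3) x).symm y) =
    (f.toChart hP x).bdryW (e ∘ (extChartAt (𝓡 3) x).symm) (hc ∘ (extChartAt (𝓡 3) x).symm) y := by
  simp only [bdryW, f.D1bar_symm hP x _ _ hy, f.D1_symm hP x _ _ hy]
  rfl

lemma chartVec_bdryVec (e hc : M → ℂ) : chartVec (f.bdryVec e hc) x y =
    (f.toChart hP x).bdryVec (e ∘ (extChartAt (𝓡 3) x).symm) (hc ∘ (extChartAt (𝓡 3) x).symm) y := by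
  rw [chartVec, bdryVec, f.bdryW_symm hP x hy]
  simp only [map_add, map_smul]
  rfl

lemma E11_symm' (E : EndField M) : f.E11 E ((extChartAt (𝓡 3) x).symm y) =
    (f.toChart hP x).endComp (chartEnd E x) y := f.E11_symm hP x E hy

end UnitaryFrame

section Gauge

variable (hP : IsPseudohermitian J θ) {x : M} {Ω : Set E3} {U : Set M}
  (c : ChartFrame (chartEnd J x) (chartForm θ x) Ω) (f : UnitaryFrame J θ U)
include hP

/-- A frame in a chart and a frame on the manifold differ by a unitary factor. -/
lemma exists_gaugeRel_toChart (hO : IsOpen (Ω ∩ chartSet x U)) :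
    ∃ g, ChartFrame.GaugeRel (c.restrict inter_subset_left hO)
      ((f.toChart hP x).restrict inter_subset_right hO) g :=
  ⟨_, ChartFrame.exists_gaugeRel _ _ fun _ hy => (hP.chartPseudo hy.2.1).sq_J⟩

variable {y : E3} (hy : y ∈ Ω) (hyU : y ∈ chartSet x U)
include hy hyU

lemma R_eq_of_chart : f.R ((extChartAt (𝓡 3) x).symm y) = c.R y := by
  have hO := c.isOpen.inter (isOpen_chartSet x f.isOpen)
  obtain ⟨g, h⟩ := exists_gaugeRel_toChart hP c f hO
  exact Complex.ofReal_injective (h.Rc_eq ⟨hy, hyU⟩)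

lemma norm_A_eq_of_chart : ‖f.A ((extChartAt (𝓡 3) x).symm y)‖ = ‖c.A y‖ := by
  have hO := c.isOpen.inter (isOpen_chartSet x f.isOpen)
  obtain ⟨g, h⟩ := exists_gaugeRel_toChart hP c f hO
  have h1 := h.comp_A.eq y ⟨hy, hyU⟩
  have h2 : ‖g y‖ = 1 := by
    have := h.norm y ⟨hy, hyU⟩
    rw [Complex.mul_conj, Complex.normSq_eq_norm_sq] at this
    have h3 : ‖g y‖ ^ 2 = 1 := by exact_mod_cast this
    exact (pow_eq_one_iff_of_nonneg (norm_nonneg _) two_ne_zero).1 h3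
  have h4 : f.A ((extChartAt (𝓡 3) x).symm y) = g y ^ (-2 : ℤ) * c.A y := h1
  rw [h4, norm_mul, norm_zpow, h2, one_zpow, one_mul]

-- The value of `websterR` is selected among the curvatures of all frames around the point. A chart
-- frame shows that there is one, and any selected frame is gauge related to the given chart frame,
-- so it has the same curvature.
omit f hyU in
lemma websterR_symm (hyt : y ∈ (extChartAt (𝓡 3) x).target) :
    websterR J θ ((extChartAt (𝓡 3) x).symm y) = c.R y := by
  have hp : (extChartAt (𝓡 3) x).symm y ∈ chartPre x Ω :=
    ⟨(extChartAt (𝓡 3) x).map_target hyt, by rwa [mem_preimage, (extChartAt (𝓡 3) x).right_inv hyt]⟩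
  obtain ⟨U, f, hpU, h⟩ := Classical.epsilon_spec
    (p := fun r : ℝ => ∃ (U : Set M) (f : UnitaryFrame J θ U),
      (extChartAt (𝓡 3) x).symm y ∈ U ∧ f.R ((extChartAt (𝓡 3) x).symm y) = r)
    ⟨_, _, c.toUnitary, hp, rfl⟩
  rw [websterR, ← h]
  exact R_eq_of_chart hP c f hy ⟨hyt, hpU⟩

omit f hyU in
lemma torsionSq_symm (hyt : y ∈ (extChartAt (𝓡 3) x).target) :
    torsionSq J θ ((extChartAt (𝓡 3) x).symm y) = ‖c.A y‖ ^ 2 := by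
  have hp : (extChartAt (𝓡 3) x).symm y ∈ chartPre x Ω :=
    ⟨(extChartAt (𝓡 3) x).map_target hyt, by rwa [mem_preimage, (extChartAt (𝓡 3) x).right_inv hyt]⟩
  obtain ⟨U, f, hpU, h⟩ := Classical.epsilon_spec
    (p := fun r : ℝ => ∃ (U : Set M) (f : UnitaryFrame J θ U),
      (extChartAt (𝓡 3) x).symm y ∈ U ∧ ‖f.A ((extChartAt (𝓡 3) x).symm y)‖ ^ 2 = r)
    ⟨_, _, c.toUnitary, hp, rfl⟩
  rw [torsionSq, ← h, norm_A_eq_of_chart hP c f hy ⟨hyt, hpU⟩]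

variable {E : EndField M} {hm : M → ℂ} (he : ContDiffOn ℝ ∞ (c.endComp (chartEnd E x)) Ω)
include he

lemma varInt_eq_of_chart : f.varInt (f.E11 E) hm ((extChartAt (𝓡 3) x).symm y) =
    c.varInt (c.endComp (chartEnd E x)) (hm ∘ (extChartAt (𝓡 3) x).symm) y := by
  have hO := c.isOpen.inter (isOpen_chartSet x f.isOpen)
  obtain ⟨g, h⟩ := exists_gaugeRel_toChart hP c f hO
  have hcomp : ChartFrame.IsComp (c.restrict inter_subset_left hO) g 2 (c.endComp (chartEnd E x))
      (f.E11 E ∘ (extChartAt (𝓡 3) x).symm) :=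
    ⟨he.mono inter_subset_left, fun z hz => by
      rw [Function.comp_apply, f.E11_symm' hP x hz.2]
      exact h.comp_end hz⟩
  have h1 := h.gradJ_mul_eq hcomp ⟨hy, hyU⟩
  have h2 := h.gradθ_eq ⟨hy, hyU⟩
  rw [f.varInt_symm hP x hyU, ChartFrame.varInt, ChartFrame.varInt]
  exact congrArg₂ _ h1 (congrArg (· * _) h2)

lemma bdryVec_eq_of_chart (hh : ContDiffOn ℝ ∞ (hm ∘ (extChartAt (𝓡 3) x).symm) Ω) :
    chartVec (f.bdryVec (f.E11 E) hm) x y =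
      c.bdryVec (c.endComp (chartEnd E x)) (hm ∘ (extChartAt (𝓡 3) x).symm) y := by
  have hO := c.isOpen.inter (isOpen_chartSet x f.isOpen)
  obtain ⟨g, h⟩ := exists_gaugeRel_toChart hP c f hO
  have hcomp : ChartFrame.IsComp (c.restrict inter_subset_left hO) g 2 (c.endComp (chartEnd E x))
      (f.E11 E ∘ (extChartAt (𝓡 3) x).symm) :=
    ⟨he.mono inter_subset_left, fun z hz => by
      rw [Function.comp_apply, f.E11_symm' hP x hz.2]
      exact h.comp_end hz⟩
  have hw := h.bdryW_eq hcomp (hh.mono inter_subset_left) ⟨hy, hyU⟩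
  have hz := h.bdryZ_eq hcomp ⟨hy, hyU⟩
  rw [f.chartVec_bdryVec hP x hyU]
  exact h.realVec_eq ⟨hy, hyU⟩ hw hz

end Gauge

end CR3

end

/-! ### Differentiating the energy along a variation -/

noncomputable section

namespace CR3

/-- Differentiation under the integral over a compact space, from local bounds. -/
lemma hasDerivAt_integral_of_locally {M : Type*} [TopologicalSpace M] [CompactSpace M]
    [MeasurableSpace M] [BorelSpace M] (μ : Measure M) [IsFiniteMeasure μ] {G : ℝ → M → ℝ}
    {G' : M → ℝ} (hG' : Continuous G') (hd : ∀ p, HasDerivAt (fun t => G t p) (G' p) 0)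
    (hloc : ∀ p, ∃ N ∈ 𝓝 p, ∃ δ > 0, ∃ C : ℝ, ∀ t : ℝ, |t| < δ → ∀ q ∈ N,
      ContinuousAt (G t) q ∧ ∃ d, HasDerivAt (fun s => G s q) d t ∧ |d| ≤ C) :
    HasDerivAt (fun t => ∫ p, G t p ∂μ) (∫ p, G' p ∂μ) 0 := by
  choose N hN δ hδ C hC using hloc
  obtain ⟨s, hs⟩ := CompactSpace.elim_nhds_subcover N hN
  -- A finite subcover allows the smallest time interval and the largest bound; the empty case
  -- occurs only when the space itself is empty.
  obtain ⟨δ₀, hδ₀, hδs⟩ : ∃ δ₀ > 0, ∀ p ∈ s, δ₀ ≤ δ p := by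
    rcases s.eq_empty_or_nonempty with rfl | hne
    · exact ⟨1, one_pos, by simp⟩
    · obtain ⟨p, hp, h⟩ := s.exists_min_image δ hne
      exact ⟨δ p, hδ p, h⟩
  obtain ⟨C₀, hCs⟩ : ∃ C₀, ∀ p ∈ s, C p ≤ C₀ := by
    rcases s.eq_empty_or_nonempty with rfl | hne
    · exact ⟨1, by simp⟩
    · obtain ⟨p, hp, h⟩ := s.exists_max_image C hne
      exact ⟨C p, h⟩
  have key : ∀ t : ℝ, |t| < δ₀ → ∀ q, ContinuousAt (G t) q ∧
      ∃ d, HasDerivAt (fun s => G s q) d t ∧ |d| ≤ C₀ := by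
    intro t ht q
    obtain ⟨p, hp, hq⟩ := mem_iUnion₂.1 (hs.symm ▸ mem_univ q : q ∈ ⋃ x ∈ s, N x)
    obtain ⟨h1, d, h2, h3⟩ := hC p t (ht.trans_le (hδs p hp)) q hq
    exact ⟨h1, d, h2, h3.trans (hCs p hp)⟩
  have hcont : ∀ t : ℝ, |t| < δ₀ → Continuous (G t) := fun t ht =>
    continuous_iff_continuousAt.2 fun q => (key t ht q).1
  have hball : Metric.ball (0 : ℝ) δ₀ ∈ 𝓝 (0 : ℝ) := Metric.ball_mem_nhds 0 hδ₀
  have hmem : ∀ t ∈ Metric.ball (0 : ℝ) δ₀, |t| < δ₀ := fun t ht => by simpa using ht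
  have := (hasDerivAt_integral_of_dominated_loc_of_deriv_le (μ := μ) (F := G)
    (F' := fun t p => deriv (fun s => G s p) t) (x₀ := (0 : ℝ)) (bound := fun _ => C₀) hball
    (Filter.eventually_of_mem hball fun t ht => (hcont t (hmem t ht)).stronglyMeasurable.aestronglyMeasurable)
    ((hcont 0 (by simpa using hδ₀)).integrable_of_hasCompactSupport
      (HasCompactSupport.of_compactSpace _))
    (by
      have : (fun p => deriv (fun s => G s p) 0) = G' := funext fun p => (hd p).deriv
      rw [this]
      exact hG'.stronglyMeasurable.aestronglyMeasurable)
    (Filter.Eventually.of_forall fun p t ht => by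
      obtain ⟨-, d, h2, h3⟩ := key t (hmem t ht) p
      rw [h2.deriv]; exact h3)
    (integrable_const C₀)
    (Filter.Eventually.of_forall fun p t ht => by
      obtain ⟨-, d, h2, h3⟩ := key t (hmem t ht) p
      rw [h2.deriv]; exact h2)).2
  refine this.congr_deriv (integral_congr_ae (Filter.Eventually.of_forall fun p => (hd p).deriv))

lemma hasDerivAt_comp_clm (L : E3 →L[ℝ] E3) {u : ℝ → E3} {u' : E3} {t : ℝ}
    (h : HasDerivAt u u' t) : HasDerivAt (fun s => L (u s)) (L u') t :=
  L.hasFDerivAt.comp_hasDerivAt t h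

variable {M : Type*} [TopologicalSpace M] [ChartedSpace E3 M] [IsManifold (𝓡 3) ∞ M]

/-- A smooth variation of pseudohermitian structures with fixed contact bundle, with `δJ = 2E` and
`δθ = 2hθ`. -/
structure IsVariation (Jt : ℝ → EndField M) (θt : ℝ → OneForm M ℝ) (E : EndField M) (h : M → ℝ)
    (ε : ℝ) : Prop where
  pos : 0 < ε
  smooth_J : SmoothEndFieldFamily Jt (Ioo (-ε) ε ×ˢ univ)
  smooth_θ : SmoothOneFormFamily θt (Ioo (-ε) ε ×ˢ univ)
  pseudo : ∀ t ∈ Ioo (-ε) ε, IsPseudohermitian (Jt t) (θt t)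
  ker_eq : ∀ t ∈ Ioo (-ε) ε, ∀ p v, θt t p v = 0 ↔ θt 0 p v = 0
  deriv_J : ∀ p v, θt 0 p v = 0 → HasDerivAt (fun t => Jt t p v) ((2 : ℝ) • E p v) 0
  deriv_θ : ∀ p v, HasDerivAt (fun t => θt t p v) (2 * h p * θt 0 p v) 0

namespace IsVariation

variable {Jt : ℝ → EndField M} {θt : ℝ → OneForm M ℝ} {E : EndField M} {h : M → ℝ} {ε : ℝ}
  (hv : IsVariation Jt θt E h ε)
include hv

lemma zero_mem : (0 : ℝ) ∈ Ioo (-ε) ε := ⟨neg_lt_zero.2 hv.pos, hv.pos⟩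

lemma base : IsPseudohermitian (Jt 0) (θt 0) := hv.pseudo 0 hv.zero_mem

/-- The defining conditions of the variation are pointwise, so they pass to chart coordinates; the
derivative of J_t is transported by the fixed linear map given by the derivative of the chart. -/
lemma exists_chartVariation {x : M} {y : E3} (hy : y ∈ (extChartAt (𝓡 3) x).target) :
    ∃ I' ⊆ Ioo (-ε) ε, ∃ Ω' ⊆ (extChartAt (𝓡 3) x).target, y ∈ Ω' ∧
      Nonempty (ChartVariation (fun z => chartEnd (Jt z.1) x z.2)
        (fun z => chartForm (θt z.1) x z.2) I' Ω' (h ∘ (extChartAt (𝓡 3) x).symm)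
        (chartEnd E x)) := by
  obtain ⟨I', hI', Ω', hΩ', h0, hy', ⟨F⟩⟩ := exists_frameFamily isOpen_Ioo (isOpen_target x)
    (hv.smooth_θ.contDiffOn x) (hv.smooth_J.contDiffOn x)
    (fun t ht z hz => (hv.pseudo t ht).chartPseudo hz) hv.zero_mem hy
  refine ⟨I', hI', Ω', hΩ', hy', ⟨{ F with
    zero_mem := h0
    pseudo := fun t ht z hz => (hv.pseudo t (hI' ht)).chartPseudo (hΩ' hz)
    ker_eq := fun t ht z hz v => hv.ker_eq t (hI' ht) _ _
    deriv_θ := fun z hz v => hv.deriv_θ ((extChartAt (𝓡 3) x).symm z) (dChartSymm x z v)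
    deriv_J := fun z hz v hzv => ?_ }⟩⟩
  have h1 : HasDerivAt (fun t => (Jt t ((extChartAt (𝓡 3) x).symm z) (dChartSymm x z v) : E3))
      ((2 : ℝ) • E ((extChartAt (𝓡 3) x).symm z) (dChartSymm x z v) : E3) 0 :=
    hv.deriv_J _ (dChartSymm x z v) hzv
  have h2 := hasDerivAt_comp_clm (dChart x ((extChartAt (𝓡 3) x).symm z) : E3 →L[ℝ] E3)
    (u := fun t => (Jt t ((extChartAt (𝓡 3) x).symm z) (dChartSymm x z v) : E3)) h1
  exact h2.congr_deriv (map_smul (dChart x ((extChartAt (𝓡 3) x).symm z) : E3 →L[ℝ] E3) (2 : ℝ)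
    (E ((extChartAt (𝓡 3) x).symm z) (dChartSymm x z v) : E3))

/-- A vector field on which the base contact form takes the value one. -/
lemma exists_unit (p : M) : ∃ v : TangentSpace (𝓡 3) p, θt 0 p v = 1 := by
  obtain ⟨U, hp, ⟨f⟩⟩ := hv.base.exists_unitaryFrame p
  exact ⟨f.T p, (f.reeb p hp).1⟩

/-- The conformal factor of `θt t` with respect to `θt 0`. -/
def factor (t : ℝ) (p : M) : ℝ := θt t p (hv.exists_unit p).choose

/-- Two linear functionals with the same kernel are proportional, and the ratio is the value on any
vector where the base form equals one. -/
lemma apply_eq_factor {t : ℝ} (ht : t ∈ Ioo (-ε) ε) (p : M) (v : TangentSpace (𝓡 3) p) :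
    θt t p v = hv.factor t p * θt 0 p v := by
  have h1 := (hv.exists_unit p).choose_spec
  have h2 : θt t p (v - θt 0 p v • (hv.exists_unit p).choose) = 0 := by
    rw [hv.ker_eq t ht, map_sub, map_smul, h1]
    simp
  rw [map_sub, map_smul, smul_eq_mul, sub_eq_zero] at h2
  rw [h2, factor, mul_comm]

lemma eq_factor_smul {t : ℝ} (ht : t ∈ Ioo (-ε) ε) : θt t = fun p => hv.factor t p • θt 0 p := by
  funext p
  ext v
  exact hv.apply_eq_factor ht p v

lemma factor_symm {t : ℝ} (ht : t ∈ Ioo (-ε) ε) {x : M} {y w : E3}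
    (hw : chartForm (θt 0) x y w = 1) :
    hv.factor t ((extChartAt (𝓡 3) x).symm y) = chartForm (θt t) x y w := by
  rw [chartForm_apply] at hw ⊢
  rw [hv.apply_eq_factor ht, hw, mul_one]

/-- The factor is defined with an arbitrary choice of vector at each point. The choice does not
matter, so locally the Reeb field may be used, and then the factor is smooth. -/
lemma contDiffOn_factor {t : ℝ} (ht : t ∈ Ioo (-ε) ε) (x : M) :
    ContDiffOn ℝ ∞ (hv.factor t ∘ (extChartAt (𝓡 3) x).symm) (extChartAt (𝓡 3) x).target := by
  intro y hy
  obtain ⟨Ω, hΩ, hyΩ, ⟨f⟩⟩ := hv.base.exists_chartFrame hy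
  have h1 : ContDiffOn ℝ ∞ (fun z => chartForm (θt t) x z (f.T z)) Ω :=
    (((hv.smooth_θ.slice ht).contDiffOn_target x).mono hΩ).clm_apply f.smooth_T
  have h2 : ContDiffOn ℝ ∞ (hv.factor t ∘ (extChartAt (𝓡 3) x).symm) Ω :=
    h1.congr fun z hz => hv.factor_symm ht (f.dual z hz).θT
  exact (h2.contDiffAt (f.isOpen.mem_nhds hyΩ)).contDiffWithinAt

lemma continuous_factor {t : ℝ} (ht : t ∈ Ioo (-ε) ε) : Continuous (hv.factor t) :=
  continuous_of_charts fun x => (hv.contDiffOn_factor ht x).continuousOn.continuousAt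
    (target_mem_nhds x (mem_extChartAt_target x))

/-- The density of the energy with respect to the volume form of the base structure. -/
def dens (t : ℝ) (p : M) : ℝ :=
  hv.factor t p ^ 2 * (websterR (Jt t) (θt t) p ^ 2 - torsionSq (Jt t) (θt t) p)

/-- The volume form of φθ is φ² times that of θ. Moving this factor into the integrand makes the
measure independent of time. -/
lemma energy_eq [CompactSpace M] [MeasurableSpace M] [BorelSpace M] {t : ℝ}
    (ht : t ∈ Ioo (-ε) ε) :
    energy (Jt t) (θt t) = ∫ p, hv.dens t p ∂(contactVolume (θt 0)) := by
  have h1 : contactVolume (θt t) =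
      (contactVolume (θt 0)).withDensity fun p => ENNReal.ofReal (hv.factor t p ^ 2) := by
    conv_lhs => rw [hv.eq_factor_smul ht]
    exact contactVolume_smul hv.base.smooth_form (hv.continuous_factor ht)
      (hv.contDiffOn_factor ht) (hv.eq_factor_smul ht ▸ (hv.pseudo t ht).smooth_form)
  have hm : Measurable fun p => hv.factor t p ^ 2 := (hv.continuous_factor ht).measurable.pow_const 2
  rw [energy, h1, integral_withDensity_eq_integral_toReal_smul₀
    hm.ennreal_ofReal.aemeasurable (by simp)]
  refine integral_congr_ae (Filter.Eventually.of_forall fun p => ?_)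
  simp only [dens]
  rw [ENNReal.toReal_ofReal (sq_nonneg _), smul_eq_mul]

section Chart

variable {x : M} {I' : Set ℝ} (hI' : I' ⊆ Ioo (-ε) ε) {Ω' : Set E3}
  (hΩ' : Ω' ⊆ (extChartAt (𝓡 3) x).target)
  (V : ChartVariation (fun z => chartEnd (Jt z.1) x z.2) (fun z => chartForm (θt z.1) x z.2) I' Ω'
    (h ∘ (extChartAt (𝓡 3) x).symm) (chartEnd E x))
include hI' hΩ'

/-- The globally selected curvature, torsion norm and factor agree with those of the frame family in
the chart. This transfers joint smoothness in time and space to the pointwise defined density. -/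
lemma dens_symm {t : ℝ} (ht : t ∈ I') {y : E3} (hy : y ∈ Ω') :
    hv.dens t ((extChartAt (𝓡 3) x).symm y) = V.dens (t, y) := by
  obtain ⟨f, -, -, hA, hR⟩ := V.slice t ht
  have hP := hv.pseudo t (hI' ht)
  rw [dens, websterR_symm hP f hy (hΩ' hy), torsionSq_symm hP f hy (hΩ' hy), hA, hR,
    hv.factor_symm (hI' ht) (V.base.dual y hy).θT]
  rfl


include V in
lemma hasDerivAt_dens {t : ℝ} (ht : t ∈ I') {y : E3} (hy : y ∈ Ω') :
    HasDerivAt (fun s => hv.dens s ((extChartAt (𝓡 3) x).symm y))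
      (fderiv ℝ V.dens (t, y) (1, 0)) t := by
  have hd := (diffAt_of_contDiffOn V.smooth_dens (V.isOpen_left.prod V.isOpen_right)
    (mk_mem_prod ht hy)).hasFDerivAt
  have h1 : HasDerivAt (fun t : ℝ => (t, y)) ((1 : ℝ), (0 : E3)) t :=
    (hasDerivAt_id t).prodMk (hasDerivAt_const t y)
  have h2 : HasDerivAt (fun s => V.dens (s, y)) (fderiv ℝ V.dens (t, y) (1, 0)) t :=
    HasFDerivAt.comp_hasDerivAt (l := V.dens) t hd h1
  refine h2.congr_of_eventuallyEq ?_
  filter_upwards [V.isOpen_left.mem_nhds ht] with s hs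
  exact hv.dens_symm hI' hΩ' V hs hy

omit hI' in
lemma varInt_symm {U : Set M} (f : UnitaryFrame (Jt 0) (θt 0) U) {y : E3} (hy : y ∈ Ω')
    (hyU : (extChartAt (𝓡 3) x).symm y ∈ U) :
    f.varInt (f.E11 E) (fun p => (h p : ℂ)) ((extChartAt (𝓡 3) x).symm y) = V.varHalf y :=
  varInt_eq_of_chart hv.base V.base f hy ⟨hΩ' hy, hyU⟩ V.smooth_e

omit hI' in
lemma bdryVec_symm {U : Set M} (f : UnitaryFrame (Jt 0) (θt 0) U) {y : E3} (hy : y ∈ Ω')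
    (hyU : (extChartAt (𝓡 3) x).symm y ∈ U) :
    chartVec (f.bdryVec (f.E11 E) (fun p => (h p : ℂ))) x y = V.base.bdryVec V.e V.hc y :=
  bdryVec_eq_of_chart hv.base V.base f hy ⟨hΩ' hy, hyU⟩ V.smooth_e V.smooth_hc

end Chart

lemma exists_frames : ∃ U : M → Set M, (∀ p, p ∈ U p) ∧
    Nonempty (∀ p, UnitaryFrame (Jt 0) (θt 0) (U p)) := by
  choose U hU f using hv.base.exists_unitaryFrame
  exact ⟨U, hU, ⟨fun p => (f p).some⟩⟩

/-- The derivative of the energy is the integral of the derivative of its density. -/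
lemma hasDerivAt_energy_aux [CompactSpace M] [MeasurableSpace M] [BorelSpace M] {G' : M → ℝ}
    (hG' : Continuous G') (hd : ∀ p, HasDerivAt (fun t => hv.dens t p) (G' p) 0) :
    HasDerivAt (fun t => energy (Jt t) (θt t)) (∫ p, G' p ∂(contactVolume (θt 0))) 0 := by
  have := isFiniteMeasure_contactVolume hv.base.smooth_form
  refine (hasDerivAt_integral_of_locally (contactVolume (θt 0)) (G := hv.dens) hG' hd
    fun x => ?_).congr_of_eventuallyEq (by
      filter_upwards [isOpen_Ioo.mem_nhds hv.zero_mem] with t ht using hv.energy_eq ht)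
  obtain ⟨I', hI', Ω', hΩ', hy, ⟨V⟩⟩ :=
    hv.exists_chartVariation (mem_extChartAt_target (I := 𝓡 3) x)
  set y₀ := extChartAt (𝓡 3) x x with hy₀
  have hO : IsOpen (I' ×ˢ Ω') := V.isOpen_left.prod V.isOpen_right
  -- A closed ball of the product ℝ × `E3` inside the domain of the frame family is compact, so the
  -- time derivative of the density is bounded on it, uniformly in time and space.
  obtain ⟨r, hr, hrs⟩ := Metric.nhds_basis_closedBall.mem_iff.1
    (hO.mem_nhds (mk_mem_prod V.zero_mem hy))
  have hc : ContinuousOn (fun z => fderiv ℝ V.dens z (1, 0)) (I' ×ˢ Ω') :=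
    ((V.smooth_dens.fderiv_of_isOpen (m := ∞) hO (by simp)).clm_apply contDiffOn_const).continuousOn
  obtain ⟨C, hC⟩ := (isCompact_closedBall ((0 : ℝ), y₀) r).exists_bound_of_continuousOn
    (hc.mono hrs)
  refine ⟨chartPre x (Metric.ball y₀ r), (isOpen_chartPre x Metric.isOpen_ball).mem_nhds
    ⟨mem_extChartAt_source x, Metric.mem_ball_self hr⟩, r, hr, C, fun t ht q hq => ?_⟩
  obtain ⟨y, hyb, rfl, -⟩ := ChartFrame.chartPre_eq hq
  have hmem : (t, y) ∈ Metric.closedBall ((0 : ℝ), y₀) r := by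
    rw [← closedBall_prod_same]
    exact ⟨by simpa using ht.le, Metric.ball_subset_closedBall hyb.2⟩
  have hty := hrs hmem
  constructor
  · refine continuousAt_iff_chart ((extChartAt (𝓡 3) x).map_target hyb.1) ?_
    rw [(extChartAt (𝓡 3) x).right_inv hyb.1]
    have h1 : ContDiffOn ℝ ∞ (fun y => V.dens (t, y)) Ω' := ContDiffOn.slice V.smooth_dens hty.1
    refine (h1.continuousOn.continuousAt (V.isOpen_right.mem_nhds hty.2)).congr ?_
    filter_upwards [V.isOpen_right.mem_nhds hty.2] with z hz
    exact (hv.dens_symm hI' hΩ' V hty.1 hz).symm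
  · exact ⟨_, hv.hasDerivAt_dens hI' hΩ' V hty.1 hty.2, hC _ hmem⟩

omit hv in
lemma re_eq_of_eq {a : ℝ} {z w : ℂ} (h : (a : ℂ) = (z + conj z) + (w + conj w)) :
    a - 2 * z.re = 2 * w.re := by
  have h3 := congrArg Complex.re h
  simp only [Complex.add_re, Complex.ofReal_re, Complex.conj_re] at h3
  rw [h3]; ring

/-- The derivative of the energy density differs from the integrand of the first variation by a
divergence. -/
lemma exists_divg {U : M → Set M} (hU : ∀ p, p ∈ U p)
    (f : ∀ p, UnitaryFrame (Jt 0) (θt 0) (U p)) (x : M) :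
    ∃ N, IsOpen N ∧ x ∈ N ∧ N ⊆ (extChartAt (𝓡 3) x).source ∧
      ContDiffOn ℝ ∞ (chartVec (fun p => (f p).bdryVec ((f p).E11 E) (fun p => (h p : ℂ)) p) x)
        (chartSet x N) ∧ ∀ y ∈ chartSet x N,
        divg (fun y => wedgeStd (chartForm (θt 0) x) y •
          chartVec (fun p => (f p).bdryVec ((f p).E11 E) (fun p => (h p : ℂ)) p) x y) y =
          wedgeStd (chartForm (θt 0) x) y *
            (deriv (fun t => hv.dens t ((extChartAt (𝓡 3) x).symm y)) 0
              - 2 * ((f ((extChartAt (𝓡 3) x).symm y)).varInt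
                  ((f ((extChartAt (𝓡 3) x).symm y)).E11 E) (fun p => (h p : ℂ))
                  ((extChartAt (𝓡 3) x).symm y)).re) := by
  obtain ⟨I', hI', Ω', hΩ', hy, ⟨V⟩⟩ :=
    hv.exists_chartVariation (mem_extChartAt_target (I := 𝓡 3) x)
  have hw := V.base.smooth_bdryW V.smooth_e V.smooth_hc
  have hz := V.base.smooth_bdryZ V.smooth_e
  set W : VField M := fun p => (f p).bdryVec ((f p).E11 E) (fun p => (h p : ℂ)) p with hW
  -- The field is assembled from unrelated frames, one for each point. Frame independence identifies
  -- it with the smooth boundary field of the chart frame.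
  have hWe : ∀ y ∈ Ω', chartVec W x y = V.base.bdryVec V.e V.hc y := by
    intro y hy
    rw [← hv.bdryVec_symm hΩ' V (f ((extChartAt (𝓡 3) x).symm y)) hy (hU _), chartVec, chartVec]
  refine ⟨chartPre x Ω', isOpen_chartPre x V.isOpen_right, ⟨mem_extChartAt_source x, hy⟩,
    inter_subset_left, ?_⟩
  rw [ChartFrame.chartSet_chartPre]
  refine ⟨((V.base.smooth_realVec hw hz).mono inter_subset_right).congr
    fun y hy => hWe y hy.2, fun y hy => ?_⟩
  have he : (fun y => wedgeStd (chartForm (θt 0) x) y • chartVec W x y) =ᶠ[𝓝 y]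
      fun y => wedgeStd (chartForm (θt 0) x) y • V.base.bdryVec V.e V.hc y := by
    filter_upwards [V.isOpen_right.mem_nhds hy.2] with z hz
    rw [hWe z hz]
  have h1 : deriv (fun t => hv.dens t ((extChartAt (𝓡 3) x).symm y)) 0 = dt V.dens y :=
    (hv.hasDerivAt_dens hI' hΩ' V V.zero_mem hy.2).deriv
  rw [divg_congr he, h1, hv.varInt_symm hΩ' V (f _) hy.2 (hU _), re_eq_of_eq (V.dt_dens_eq hy.2)]
  exact V.base.divg_realVec hw hz hy.2

/-- The first variation of the energy. -/
theorem hasDerivAt_energy [CompactSpace M] [T2Space M] [MeasurableSpace M] [BorelSpace M] :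
    ∃ F : M → ℝ, (∀ (U : Set M) (f : UnitaryFrame (Jt 0) (θt 0) U), ∀ p ∈ U,
      F p = 2 * (f.varInt (f.E11 E) (fun p => (h p : ℂ)) p).re) ∧ Continuous F ∧
      HasDerivAt (fun t => energy (Jt t) (θt t)) (∫ p, F p ∂(contactVolume (θt 0))) 0 := by
  obtain ⟨U, hU, ⟨f⟩⟩ := hv.exists_frames
  -- A frame is chosen separately at each point; only the value there is used, and it does not
  -- depend on the choice. Continuity is recovered from the smooth integrand in chart frames.
  set F : M → ℝ := fun p => 2 * ((f p).varInt ((f p).E11 E) (fun p => (h p : ℂ)) p).re with hF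
  set W : VField M := fun p => (f p).bdryVec ((f p).E11 E) (fun p => (h p : ℂ)) p with hW
  set G' : M → ℝ := fun p => deriv (fun t => hv.dens t p) 0 with hG'
  have hcont : ∀ {u : M → ℝ}, (∀ x, ∃ Ω, IsOpen Ω ∧ extChartAt (𝓡 3) x x ∈ Ω ∧
      ∃ v : E3 → ℝ, ContinuousOn v Ω ∧ ∀ y ∈ Ω, u ((extChartAt (𝓡 3) x).symm y) = v y) →
      Continuous u := by
    intro u hu
    refine continuous_of_charts fun x => ?_
    obtain ⟨Ω, hΩ, hx, v, hv, he⟩ := hu x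
    refine (hv.continuousAt (hΩ.mem_nhds hx)).congr ?_
    filter_upwards [hΩ.mem_nhds hx] with y hy
    exact (he y hy).symm
  have hre : ∀ {u : E3 → ℂ} {Ω : Set E3}, ContDiffOn ℝ ∞ u Ω →
      ContinuousOn (fun y => 2 * (u y).re) Ω := fun hu =>
    continuousOn_const.mul (Complex.continuous_re.comp_continuousOn hu.continuousOn)
  have hFc : Continuous F := hcont fun x => by
    obtain ⟨I', hI', Ω', hΩ', hy, ⟨V⟩⟩ :=
      hv.exists_chartVariation (mem_extChartAt_target (I := 𝓡 3) x)
    exact ⟨Ω', V.isOpen_right, hy, _, hre V.smooth_varHalf, fun y hy => by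
      simp only [hF, hv.varInt_symm hΩ' V (f _) hy (hU _)]⟩
  have hG'c : Continuous G' := hcont fun x => by
    obtain ⟨I', hI', Ω', hΩ', hy, ⟨V⟩⟩ :=
      hv.exists_chartVariation (mem_extChartAt_target (I := 𝓡 3) x)
    exact ⟨Ω', V.isOpen_right, hy, dt V.dens, (contDiffOn_dt V.isOpen_left V.isOpen_right
      V.zero_mem V.smooth_dens).continuousOn, fun y hy =>
      (hv.hasDerivAt_dens hI' hΩ' V V.zero_mem hy).deriv⟩
  have hd : ∀ x, ∀ y ∈ (extChartAt (𝓡 3) x).target, HasDerivAt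
      (fun t => hv.dens t ((extChartAt (𝓡 3) x).symm y)) (G' ((extChartAt (𝓡 3) x).symm y)) 0 := by
    intro x y hyt
    obtain ⟨I', hI', Ω', hΩ', hy, ⟨V⟩⟩ := hv.exists_chartVariation hyt
    exact (hv.hasDerivAt_dens hI' hΩ' V V.zero_mem hy).differentiableAt.hasDerivAt
  have hFf : ∀ x, ∀ y ∈ (extChartAt (𝓡 3) x).target, ∀ (U : Set M)
      (f : UnitaryFrame (Jt 0) (θt 0) U), (extChartAt (𝓡 3) x).symm y ∈ U →
      F ((extChartAt (𝓡 3) x).symm y) =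
        2 * (f.varInt (f.E11 E) (fun p => (h p : ℂ)) ((extChartAt (𝓡 3) x).symm y)).re := by
    intro x y hyt U' f' hyU
    obtain ⟨I', hI', Ω', hΩ', hy, ⟨V⟩⟩ := hv.exists_chartVariation hyt
    rw [hv.varInt_symm hΩ' V f' hy hyU, ← hv.varInt_symm hΩ' V (f _) hy (hU _)]
  refine ⟨F, fun U' f' p hp => ?_, hFc, ?_⟩
  · have := hFf p _ (mem_extChartAt_target p) U' f'
    rw [(extChartAt (𝓡 3) p).left_inv (mem_extChartAt_source p)] at this
    exact this hp
  have hE := hv.hasDerivAt_energy_aux hG'c fun p => by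
    have := hd p _ (mem_extChartAt_target p)
    rwa [(extChartAt (𝓡 3) p).left_inv (mem_extChartAt_source p)] at this
  refine hE.congr_deriv ?_
  -- The difference between the true derivative of the density and the claimed integrand is a
  -- divergence, so both have the same integral.
  have hq : Continuous fun p => G' p - F p := hG'c.sub hFc
  have h0 : ∫ p, (G' p - F p) ∂(contactVolume (θt 0)) = 0 :=
    integral_eq_zero_of_divg hv.base.smooth_form hv.base.contact (V := W) hq
      (hv.exists_divg hU f)
  have hfin := isFiniteMeasure_contactVolume hv.base.smooth_form
  have hint : ∀ {f : M → ℝ}, Continuous f → Integrable f (contactVolume (θt 0)) := fun hf =>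
    hf.integrable_of_hasCompactSupport (HasCompactSupport.of_compactSpace _)
  rw [integral_sub (hint hG'c) (hint hFc), sub_eq_zero] at h0
  exact h0

end IsVariation

end CR3

end

/-! ### The gradients and the Euler–Lagrange expressions -/

noncomputable section

namespace CR3

namespace ChartFrame

variable {J : E3 → E3 →L[ℝ] E3} {θ : E3 → E3 →L[ℝ] ℝ} {Ω : Set E3} (f : ChartFrame J θ Ω)

/-- The gradient with respect to the contact form in terms of the curvature and the torsion. -/
lemma gradθ_add_conj {y : E3} (hy : y ∈ Ω) : f.gradθ y + conj (f.gradθ y) =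
    -8 * (f.Db 1 (f.D1 0 f.Rc) y + f.D1 (-1) (f.Db 0 f.Rc) y)
      - 2 * Complex.I * (f.D1 (-1) (f.D1 (-2) f.Abar) y - f.Db 1 (f.Db 2 f.A) y) := by
  have h1 : conj (f.Db 1 (f.D1 0 f.Rc) y) = f.D1 (-1) (f.Db 0 f.Rc) y := by
    rw [← f.D1_conj 1 hy (f.diffAt (f.smooth_D1 0 f.smooth_Rc) hy)]
    refine f.D1_congr (-1) (fun z hz => ?_) hy
    rw [← f.Db_conj 0 hz (f.diffAt f.smooth_Rc hz), neg_zero]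
    simp only [Rc, Complex.conj_ofReal]
    rfl
  have h2 : conj (f.Db 1 (f.Db 2 f.A) y) = f.D1 (-1) (f.D1 (-2) f.Abar) y := by
    rw [← f.D1_conj 1 hy (f.diffAt (f.smooth_Db 2 f.smooth_A) hy)]
    refine f.D1_congr (-1) (fun z hz => ?_) hy
    exact (f.D1_conj 2 hz (f.diffAt f.smooth_A hz)).symm
  simp only [gradθ, map_add, map_mul, map_neg, Complex.conj_I, Complex.conj_ofNat, h1, h2]
  ring

/-- The gradient with respect to the CR structure, through the commutation relation. -/
lemma conj_gradJ {y : E3} (hy : y ∈ Ω) : conj (f.gradJ y) =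
    -2 * Complex.I * (f.D1 1 (f.D1 0 f.Rc) y
      - Complex.I / 2 * (f.Db 3 (f.D1 2 f.A) y - f.D1 1 (f.Db 2 f.A) y)) := by
  have h1 : conj (f.Db (-1) (f.Db 0 f.Rc) y) = f.D1 1 (f.D1 0 f.Rc) y := by
    have := f.D1_conj (-1) hy (f.diffAt (f.smooth_Db 0 f.smooth_Rc) hy)
    rw [neg_neg] at this
    rw [← this]
    refine f.D1_congr 1 (fun z hz => ?_) hy
    rw [← f.D1_conj 0 hz (f.diffAt f.smooth_Rc hz), neg_zero]
    simp only [Rc, Complex.conj_ofReal]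
    rfl
  have h2 : conj (f.D0 (-2) f.Abar y) = f.D0 2 f.A y := by
    have := f.D0_conj 2 hy (f.diffAt f.smooth_A hy)
    change conj (f.D0 (-2) (fun z => conj (f.A z)) y) = _
    rw [this, Complex.conj_conj]
  -- For the weight-two component A₁₁ the commutation formula replaces iA_{11,0} + 2RA₁₁ by
  -- A_{11,11̄} - A_{11,1̄1}, which is the form in which the torsion enters the first equation.
  have h3 := f.commutation 2 f.smooth_A hy
  norm_num at h3
  have h4 : conj (f.Rc y) = f.Rc y := Complex.conj_ofReal _
  have h5 : conj (f.Abar y) = f.A y := Complex.conj_conj _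
  simp only [gradJ, map_add, map_sub, map_mul, Complex.conj_I, Complex.conj_ofNat, h1, h2, h4, h5]
  linear_combination h3 - (f.Db 3 (f.D1 2 f.A) y - f.D1 1 (f.Db 2 f.A) y) * Complex.I_sq

end ChartFrame

variable {M : Type*} [TopologicalSpace M] [ChartedSpace E3 M] [IsManifold (𝓡 3) ∞ M]
  {J : EndField M} {θ : OneForm M ℝ}

/-- A property of points holds if it holds in chart coordinates. -/
lemma of_symm {P : M → Prop} {U : Set M} {p : M} (hp : p ∈ U)
    (h : ∀ x : M, ∀ y ∈ chartSet x U, P ((extChartAt (𝓡 3) x).symm y)) : P p := by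
  have := h p _ (mem_chartSet (mem_extChartAt_source p) hp)
  rwa [(extChartAt (𝓡 3) p).left_inv (mem_extChartAt_source p)] at this

namespace UnitaryFrame

variable {U : Set M} (f : UnitaryFrame J θ U) (hP : IsPseudohermitian J θ)
include hP

lemma gradθ_add_conj {p : M} (hp : p ∈ U) : f.gradθ p + conj (f.gradθ p) =
    -8 * f.sublapR p - 2 * Complex.I * (f.Abar_11 p - f.A_bb p) := by
  refine of_symm (P := fun p => f.gradθ p + conj (f.gradθ p) =
    -8 * f.sublapR p - 2 * Complex.I * (f.Abar_11 p - f.A_bb p)) hp fun x y hy => ?_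
  rw [f.gradθ_symm hP x hy, (f.toChart hP x).gradθ_add_conj hy, sublapR, Abar_11, A_bb,
    f.D1bar_D1_symm hP x hy, f.D1_D1bar_symm hP x hy, f.D1_D1_symm hP x hy,
    f.D1bar_D1bar_symm hP x hy]
  rfl

lemma conj_gradJ {p : M} (hp : p ∈ U) : conj (f.gradJ p) =
    -2 * Complex.I * (f.R_11 p - Complex.I / 2 * (f.A_1b p - f.A_b1 p)) := by
  refine of_symm (P := fun p => conj (f.gradJ p) =
    -2 * Complex.I * (f.R_11 p - Complex.I / 2 * (f.A_1b p - f.A_b1 p))) hp fun x y hy => ?_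
  rw [f.gradJ_symm hP x hy, (f.toChart hP x).conj_gradJ hy, R_11, A_1b, A_b1,
    f.D1bar_D1_symm hP x hy, f.D1_D1bar_symm hP x hy, f.D1_D1_symm hP x hy]
  rfl

lemma gradJ_eq_zero_iff {p : M} (hp : p ∈ U) : f.gradJ p = 0 ↔
    f.R_11 p - Complex.I / 2 * (f.A_1b p - f.A_b1 p) = 0 := by
  rw [← map_eq_zero (starRingEnd ℂ), f.conj_gradJ hP hp]
  simp [Complex.I_ne_zero]

/-- The left side of the second Euler–Lagrange equation is half of `gradθ` plus its conjugate, hence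
the real number Re `gradθ`. -/
lemma re_gradθ_eq_zero_iff {p : M} (hp : p ∈ U) : (f.gradθ p).re = 0 ↔
    -4 * f.sublapR p - Complex.I * (f.Abar_11 p - f.A_bb p) = 0 := by
  have h := f.gradθ_add_conj hP hp
  rw [Complex.add_conj] at h
  have h2 : -4 * f.sublapR p - Complex.I * (f.Abar_11 p - f.A_bb p) = ((f.gradθ p).re : ℂ) := by
    push_cast at h
    linear_combination (-1 / 2) * h
  rw [h2, Complex.ofReal_eq_zero]

lemma continuousAt_gradJ {p : M} (hp : p ∈ U) : ContinuousAt f.gradJ p := by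
  refine continuousAt_iff_chart (mem_extChartAt_source p) ?_
  have hm := mem_chartSet (mem_extChartAt_source (I := 𝓡 3) p) hp
  have ho := isOpen_chartSet p f.isOpen
  refine ((f.toChart hP p).smooth_gradJ.continuousOn.continuousAt (ho.mem_nhds hm)).congr ?_
  filter_upwards [ho.mem_nhds hm] with y hy
  exact (f.gradJ_symm hP p hy).symm

lemma continuousAt_gradθ {p : M} (hp : p ∈ U) : ContinuousAt f.gradθ p := by
  refine continuousAt_iff_chart (mem_extChartAt_source p) ?_
  have hm := mem_chartSet (mem_extChartAt_source (I := 𝓡 3) p) hp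
  have ho := isOpen_chartSet p f.isOpen
  refine ((f.toChart hP p).smooth_gradθ.continuousOn.continuousAt (ho.mem_nhds hm)).congr ?_
  filter_upwards [ho.mem_nhds hm] with y hy
  exact (f.gradθ_symm hP p hy).symm

end UnitaryFrame

variable [CompactSpace M] [T2Space M] [MeasurableSpace M] [BorelSpace M]

lemma Continuous.integrable_contactVolume (hθ : SmoothOneForm θ univ) {F : M → ℝ}
    (hF : Continuous F) : Integrable F (contactVolume θ) :=
  have := isFiniteMeasure_contactVolume hθ
  hF.integrable_of_hasCompactSupport (HasCompactSupport.of_compactSpace _)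

/-- The first variation of the energy with respect to the CR structure. -/
lemma IsJVariation.hasDerivAt_energy (hP : IsPseudohermitian J θ) {Jt : ℝ → EndField M}
    {E : EndField M} (hv : IsJVariation J θ Jt E) : ∃ F : M → ℝ,
      (∀ (U : Set M) (f : UnitaryFrame J θ U), ∀ p ∈ U, F p = 2 * (f.gradJ p * f.E11 E p).re) ∧
      Continuous F ∧
      HasDerivAt (fun t => energy (Jt t) θ) (∫ p, F p ∂(contactVolume θ)) 0 := by
  obtain ⟨ε, hε, hs, hp⟩ := hv.exists_interval
  have hV : IsVariation Jt (fun _ => θ) E (fun _ => 0) ε :=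
    { pos := hε
      smooth_J := hs
      smooth_θ := hP.smooth_form.family _
      pseudo := hp
      ker_eq := fun _ _ _ _ => Iff.rfl
      deriv_J := hv.deriv_eq
      deriv_θ := fun p v => by simpa using hasDerivAt_const (0 : ℝ) (θ p v) }
  obtain ⟨F, hF, hFc, hd⟩ := hV.hasDerivAt_energy
  refine ⟨F, fun U f p hp => ?_, hFc, hd⟩
  -- The variation starts at an endomorphism agreeing with `J` on ker θ only. That is all a unitary
  -- frame sees, so frames for `J` serve for it as well.
  have := hF U (f.congrJ hv.initial) p hp
  simp only [UnitaryFrame.varInt, Complex.ofReal_zero, mul_zero, add_zero] at this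
  exact this

/-- The first variation of the energy with respect to the contact form. -/
lemma IsThetaVariation.hasDerivAt_energy (hP : IsPseudohermitian J θ) {θt : ℝ → OneForm M ℝ}
    {h : M → ℝ} (hv : IsThetaVariation J θ θt h) : ∃ F : M → ℝ,
      (∀ (U : Set M) (f : UnitaryFrame J θ U), ∀ p ∈ U, F p = 2 * (f.gradθ p).re * h p) ∧
      Continuous F ∧
      HasDerivAt (fun t => energy J (θt t)) (∫ p, F p ∂(contactVolume θ)) 0 := by
  obtain ⟨ε, hε, hs, hp⟩ := hv.exists_interval
  have h0 := hv.initial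
  have hd := hv.deriv_eq
  subst h0
  have hV : IsVariation (fun _ => J) θt 0 h ε :=
    { pos := hε
      smooth_J := hP.smooth_J.family _
      smooth_θ := hs
      pseudo := fun t ht => (hp t ht).1
      ker_eq := fun t ht => (hp t ht).2
      deriv_J := fun p v _ => by
        have h0 : (2 : ℝ) • ((0 : EndField M) p v) = 0 := smul_zero _
        rw [h0]
        exact hasDerivAt_const (F := E3) (0 : ℝ) (J p v)
      deriv_θ := hd }
  obtain ⟨F, hF, hFc, hd⟩ := hV.hasDerivAt_energy
  refine ⟨F, fun U f p hp => ?_, hFc, hd⟩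
  rw [hF U f p hp]
  simp [UnitaryFrame.varInt, UnitaryFrame.E11]
  ring

end CR3

end

/-! ### Test variations -/

noncomputable section

namespace CR3

variable {M : Type*} [TopologicalSpace M] [ChartedSpace E3 M] [IsManifold (𝓡 3) ∞ M]
  {J : EndField M} {θ : OneForm M ℝ}

lemma chartSet_source (x : M) :
    chartSet x (extChartAt (𝓡 3) x).source = (extChartAt (𝓡 3) x).target :=
  inter_eq_left.2 fun _ hy => (extChartAt (𝓡 3) x).map_target hy

lemma smoothOneFormFamily_of_charts {α : ℝ → OneForm M ℝ} {I : Set ℝ} (hI : IsOpen I)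
    (h : ∀ x, ContDiffOn ℝ ∞ (fun z : ℝ × E3 => chartForm (α z.1) x z.2)
      (I ×ˢ (extChartAt (𝓡 3) x).target)) : SmoothOneFormFamily α (I ×ˢ univ) := by
  rintro ⟨t, p⟩ ⟨ht, -⟩
  have h1 := (contMDiffOn_family_oneForm_iff (α := α) (I := I) (x := p) subset_rfl).2
    (by rw [chartSet_source]; exact h p)
  exact (h1.contMDiffAt ((hI.prod (isOpen_extChartAt_source p)).mem_nhds
    ⟨ht, mem_extChartAt_source p⟩)).contMDiffWithinAt

lemma smoothEndFieldFamily_of_charts {J : ℝ → EndField M} {I : Set ℝ} (hI : IsOpen I)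
    (h : ∀ x, ∃ N, IsOpen N ∧ x ∈ N ∧ N ⊆ (extChartAt (𝓡 3) x).source ∧
      ContDiffOn ℝ ∞ (fun z : ℝ × E3 => chartEnd (J z.1) x z.2) (I ×ˢ chartSet x N)) :
    SmoothEndFieldFamily J (I ×ˢ univ) := by
  rintro ⟨t, p⟩ ⟨ht, -⟩
  obtain ⟨N, hN, hp, hNs, hd⟩ := h p
  have h1 : ContMDiffOn _ _ _ _ _ := (contMDiffOn_family_endField_iff hNs).2 hd
  exact (h1.contMDiffAt ((hI.prod hN).mem_nhds ⟨ht, hp⟩)).contMDiffWithinAt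

section Conformal

/-- The conformal family of contact forms generated by a function. -/
def conformalFamily (θ : OneForm M ℝ) (h : M → ℝ) (t : ℝ) : OneForm M ℝ :=
  fun p => Real.exp (2 * t * h p) • θ p

variable {h : M → ℝ} (hh : ContMDiff (𝓡 3) 𝓘(ℝ, ℝ) ∞ h)
include hh

lemma smooth_conformalFamily (hθ : SmoothOneForm θ univ) :
    SmoothOneFormFamily (conformalFamily θ h) (Ioo (-1) 1 ×ˢ univ) := by
  refine smoothOneFormFamily_of_charts isOpen_Ioo fun x => ?_
  have h1 : ContDiffOn ℝ ∞ (fun z : ℝ × E3 => Real.exp (2 * z.1 * h ((extChartAt (𝓡 3) x).symm z.2)))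
      (Ioo (-1) 1 ×ˢ (extChartAt (𝓡 3) x).target) :=
    Real.contDiff_exp.comp_contDiffOn ((contDiffOn_const.mul contDiffOn_fst).mul
      ((contDiffOn_symm_of_contMDiff hh x).comp contDiffOn_snd fun z hz => hz.2))
  exact h1.smul ((hθ.contDiffOn_target x).comp contDiffOn_snd fun z hz => hz.2)

/-- For u = exp(2th) > 0, the volume form is multiplied by u², and on ker θ one has d(uθ) = u dθ
because du∧θ vanishes there. So the contact condition and positivity persist. -/
lemma isPseudohermitian_conformalFamily (hP : IsPseudohermitian J θ) {t : ℝ}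
    (ht : t ∈ Ioo (-1 : ℝ) 1) : IsPseudohermitian J (conformalFamily θ h t) := by
  have hs : SmoothOneForm (conformalFamily θ h t) univ :=
    (smooth_conformalFamily hh hP.smooth_form).slice ht
  have hk : ∀ p v, conformalFamily θ h t p v = 0 ↔ θ p v = 0 := fun p v => by
    change Real.exp _ * θ p v = 0 ↔ _
    rw [mul_eq_zero, or_iff_right (Real.exp_ne_zero _)]
  have hu : ∀ x : M, ContDiffOn ℝ ∞ ((fun p => Real.exp (2 * t * h p)) ∘ (extChartAt (𝓡 3) x).symm)
      (extChartAt (𝓡 3) x).target := fun x =>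
    Real.contDiff_exp.comp_contDiffOn (contDiffOn_const.mul (contDiffOn_symm_of_contMDiff hh x))
  have hd : ∀ x : M, ∀ y ∈ (extChartAt (𝓡 3) x).target, DifferentiableAt ℝ
      ((fun p => Real.exp (2 * t * h p)) ∘ (extChartAt (𝓡 3) x).symm) y ∧
      DifferentiableAt ℝ (chartForm θ x) y := fun x y hy =>
    ⟨diffAt_of_contDiffOn (hu x) (isOpen_target x) hy,
      differentiableAt_chartForm hP.smooth_form isOpen_univ ⟨hy, trivial⟩⟩
  refine ⟨hs, fun p => ?_, hP.smooth_J, fun p v hv => ?_, fun p v hv => ?_, fun p v hv hv0 => ?_⟩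
  · refine of_symm (P := fun p => ∃ u v w : TangentSpace (𝓡 3) p,
      wedgeD (conformalFamily θ h t) p u v w ≠ 0) (mem_univ p) fun x y hy => ?_
    refine ⟨dChartSymm x y (stdVec 0), dChartSymm x y (stdVec 1), dChartSymm x y (stdVec 2), ?_⟩
    have h1 := volDensity_eq hs hy.1
    have h2 : volDensity (conformalFamily θ h t) x y = |wedgeD (conformalFamily θ h t) _
      (dChartSymm x y (stdVec 0)) (dChartSymm x y (stdVec 1)) (dChartSymm x y (stdVec 2))| := rfl
    rw [← abs_pos, ← h2, h1, abs_pos]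
    have h3 := wedgeStd_smul (hd x y hy.1).1 (hd x y hy.1).2
    refine (h3.trans_ne ?_)
    exact mul_ne_zero (pow_ne_zero _ (Real.exp_ne_zero _))
      (wedgeStd_ne_zero hP.smooth_form hP.contact hy.1)
  · rw [hk] at hv ⊢
    exact hP.map_ker p v hv
  · exact hP.sq_J p v ((hk p v).1 hv)
  · rw [hk] at hv
    have key : ∀ v w, θ p v = 0 → θ p w = 0 → extD (conformalFamily θ h t) p v w =
        Real.exp (2 * t * h p) * extD θ p v w := by
      refine of_symm (P := fun p => ∀ v w, θ p v = 0 → θ p w = 0 →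
        extD (conformalFamily θ h t) p v w = Real.exp (2 * t * h p) * extD θ p v w)
        (mem_univ p) fun x y hy v w hv hw => ?_
      obtain ⟨d1, d2⟩ := hd x y hy.1
      rw [extD_symm _ hy.1 (differentiableAt_chartForm hs isOpen_univ hy), extD_symm _ hy.1 d2]
      have he : chartForm (conformalFamily θ h t) x = fun z =>
        ((fun p => Real.exp (2 * t * h p)) ∘ (extChartAt (𝓡 3) x).symm) z • chartForm θ x z := rfl
      rw [he, ed, fderiv_fun_smul d1 d2]
      simp only [ed, add_apply, smul_apply, ContinuousLinearMap.smulRight_apply, smul_eq_mul,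
        chartForm_dChart _ hy.1, hv, hw, Function.comp_apply]
      ring
    rw [key _ _ hv (hP.map_ker p v hv)]
    exact mul_pos (Real.exp_pos _) (hP.pos p v hv hv0)

lemma isThetaVariation_conformalFamily (hP : IsPseudohermitian J θ) :
    IsThetaVariation J θ (conformalFamily θ h) h where
  initial := by
    funext p
    simp [conformalFamily]
  exists_interval := by
    refine ⟨1, one_pos, smooth_conformalFamily hh hP.smooth_form, fun t ht =>
      ⟨isPseudohermitian_conformalFamily hh hP ht, fun p v => ?_⟩⟩
    change Real.exp _ * θ p v = 0 ↔ _
    rw [mul_eq_zero, or_iff_right (Real.exp_ne_zero _)]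
  deriv_eq p v := by
    have h1 : HasDerivAt (fun t : ℝ => 2 * t * h p) (2 * h p) 0 := by
      simpa using ((hasDerivAt_id (0 : ℝ)).const_mul 2).mul_const (h p)
    have h2 := (h1.exp).mul_const (θ p v)
    have h3 : HasDerivAt (fun t : ℝ => Real.exp (2 * t * h p) * θ p v) (2 * h p * θ p v) 0 := by
      simpa using h2
    exact h3

end Conformal

section EndTest

/-- The radicand is even in t, so the square root is stationary at 0: correcting J_t to keep J_t² =
-1 costs nothing to first order. -/
lemma hasDerivAt_sqrt_smul (k : ℝ) (a b : E3) :
    HasDerivAt (fun t : ℝ => Real.sqrt (1 + 4 * t ^ 2 * k) • a + (2 * t) • b) ((2 : ℝ) • b) 0 := by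
  have h1 : HasDerivAt (fun t : ℝ => 1 + 4 * t ^ 2 * k) 0 0 := by
    have := ((((hasDerivAt_id (0 : ℝ)).pow 2).const_mul 4).mul_const k).const_add 1
    simpa using this
  have h2 := (h1.sqrt (by simp)).smul_const a
  have h3 := (((hasDerivAt_id (0 : ℝ)).const_mul 2).smul_const b)
  refine (h2.add h3).congr_deriv ?_
  simp

namespace UnitaryFrame

variable {U : Set M} (f : UnitaryFrame J θ U) (hP : IsPseudohermitian J θ)

lemma isDualFrame (hP : IsPseudohermitian J θ) {p : M} (hp : p ∈ U) :
    IsDualFrame (θ p) (f.θ1 p) (f.X p) (f.Y p) (f.T p) where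
  θX := f.X_mem p hp
  θY := by
    have := hP.map_ker p _ (f.X_mem p hp)
    rwa [← f.Y_eq p hp] at this
  θT := (f.reeb p hp).1
  ζX := f.θ1_X p hp
  ζY := f.θ1_Y p hp
  ζT := f.θ1_T p hp

lemma θ1_J (hP : IsPseudohermitian J θ) {p : M} (hp : p ∈ U) {v : TangentSpace (𝓡 3) p}
    (hv : θ p v = 0) : f.θ1 p (J p v) = Complex.I * f.θ1 p v := by
  have h := f.isDualFrame hP hp
  have hd : v = (f.θ1 p v).re • f.X p + (f.θ1 p v).im • f.Y p + (θ p v) • f.T p := h.decomp v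
  have hY : J p (f.Y p) = - f.X p := by rw [f.Y_eq p hp, hP.sq_J p _ (f.X_mem p hp)]
  have h1 : J p v = (f.θ1 p v).re • f.Y p - (f.θ1 p v).im • f.X p := by
    conv_lhs => rw [hd]
    rw [hv, zero_smul, add_zero, map_add, map_smul, map_smul, hY, ← f.Y_eq p hp]
    module
  rw [h1, map_sub, map_smul, map_smul, f.θ1_X p hp, f.θ1_Y p hp]
  conv_rhs => rw [← Complex.re_add_im (f.θ1 p v)]
  simp only [Complex.real_smul]
  linear_combination (-(f.θ1 p v).im) * Complex.I_sq

/-- The endomorphism field with component `E₁₁ = ρ c`. -/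
def testEnd (ρ : M → ℝ) (c : ℂ) : EndField M := fun p =>
  ρ p • ((Complex.reCLM.comp (c • f.θ1 p)).smulRight (f.X p)
    - (Complex.imCLM.comp (c • f.θ1 p)).smulRight (f.Y p))

/-- A family of almost complex structures with derivative `2 E` for `E₁₁ = ρ c`. -/
def testFamily (ρ : M → ℝ) (c : ℂ) (t : ℝ) : EndField M := fun p =>
  Real.sqrt (1 + 4 * t ^ 2 * (ρ p ^ 2 * ‖c‖ ^ 2)) • J p + (2 * t) • f.testEnd ρ c p

lemma testEnd_apply (ρ : M → ℝ) (c : ℂ) (p : M) (v : TangentSpace (𝓡 3) p) :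
    f.testEnd ρ c p v = ρ p • ((c * f.θ1 p v).re • f.X p - (c * f.θ1 p v).im • f.Y p) := rfl

lemma testFamily_apply (ρ : M → ℝ) (c : ℂ) (t : ℝ) (p : M) (v : TangentSpace (𝓡 3) p) :
    f.testFamily ρ c t p v = Real.sqrt (1 + 4 * t ^ 2 * (ρ p ^ 2 * ‖c‖ ^ 2)) • J p v
      + (2 * t) • f.testEnd ρ c p v := rfl

lemma testEnd_of_eq_zero {ρ : M → ℝ} {p : M} (h : ρ p = 0) (c : ℂ) : f.testEnd ρ c p = 0 := by
  rw [testEnd, h, zero_smul]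

lemma testFamily_of_eq_zero {ρ : M → ℝ} {p : M} (h : ρ p = 0) (c : ℂ) (t : ℝ) :
    f.testFamily ρ c t p = J p := by
  rw [testFamily, f.testEnd_of_eq_zero h, h]
  simp

lemma θ1_testEnd (ρ : M → ℝ) (c : ℂ) {p : M} (hp : p ∈ U) (v : TangentSpace (𝓡 3) p) :
    f.θ1 p (f.testEnd ρ c p v) = ρ p * conj (c * f.θ1 p v) := by
  rw [testEnd_apply, map_smul, map_sub, map_smul, map_smul, f.θ1_X p hp, f.θ1_Y p hp,
    Complex.real_smul, Complex.real_smul, Complex.real_smul]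
  congr 1
  apply Complex.ext
  · simp
  · simp
    ring

include hP in
lemma θ_testEnd (ρ : M → ℝ) (c : ℂ) {p : M} (hp : p ∈ U) (v : TangentSpace (𝓡 3) p) :
    θ p (f.testEnd ρ c p v) = 0 := by
  have h := f.isDualFrame hP hp
  have hY : θ p (f.Y p) = 0 := h.θY
  rw [testEnd_apply, map_smul, map_sub, map_smul, map_smul, f.X_mem p hp, hY]
  simp

lemma E11_testEnd (ρ : M → ℝ) (c : ℂ) {p : M} (hp : p ∈ U) :
    f.E11 (f.testEnd ρ c) p = ρ p * c := by
  rw [E11, f.θ1_testEnd ρ c hp, f.θ1_testEnd ρ c hp, f.θ1_X p hp, f.θ1_Y p hp]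
  simp only [map_mul, Complex.conj_conj, Complex.conj_ofReal, mul_one]
  linear_combination (-(1 / 2) * (ρ p * c)) * Complex.I_sq

lemma E11_of_eq_zero {E : EndField M} {p : M} (h : E p = 0) : f.E11 E p = 0 := by
  simp [E11, h]

variable {ρ : M → ℝ} (hρ : ContMDiff (𝓡 3) 𝓘(ℝ, ℝ) ∞ ρ) (hρU : tsupport ρ ⊆ U) (c : ℂ)

include hρU in
lemma eq_zero_of_notMem {p : M} (hp : p ∉ U) : ρ p = 0 :=
  image_eq_zero_of_notMem_tsupport fun h => hp (hρU h)

include hP hρU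

/-- On ξ the endomorphism E anticommutes with J and E² = ρ²|c|². Hence (sJ + 2tE)² = -s² + 4t²ρ²|c|²
= -1 for the chosen square root s. With a = ζ(v), the quadratic form is 2s|a|² - 4tρ Im(ca²),
positive because s exceeds 2|tρ||c|. Outside the domain of the frame ρ = 0 and J is unchanged. -/
lemma isPseudohermitian_testFamily (t : ℝ) (hs : SmoothEndField (f.testFamily ρ c t)) :
    IsPseudohermitian (f.testFamily ρ c t) θ := by
  have hθk : ∀ p v, θ p v = 0 → θ p (f.testFamily ρ c t p v) = 0 := by
    intro p v hv
    by_cases hp : p ∈ U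
    · rw [testFamily_apply, map_add, map_smul, map_smul, hP.map_ker p v hv, f.θ_testEnd hP ρ c hp]
      simp
    · rw [f.testFamily_of_eq_zero (eq_zero_of_notMem hρU hp)]
      exact hP.map_ker p v hv
  have hζ : ∀ p ∈ U, ∀ v, θ p v = 0 → f.θ1 p (f.testFamily ρ c t p v) =
      Real.sqrt (1 + 4 * t ^ 2 * (ρ p ^ 2 * ‖c‖ ^ 2)) * (Complex.I * f.θ1 p v)
        + 2 * t * (ρ p * conj (c * f.θ1 p v)) := by
    intro p hp v hv
    rw [testFamily_apply, map_add, map_smul, map_smul, f.θ1_J hP hp hv, f.θ1_testEnd ρ c hp,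
      Complex.real_smul, Complex.real_smul]
    push_cast
    ring
  refine ⟨hP.smooth_form, hP.contact, hs, hθk, fun p v hv => ?_, fun p v hv hv0 => ?_⟩
  · by_cases hp : p ∈ U
    · have h := f.isDualFrame hP hp
      have h1 := hζ p hp _ (hθk p v hv)
      rw [hζ p hp v hv] at h1
      set s := Real.sqrt (1 + 4 * t ^ 2 * (ρ p ^ 2 * ‖c‖ ^ 2)) with hs
      have hs2 : (s : ℂ) ^ 2 = 1 + 4 * t ^ 2 * (ρ p ^ 2 * (c * conj c)) := by
        rw [Complex.mul_conj, Complex.normSq_eq_norm_sq]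
        have : s ^ 2 = 1 + 4 * t ^ 2 * (ρ p ^ 2 * ‖c‖ ^ 2) := Real.sq_sqrt (by positivity)
        exact_mod_cast this
      have h2 : f.testFamily ρ c t p (f.testFamily ρ c t p v) + v = 0 := by
        refine h.injective ?_ ?_
        · have : θ p (f.testFamily ρ c t p (f.testFamily ρ c t p v) + v) = 0 := by
            rw [map_add, hv, hθk _ _ (hθk p v hv), add_zero]
          exact this
        · have : f.θ1 p (f.testFamily ρ c t p (f.testFamily ρ c t p v) + v) = 0 := by
            rw [map_add, h1]
            simp only [map_add, map_mul, Complex.conj_I, Complex.conj_conj, Complex.conj_ofReal,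
              Complex.conj_ofNat]
            linear_combination (-(f.θ1 p v)) * hs2 + s ^ 2 * f.θ1 p v * Complex.I_sq
          exact this
      exact eq_neg_of_add_eq_zero_left h2
    · rw [f.testFamily_of_eq_zero (eq_zero_of_notMem hρU hp)]
      exact hP.sq_J p v hv
  · by_cases hp : p ∈ U
    · have h := f.isDualFrame hP hp
      have hu := f.unitary p hp v (f.testFamily ρ c t p v)
      rw [hζ p hp v hv] at hu
      set s := Real.sqrt (1 + 4 * t ^ 2 * (ρ p ^ 2 * ‖c‖ ^ 2)) with hs
      have hs2 : s ^ 2 = 1 + 4 * t ^ 2 * (ρ p ^ 2 * ‖c‖ ^ 2) := Real.sq_sqrt (by positivity)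
      have hs0 : 0 ≤ s := Real.sqrt_nonneg _
      set a := f.θ1 p v with ha
      have ha0 : a ≠ 0 := fun h0 => hv0 (h.injective hv h0)
      have e1 : extD θ p v (f.testFamily ρ c t p v) =
          2 * s * ‖a‖ ^ 2 - 4 * t * ρ p * (c * a ^ 2).im := by
        have hre := congrArg Complex.re hu
        rw [Complex.ofReal_re] at hre
        rw [hre, ← Complex.normSq_eq_norm_sq, Complex.normSq_apply, pow_two a]
        simp
        ring
      have e2 : |(c * a ^ 2).im| ≤ ‖c‖ * ‖a‖ ^ 2 := by
        refine (Complex.abs_im_le_norm _).trans_eq ?_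
        rw [norm_mul, norm_pow]
      -- The squares differ by exactly the 1 under the root.
      have e3 : 2 * |t * ρ p| * ‖c‖ < s := by
        refine lt_of_pow_lt_pow_left₀ 2 hs0 ?_
        rw [hs2, mul_pow, mul_pow, sq_abs]
        nlinarith
      have e4 : 4 * t * ρ p * (c * a ^ 2).im ≤ 4 * |t * ρ p| * (‖c‖ * ‖a‖ ^ 2) := by
        have := abs_mul (t * ρ p) (c * a ^ 2).im
        have h5 := le_abs_self ((t * ρ p) * (c * a ^ 2).im)
        have h6 := mul_le_mul_of_nonneg_left e2 (abs_nonneg (t * ρ p))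
        nlinarith
      have e5 : 0 < ‖a‖ ^ 2 := by positivity
      rw [e1]
      nlinarith [mul_lt_mul_of_pos_right e3 e5]
    · rw [f.testFamily_of_eq_zero (eq_zero_of_notMem hρU hp)]
      exact hP.pos p v hv hv0

omit hP hρU in
lemma chartEnd_testEnd (x : M) {y : E3} : chartEnd (f.testEnd ρ c) x y =
    ρ ((extChartAt (𝓡 3) x).symm y) •
      ((Complex.reCLM.comp (c • chartForm f.θ1 x y)).smulRight (chartVec f.X x y)
        - (Complex.imCLM.comp (c • chartForm f.θ1 x y)).smulRight (chartVec f.Y x y)) := by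
  ext1 w
  rw [chartEnd_apply, testEnd_apply, map_smul, map_sub, map_smul, map_smul]
  rfl

-- The frame is uncontrolled outside `U`. Points of `U` are handled by the smooth frame; near the
-- other points E vanishes, as they lie outside the closed support of ρ.
include hρ in
lemma smooth_testFamily :
    SmoothEndFieldFamily (f.testFamily ρ c) (Ioo (-1) 1 ×ˢ univ) := by
  refine smoothEndFieldFamily_of_charts isOpen_Ioo fun x => ?_
  have hJ := (hP.smooth_J.family (Ioo (-1 : ℝ) 1 ×ˢ univ)).contDiffOn x
  have hr : ContDiffOn ℝ ∞ (fun z : ℝ × E3 => ρ ((extChartAt (𝓡 3) x).symm z.2))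
      (Ioo (-1) 1 ×ˢ (extChartAt (𝓡 3) x).target) :=
    (contDiffOn_symm_of_contMDiff hρ x).comp contDiffOn_snd fun z hz => hz.2
  have hs : ContDiffOn ℝ ∞ (fun z : ℝ × E3 => Real.sqrt
      (1 + 4 * z.1 ^ 2 * (ρ ((extChartAt (𝓡 3) x).symm z.2) ^ 2 * ‖c‖ ^ 2)))
      (Ioo (-1) 1 ×ˢ (extChartAt (𝓡 3) x).target) := by
    refine ContDiffOn.sqrt (contDiffOn_const.add ((contDiffOn_const.mul (contDiffOn_fst.pow 2)).mul
      ((hr.pow 2).mul contDiffOn_const))) fun z hz => ?_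
    positivity
  have key : ∀ N, N ⊆ (extChartAt (𝓡 3) x).source →
      ContDiffOn ℝ ∞ (chartEnd (f.testEnd ρ c) x) (chartSet x N) →
      ContDiffOn ℝ ∞ (fun z : ℝ × E3 => chartEnd (f.testFamily ρ c z.1) x z.2)
        (Ioo (-1) 1 ×ˢ chartSet x N) := by
    intro N hN hE
    have hsub : Ioo (-1 : ℝ) 1 ×ˢ chartSet x N ⊆ Ioo (-1) 1 ×ˢ (extChartAt (𝓡 3) x).target :=
      prod_mono subset_rfl fun y hy => hy.1
    have h2 : ContDiffOn ℝ ∞ (fun z : ℝ × E3 => (2 * z.1) • chartEnd (f.testEnd ρ c) x z.2)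
        (Ioo (-1) 1 ×ˢ chartSet x N) :=
      (contDiffOn_const.mul contDiffOn_fst).smul (hE.comp contDiffOn_snd fun z hz => hz.2)
    refine (((hs.smul hJ).mono hsub).add h2).congr fun z hz => ?_
    ext1 w
    rw [chartEnd_apply, testFamily_apply, map_add, map_smul, map_smul]
    rfl
  by_cases hx : x ∈ U
  · refine ⟨U ∩ (extChartAt (𝓡 3) x).source, f.isOpen.inter (isOpen_extChartAt_source x),
      ⟨hx, mem_extChartAt_source x⟩, inter_subset_right, key _ inter_subset_right ?_⟩
    rw [chartSet_inter_source]
    have hX := f.smooth_X.contDiffOn x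
    have hY := f.smooth_Y.contDiffOn x
    have h1 := f.smooth_θ1.contDiffOn x
    have hρ' : ContDiffOn ℝ ∞ (ρ ∘ (extChartAt (𝓡 3) x).symm) (chartSet x U) :=
      (contDiffOn_symm_of_contMDiff hρ x).mono fun y hy => hy.1
    have hcζ : ContDiffOn ℝ ∞ (fun y => c • chartForm f.θ1 x y) (chartSet x U) :=
      h1.const_smul c
    have hre : ContDiffOn ℝ ∞ (fun y => Complex.reCLM.comp (c • chartForm f.θ1 x y))
      (chartSet x U) := contDiffOn_const.clm_comp hcζ
    have him : ContDiffOn ℝ ∞ (fun y => Complex.imCLM.comp (c • chartForm f.θ1 x y))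
      (chartSet x U) := contDiffOn_const.clm_comp hcζ
    have : chartEnd (f.testEnd ρ c) x = fun y => _ := funext fun y => f.chartEnd_testEnd c x
    rw [this]
    exact hρ'.smul ((hre.smulRight hX).sub (him.smulRight hY))
  · refine ⟨(tsupport ρ)ᶜ ∩ (extChartAt (𝓡 3) x).source,
      (isClosed_tsupport ρ).isOpen_compl.inter (isOpen_extChartAt_source x),
      ⟨fun h => hx (hρU h), mem_extChartAt_source x⟩, inter_subset_right,
      key _ inter_subset_right ?_⟩
    refine (contDiffOn_const (c := (0 : E3 →L[ℝ] E3))).congr fun y hy => ?_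
    rw [chartEnd, f.testEnd_of_eq_zero (image_eq_zero_of_notMem_tsupport hy.2.1)]
    ext1 w
    exact map_zero (dChart x _)

include hρ in
lemma isJVariation_testFamily : IsJVariation J θ (f.testFamily ρ c) (f.testEnd ρ c) where
  initial p v _ := by simp [testFamily_apply]
  exists_interval := by
    have hs := f.smooth_testFamily hP hρ hρU c
    exact ⟨1, one_pos, hs, fun t ht => f.isPseudohermitian_testFamily hP hρU c t (hs.slice ht)⟩
  deriv_eq p v _ := hasDerivAt_sqrt_smul (ρ p ^ 2 * ‖c‖ ^ 2) (J p v) (f.testEnd ρ c p v)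

end UnitaryFrame

end EndTest

end CR3

end

/-! ### Necessity of the Euler–Lagrange equations and the main theorem -/

noncomputable section

namespace CR3

variable {M : Type*} [TopologicalSpace M] [ChartedSpace E3 M] [IsManifold (𝓡 3) ∞ M]
  [CompactSpace M] [T2Space M] [MeasurableSpace M] [BorelSpace M]
  {J : EndField M} {θ : OneForm M ℝ}

/-- A smooth nonnegative function supported near a point. -/
lemma exists_bump {p : M} {N : Set M} (hN : N ∈ 𝓝 p) : ∃ ρ : M → ℝ,
    ContMDiff (𝓡 3) 𝓘(ℝ, ℝ) ∞ ρ ∧ tsupport ρ ⊆ N ∧ ρ p = 1 ∧ ∀ q, 0 ≤ ρ q := by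
  obtain ⟨ρ, -, h⟩ := (SmoothBumpFunction.nhds_basis_tsupport (I := 𝓡 3) p).mem_iff.1 hN
  exact ⟨ρ, ρ.contMDiff, h, ρ.eq_one, fun q => ρ.nonneg⟩

lemma integral_contactVolume_pos (hP : IsPseudohermitian J θ) {F : M → ℝ} (hF : Continuous F)
    (h0 : ∀ q, 0 ≤ F q) {p : M} (hp : F p ≠ 0) : 0 < ∫ q, F q ∂(contactVolume θ) := by
  have := isFiniteMeasure_contactVolume hP.smooth_form
  have := isOpenPosMeasure_contactVolume hP.smooth_form hP.contact
  exact hF.integral_pos_of_hasCompactSupport_nonneg_nonzero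
    (HasCompactSupport.of_compactSpace _) h0 hp

/-- If `gradJ` were nonzero at p, take E₁₁ = ρc with the constant c conjugate to `gradJ` at p. The
integrand is 2ρ Re(`gradJ` c), nonnegative when ρ is supported where the real part is positive, and
nonzero at p, so the first variation would be positive. -/
lemma IsCriticalInJ.gradJ_eq_zero (hP : IsPseudohermitian J θ) (hc : IsCriticalInJ J θ) {U : Set M}
    (f : UnitaryFrame J θ U) {p : M} (hp : p ∈ U) : f.gradJ p = 0 := by
  by_contra hne
  set c := conj (f.gradJ p) with hcdef
  have hpos : 0 < (f.gradJ p * c).re := by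
    rw [hcdef, Complex.mul_conj, Complex.ofReal_re]
    exact Complex.normSq_pos.2 hne
  have hcont : ContinuousAt (fun q => (f.gradJ q * c).re) p :=
    Complex.continuous_re.continuousAt.comp ((f.continuousAt_gradJ hP hp).mul continuousAt_const)
  obtain ⟨ρ, hρ, hρN, hρ1, hρ0⟩ := exists_bump
    (Filter.inter_mem (f.isOpen.mem_nhds hp) (hcont.eventually (lt_mem_nhds hpos)))
  have hρU : tsupport ρ ⊆ U := hρN.trans inter_subset_left
  have hv := f.isJVariation_testFamily hP hρ hρU c
  obtain ⟨F, hF, hFc, hd⟩ := hv.hasDerivAt_energy hP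
  have h0 := hd.unique (hc _ _ hv)
  have hval : ∀ q ∈ U, F q = 2 * (ρ q * (f.gradJ q * c).re) := by
    intro q hq
    rw [hF U f q hq, f.E11_testEnd ρ c hq, mul_left_comm (f.gradJ q), Complex.re_ofReal_mul]
  refine (integral_contactVolume_pos hP hFc (fun q => ?_) (p := p) ?_).ne' h0
  · by_cases hq : q ∈ tsupport ρ
    · rw [hval q (hρU hq)]
      have h1 : 0 < (f.gradJ q * c).re := (hρN hq).2
      have := hρ0 q
      positivity
    · obtain ⟨U', hq', ⟨f'⟩⟩ := hP.exists_unitaryFrame q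
      rw [hF U' f' q hq', f'.E11_of_eq_zero
        (f.testEnd_of_eq_zero (image_eq_zero_of_notMem_tsupport hq) c)]
      simp
  · rw [hval p hp, hρ1, one_mul]
    positivity

/-- The same argument with h = cρ and c the value of Re `gradθ` at p; since h is real, only this
real part can be detected. -/
lemma IsCriticalInTheta.re_gradθ_eq_zero (hP : IsPseudohermitian J θ) (hc : IsCriticalInTheta J θ)
    {U : Set M} (f : UnitaryFrame J θ U) {p : M} (hp : p ∈ U) : (f.gradθ p).re = 0 := by
  by_contra hne
  set c := (f.gradθ p).re with hcdef
  have hpos : 0 < (f.gradθ p).re * c := mul_self_pos.2 hne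
  have hcont : ContinuousAt (fun q => (f.gradθ q).re * c) p :=
    (Complex.continuous_re.continuousAt.comp (f.continuousAt_gradθ hP hp)).mul continuousAt_const
  obtain ⟨ρ, hρ, hρN, hρ1, hρ0⟩ := exists_bump
    (Filter.inter_mem (f.isOpen.mem_nhds hp) (hcont.eventually (lt_mem_nhds hpos)))
  have hρU : tsupport ρ ⊆ U := hρN.trans inter_subset_left
  have hv := isThetaVariation_conformalFamily (h := fun q => c * ρ q)
    (contMDiff_const.mul hρ) hP
  obtain ⟨F, hF, hFc, hd⟩ := hv.hasDerivAt_energy hP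
  have h0 := hd.unique (hc _ _ hv)
  refine (integral_contactVolume_pos hP hFc (fun q => ?_) (p := p) ?_).ne' h0
  · by_cases hq : q ∈ tsupport ρ
    · rw [hF U f q (hρU hq)]
      have h1 : 0 < (f.gradθ q).re * c := (hρN hq).2
      have := mul_nonneg h1.le (hρ0 q)
      linarith
    · obtain ⟨U', hq', ⟨f'⟩⟩ := hP.exists_unitaryFrame q
      rw [hF U' f' q hq', image_eq_zero_of_notMem_tsupport hq]
      simp
  · rw [hF U f p hp, hρ1, mul_one, ← hcdef]
    have : c ≠ 0 := hne
    positivity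

end CR3

end

theorem proposition2p1 {M : Type*} [TopologicalSpace M] [ChartedSpace CR3.E3 M]
    [IsManifold (𝓡 3) ∞ M] [CompactSpace M] [T2Space M] [MeasurableSpace M] [BorelSpace M]
    (J : CR3.EndField M) (θ : CR3.OneForm M ℝ) (hJθ : CR3.IsPseudohermitian J θ) :
    -- local unitary frames exist around every point
    (∀ p : M, ∃ U : Set M, p ∈ U ∧ Nonempty (CR3.UnitaryFrame J θ U)) ∧
    -- the first variation with respect to `J`
    (∀ (Jt : ℝ → CR3.EndField M) (E : CR3.EndField M), CR3.IsJVariation J θ Jt E →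
      ∃ F : M → ℝ,
        (∀ (U : Set M) (f : CR3.UnitaryFrame J θ U), ∀ p ∈ U,
          (F p : ℂ) =
            (2 * Complex.I * f.R_bb p - 2 * f.Rc p * f.Abar p + Complex.I * f.Abar_0 p)
                * f.E11 E p
              + conj ((2 * Complex.I * f.R_bb p - 2 * f.Rc p * f.Abar p
                  + Complex.I * f.Abar_0 p) * f.E11 E p)) ∧
        Integrable F (CR3.contactVolume θ) ∧
        HasDerivAt (fun t => CR3.energy (Jt t) θ) (∫ p, F p ∂(CR3.contactVolume θ)) 0) ∧
    -- the first variation with respect to `θ`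
    (∀ (θt : ℝ → CR3.OneForm M ℝ) (h : M → ℝ), CR3.IsThetaVariation J θ θt h →
      ∃ F : M → ℝ,
        (∀ (U : Set M) (f : CR3.UnitaryFrame J θ U), ∀ p ∈ U,
          (F p : ℂ) =
            (-8 * f.sublapR p - 2 * Complex.I * (f.Abar_11 p - f.A_bb p)) * (h p : ℂ)) ∧
        Integrable F (CR3.contactVolume θ) ∧
        HasDerivAt (fun t => CR3.energy J (θt t)) (∫ p, F p ∂(CR3.contactVolume θ)) 0) ∧
    -- the Euler-Lagrange equation in `J`
    (CR3.IsCriticalInJ J θ ↔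
      ∀ (U : Set M) (f : CR3.UnitaryFrame J θ U), ∀ p ∈ U,
        f.R_11 p - Complex.I / 2 * (f.A_1b p - f.A_b1 p) = 0) ∧
    -- the Euler-Lagrange equation in `θ`
    (CR3.IsCriticalInTheta J θ ↔
      ∀ (U : Set M) (f : CR3.UnitaryFrame J θ U), ∀ p ∈ U,
        -4 * f.sublapR p - Complex.I * (f.Abar_11 p - f.A_bb p) = 0) := by
  refine ⟨hJθ.exists_unitaryFrame, fun Jt E hv => ?_, fun θt h hv => ?_, ⟨fun hc U f p hp => ?_,
    fun hE Jt E hv => ?_⟩, ⟨fun hc U f p hp => ?_, fun hE θt h hv => ?_⟩⟩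
  · obtain ⟨F, hF, hFc, hd⟩ := hv.hasDerivAt_energy hJθ
    refine ⟨F, fun U f p hp => ?_,
      CR3.Continuous.integrable_contactVolume hJθ.smooth_form hFc, hd⟩
    rw [hF U f p hp, ← CR3.UnitaryFrame.gradJ, Complex.add_conj]
  · obtain ⟨F, hF, hFc, hd⟩ := hv.hasDerivAt_energy hJθ
    refine ⟨F, fun U f p hp => ?_,
      CR3.Continuous.integrable_contactVolume hJθ.smooth_form hFc, hd⟩
    rw [hF U f p hp, ← f.gradθ_add_conj hJθ hp, Complex.add_conj]
    push_cast
    ring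
  · exact (f.gradJ_eq_zero_iff hJθ hp).1 (hc.gradJ_eq_zero hJθ f hp)
  · obtain ⟨F, hF, -, hd⟩ := hv.hasDerivAt_energy hJθ
    -- The equation makes the integrand of the first variation vanish in a frame around each point.
    have h0 : ∀ p, F p = 0 := fun p => by
      obtain ⟨U, hp, ⟨f⟩⟩ := hJθ.exists_unitaryFrame p
      rw [hF U f p hp, (f.gradJ_eq_zero_iff hJθ hp).2 (hE U f p hp)]
      simp
    simpa only [h0, integral_zero] using hd
  · exact (f.re_gradθ_eq_zero_iff hJθ hp).1 (hc.re_gradθ_eq_zero hJθ f hp)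
  · obtain ⟨F, hF, -, hd⟩ := hv.hasDerivAt_energy hJθ
    have h0 : ∀ p, F p = 0 := fun p => by
      obtain ⟨U, hp, ⟨f⟩⟩ := hJθ.exists_unitaryFrame p
      rw [hF U f p hp, (f.re_gradθ_eq_zero_iff hJθ hp).2 (hE U f p hp)]
      simp
    simpa only [h0, integral_zero] using hd
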